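/- **Notation.** Let $n\ge 1$, $s\in(0,1)$, $\alpha\in(0,1)$, $\epsilon\in(0,\alpha]$. Write $y=(y'',y_n,y_{n+1})\in\mathbb R^{n-1}\times\mathbb R\times\mathbb R$, $Q_+=\{y_n\ge0,\ y_{n+1}\ge0\}$, $P=\{y_n=y_{n+1}=0\}$, $\mathbb R^{n+1}_+=\{x_{n+1}\ge 0\}$. Let $Y_1,\dots,Y_{2n}$ be the Baouendi–Grushin fields $y_n\partial_i,\ y_{n+1}\partial_i$ ($i\le n-1$), $\partial_n,\partial_{n+1}$, and let $d_G$ be the Carnot–Carathéodory distance on $\mathbb R^{n+1}$ of the metric $g_y(w,w)=(y_n^2+y_{n+1}^2)^{-1}|w''|^2+w_n^2+w_{n+1}^2$ (infimum of lengths of curves with velocities in the span of the $Y_k$). Let $$\mathcal B=\{y\in Q_+: d_G(y,0)<1,\ d_G((y'',0,0),0)<1\}$$ be the part of the unit Baouendi–Grushin ball in $Q_+$ that lies over its intersection with $P$, let $\mathcal B^\circ=\mathcal B\cap\{y_n>0,\ y_{n+1}>0\}$, and $[u]_\epsilon=\sup_{y\neq z\in\mathcal B^\circ}|u(y)-u(z)|\,d_G(y,z)^{-\epsilon}$.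 $\mathcal P_k$ is the set of polynomials $\sum_\beta b_\beta y^\beta$ with $b_\beta=0$ unless $\sum_{i<n}2\beta_i+\beta_n+\beta_{n+1}\le k$; $|p|=\sum_\beta|b_\beta|$. A function $u$ on $\mathcal B^\circ$ is $C^{k,\alpha}_*$ at $\bar y\in P\cap\mathcal B$ if there is a (unique) approximating polynomial $p\in\mathcal P_k$ with $|u(y)-p(y)|\le C\,d_G(y,\bar y)^{k+2\alpha}$ for $y\in\mathcal B^\circ$, $d_G(y,\bar y)\le1$. **The space $X_{\alpha,\epsilon}$** consists of the bounded $v\in C^2(\mathcal B^\circ)$ with $v=0$ on $\{y_n=0\}\cap\mathcal B$ (as a limit), $y_n^{-2s}v$ being $C^{2,\alpha}_*$ at every $\bar y\in P\cap\mathcal B$ with approximating polynomial $P_{\bar y}$, $\lim_{y_{n+1}\to0+}\partial_{n+1}(y_n^{-2s}v)=0$ over the points of $\mathcal B\cap\{y_{n+1}=0,\ y_n>0\}$, $\partial_n(y_n^{1-2s}\partial_nv)\to0$ as $y\to\bar y$ for all $\bar y\in P\cap\mathcal B$, and finite norm $\|v\|_X=\sup_{\bar y\in P\cap\mathcal B}N_{\bar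 y}(v-y_n^{2s}P_{\bar y})+\sup_{\bar y\in P\cap\mathcal B}|P_{\bar y}|$, where with $d=d_G(\cdot,\bar y)$ $$N_{\bar y}(h)=\|d^{-(2+2\alpha)}y_n^{-2s}h\|_{L^\infty(\mathcal B^\circ)}+[d^{-2\alpha+\epsilon}y_{n+1}^{-1}y_n^{-2s}\partial_{n+1}h]_\epsilon+[d^{-(2+2\alpha-\epsilon)}y_n^{1-2s}\partial_nh]_\epsilon+\sum_{i=1}^{n-1}[d^{-(2\alpha-\epsilon)}y_n^{-2s}\partial_ih]_\epsilon+\sum_{k,l=1}^{2n}[d^{-(1+2\alpha-\epsilon)}Y_k(y_n^{1-2s}Y_lh)]_\epsilon .$$ **The space $Y_{\alpha,\epsilon}$** consists of the functions $g$ on $\mathcal B^\circ$ such that $y_{n+1}^{2s-1}g$ is $C^{1,\alpha}_*$ at every $\bar y\in P\cap\mathcal B$ with an approximating polynomial $Q_{\bar y}$ that has no $y_{n+1}$-term (i.e. $\partial_{n+1}(y_{n+1}^{2s-1}g)=0$ at $\bar y$), $y_{n+1}^{2s-1}g\to0$ as $y\to\bar y$, and finite norm $$\|g\|_Y=\sup_{\bar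 y\in P\cap\mathcal B}\big[d_G(\cdot,\bar y)^{-(1+2\alpha-\epsilon)}y_{n+1}^{2s-1}(g-y_{n+1}^{1-2s}Q_{\bar y})\big]_\epsilon+\sup_{\bar y\in P\cap\mathcal B}|Q_{\bar y}|.$$ **The functional.** Put $x_n=-\frac1{2s}y_n^{1-2s}\partial_nv$, $x_{n+1}=(y_{n+1}^{2s-1}\partial_{n+1}v)^{1/(2s)}$, $$J(v)=\det\begin{pmatrix}-\frac1{2s}\partial_n(y_n^{1-2s}\partial_nv)&-\frac1{2s}\partial_{n+1}(y_n^{1-2s}\partial_nv)\\ \frac1{2s}x_{n+1}^{1-2s}\partial_n(y_{n+1}^{2s-1}\partial_{n+1}v)&\frac1{2s}x_{n+1}^{1-2s}\partial_{n+1}(y_{n+1}^{2s-1}\partial_{n+1}v)\end{pmatrix},$$ $$F(v)=\sum_{i=1}^{n-1}x_{n+1}^{2-4s}\det\begin{pmatrix}\partial_{ii}v&\partial_{in}v&\partial_{i,n+1}v\\ \frac1{2s}\partial_i(y_n^{1-2s}\partial_nv)&-\frac1{2s}\partial_n(y_n^{1-2s}\partial_nv)&-\frac1{2s}\partial_{n+1}(y_n^{1-2s}\partial_nv)\\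 -\frac1{2s}\partial_i(y_{n+1}^{2s-1}\partial_{n+1}v)&\frac1{2s}\partial_n(y_{n+1}^{2s-1}\partial_{n+1}v)&\frac1{2s}\partial_{n+1}(y_{n+1}^{2s-1}\partial_{n+1}v)\end{pmatrix}$$ $$\qquad+\partial_n(y_n^{1-2s}y_{n+1}^{1-2s}\partial_nv)+x_{n+1}^{2-4s}\partial_{n+1}(y_n^{2s-1}y_{n+1}^{2s-1}\partial_{n+1}v)-x_{n+1}^{3-2s}J(v)\,f(y'',x_n,x_{n+1}).$$ **Proposition.** The model solution $v_0=-\frac{s}{s+1}y_n^{2s+2}+y_n^{2s}y_{n+1}^2$ belongs to $X_{\alpha,\epsilon}$. Let $0<r_0\le\frac14\|v_0\|_X$, let $\Omega$ be a relatively open subset of $\mathbb R^{n+1}_+$, and let $\mathcal U$ be the set of all $v\in X_{\alpha,\epsilon}$ with $\|v-v_0\|_X<r_0$ such that the closure of $\{(y'',x_n(y),x_{n+1}(y)):y\in\mathcal B^\circ\}$ is contained in $\Omega$ (for $\Omega=\mathbb R^{n+1}_+$ this is the whole neighborhood $\mathcal U_{r_0}(v_0)$). If $f$ is smooth on $\Omega$,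 then $v\mapsto F(v)$ maps $\mathcal U$ into $Y_{\alpha,\epsilon}$ and is smooth. If $f$ is real analytic on $\Omega$ (at each point of $\Omega$, as a function on a neighborhood in $\mathbb R^{n+1}$), this map is real analytic. -/

import Mathlib

open MeasureTheory Set Filter Topology
open scoped ENNReal ContDiff

noncomputable section

namespace Grushin

/-! ### Points and coordinates -/

/-- Points `y = (y'', y_n, y_{n+1})` of `ℝ^{n+1}`, where `m = n - 1` is the number of tangential
variables. -/
abbrev Pt (m : ℕ) : Type := EuclideanSpace ℝ (Fin m) × ℝ × ℝ

/-- The exponents `s ∈ (0,1)`, `α ∈ (0,1)`, `ε ∈ (0,α]`. -/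
structure Exponents where
  s : ℝ
  α : ℝ
  ε : ℝ
  s_pos : 0 < s
  s_lt_one : s < 1
  ε_pos : 0 < ε
  ε_le_α : ε ≤ α
  α_lt_one : α < 1

variable {m : ℕ}

/-- The tangential unit vector `e_i`, `i ≤ n-1`. -/
def eT (i : Fin m) : Pt m := (EuclideanSpace.single i 1, 0, 0)

/-- The unit vector `e_n`. -/
def eN : Pt m := (0, 1, 0)

/-- The unit vector `e_{n+1}`. -/
def eL : Pt m := (0, 0, 1)

/-- The derivative of `u` in direction `e`; `∂_i`, `∂_n`, `∂_{n+1}` are `pd (eT i)`, `pd eN`,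
`pd eL`. -/
def pd (e : Pt m) (u : Pt m → ℝ) (y : Pt m) : ℝ := fderiv ℝ u y e

/-- The index set of the `2n` Baouendi–Grushin vector fields. -/
abbrev FieldIdx (m : ℕ) : Type := (Fin m ⊕ Fin m) ⊕ Fin 2

/-- The Baouendi–Grushin vector fields
`y_n ∂_i`, `y_{n+1} ∂_i` (`i ≤ n-1`), `∂_n`, `∂_{n+1}`. -/
def field : FieldIdx m → Pt m → Pt m
  | Sum.inl (Sum.inl i), y => y.2.1 • eT i
  | Sum.inl (Sum.inr i), y => y.2.2 • eT i
  | Sum.inr 0, _ => eN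
  | Sum.inr 1, _ => eL

/-- `Y_k u`, the derivative of `u` along the `k`-th Baouendi–Grushin vector field. -/
def Yd (k : FieldIdx m) (u : Pt m → ℝ) (y : Pt m) : ℝ := pd (field k y) u y

/-! ### The Baouendi–Grushin (Carnot–Carathéodory) distance -/

/-- The length `√(g_y(w,w))` of a velocity `w` at the point `y`. -/
def speed (y w : Pt m) : ℝ :=
  √(‖w.1‖ ^ 2 / (y.2.1 ^ 2 + y.2.2 ^ 2) + w.2.1 ^ 2 + w.2.2 ^ 2)

/-- `γ` is an absolutely continuous horizontal curve from `x` to `y`, parametrized over `[0,1]`,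
with velocity `γ'`. Horizontal means that the velocity lies in the span of the Baouendi–Grushin
vector fields: this span is everything where `(y_n, y_{n+1}) ≠ 0`, and consists of the vectors with
vanishing tangential part where `y_n = y_{n+1} = 0`. -/
structure IsHorizontalCurve (γ γ' : ℝ → Pt m) (x y : Pt m) : Prop where
  integrable : IntervalIntegrable γ' volume 0 1
  eq_integral : ∀ t ∈ Icc (0 : ℝ) 1, γ t = x + ∫ τ in (0 : ℝ)..t, γ' τ
  endpoint : γ 1 = y
  horizontal : ∀ᵐ t ∂(volume.restrict (Icc (0 : ℝ) 1)),
    (γ t).2.1 = 0 → (γ t).2.2 = 0 → (γ' t).1 = 0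

/-- The length of a curve, possibly infinite. -/
def curveLength (γ γ' : ℝ → Pt m) : ℝ≥0∞ :=
  ∫⁻ t in Icc (0 : ℝ) 1, ENNReal.ofReal (speed (γ t) (γ' t))

/-- The Baouendi–Grushin distance `d_G`. -/
def dG (x y : Pt m) : ℝ :=
  (⨅ (γ : ℝ → Pt m) (γ' : ℝ → Pt m) (_ : IsHorizontalCurve γ γ' x y), curveLength γ γ').toReal

/-! ### The unit ball -/

/-- The vertical projection of a point onto `P = {y_n = y_{n+1} = 0}`. -/
def proj (y : Pt m) : Pt m := (y.1, 0, 0)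

variable (m) in
/-- The open unit Baouendi–Grushin ball about the origin, restricted to those points whose vertical
projection onto `P` also belongs to this ball. (Baouendi–Grushin balls are not closed under this
projection: the unit ball reaches `|y''| = 1/π`, but its part in `P` only `|y''| = 1/(2π)`. Without
the restriction the local norms give no expansion at the projection of `y`.) -/
def ball1 : Set (Pt m) := {y | dG y 0 < 1 ∧ dG (proj y) 0 < 1}

variable (m) in
/-- The (interior of the) local domain: the part of `ball1` in the open quarter space. -/
def dom : Set (Pt m) := {y | y ∈ ball1 m ∧ 0 < y.2.1 ∧ 0 < y.2.2}

variable (m) in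
/-- The part of `P` in the unit ball. -/
def edge : Set (Pt m) := {y | y ∈ ball1 m ∧ y.2.1 = 0 ∧ y.2.2 = 0}

/-! ### Homogeneous polynomials and approximation at `P` -/

/-- Polynomials in the `n+1` variables; `inl i` is the variable `y_i`, `inr 0` is `y_n`,
`inr 1` is `y_{n+1}`. -/
abbrev Poly (m : ℕ) : Type := MvPolynomial (Fin m ⊕ Fin 2) ℝ

/-- The coordinates of a point. -/
def coords (y : Pt m) : Fin m ⊕ Fin 2 → ℝ := Sum.elim (fun i => y.1 i) ![y.2.1, y.2.2]

/-- The value of a polynomial at a point. -/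
def pev (p : Poly m) (y : Pt m) : ℝ := MvPolynomial.eval (coords y) p

/-- `p ∈ 𝒫_k`: tangential variables count twice, normal variables count once. -/
def HomDegLE (k : ℕ) (p : Poly m) : Prop :=
  ∀ β : (Fin m ⊕ Fin 2) →₀ ℕ, p.coeff β ≠ 0 →
    (∑ i : Fin m, 2 * β (Sum.inl i)) + β (Sum.inr 0) + β (Sum.inr 1) ≤ k

/-- `|p| = ∑_β |b_β|` for `p(y) = ∑_β b_β y^β`. -/
def coeffNorm (p : Poly m) : ℝ := ∑ β ∈ p.support, |p.coeff β|

/-- `p` is a `k`-th order approximating polynomial of `u` at `ȳ ∈ P`, with exponent `k + 2α`.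
(Such a polynomial is unique if it exists.) -/
def IsApprox (k : ℕ) (α : ℝ) (u : Pt m → ℝ) (ybar : Pt m) (p : Poly m) : Prop :=
  HomDegLE k p ∧ ∃ C : ℝ, ∀ y ∈ dom m, dG y ybar ≤ 1 →
    |u y - pev p y| ≤ C * dG y ybar ^ ((k : ℝ) + 2 * α)

/-! ### Supremum norms and Hölder seminorms on the local domain -/

/-- `‖u‖_{L^∞}` on the local domain (used for continuous functions). -/
def supNorm (u : Pt m → ℝ) : ℝ≥0∞ := ⨆ y ∈ dom m, ENNReal.ofReal |u y|

/-- The Hölder seminorm `[u]_{Ċ^{0,ε}_*}` on the local domain. -/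
def holderSemi (ε : ℝ) (u : Pt m → ℝ) : ℝ≥0∞ :=
  ⨆ y ∈ dom m, ⨆ z ∈ dom m, ENNReal.ofReal |u y - u z| / ENNReal.ofReal (dG y z ^ ε)

/-! ### The space `X_{α,ε}` -/

/-- `v - y_n^{2s} P`. -/
def remX (s : ℝ) (v : Pt m → ℝ) (P : Poly m) (y : Pt m) : ℝ :=
  v y - y.2.1 ^ (2 * s) * pev P y

/-- The sum of weighted terms in the homogeneous norm of `X_{α,ε}` at the point `ȳ ∈ P`, for the
remainder `h = v - y_n^{2s} P_ȳ`. -/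
def homX (e : Exponents) (ybar : Pt m) (h : Pt m → ℝ) : ℝ≥0∞ :=
  supNorm (fun y => dG y ybar ^ (-(2 + 2 * e.α)) * y.2.1 ^ (-(2 * e.s)) * h y)
  + holderSemi e.ε (fun y =>
      dG y ybar ^ (-(2 * e.α) + e.ε) * y.2.2⁻¹ * y.2.1 ^ (-(2 * e.s)) * pd eL h y)
  + holderSemi e.ε (fun y =>
      dG y ybar ^ (-(2 + 2 * e.α - e.ε)) * y.2.1 ^ (1 - 2 * e.s) * pd eN h y)
  + ∑ i : Fin m, holderSemi e.ε (fun y =>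
      dG y ybar ^ (-(2 * e.α - e.ε)) * y.2.1 ^ (-(2 * e.s)) * pd (eT i) h y)
  + ∑ k : FieldIdx m, ∑ l : FieldIdx m, holderSemi e.ε (fun y =>
      dG y ybar ^ (-(1 + 2 * e.α - e.ε)) *
        Yd k (fun z => z.2.1 ^ (1 - 2 * e.s) * Yd l h z) y)

/-- The function `y_n^{-2s} v`. -/
def quotX (s : ℝ) (v : Pt m → ℝ) (y : Pt m) : ℝ := y.2.1 ^ (-(2 * s)) * v y

/-- Families of second order approximating polynomials of `y_n^{-2s} v` at the points of `P`. -/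
def FamX (e : Exponents) (v : Pt m → ℝ) : Type :=
  {P : Pt m → Poly m // ∀ ybar ∈ edge m, IsApprox 2 e.α (quotX e.s v) ybar (P ybar)}

/-- The norm of `X_{α,ε}(𝓑_1^+)`, with values in `[0,∞]`: the homogeneous part plus the supremum of
the coefficients of the approximating polynomials. (On the points of `P` the family of approximating
polynomials is unique, so that the infimum is the value at this family; it is `∞` if
there is none.) -/
def eNormX (e : Exponents) (v : Pt m → ℝ) : ℝ≥0∞ :=
  ⨅ P : FamX e v, (⨆ ybar ∈ edge m, homX e ybar (remX e.s v (P.1 ybar)))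
    + ⨆ ybar ∈ edge m, ENNReal.ofReal (coeffNorm (P.1 ybar))

/-- Membership in `X_{α,ε}(𝓑_1^+)`. Functions on the local domain are extended by zero. -/
structure MemX (e : Exponents) (v : Pt m → ℝ) : Prop where
  zero_off : ∀ y, y ∉ dom m → v y = 0
  contDiff : ∀ y ∈ dom m, ContDiffAt ℝ 2 v y
  bounded : ∃ M : ℝ, ∀ y ∈ dom m, |v y| ≤ M
  dirichlet : ∀ z ∈ ball1 m, z.2.1 = 0 → Tendsto v (𝓝[dom m] z) (𝓝 0)
  approx : ∀ ybar ∈ edge m, ∃ P : Poly m, IsApprox 2 e.α (quotX e.s v) ybar P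
  neumann : ∀ z ∈ ball1 m, 0 < z.2.1 → z.2.2 = 0 →
    Tendsto (pd eL (quotX e.s v)) (𝓝[dom m ∩ {y | y.1 = z.1 ∧ y.2.1 = z.2.1}] z) (𝓝 0)
  normal : ∀ ybar ∈ edge m,
    Tendsto (pd eN (fun y => y.2.1 ^ (1 - 2 * e.s) * pd eN v y)) (𝓝[dom m] ybar) (𝓝 0)
  finite : eNormX e v < ⊤

/-! ### The space `Y_{α,ε}` -/

/-- The function `y_{n+1}^{2s-1} g`. -/
def quotY (s : ℝ) (g : Pt m → ℝ) (y : Pt m) : ℝ := y.2.2 ^ (2 * s - 1) * g y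

/-- The weighted term in the homogeneous norm of `Y_{α,ε}` at `ȳ ∈ P`, with
`Q` in the place of the approximating polynomial. -/
def homY (e : Exponents) (ybar : Pt m) (g : Pt m → ℝ) (Q : Poly m) : ℝ≥0∞ :=
  holderSemi e.ε (fun y => dG y ybar ^ (-(1 + 2 * e.α - e.ε)) *
    (y.2.2 ^ (2 * e.s - 1) * (g y - y.2.2 ^ (1 - 2 * e.s) * pev Q y)))

/-- Families of first order approximating polynomials of `y_{n+1}^{2s-1} g` at the points
of `P`. -/
def FamY (e : Exponents) (g : Pt m → ℝ) : Type :=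
  {Q : Pt m → Poly m // ∀ ybar ∈ edge m, IsApprox 1 e.α (quotY e.s g) ybar (Q ybar)}

/-- The norm of `Y_{α,ε}(𝓑_1^+)`, with values in `[0,∞]`; as for `X_{α,ε}`, the family of
approximating polynomials is unique on `P`. -/
def eNormY (e : Exponents) (g : Pt m → ℝ) : ℝ≥0∞ :=
  ⨅ Q : FamY e g, (⨆ ybar ∈ edge m, homY e ybar g (Q.1 ybar))
    + ⨆ ybar ∈ edge m, ENNReal.ofReal (coeffNorm (Q.1 ybar))

/-- Membership in `Y_{α,ε}(𝓑_1^+)`. Functions on the local domain are extended by zero. The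
condition `∂_{n+1}(y_{n+1}^{2s-1} g) = 0` at `ȳ ∈ P` is imposed on the first order expansion at `ȳ`:
the approximating polynomial has no `y_{n+1}` term. -/
structure MemY (e : Exponents) (g : Pt m → ℝ) : Prop where
  zero_off : ∀ y, y ∉ dom m → g y = 0
  approx : ∀ ybar ∈ edge m, ∃ Q : Poly m, IsApprox 1 e.α (quotY e.s g) ybar Q ∧
    Q.coeff (Finsupp.single (Sum.inr 1) 1) = 0
  vanish : ∀ ybar ∈ edge m, Tendsto (quotY e.s g) (𝓝[dom m] ybar) (𝓝 0)
  finite : eNormY e g < ⊤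

/-! ### Linearity of the ingredients -/

theorem pev_comb (a b : ℝ) (p q : Poly m) (y : Pt m) :
    pev (a • p + b • q) y = a * pev p y + b * pev q y := by
  simp [pev, MvPolynomial.smul_eval]

theorem homDegLE_comb {k : ℕ} (a b : ℝ) {p q : Poly m} (hp : HomDegLE k p) (hq : HomDegLE k q) :
    HomDegLE k (a • p + b • q) := by
  intro β hβ
  by_cases h1 : p.coeff β = 0
  · by_cases h2 : q.coeff β = 0
    · simp [h1, h2] at hβ
    · exact hq β h2
  · exact hp β h1

theorem coeffNorm_eq {p : Poly m} {S : Finset ((Fin m ⊕ Fin 2) →₀ ℕ)} (h : p.support ⊆ S) :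
    coeffNorm p = ∑ β ∈ S, |p.coeff β| := by
  refine Finset.sum_subset h ?_
  intro β _ hβ
  simp [MvPolynomial.notMem_support_iff.mp hβ]

theorem coeffNorm_comb (a b : ℝ) (p q : Poly m) :
    coeffNorm (a • p + b • q) ≤ |a| * coeffNorm p + |b| * coeffNorm q := by
  classical
  set S := (a • p + b • q).support ∪ (p.support ∪ q.support) with hS
  rw [coeffNorm_eq (p := a • p + b • q) (S := S) Finset.subset_union_left,
    coeffNorm_eq (p := p) (S := S)
      (Finset.subset_union_left.trans Finset.subset_union_right),
    coeffNorm_eq (p := q) (S := S)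
      (Finset.subset_union_right.trans Finset.subset_union_right),
    Finset.mul_sum, Finset.mul_sum, ← Finset.sum_add_distrib]
  refine Finset.sum_le_sum fun β _ => ?_
  simp only [MvPolynomial.coeff_add, MvPolynomial.coeff_smul, smul_eq_mul]
  calc |a * p.coeff β + b * q.coeff β| ≤ |a * p.coeff β| + |b * q.coeff β| := abs_add_le _ _
    _ = _ := by rw [abs_mul, abs_mul]

theorem dG_nonneg (x y : Pt m) : 0 ≤ dG x y := ENNReal.toReal_nonneg

theorem isApprox_comb {k : ℕ} {α : ℝ} {u v w : Pt m → ℝ} {ybar : Pt m} {p q : Poly m} (a b : ℝ)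
    (hw : ∀ y ∈ dom m, w y = a * u y + b * v y)
    (hp : IsApprox k α u ybar p) (hq : IsApprox k α v ybar q) :
    IsApprox k α w ybar (a • p + b • q) := by
  obtain ⟨hp1, C, hC⟩ := hp
  obtain ⟨hq1, D, hD⟩ := hq
  refine ⟨homDegLE_comb a b hp1 hq1, |a| * C + |b| * D, fun y hy hd => ?_⟩
  rw [hw y hy, pev_comb]
  have h1 := mul_le_mul_of_nonneg_left (hC y hy hd) (abs_nonneg a)
  have h2 := mul_le_mul_of_nonneg_left (hD y hy hd) (abs_nonneg b)
  calc |a * u y + b * v y - (a * pev p y + b * pev q y)|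
      = |a * (u y - pev p y) + b * (v y - pev q y)| := by ring_nf
    _ ≤ |a| * |u y - pev p y| + |b| * |v y - pev q y| := by
        rw [← abs_mul, ← abs_mul]; exact abs_add_le _ _
    _ ≤ _ := by linarith

theorem ofReal_comb_le (a b x y z : ℝ) (h : z = a * x + b * y) :
    ENNReal.ofReal |z| ≤
      ENNReal.ofReal |a| * ENNReal.ofReal |x| + ENNReal.ofReal |b| * ENNReal.ofReal |y| := by
  rw [← ENNReal.ofReal_mul (abs_nonneg _), ← ENNReal.ofReal_mul (abs_nonneg _),
    ← ENNReal.ofReal_add (by positivity) (by positivity), ← abs_mul, ← abs_mul, h]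
  exact ENNReal.ofReal_le_ofReal (abs_add_le _ _)

theorem supNorm_comb {u v w : Pt m → ℝ} (a b : ℝ) (hw : ∀ y ∈ dom m, w y = a * u y + b * v y) :
    supNorm w ≤ ENNReal.ofReal |a| * supNorm u + ENNReal.ofReal |b| * supNorm v := by
  refine iSup₂_le fun y hy => (ofReal_comb_le a b (u y) (v y) _ (hw y hy)).trans ?_
  gcongr
  · exact le_iSup₂ (f := fun y (_ : y ∈ dom m) => ENNReal.ofReal |u y|) y hy
  · exact le_iSup₂ (f := fun y (_ : y ∈ dom m) => ENNReal.ofReal |v y|) y hy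

theorem le_holderSemi {ε : ℝ} {u : Pt m → ℝ} {y z : Pt m} (hy : y ∈ dom m) (hz : z ∈ dom m) :
    ENNReal.ofReal |u y - u z| / ENNReal.ofReal (dG y z ^ ε) ≤ holderSemi ε u :=
  (le_iSup₂ (f := fun z (_ : z ∈ dom m) =>
    ENNReal.ofReal |u y - u z| / ENNReal.ofReal (dG y z ^ ε)) z hz).trans
    (le_iSup₂ (f := fun y (_ : y ∈ dom m) => ⨆ z ∈ dom m,
      ENNReal.ofReal |u y - u z| / ENNReal.ofReal (dG y z ^ ε)) y hy)

theorem holderSemi_comb {ε : ℝ} {u v w : Pt m → ℝ} (a b : ℝ)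
    (hw : ∀ y ∈ dom m, w y = a * u y + b * v y) :
    holderSemi ε w ≤ ENNReal.ofReal |a| * holderSemi ε u + ENNReal.ofReal |b| * holderSemi ε v := by
  refine iSup₂_le fun y hy => iSup₂_le fun z hz => ?_
  have h := ofReal_comb_le a b (u y - u z) (v y - v z) (w y - w z)
    (by rw [hw y hy, hw z hz]; ring)
  refine (ENNReal.div_le_div_right h _).trans ?_
  rw [ENNReal.add_div, mul_div_assoc, mul_div_assoc]
  gcongr
  · exact le_holderSemi hy hz
  · exact le_holderSemi hy hz

theorem contDiff_pev (p : Poly m) : ContDiff ℝ 2 (pev p) := by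
  unfold pev
  induction p using MvPolynomial.induction_on with
  | C a => simpa using contDiff_const
  | add p q hp hq => simpa using hp.add hq
  | mul_X p i hp =>
    have hi : ContDiff ℝ 2 (fun y : Pt m => coords y i) := by
      rcases i with i | i
      · have : (fun y : Pt m => coords y (Sum.inl i)) =
            fun y => EuclideanSpace.proj (𝕜 := ℝ) i y.1 := rfl
        rw [this]
        exact (EuclideanSpace.proj (𝕜 := ℝ) i).contDiff.comp contDiff_fst
      · fin_cases i
        · exact contDiff_fst.comp contDiff_snd
        · exact contDiff_snd.comp contDiff_snd
    simpa using hp.mul hi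

theorem contDiffAt_rpow {y : Pt m} (hy : 0 < y.2.1) (c : ℝ) :
    ContDiffAt ℝ 2 (fun z : Pt m => z.2.1 ^ c) y :=
  ContDiffAt.rpow_const_of_ne (contDiff_fst.comp contDiff_snd).contDiffAt hy.ne'

theorem contDiffAt_remX (s : ℝ) {v : Pt m → ℝ} (P : Poly m) {y : Pt m} (hy : 0 < y.2.1)
    (hv : ContDiffAt ℝ 2 v y) : ContDiffAt ℝ 2 (remX s v P) y :=
  hv.sub ((contDiffAt_rpow hy _).mul (contDiff_pev P).contDiffAt)

theorem remX_comb (s a b : ℝ) (u v : Pt m → ℝ) (p q : Poly m) :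
    remX s (a • u + b • v) (a • p + b • q) = a • remX s u p + b • remX s v q := by
  funext y
  simp only [remX, pev_comb, Pi.add_apply, Pi.smul_apply, smul_eq_mul]
  ring

theorem pd_comb {u v : Pt m → ℝ} {y : Pt m} (e : Pt m) (a b : ℝ)
    (hu : DifferentiableAt ℝ u y) (hv : DifferentiableAt ℝ v y) :
    pd e (a • u + b • v) y = a * pd e u y + b * pd e v y := by
  unfold pd
  rw [fderiv_add (hu.const_smul a) (hv.const_smul b), fderiv_const_smul hu, fderiv_const_smul hv]
  simp

theorem differentiableAt_of_C2 {u : Pt m → ℝ} {y : Pt m} (hu : ContDiffAt ℝ 2 u y) :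
    DifferentiableAt ℝ u y := hu.differentiableAt (by norm_num)

theorem eventually_differentiableAt {u : Pt m → ℝ} {y : Pt m} (hu : ContDiffAt ℝ 2 u y) :
    ∀ᶠ z in 𝓝 y, DifferentiableAt ℝ u z :=
  (hu.eventually (by simp)).mono fun _ h => differentiableAt_of_C2 h

/-- First order operators with differentiable coefficients can be differentiated once more. -/
theorem differentiableAt_weight_pd {u : Pt m → ℝ} {y : Pt m} (hy : 0 < y.2.1)
    (hu : ContDiffAt ℝ 2 u y) (c : ℝ) {X : Pt m → Pt m} (hX : DifferentiableAt ℝ X y) :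
    DifferentiableAt ℝ (fun z => z.2.1 ^ c * pd (X z) u z) y := by
  refine (differentiableAt_of_C2 (contDiffAt_rpow hy c)).mul ?_
  have h1 : ContDiffAt ℝ 1 (fderiv ℝ u) y := hu.fderiv_right (by norm_num)
  exact (h1.differentiableAt (by norm_num)).clm_apply hX

theorem differentiable_field (k : FieldIdx m) : Differentiable ℝ (field k) := by
  rcases k with (i | i) | i
  · exact (differentiable_fst.comp differentiable_snd).smul_const _
  · exact (differentiable_snd.comp differentiable_snd).smul_const _
  · fin_cases i
    · exact differentiable_const _
    · exact differentiable_const _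

theorem pd_weight_comb {u v : Pt m → ℝ} {y : Pt m} (hy : 0 < y.2.1) (a b c : ℝ) (e : Pt m)
    {X : Pt m → Pt m} (hX : DifferentiableAt ℝ X y)
    (hu : ContDiffAt ℝ 2 u y) (hv : ContDiffAt ℝ 2 v y) :
    pd e (fun z => z.2.1 ^ c * pd (X z) (a • u + b • v) z) y =
      a * pd e (fun z => z.2.1 ^ c * pd (X z) u z) y
        + b * pd e (fun z => z.2.1 ^ c * pd (X z) v z) y := by
  have h : (fun z : Pt m => z.2.1 ^ c * pd (X z) (a • u + b • v) z) =ᶠ[𝓝 y]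
      a • (fun z => z.2.1 ^ c * pd (X z) u z) + b • (fun z => z.2.1 ^ c * pd (X z) v z) := by
    filter_upwards [eventually_differentiableAt hu, eventually_differentiableAt hv] with z h1 h2
    rw [pd_comb _ _ _ h1 h2]
    simp only [Pi.add_apply, Pi.smul_apply, smul_eq_mul]
    ring
  rw [← pd_comb e a b (differentiableAt_weight_pd hy hu c hX)
    (differentiableAt_weight_pd hy hv c hX)]
  unfold pd at h ⊢
  rw [h.fderiv_eq]

theorem homX_comb (e : Exponents) (ybar : Pt m) (a b : ℝ) {u v : Pt m → ℝ}
    (hu : ∀ y ∈ dom m, ContDiffAt ℝ 2 u y) (hv : ∀ y ∈ dom m, ContDiffAt ℝ 2 v y) :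
    homX e ybar (a • u + b • v) ≤
      ENNReal.ofReal |a| * homX e ybar u + ENNReal.ofReal |b| * homX e ybar v := by
  have key : ∀ A B x1 x2 x3 x4 x5 z1 z2 z3 z4 z5 : ℝ≥0∞,
      A * (x1 + x2 + x3 + x4 + x5) + B * (z1 + z2 + z3 + z4 + z5) =
      (A * x1 + B * z1) + (A * x2 + B * z2) + (A * x3 + B * z3) + (A * x4 + B * z4)
        + (A * x5 + B * z5) := by intros; ring
  unfold homX
  rw [key]
  have d1 := fun y (hy : y ∈ dom m) => differentiableAt_of_C2 (hu y hy)
  have d2 := fun y (hy : y ∈ dom m) => differentiableAt_of_C2 (hv y hy)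
  refine add_le_add (add_le_add (add_le_add (add_le_add ?_ ?_) ?_) ?_) ?_
  · refine supNorm_comb a b fun y _ => ?_
    simp only [Pi.add_apply, Pi.smul_apply, smul_eq_mul]
    ring
  · refine holderSemi_comb a b fun y hy => ?_
    rw [pd_comb _ _ _ (d1 y hy) (d2 y hy)]
    ring
  · refine holderSemi_comb a b fun y hy => ?_
    rw [pd_comb _ _ _ (d1 y hy) (d2 y hy)]
    ring
  · rw [Finset.mul_sum, Finset.mul_sum, ← Finset.sum_add_distrib]
    refine Finset.sum_le_sum fun i _ => holderSemi_comb a b fun y hy => ?_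
    rw [pd_comb _ _ _ (d1 y hy) (d2 y hy)]
    ring
  · rw [Finset.mul_sum, Finset.mul_sum, ← Finset.sum_add_distrib]
    refine Finset.sum_le_sum fun k _ => ?_
    rw [Finset.mul_sum, Finset.mul_sum, ← Finset.sum_add_distrib]
    refine Finset.sum_le_sum fun l _ => holderSemi_comb a b fun y hy => ?_
    unfold Yd
    rw [pd_weight_comb hy.2.1 a b _ _ (differentiable_field l).differentiableAt (hu y hy) (hv y hy)]
    ring

theorem iInf_comb_le {ι κ : Type*} [Nonempty ι] [Nonempty κ] (f : ι → ℝ≥0∞) (g : κ → ℝ≥0∞)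
    (a b : ℝ) (c : ℝ≥0∞)
    (h : ∀ i j, c ≤ ENNReal.ofReal |a| * f i + ENNReal.ofReal |b| * g j) :
    c ≤ ENNReal.ofReal |a| * (⨅ i, f i) + ENNReal.ofReal |b| * ⨅ j, g j := by
  rw [ENNReal.mul_iInf (by simp), ENNReal.mul_iInf (by simp), ENNReal.iInf_add]
  refine le_iInf fun i => ?_
  rw [ENNReal.add_iInf]
  exact le_iInf fun j => h i j

theorem biSup_comb_le {S : Set (Pt m)} {f g h : Pt m → ℝ≥0∞} {A B : ℝ≥0∞}
    (H : ∀ y ∈ S, h y ≤ A * f y + B * g y) :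
    ⨆ y ∈ S, h y ≤ A * (⨆ y ∈ S, f y) + B * ⨆ y ∈ S, g y := by
  refine iSup₂_le fun y hy => (H y hy).trans ?_
  gcongr
  · exact le_iSup₂ (f := fun y (_ : y ∈ S) => f y) y hy
  · exact le_iSup₂ (f := fun y (_ : y ∈ S) => g y) y hy

theorem quotX_comb (s a b : ℝ) (u v : Pt m → ℝ) :
    quotX s (a • u + b • v) = a • quotX s u + b • quotX s v := by
  funext y
  simp only [quotX, Pi.add_apply, Pi.smul_apply, smul_eq_mul]
  ring

theorem quotY_comb (s a b : ℝ) (u v : Pt m → ℝ) :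
    quotY s (a • u + b • v) = a • quotY s u + b • quotY s v := by
  funext y
  simp only [quotY, Pi.add_apply, Pi.smul_apply, smul_eq_mul]
  ring

theorem ofReal_coeffNorm_comb (a b : ℝ) (p q : Poly m) :
    ENNReal.ofReal (coeffNorm (a • p + b • q)) ≤
      ENNReal.ofReal |a| * ENNReal.ofReal (coeffNorm p)
        + ENNReal.ofReal |b| * ENNReal.ofReal (coeffNorm q) := by
  have h : ∀ r : Poly m, 0 ≤ coeffNorm r := fun r => Finset.sum_nonneg fun _ _ => abs_nonneg _
  rw [← ENNReal.ofReal_mul (abs_nonneg _), ← ENNReal.ofReal_mul (abs_nonneg _),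
    ← ENNReal.ofReal_add (mul_nonneg (abs_nonneg _) (h _)) (mul_nonneg (abs_nonneg _) (h _))]
  exact ENNReal.ofReal_le_ofReal (coeffNorm_comb a b p q)

theorem eNormX_comb (e : Exponents) (a b : ℝ) {u v : Pt m → ℝ} (hu : MemX e u) (hv : MemX e v) :
    eNormX e (a • u + b • v) ≤
      ENNReal.ofReal |a| * eNormX e u + ENNReal.ofReal |b| * eNormX e v := by
  choose! p hp using hu.approx
  choose! q hq using hv.approx
  have : Nonempty (FamX e u) := ⟨⟨p, hp⟩⟩
  have : Nonempty (FamX e v) := ⟨⟨q, hq⟩⟩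
  refine iInf_comb_le _ _ a b _ ?_
  intro P Q
  have hR : ∀ ybar ∈ edge m,
      IsApprox 2 e.α (quotX e.s (a • u + b • v)) ybar (a • P.1 ybar + b • Q.1 ybar) :=
    fun ybar hy => isApprox_comb a b (fun y _ => by rw [quotX_comb]; rfl) (P.2 ybar hy) (Q.2 ybar hy)
  refine (iInf_le _ (⟨_, hR⟩ : FamX e (a • u + b • v))).trans ?_
  rw [mul_add, mul_add, add_add_add_comm]
  refine add_le_add (biSup_comb_le fun ybar _ => ?_)
    (biSup_comb_le fun ybar _ => ofReal_coeffNorm_comb a b _ _)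
  rw [remX_comb]
  exact homX_comb e ybar a b (fun y hy => contDiffAt_remX _ _ hy.2.1 (hu.contDiff y hy))
    (fun y hy => contDiffAt_remX _ _ hy.2.1 (hv.contDiff y hy))

theorem tendsto_comb {F G : Pt m → ℝ} {l : Filter (Pt m)} (a b : ℝ)
    (hF : Tendsto F l (𝓝 0)) (hG : Tendsto G l (𝓝 0)) :
    Tendsto (fun y => a * F y + b * G y) l (𝓝 0) := by
  simpa using (hF.const_mul a).add (hG.const_mul b)

theorem memX_comb (e : Exponents) (a b : ℝ) {u v : Pt m → ℝ} (hu : MemX e u) (hv : MemX e v) :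
    MemX e (a • u + b • v) where
  zero_off y hy := by simp [hu.zero_off y hy, hv.zero_off y hy]
  contDiff y hy := ((hu.contDiff y hy).const_smul a).add ((hv.contDiff y hy).const_smul b)
  bounded := by
    obtain ⟨M, hM⟩ := hu.bounded
    obtain ⟨N, hN⟩ := hv.bounded
    refine ⟨|a| * M + |b| * N, fun y hy => ?_⟩
    have h1 := mul_le_mul_of_nonneg_left (hM y hy) (abs_nonneg a)
    have h2 := mul_le_mul_of_nonneg_left (hN y hy) (abs_nonneg b)
    calc |(a • u + b • v) y| ≤ |a * u y| + |b * v y| := abs_add_le _ _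
      _ = |a| * |u y| + |b| * |v y| := by rw [abs_mul, abs_mul]
      _ ≤ _ := add_le_add h1 h2
  dirichlet z hz h0 := tendsto_comb a b (hu.dirichlet z hz h0) (hv.dirichlet z hz h0)
  approx ybar hy := by
    obtain ⟨P, hP⟩ := hu.approx ybar hy
    obtain ⟨Q, hQ⟩ := hv.approx ybar hy
    exact ⟨_, isApprox_comb a b (fun y _ => by rw [quotX_comb]; rfl) hP hQ⟩
  neumann z hz h1 h2 := by
    refine (tendsto_comb a b (hu.neumann z hz h1 h2) (hv.neumann z hz h1 h2)).congr' ?_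
    filter_upwards [self_mem_nhdsWithin] with y hy
    rw [quotX_comb, pd_comb]
    · exact differentiableAt_of_C2 ((contDiffAt_rpow hy.1.2.1 _).mul (hu.contDiff y hy.1))
    · exact differentiableAt_of_C2 ((contDiffAt_rpow hy.1.2.1 _).mul (hv.contDiff y hy.1))
  normal ybar hy0 := by
    refine (tendsto_comb a b (hu.normal ybar hy0) (hv.normal ybar hy0)).congr' ?_
    filter_upwards [self_mem_nhdsWithin] with y hy
    exact (pd_weight_comb (X := fun _ => eN) hy.2.1 a b _ _ (differentiableAt_const _)
      (hu.contDiff y hy) (hv.contDiff y hy)).symm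
  finite := (eNormX_comb e a b hu hv).trans_lt (ENNReal.add_lt_top.mpr
    ⟨ENNReal.mul_lt_top ENNReal.ofReal_lt_top hu.finite,
      ENNReal.mul_lt_top ENNReal.ofReal_lt_top hv.finite⟩)

theorem pev_zero (y : Pt m) : pev (0 : Poly m) y = 0 := by simp [pev]

theorem isApprox_zero (k : ℕ) (α : ℝ) (ybar : Pt m) :
    IsApprox k α (fun _ => 0) ybar (0 : Poly m) :=
  ⟨fun β h => by simp at h, 0, fun y _ _ => by simp [pev_zero]⟩

theorem holderSemi_zero (ε : ℝ) : holderSemi (m := m) ε (fun _ => 0) = 0 := by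
  simp [holderSemi]

theorem pd_zero (e y : Pt m) : pd e (fun _ => (0 : ℝ)) y = 0 := by simp [pd]

theorem quotX_zero (s : ℝ) : quotX (m := m) s 0 = fun _ => 0 := by funext y; simp [quotX]

theorem quotY_zero (s : ℝ) : quotY (m := m) s 0 = fun _ => 0 := by funext y; simp [quotY]

theorem remX_zero (s : ℝ) : remX (m := m) s 0 0 = fun _ => 0 := by
  funext y; simp [remX, pev_zero]

theorem eNormX_zero (e : Exponents) : eNormX (m := m) e 0 = 0 := by
  refine le_antisymm ?_ bot_le
  refine (iInf_le _ (⟨fun _ => 0, fun ybar _ => ?_⟩ : FamX e 0)).trans ?_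
  · rw [quotX_zero]; exact isApprox_zero _ _ _
  · simp [remX_zero, homX, supNorm, pd_zero, Yd, holderSemi_zero, coeffNorm]

theorem memX_zero (e : Exponents) : MemX (m := m) e 0 where
  zero_off _ _ := rfl
  contDiff _ _ := contDiffAt_const
  bounded := ⟨0, fun _ _ => by simp⟩
  dirichlet _ _ _ := tendsto_const_nhds
  approx _ _ := ⟨0, by rw [quotX_zero]; exact isApprox_zero _ _ _⟩
  neumann z _ _ _ := by
    rw [quotX_zero]
    have : pd (m := m) eL (fun _ => (0 : ℝ)) = fun _ => 0 := funext fun y => pd_zero _ _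
    rw [this]; exact tendsto_const_nhds
  normal z _ := by
    have h1 : pd (m := m) eN (0 : Pt m → ℝ) = fun _ => 0 := funext fun y => pd_zero _ _
    have : pd (m := m) eN (fun y => y.2.1 ^ (1 - 2 * e.s) * pd eN (0 : Pt m → ℝ) y) = fun _ => 0 := by
      rw [h1]; simp only [mul_zero]; exact funext fun y => pd_zero _ _
    rw [this]; exact tendsto_const_nhds
  finite := by simp [eNormX_zero]

theorem homY_comb (e : Exponents) (ybar : Pt m) (a b : ℝ) (u v : Pt m → ℝ) (p q : Poly m) :
    homY e ybar (a • u + b • v) (a • p + b • q) ≤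
      ENNReal.ofReal |a| * homY e ybar u p + ENNReal.ofReal |b| * homY e ybar v q := by
  refine holderSemi_comb a b fun y _ => ?_
  simp only [pev_comb, Pi.add_apply, Pi.smul_apply, smul_eq_mul]
  ring

theorem eNormY_comb (e : Exponents) (a b : ℝ) {u v : Pt m → ℝ} (hu : MemY e u) (hv : MemY e v) :
    eNormY e (a • u + b • v) ≤
      ENNReal.ofReal |a| * eNormY e u + ENNReal.ofReal |b| * eNormY e v := by
  choose! p hp using hu.approx
  choose! q hq using hv.approx
  have : Nonempty (FamY e u) := ⟨⟨p, fun y hy => (hp y hy).1⟩⟩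
  have : Nonempty (FamY e v) := ⟨⟨q, fun y hy => (hq y hy).1⟩⟩
  refine iInf_comb_le _ _ a b _ ?_
  intro P Q
  have hR : ∀ ybar ∈ edge m,
      IsApprox 1 e.α (quotY e.s (a • u + b • v)) ybar (a • P.1 ybar + b • Q.1 ybar) :=
    fun ybar hy => isApprox_comb a b (fun y _ => by rw [quotY_comb]; rfl) (P.2 ybar hy) (Q.2 ybar hy)
  refine (iInf_le _ (⟨_, hR⟩ : FamY e (a • u + b • v))).trans ?_
  rw [mul_add, mul_add, add_add_add_comm]
  exact add_le_add (biSup_comb_le fun ybar _ => homY_comb e ybar a b u v _ _)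
    (biSup_comb_le fun ybar _ => ofReal_coeffNorm_comb a b _ _)

theorem memY_comb (e : Exponents) (a b : ℝ) {u v : Pt m → ℝ} (hu : MemY e u) (hv : MemY e v) :
    MemY e (a • u + b • v) where
  zero_off y hy := by simp [hu.zero_off y hy, hv.zero_off y hy]
  approx ybar hy := by
    obtain ⟨P, hP, hP0⟩ := hu.approx ybar hy
    obtain ⟨Q, hQ, hQ0⟩ := hv.approx ybar hy
    exact ⟨_, isApprox_comb a b (fun y _ => by rw [quotY_comb]; rfl) hP hQ, by simp [hP0, hQ0]⟩
  vanish ybar hy := by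
    rw [quotY_comb]
    exact tendsto_comb a b (hu.vanish ybar hy) (hv.vanish ybar hy)
  finite := (eNormY_comb e a b hu hv).trans_lt (ENNReal.add_lt_top.mpr
    ⟨ENNReal.mul_lt_top ENNReal.ofReal_lt_top hu.finite,
      ENNReal.mul_lt_top ENNReal.ofReal_lt_top hv.finite⟩)

theorem eNormY_zero (e : Exponents) : eNormY (m := m) e 0 = 0 := by
  refine le_antisymm ?_ bot_le
  refine (iInf_le _ (⟨fun _ => 0, fun ybar _ => ?_⟩ : FamY e 0)).trans ?_
  · rw [quotY_zero]; exact isApprox_zero _ _ _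
  · simp [homY, pev_zero, holderSemi_zero, coeffNorm]

theorem memY_zero (e : Exponents) : MemY (m := m) e 0 where
  zero_off _ _ := rfl
  approx _ _ := ⟨0, by rw [quotY_zero]; exact isApprox_zero _ _ _, by simp⟩
  vanish _ _ := by rw [quotY_zero]; exact tendsto_const_nhds
  finite := by simp [eNormY_zero]

/-! ### The norms are definite -/

theorem dG_le_of_curve {γ γ' : ℝ → Pt m} {M : ℝ} (hM : 0 ≤ M)
    (hd : ∀ t, HasDerivAt γ (γ' t) t) (hc : Continuous γ')
    (hh : ∀ t ∈ Icc (0 : ℝ) 1, (γ t).2.1 = 0 → (γ t).2.2 = 0 → (γ' t).1 = 0)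
    (hs : ∀ t ∈ Icc (0 : ℝ) 1, speed (γ t) (γ' t) ≤ M) : dG (γ 0) (γ 1) ≤ M := by
  have hcurve : IsHorizontalCurve γ γ' (γ 0) (γ 1) := by
    refine ⟨hc.intervalIntegrable _ _, fun t _ => ?_, rfl, ?_⟩
    · rw [intervalIntegral.integral_eq_sub_of_hasDerivAt (fun x _ => hd x)
        (hc.intervalIntegrable _ _)]
      abel
    · exact (ae_restrict_iff' measurableSet_Icc).mpr (Eventually.of_forall hh)
  have hlen : curveLength γ γ' ≤ ENNReal.ofReal M := by
    unfold curveLength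
    calc ∫⁻ t in Icc (0 : ℝ) 1, ENNReal.ofReal (speed (γ t) (γ' t))
        ≤ ∫⁻ _ in Icc (0 : ℝ) 1, ENNReal.ofReal M :=
          setLIntegral_mono measurable_const fun t ht => ENNReal.ofReal_le_ofReal (hs t ht)
      _ = ENNReal.ofReal M := by simp
  refine ENNReal.toReal_le_of_le_ofReal hM (le_trans ?_ hlen)
  exact iInf_le_of_le γ (iInf_le_of_le γ' (iInf_le _ hcurve))

theorem dG_diag_le {t : ℝ} (ht : 0 ≤ t) : dG ((0, t, t) : Pt m) 0 ≤ 2 * t := by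
  have h := dG_le_of_curve (m := m) (γ := fun τ => (1 - τ) • ((0, t, t) : Pt m))
    (γ' := fun _ => (-1 : ℝ) • ((0, t, t) : Pt m)) (M := 2 * t) (by linarith)
    (fun τ => by
      have h1 : HasDerivAt (fun τ : ℝ => 1 - τ) (-1) τ := by
        simpa using (hasDerivAt_id τ).const_sub 1
      exact h1.smul_const _) continuous_const (fun τ _ _ _ => by simp) (fun τ _ => by
        unfold speed
        refine Real.sqrt_le_iff.mpr ⟨by linarith, ?_⟩
        simp
        nlinarith)
  simpa using h

theorem dG_to_diag_le {y : Pt m} (hy : 0 < y.2.1) {t : ℝ} (h0 : 0 < t) (h1 : t < 1) :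
    dG y (0, t, t) ≤
      √(4 * ‖y.1‖ ^ 2 / y.2.1 ^ 2 + (1 + |y.2.1|) ^ 2 + (1 + |y.2.2|) ^ 2) := by
  have hid : ∀ τ : ℝ, HasDerivAt (fun τ : ℝ => 1 - τ) (-1) τ := fun τ => by
    simpa using (hasDerivAt_id τ).const_sub 1
  have h := dG_le_of_curve (m := m)
    (γ := fun τ => ((1 - τ) ^ 2 • y.1, (1 - τ) * y.2.1 + τ * t, (1 - τ) * y.2.2 + τ * t))
    (γ' := fun τ => ((2 * (1 - τ) * (-1)) • y.1, -1 * y.2.1 + 1 * t, -1 * y.2.2 + 1 * t))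
    (M := √(4 * ‖y.1‖ ^ 2 / y.2.1 ^ 2 + (1 + |y.2.1|) ^ 2 + (1 + |y.2.2|) ^ 2))
    (Real.sqrt_nonneg _)
    (fun τ => by
      have e1 : HasDerivAt (fun τ : ℝ => (1 - τ) ^ 2 • y.1) ((2 * (1 - τ) * (-1)) • y.1) τ := by
        have := ((hid τ).pow 2).smul_const y.1
        simpa using this
      exact e1.prodMk ((((hid τ).mul_const _).add ((hasDerivAt_id τ).mul_const t)).prodMk
        (((hid τ).mul_const _).add ((hasDerivAt_id τ).mul_const t))))
    (by fun_prop)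
    (fun τ hτ ha _ => by
      exfalso
      have hτ0 : 0 ≤ τ := hτ.1
      have hτ1 : τ ≤ 1 := hτ.2
      simp only at ha
      rcases eq_or_lt_of_le hτ0 with h | h
      · subst h; simp at ha; linarith
      · nlinarith [mul_pos h h0, mul_nonneg (sub_nonneg.mpr hτ1) hy.le])
    (fun τ hτ => by
      have hτ0 : 0 ≤ τ := hτ.1
      have hτ1 : 0 ≤ 1 - τ := sub_nonneg.mpr hτ.2
      unfold speed
      refine Real.sqrt_le_sqrt ?_
      have hA : 0 ≤ (1 - τ) * y.2.1 := mul_nonneg hτ1 hy.le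
      have hB : 0 ≤ τ * t := mul_nonneg hτ0 h0.le
      have i1 : ‖(2 * (1 - τ) * (-1)) • y.1‖ ^ 2 /
          (((1 - τ) * y.2.1 + τ * t) ^ 2 + ((1 - τ) * y.2.2 + τ * t) ^ 2) ≤
          4 * ‖y.1‖ ^ 2 / y.2.1 ^ 2 := by
        rw [norm_smul, mul_pow, Real.norm_eq_abs, sq_abs]
        refine div_le_of_le_mul₀ (by positivity) (by positivity) ?_
        have hk : ((1 - τ) * y.2.1) ^ 2 ≤
            ((1 - τ) * y.2.1 + τ * t) ^ 2 + ((1 - τ) * y.2.2 + τ * t) ^ 2 := by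
          nlinarith [sq_nonneg ((1 - τ) * y.2.2 + τ * t)]
        calc (2 * (1 - τ) * -1) ^ 2 * ‖y.1‖ ^ 2
            = 4 * ‖y.1‖ ^ 2 / y.2.1 ^ 2 * ((1 - τ) * y.2.1) ^ 2 := by
              field_simp
              ring
          _ ≤ _ := mul_le_mul_of_nonneg_left hk (by positivity)
      have i2 : ∀ a : ℝ, (-1 * a + 1 * t) ^ 2 ≤ (1 + |a|) ^ 2 := fun a => by
        refine sq_le_sq' ?_ ?_
        · have := le_abs_self a; linarith
        · have := neg_abs_le a; linarith
      exact add_le_add (add_le_add i1 (i2 _)) (i2 _))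
  simpa using h

theorem zero_mem_ball1 : (0 : Pt m) ∈ ball1 m := by
  have h : dG (0 : Pt m) 0 ≤ 0 := by
    have h := dG_diag_le (m := m) (t := 0) le_rfl
    rw [mul_zero] at h
    exact h
  exact ⟨by linarith, by change dG (0 : Pt m) 0 < 1; linarith⟩

theorem zero_mem_edge : (0 : Pt m) ∈ edge m := ⟨zero_mem_ball1, rfl, rfl⟩

theorem diag_mem_dom {t : ℝ} (h0 : 0 < t) (h1 : t < 1 / 2) : ((0, t, t) : Pt m) ∈ dom m := by
  refine ⟨⟨?_, ?_⟩, h0, h0⟩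
  · have := dG_diag_le (m := m) h0.le
    linarith
  · exact zero_mem_ball1.1

theorem abs_pev_le {k : ℕ} {p : Poly m} (hp : HomDegLE k p) (y : Pt m) :
    |pev p y| ≤ coeffNorm p * (1 + ∑ i, |coords y i|) ^ k := by
  unfold pev coeffNorm
  rw [MvPolynomial.eval_eq, Finset.sum_mul]
  refine (Finset.abs_sum_le_sum_abs _ _).trans (Finset.sum_le_sum fun β hβ => ?_)
  rw [abs_mul]
  refine mul_le_mul_of_nonneg_left ?_ (abs_nonneg _)
  set B := 1 + ∑ i, |coords y i| with hB
  have hB1 : 1 ≤ B := by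
    have : 0 ≤ ∑ i, |coords y i| := Finset.sum_nonneg fun _ _ => abs_nonneg _
    linarith
  have hdeg : ∑ i, β i ≤ k := by
    have h := hp β (MvPolynomial.mem_support_iff.mp hβ)
    rw [Fintype.sum_sum_type, Fin.sum_univ_two]
    have h2 : ∑ i : Fin m, β (Sum.inl i) ≤ ∑ i : Fin m, 2 * β (Sum.inl i) :=
      Finset.sum_le_sum fun i _ => by omega
    omega
  calc |∏ i ∈ β.support, coords y i ^ β i| = ∏ i ∈ β.support, |coords y i| ^ β i := by
        rw [Finset.abs_prod]
        exact Finset.prod_congr rfl fun i _ => abs_pow _ _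
    _ ≤ ∏ i ∈ β.support, B ^ β i := by
        refine Finset.prod_le_prod (fun _ _ => by positivity) fun i _ => ?_
        refine pow_le_pow_left₀ (abs_nonneg _) ?_ _
        have := Finset.single_le_sum (f := fun i => |coords y i|) (fun _ _ => abs_nonneg _)
          (Finset.mem_univ i)
        linarith
    _ = B ^ ∑ i ∈ β.support, β i := by rw [Finset.prod_pow_eq_pow_sum]
    _ ≤ B ^ k := by
        refine pow_le_pow_right₀ hB1 (le_trans ?_ hdeg)
        exact Finset.sum_le_sum_of_subset (Finset.subset_univ _)

theorem eq_zero_of_forall_le {x K : ℝ} (h : ∀ δ : ℝ, 0 < δ → |x| ≤ δ * K) : x = 0 := by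
  by_contra hx
  have hx' : 0 < |x| := abs_pos.mpr hx
  have h1 := h 1 one_pos
  have hK : 0 < K := by linarith
  have h2 := h (|x| / (2 * K)) (by positivity)
  have : |x| / (2 * K) * K = |x| / 2 := by field_simp
  linarith

theorem eNormX_eq_zero {e : Exponents} {v : Pt m → ℝ} (hv : MemX e v) (h : eNormX e v = 0) :
    v = 0 := by
  funext y
  by_cases hy : y ∈ dom m
  swap
  · exact hv.zero_off y hy
  have hα : 0 < e.α := e.ε_pos.trans_le e.ε_le_α
  have hyn : 0 < y.2.1 := hy.2.1
  suffices hq : quotX e.s v y = 0 by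
    have h0 : y.2.1 ^ (-(2 * e.s)) ≠ 0 := (Real.rpow_pos_of_pos hyn _).ne'
    exact (mul_eq_zero.mp hq).resolve_left h0
  refine eq_zero_of_forall_le
    (K := dG y 0 ^ (2 + 2 * e.α) + (1 + ∑ i, |coords y i|) ^ 2) fun δ hδ => ?_
  have hlt : eNormX e v < ENNReal.ofReal δ := by rw [h]; exact ENNReal.ofReal_pos.mpr hδ
  obtain ⟨P, hP⟩ := iInf_lt_iff.mp hlt
  have hP0 := P.2 0 zero_mem_edge
  have hc : coeffNorm (P.1 0) ≤ δ := by
    rw [← ENNReal.ofReal_le_ofReal_iff hδ.le]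
    refine le_trans ?_ (le_add_self.trans hP.le)
    exact le_iSup₂ (f := fun z (_ : z ∈ edge m) => ENNReal.ofReal (coeffNorm (P.1 z)))
      0 zero_mem_edge
  have hs : |dG y 0 ^ (-(2 + 2 * e.α)) * y.2.1 ^ (-(2 * e.s)) * remX e.s v (P.1 0) y| ≤ δ := by
    rw [← ENNReal.ofReal_le_ofReal_iff hδ.le]
    refine le_trans ?_ (le_self_add.trans hP.le)
    refine le_trans ?_ (le_iSup₂ (f := fun z (_ : z ∈ edge m) => homX e z (remX e.s v (P.1 z)))
      0 zero_mem_edge)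
    unfold homX
    refine le_trans ?_ (le_self_add.trans (le_self_add.trans (le_self_add.trans le_self_add)))
    exact le_iSup₂ (f := fun y (_ : y ∈ dom m) => ENNReal.ofReal
      |dG y 0 ^ (-(2 + 2 * e.α)) * y.2.1 ^ (-(2 * e.s)) * remX e.s v (P.1 0) y|) y hy
  have hrem : y.2.1 ^ (-(2 * e.s)) * remX e.s v (P.1 0) y = quotX e.s v y - pev (P.1 0) y := by
    unfold remX quotX
    rw [mul_sub, ← mul_assoc, ← Real.rpow_add hyn]
    simp
  have hdiff : |quotX e.s v y - pev (P.1 0) y| ≤ δ * dG y 0 ^ (2 + 2 * e.α) := by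
    rcases eq_or_lt_of_le (dG_nonneg y 0) with hd | hd
    · obtain ⟨C, hC⟩ := hP0.2
      have h3 := hC y hy hy.1.1.le
      rw [← hd, Real.zero_rpow (by push_cast; linarith), mul_zero] at h3
      refine h3.trans ?_
      rw [← hd]
      positivity
    · rw [mul_assoc, hrem, abs_mul, Real.rpow_neg hd.le, abs_inv,
        abs_of_pos (Real.rpow_pos_of_pos hd _), inv_mul_le_iff₀ (Real.rpow_pos_of_pos hd _)] at hs
      linarith
  have hpev := abs_pev_le hP0.1 y
  have hpev2 : |pev (P.1 0) y| ≤ δ * (1 + ∑ i, |coords y i|) ^ 2 :=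
    hpev.trans (mul_le_mul_of_nonneg_right hc (by positivity))
  calc |quotX e.s v y| = |(quotX e.s v y - pev (P.1 0) y) + pev (P.1 0) y| := by ring_nf
    _ ≤ _ := abs_add_le _ _
    _ ≤ _ := by rw [mul_add]; exact add_le_add hdiff hpev2

theorem eNormY_eq_zero {e : Exponents} {g : Pt m → ℝ} (hg : MemY e g) (h : eNormY e g = 0) :
    g = 0 := by
  funext y
  by_cases hy : y ∈ dom m
  swap
  · exact hg.zero_off y hy
  have hε := e.ε_pos
  have hα : 0 < e.α := e.ε_pos.trans_le e.ε_le_α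
  have hyn : 0 < y.2.1 := hy.2.1
  suffices hq : quotY e.s g y = 0 by
    have h0 : y.2.2 ^ (2 * e.s - 1) ≠ 0 := (Real.rpow_pos_of_pos hy.2.2 _).ne'
    exact (mul_eq_zero.mp hq).resolve_left h0
  set M := √(4 * ‖y.1‖ ^ 2 / y.2.1 ^ 2 + (1 + |y.2.1|) ^ 2 + (1 + |y.2.2|) ^ 2) with hM
  have hM0 : 0 ≤ M := Real.sqrt_nonneg _
  refine eq_zero_of_forall_le
    (K := M ^ e.ε * dG y 0 ^ (1 + 2 * e.α - e.ε) + (1 + ∑ i, |coords y i|) ^ 1) fun δ hδ => ?_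
  have hlt : eNormY e g < ENNReal.ofReal δ := by rw [h]; exact ENNReal.ofReal_pos.mpr hδ
  obtain ⟨Q, hQ⟩ := iInf_lt_iff.mp hlt
  have hQ0 := Q.2 0 zero_mem_edge
  obtain ⟨C, hC⟩ := hQ0.2
  have hc : coeffNorm (Q.1 0) ≤ δ := by
    rw [← ENNReal.ofReal_le_ofReal_iff hδ.le]
    refine le_trans ?_ (le_add_self.trans hQ.le)
    exact le_iSup₂ (f := fun z (_ : z ∈ edge m) => ENNReal.ofReal (coeffNorm (Q.1 z)))
      0 zero_mem_edge
  set u : Pt m → ℝ := fun y => dG y 0 ^ (-(1 + 2 * e.α - e.ε)) *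
    (y.2.2 ^ (2 * e.s - 1) * (g y - y.2.2 ^ (1 - 2 * e.s) * pev (Q.1 0) y)) with hu
  have hu2 : ∀ z ∈ dom m, u z = dG z 0 ^ (-(1 + 2 * e.α - e.ε)) *
      (quotY e.s g z - pev (Q.1 0) z) := fun z hz => by
    have h1 : z.2.2 ^ (2 * e.s - 1) * z.2.2 ^ (1 - 2 * e.s) = 1 := by
      rw [← Real.rpow_add hz.2.2]; simp
    simp only [hu, quotY]
    rw [mul_sub, ← mul_assoc (z.2.2 ^ (2 * e.s - 1)), h1, one_mul]
  have hs : holderSemi e.ε u ≤ ENNReal.ofReal δ := by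
    refine le_trans ?_ (le_self_add.trans hQ.le)
    exact le_iSup₂ (f := fun z (_ : z ∈ edge m) => homY e z g (Q.1 z)) 0 zero_mem_edge
  have hbound : ∀ t : ℝ, 0 < t → t < 1 / 2 → |u y| ≤ δ * M ^ e.ε + |C| * (2 * t) ^ e.ε := by
    intro t h0 h1
    have hyt := diag_mem_dom (m := m) h0 h1
    have hdM : dG y (0, t, t) ^ e.ε ≤ M ^ e.ε :=
      Real.rpow_le_rpow (dG_nonneg _ _) (dG_to_diag_le hyn h0 (by linarith)) hε.le
    have h2 : |u y - u (0, t, t)| ≤ δ * M ^ e.ε := by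
      have h3 := (le_holderSemi (ε := e.ε) (u := u) hy hyt).trans hs
      have h4 : ENNReal.ofReal |u y - u (0, t, t)| ≤
          ENNReal.ofReal δ * ENNReal.ofReal (dG y (0, t, t) ^ e.ε) := by
        refine (ENNReal.div_le_iff_le_mul (Or.inr ENNReal.ofReal_ne_top)
          (Or.inl ENNReal.ofReal_ne_top)).mp h3 |>.trans le_rfl
      rw [← ENNReal.ofReal_mul hδ.le, ENNReal.ofReal_le_ofReal_iff
        (mul_nonneg hδ.le (Real.rpow_nonneg (dG_nonneg _ _) _))] at h4
      exact h4.trans (mul_le_mul_of_nonneg_left hdM hδ.le)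
    have h5 : |u (0, t, t)| ≤ |C| * (2 * t) ^ e.ε := by
      rw [hu2 _ hyt, abs_mul]
      have hd1 := dG_diag_le (m := m) h0.le
      have hCt := hC _ hyt (by linarith)
      rcases eq_or_lt_of_le (dG_nonneg ((0, t, t) : Pt m) 0) with hd | hd
      · rw [← hd, Real.zero_rpow (by have := e.ε_le_α; intro h; linarith), abs_zero, zero_mul]
        positivity
      · rw [abs_of_pos (Real.rpow_pos_of_pos hd _)]
        calc dG ((0, t, t) : Pt m) 0 ^ (-(1 + 2 * e.α - e.ε)) *
              |quotY e.s g (0, t, t) - pev (Q.1 0) (0, t, t)|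
            ≤ dG ((0, t, t) : Pt m) 0 ^ (-(1 + 2 * e.α - e.ε)) *
              (|C| * dG ((0, t, t) : Pt m) 0 ^ (((1 : ℕ) : ℝ) + 2 * e.α)) := by
              refine mul_le_mul_of_nonneg_left (hCt.trans ?_) (Real.rpow_nonneg hd.le _)
              exact mul_le_mul_of_nonneg_right (le_abs_self C) (Real.rpow_nonneg hd.le _)
          _ = |C| * dG ((0, t, t) : Pt m) 0 ^ e.ε := by
              rw [mul_left_comm, ← Real.rpow_add hd]
              congr 2
              push_cast
              ring
          _ ≤ _ := mul_le_mul_of_nonneg_left (Real.rpow_le_rpow hd.le hd1 hε.le) (abs_nonneg _)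
    calc |u y| = |(u y - u (0, t, t)) + u (0, t, t)| := by ring_nf
      _ ≤ _ := abs_add_le _ _
      _ ≤ _ := add_le_add h2 h5
  have huy : |u y| ≤ δ * M ^ e.ε := by
    have hlim : Tendsto (fun t : ℝ => δ * M ^ e.ε + |C| * (2 * t) ^ e.ε) (𝓝[>] 0)
        (𝓝 (δ * M ^ e.ε)) := by
      have hcont : Continuous fun t : ℝ => δ * M ^ e.ε + |C| * (2 * t) ^ e.ε :=
        continuous_const.add (continuous_const.mul
          ((continuous_const.mul continuous_id).rpow_const fun _ => Or.inr hε.le))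
      have := (hcont.tendsto 0).mono_left (nhdsWithin_le_nhds (s := Ioi 0))
      simpa [Real.zero_rpow hε.ne'] using this
    refine ge_of_tendsto hlim ?_
    filter_upwards [Ioo_mem_nhdsGT (show (0 : ℝ) < 1 / 2 by norm_num)] with t ht
    exact hbound t ht.1 ht.2
  have hdiff : |quotY e.s g y - pev (Q.1 0) y| ≤
      δ * (M ^ e.ε * dG y 0 ^ (1 + 2 * e.α - e.ε)) := by
    rcases eq_or_lt_of_le (dG_nonneg y 0) with hd | hd
    · have h3 := hC y hy hy.1.1.le
      rw [← hd, Real.zero_rpow (by push_cast; linarith), mul_zero] at h3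
      refine h3.trans ?_
      rw [← hd]
      positivity
    · rw [hu2 y hy, abs_mul, Real.rpow_neg hd.le, abs_inv,
        abs_of_pos (Real.rpow_pos_of_pos hd _),
        inv_mul_le_iff₀ (Real.rpow_pos_of_pos hd _)] at huy
      linarith
  have hpev2 : |pev (Q.1 0) y| ≤ δ * (1 + ∑ i, |coords y i|) ^ 1 :=
    (abs_pev_le hQ0.1 y).trans (mul_le_mul_of_nonneg_right hc (by positivity))
  calc |quotY e.s g y| = |(quotY e.s g y - pev (Q.1 0) y) + pev (Q.1 0) y| := by ring_nf
    _ ≤ _ := abs_add_le _ _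
    _ ≤ _ := by rw [mul_add]; exact add_le_add hdiff hpev2

/-! ### The normed spaces -/

variable (m) in
/-- `X_{α,ε}(𝓑_1^+)` as a vector space of functions. -/
def XSubmodule (e : Exponents) : Submodule ℝ (Pt m → ℝ) where
  carrier := {v | MemX e v}
  add_mem' {u v} hu hv := by simpa using memX_comb e 1 1 hu hv
  zero_mem' := memX_zero e
  smul_mem' c v hv := by simpa using memX_comb e c 0 hv (memX_zero e)

variable (m) in
/-- `Y_{α,ε}(𝓑_1^+)` as a vector space of functions. -/
def YSubmodule (e : Exponents) : Submodule ℝ (Pt m → ℝ) where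
  carrier := {g | MemY e g}
  add_mem' {u v} hu hv := by simpa using memY_comb e 1 1 hu hv
  zero_mem' := memY_zero e
  smul_mem' c v hv := by simpa using memY_comb e c 0 hv (memY_zero e)

variable (m) in
/-- The space `X_{α,ε}(𝓑_1^+)`. -/
def XSpace (e : Exponents) : Type := XSubmodule m e

variable (m) in
/-- The space `Y_{α,ε}(𝓑_1^+)`. -/
def YSpace (e : Exponents) : Type := YSubmodule m e

instance (e : Exponents) : AddCommGroup (XSpace m e) := inferInstanceAs (AddCommGroup (XSubmodule m e))

instance (e : Exponents) : Module ℝ (XSpace m e) := inferInstanceAs (Module ℝ (XSubmodule m e))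

instance (e : Exponents) : AddCommGroup (YSpace m e) := inferInstanceAs (AddCommGroup (YSubmodule m e))

instance (e : Exponents) : Module ℝ (YSpace m e) := inferInstanceAs (Module ℝ (YSubmodule m e))

/-- The function underlying an element of `X_{α,ε}(𝓑_1^+)`. -/
def XSpace.fn {e : Exponents} (v : XSpace m e) : Pt m → ℝ := v.1

/-- The function underlying an element of `Y_{α,ε}(𝓑_1^+)`. -/
def YSpace.fn {e : Exponents} (g : YSpace m e) : Pt m → ℝ := g.1

instance (e : Exponents) : Norm (XSpace m e) := ⟨fun v => (eNormX e v.fn).toReal⟩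

instance (e : Exponents) : Norm (YSpace m e) := ⟨fun g => (eNormY e g.fn).toReal⟩

theorem toReal_comb_le {a b : ℝ} {x y z : ℝ≥0∞} (hx : x < ⊤) (hy : y < ⊤)
    (h : z ≤ ENNReal.ofReal |a| * x + ENNReal.ofReal |b| * y) :
    z.toReal ≤ |a| * x.toReal + |b| * y.toReal := by
  have h1 : ENNReal.ofReal |a| * x ≠ ⊤ := (ENNReal.mul_lt_top ENNReal.ofReal_lt_top hx).ne
  have h2 : ENNReal.ofReal |b| * y ≠ ⊤ := (ENNReal.mul_lt_top ENNReal.ofReal_lt_top hy).ne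
  have := ENNReal.toReal_mono (ENNReal.add_ne_top.mpr ⟨h1, h2⟩) h
  rwa [ENNReal.toReal_add h1 h2, ENNReal.toReal_mul, ENNReal.toReal_mul,
    ENNReal.toReal_ofReal (abs_nonneg _), ENNReal.toReal_ofReal (abs_nonneg _)] at this

theorem norm_smul_of_le {E : Type*} [AddCommGroup E] [Module ℝ E] [Norm E]
    (h0 : ‖(0 : E)‖ = 0) (h : ∀ (c : ℝ) (x : E), ‖c • x‖ ≤ ‖c‖ * ‖x‖) (c : ℝ) (x : E) :
    ‖c • x‖ = ‖c‖ * ‖x‖ := by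
  refine le_antisymm (h c x) ?_
  rcases eq_or_ne c 0 with rfl | hc
  · simp [h0]
  · have h1 := h c⁻¹ (c • x)
    rw [inv_smul_smul₀ hc, norm_inv] at h1
    have hc' : 0 < ‖c‖ := norm_pos_iff.mpr hc
    calc ‖c‖ * ‖x‖ ≤ ‖c‖ * (‖c‖⁻¹ * ‖c • x‖) := mul_le_mul_of_nonneg_left h1 hc'.le
      _ = ‖c • x‖ := by field_simp

theorem XSpace.core (e : Exponents) : NormedSpace.Core ℝ (XSpace m e) where
  norm_nonneg _ := ENNReal.toReal_nonneg
  norm_smul := norm_smul_of_le (by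
      change (eNormX e (0 : Pt m → ℝ)).toReal = 0
      rw [eNormX_zero]; rfl) fun c v => by
    have h := toReal_comb_le v.2.finite (memX_zero (m := m) e).finite
      (eNormX_comb e c 0 v.2 (memX_zero e))
    simp only [zero_smul, add_zero, abs_zero, zero_mul] at h
    exact h
  norm_triangle u v := by
    have h := toReal_comb_le u.2.finite v.2.finite (eNormX_comb e 1 1 u.2 v.2)
    simp only [one_smul, abs_one, one_mul] at h
    exact h
  norm_eq_zero_iff v := by
    constructor
    · intro h
      have h1 : eNormX e v.1 = 0 :=
        ((ENNReal.toReal_eq_zero_iff _).mp h).resolve_right v.2.finite.ne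
      exact Subtype.ext (eNormX_eq_zero v.2 h1)
    · rintro rfl
      change (eNormX e (0 : Pt m → ℝ)).toReal = 0
      rw [eNormX_zero]; rfl

theorem YSpace.core (e : Exponents) : NormedSpace.Core ℝ (YSpace m e) where
  norm_nonneg _ := ENNReal.toReal_nonneg
  norm_smul := norm_smul_of_le (by
      change (eNormY e (0 : Pt m → ℝ)).toReal = 0
      rw [eNormY_zero]; rfl) fun c v => by
    have h := toReal_comb_le v.2.finite (memY_zero (m := m) e).finite
      (eNormY_comb e c 0 v.2 (memY_zero e))
    simp only [zero_smul, add_zero, abs_zero, zero_mul] at h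
    exact h
  norm_triangle u v := by
    have h := toReal_comb_le u.2.finite v.2.finite (eNormY_comb e 1 1 u.2 v.2)
    simp only [one_smul, abs_one, one_mul] at h
    exact h
  norm_eq_zero_iff v := by
    constructor
    · intro h
      have h1 : eNormY e v.1 = 0 :=
        ((ENNReal.toReal_eq_zero_iff _).mp h).resolve_right v.2.finite.ne
      exact Subtype.ext (eNormY_eq_zero v.2 h1)
    · rintro rfl
      change (eNormY e (0 : Pt m → ℝ)).toReal = 0
      rw [eNormY_zero]; rfl

instance (e : Exponents) : NormedAddCommGroup (XSpace m e) :=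
  NormedAddCommGroup.ofCore (XSpace.core e)

instance (e : Exponents) : NormedSpace ℝ (XSpace m e) := NormedSpace.ofCore (XSpace.core e)

instance (e : Exponents) : NormedAddCommGroup (YSpace m e) :=
  NormedAddCommGroup.ofCore (YSpace.core e)

instance (e : Exponents) : NormedSpace ℝ (YSpace m e) := NormedSpace.ofCore (YSpace.core e)

/-! ### The nonlinear functional -/

/-- `y_n^{1-2s} ∂_n v`. -/
def fluxN (s : ℝ) (v : Pt m → ℝ) (y : Pt m) : ℝ := y.2.1 ^ (1 - 2 * s) * pd eN v y

/-- `y_{n+1}^{2s-1} ∂_{n+1} v`. -/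
def fluxL (s : ℝ) (v : Pt m → ℝ) (y : Pt m) : ℝ := y.2.2 ^ (2 * s - 1) * pd eL v y

/-- `x_n(y) = -(1/2s) y_n^{1-2s} ∂_n v`. -/
def xN (s : ℝ) (v : Pt m → ℝ) (y : Pt m) : ℝ := -(1 / (2 * s)) * fluxN s v y

/-- `x_{n+1}(y) = (y_{n+1}^{2s-1} ∂_{n+1} v)^{1/(2s)}`. -/
def xL (s : ℝ) (v : Pt m → ℝ) (y : Pt m) : ℝ := fluxL s v y ^ (1 / (2 * s))

/-- The point `(y'', x_n(y), x_{n+1}(y))`. -/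
def xPoint (s : ℝ) (v : Pt m → ℝ) (y : Pt m) : Pt m := (y.1, xN s v y, xL s v y)

/-- The Jacobian `J(v)`. -/
def jac (s : ℝ) (v : Pt m → ℝ) (y : Pt m) : ℝ :=
  Matrix.det !![
    -(1 / (2 * s)) * pd eN (fluxN s v) y, -(1 / (2 * s)) * pd eL (fluxN s v) y;
    1 / (2 * s) * xL s v y ^ (1 - 2 * s) * pd eN (fluxL s v) y,
      1 / (2 * s) * xL s v y ^ (1 - 2 * s) * pd eL (fluxL s v) y]

/-- The `3 × 3` determinant for the tangential direction `e_i`. -/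
def tangDet (s : ℝ) (v : Pt m → ℝ) (i : Fin m) (y : Pt m) : ℝ :=
  Matrix.det !![
    pd (eT i) (pd (eT i) v) y, pd (eT i) (pd eN v) y, pd (eT i) (pd eL v) y;
    1 / (2 * s) * pd (eT i) (fluxN s v) y, -(1 / (2 * s)) * pd eN (fluxN s v) y,
      -(1 / (2 * s)) * pd eL (fluxN s v) y;
    -(1 / (2 * s)) * pd (eT i) (fluxL s v) y, 1 / (2 * s) * pd eN (fluxL s v) y,
      1 / (2 * s) * pd eL (fluxL s v) y]

/-- The expression `F(D²v, Dv, y)` with inhomogeneity `f`. -/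
def nonlinExpr (s : ℝ) (f v : Pt m → ℝ) (y : Pt m) : ℝ :=
  (∑ i : Fin m, xL s v y ^ (2 - 4 * s) * tangDet s v i y)
  + pd eN (fun z => z.2.1 ^ (1 - 2 * s) * z.2.2 ^ (1 - 2 * s) * pd eN v z) y
  + xL s v y ^ (2 - 4 * s)
      * pd eL (fun z => z.2.1 ^ (2 * s - 1) * z.2.2 ^ (2 * s - 1) * pd eL v z) y
  - xL s v y ^ (3 - 2 * s) * jac s v y * f (xPoint s v y)

/-- The function `F(v)` on the local domain, extended by zero. -/
def nonlinF (s : ℝ) (f v : Pt m → ℝ) : Pt m → ℝ := (dom m).indicator (nonlinExpr s f v)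

/-- The model solution `v_0(y) = -(s/(s+1)) y_n^{2s+2} + y_n^{2s} y_{n+1}^2` on the local domain,
extended by zero. -/
def modelSolution (s : ℝ) : Pt m → ℝ := (dom m).indicator fun y =>
  -(s / (s + 1)) * y.2.1 ^ (2 * s + 2) + y.2.1 ^ (2 * s) * y.2.2 ^ 2

variable (m) in
/-- The closed half space `ℝ^{n+1}_+`. -/
def halfSpace : Set (Pt m) := {x | 0 ≤ x.2.2}

/-- The functions in the `r`-neighborhood `𝓤_r(v₀)` for which all points `(y'', x_n(y), x_{n+1}(y))`
at which `F(v)` evaluates the inhomogeneity stay, up to their closure, in `Ω`. -/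
def nbhd {e : Exponents} (v₀ : XSpace m e) (r : ℝ) (Ω : Set (Pt m)) : Set (XSpace m e) :=
  {v | ‖v - v₀‖ < r ∧ closure (xPoint e.s v.fn '' dom m) ⊆ Ω}

end Grushin

end

noncomputable section

open scoped NNReal

namespace Grushin

section

variable {m : ℕ}

/-! ### Horizontal curves -/

/-- The Baouendi–Grushin distance with values in `[0,∞]`. -/
def eG (x y : Pt m) : ℝ≥0∞ :=
  ⨅ (γ : ℝ → Pt m) (γ' : ℝ → Pt m) (_ : IsHorizontalCurve γ γ' x y), curveLength γ γ'

theorem dG_eq_toReal (x y : Pt m) : dG x y = (eG x y).toReal := rfl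

/-- The distance of a point to `P`. -/
def rho (y : Pt m) : ℝ := √(y.2.1 ^ 2 + y.2.2 ^ 2)

theorem rho_nonneg (y : Pt m) : 0 ≤ rho y := Real.sqrt_nonneg _

theorem rho_sq (y : Pt m) : rho y ^ 2 = y.2.1 ^ 2 + y.2.2 ^ 2 :=
  Real.sq_sqrt (by positivity)

theorem speed_nonneg (y w : Pt m) : 0 ≤ speed y w := Real.sqrt_nonneg _

theorem speed_smul (y w : Pt m) (c : ℝ) : speed y (c • w) = |c| * speed y w := by
  unfold speed
  rw [← Real.sqrt_sq_eq_abs, ← Real.sqrt_mul (sq_nonneg c)]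
  congr 1
  simp only [Prod.smul_fst, Prod.smul_snd, norm_smul, Real.norm_eq_abs, smul_eq_mul, mul_pow,
    sq_abs]
  ring

theorem lintegral_comp_affine {c : ℝ} (hc : 0 < c) (d a b : ℝ) (f : ℝ → ℝ≥0∞) :
    ∫⁻ t in Icc a b, ENNReal.ofReal c * f (c * t + d) =
      ∫⁻ t in Icc (c * a + d) (c * b + d), f t := by
  rw [← image_affine_Icc' hc, lintegral_image_eq_lintegral_abs_deriv_mul measurableSet_Icc
    (f' := fun _ => c)]
  · simp [abs_of_pos hc]
  · intro x _
    simpa using (((hasDerivAt_id x).const_mul c).add_const d).hasDerivWithinAt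
  · intro x _ y _ h
    simpa [hc.ne'] using h

/-- Horizontality is demanded only almost everywhere, so each reparametrization of a curve has to
pull back a null set. -/
theorem ae_comp_affine {c : ℝ} (hc : c ≠ 0) (d : ℝ) {p : ℝ → Prop} (h : ∀ᵐ t, p t) :
    ∀ᵐ t, p (c * t + d) := by
  rw [ae_iff] at h ⊢
  have : {t | ¬ p (c * t + d)} = (fun t => c * t) ⁻¹' ((fun t => t + d) ⁻¹' {t | ¬ p t}) := rfl
  rw [this, Real.volume_preimage_mul_left hc, measure_preimage_add_right, h, mul_zero]

namespace IsHorizontalCurve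

variable {γ γ' : ℝ → Pt m} {x y : Pt m}

theorem start (h : IsHorizontalCurve γ γ' x y) : γ 0 = x := by
  rw [h.eq_integral 0 (by simp)]; simp

theorem ae_horizontal (h : IsHorizontalCurve γ γ' x y) :
    ∀ᵐ t, t ∈ Icc (0 : ℝ) 1 → (γ t).2.1 = 0 → (γ t).2.2 = 0 → (γ' t).1 = 0 :=
  (ae_restrict_iff' measurableSet_Icc).mp h.horizontal

theorem integrable_sub (h : IsHorizontalCurve γ γ' x y) {a b : ℝ} (ha : a ∈ Icc (0 : ℝ) 1)
    (hb : b ∈ Icc (0 : ℝ) 1) : IntervalIntegrable γ' volume a b :=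
  h.integrable.mono_set (uIcc_subset_uIcc (by simpa using ha) (by simpa using hb))

theorem sub_eq_integral (h : IsHorizontalCurve γ γ' x y) {a b : ℝ} (ha : a ∈ Icc (0 : ℝ) 1)
    (hb : b ∈ Icc (0 : ℝ) 1) : γ b - γ a = ∫ τ in a..b, γ' τ := by
  rw [h.eq_integral b hb, h.eq_integral a ha, add_sub_add_left_eq_sub,
    intervalIntegral.integral_interval_sub_left (h.integrable_sub (by simp) hb)
      (h.integrable_sub (by simp) ha)]

theorem continuousOn (h : IsHorizontalCurve γ γ' x y) : ContinuousOn γ (Icc 0 1) := by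
  have h1 := intervalIntegral.continuousOn_primitive_interval'
    (μ := volume) (f := γ') (b₁ := 0) (b₂ := 1) (a := 0) h.integrable (by simp)
  rw [uIcc_of_le zero_le_one] at h1
  exact (continuousOn_const.add h1).congr h.eq_integral

/-- The displacement along a curve is controlled by its length. -/
theorem norm_sub_le (h : IsHorizontalCurve γ γ' x y) {E : Type*} [NormedAddCommGroup E]
    [NormedSpace ℝ E] [CompleteSpace E] (l : Pt m →L[ℝ] E) {a b K L : ℝ} (ha : 0 ≤ a)
    (hab : a ≤ b) (hb : b ≤ 1) (hK : 0 ≤ K) (hL : 0 ≤ L)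
    (hl : ∀ᵐ t, t ∈ Icc a b → ‖l (γ' t)‖ ≤ K * speed (γ t) (γ' t))
    (hlen : ∫⁻ t in Icc a b, ENNReal.ofReal (speed (γ t) (γ' t)) ≤ ENNReal.ofReal L) :
    ‖l (γ b - γ a)‖ ≤ K * L := by
  have ha' : a ∈ Icc (0 : ℝ) 1 := ⟨ha, hab.trans hb⟩
  have hb' : b ∈ Icc (0 : ℝ) 1 := ⟨ha.trans hab, hb⟩
  rw [h.sub_eq_integral ha' hb', ← l.intervalIntegral_comp_comm (h.integrable_sub ha' hb'),
    intervalIntegral.integral_of_le hab, ← integral_Icc_eq_integral_Ioc]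
  have h1 : ‖∫ t in Icc a b, l (γ' t)‖ₑ ≤ ENNReal.ofReal (K * L) :=
    calc ‖∫ t in Icc a b, l (γ' t)‖ₑ ≤ ∫⁻ t in Icc a b, ‖l (γ' t)‖ₑ :=
          enorm_integral_le_lintegral_enorm _
      _ ≤ ∫⁻ t in Icc a b, ENNReal.ofReal K * ENNReal.ofReal (speed (γ t) (γ' t)) := by
          refine lintegral_mono_ae ((ae_restrict_iff' measurableSet_Icc).mpr ?_)
          filter_upwards [hl] with t ht htm
          rw [← ENNReal.ofReal_mul hK, ← ofReal_norm]
          exact ENNReal.ofReal_le_ofReal (ht htm)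
      _ = ENNReal.ofReal K * ∫⁻ t in Icc a b, ENNReal.ofReal (speed (γ t) (γ' t)) :=
          lintegral_const_mul' _ _ ENNReal.ofReal_ne_top
      _ ≤ _ := by
          rw [ENNReal.ofReal_mul hK]
          gcongr
  rw [← ofReal_norm] at h1
  exact (ENNReal.ofReal_le_ofReal_iff (by positivity)).mp h1

/-- Cauchy–Schwarz: the normal part of the velocity is Euclidean in the metric. The free direction
(p, q) serves for both normal coordinates and, chosen radially, for the distance to P. -/
theorem normal_le (h : IsHorizontalCurve γ γ' x y) {a b L p q : ℝ} (hpq : p ^ 2 + q ^ 2 ≤ 1)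
    (ha : 0 ≤ a) (hab : a ≤ b) (hb : b ≤ 1) (hL : 0 ≤ L)
    (hlen : ∫⁻ t in Icc a b, ENNReal.ofReal (speed (γ t) (γ' t)) ≤ ENNReal.ofReal L) :
    |p * ((γ b).2.1 - (γ a).2.1) + q * ((γ b).2.2 - (γ a).2.2)| ≤ L := by
  have h1 := h.norm_sub_le
    (p • (ContinuousLinearMap.fst ℝ ℝ ℝ ∘L ContinuousLinearMap.snd ℝ _ (ℝ × ℝ)) +
      q • (ContinuousLinearMap.snd ℝ ℝ ℝ ∘L ContinuousLinearMap.snd ℝ _ (ℝ × ℝ)))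
    (K := 1) ha hab hb zero_le_one hL (Eventually.of_forall fun t _ => by
      rw [one_mul]
      refine Real.le_sqrt_of_sq_le ?_
      simp only [add_apply, smul_apply,
        ContinuousLinearMap.comp_apply, ContinuousLinearMap.coe_fst', ContinuousLinearMap.coe_snd',
        smul_eq_mul, Real.norm_eq_abs, sq_abs]
      set u := (γ' t).2.1
      set v := (γ' t).2.2
      have h0 : 0 ≤ ‖(γ' t).1‖ ^ 2 / ((γ t).2.1 ^ 2 + (γ t).2.2 ^ 2) := by positivity
      nlinarith [sq_nonneg (p * v - q * u), mul_nonneg (sub_nonneg.mpr hpq)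
        (add_nonneg (sq_nonneg u) (sq_nonneg v))]) hlen
  simpa using h1

theorem rho_sub_le (h : IsHorizontalCurve γ γ' x y) {a b L : ℝ}
    (ha : 0 ≤ a) (hab : a ≤ b) (hb : b ≤ 1) (hL : 0 ≤ L)
    (hlen : ∫⁻ t in Icc a b, ENNReal.ofReal (speed (γ t) (γ' t)) ≤ ENNReal.ofReal L) :
    |rho (γ b) - rho (γ a)| ≤ L := by
  have key : ∀ u v : Pt m, (∀ p q : ℝ, p ^ 2 + q ^ 2 ≤ 1 →
      |p * (u.2.1 - v.2.1) + q * (u.2.2 - v.2.2)| ≤ L) → rho u - rho v ≤ L := by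
    intro u v H
    rcases eq_or_lt_of_le (rho_nonneg u) with h0 | h0
    · rw [← h0]; linarith [rho_nonneg v]
    · have hs := rho_sq u
      have hv := rho_sq v
      -- Testing with the radial unit vector at u gives rho u minus the projection of v onto that
      -- direction, and this projection is at most rho v.
      have h1 := (le_abs_self _).trans (H (u.2.1 / rho u) (u.2.2 / rho u) (by
        rw [div_pow, div_pow, ← add_div, ← hs, div_self (by positivity)]))
      have h2 : u.2.1 / rho u * (u.2.1 - v.2.1) + u.2.2 / rho u * (u.2.2 - v.2.2) =
          rho u - (u.2.1 * v.2.1 + u.2.2 * v.2.2) / rho u := by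
        field_simp
        rw [hs]; ring
      have h3 : (u.2.1 * v.2.1 + u.2.2 * v.2.2) / rho u ≤ rho v := by
        rw [div_le_iff₀ h0]
        refine le_of_sq_le_sq ?_ (mul_nonneg (rho_nonneg v) h0.le)
        rw [mul_pow, hs, hv]
        nlinarith [sq_nonneg (u.2.1 * v.2.2 - u.2.2 * v.2.1)]
      linarith
  refine abs_sub_le_iff.mpr ⟨key _ _ fun p q hpq => h.normal_le hpq ha hab hb hL hlen,
    key _ _ fun p q hpq => ?_⟩
  have := h.normal_le (p := -p) (q := -q) (by simpa using hpq) ha hab hb hL hlen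
  convert this using 2
  ring

/-- By the form of the metric the tangential velocity is at most rho times the speed; a curve of
height at most K therefore drifts tangentially by at most K times its length. -/
theorem norm_tangential_sub_le (h : IsHorizontalCurve γ γ' x y) {a b K L : ℝ}
    (ha : 0 ≤ a) (hab : a ≤ b) (hb : b ≤ 1) (hL : 0 ≤ L)
    (hK : ∀ t ∈ Icc a b, rho (γ t) ≤ K)
    (hlen : ∫⁻ t in Icc a b, ENNReal.ofReal (speed (γ t) (γ' t)) ≤ ENNReal.ofReal L) :
    ‖(γ b).1 - (γ a).1‖ ≤ K * L := by
  have hK0 : 0 ≤ K := (rho_nonneg _).trans (hK a ⟨le_rfl, hab⟩)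
  refine h.norm_sub_le (ContinuousLinearMap.fst ℝ _ _) ha hab hb hK0 hL ?_ hlen
  filter_upwards [h.ae_horizontal] with t ht htm
  have h2 : ‖(γ' t).1‖ ≤ rho (γ t) * speed (γ t) (γ' t) := by
    -- On P the quotient in `speed` is 0 by the convention for division by zero, so `speed` does not
    -- see the tangential velocity there. The horizontality condition takes over.
    by_cases h0 : (γ t).2.1 ^ 2 + (γ t).2.2 ^ 2 = 0
    · have e1 : (γ t).2.1 = 0 := by nlinarith [sq_nonneg (γ t).2.1, sq_nonneg (γ t).2.2]
      have e2 : (γ t).2.2 = 0 := by nlinarith [sq_nonneg (γ t).2.1, sq_nonneg (γ t).2.2]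
      rw [ht ⟨ha.trans htm.1, htm.2.trans hb⟩ e1 e2, norm_zero]
      exact mul_nonneg (rho_nonneg _) (speed_nonneg _ _)
    · have h3 : 0 < (γ t).2.1 ^ 2 + (γ t).2.2 ^ 2 := lt_of_le_of_ne (by positivity) (Ne.symm h0)
      unfold rho speed
      rw [← Real.sqrt_mul h3.le]
      refine Real.le_sqrt_of_sq_le ?_
      rw [mul_add, mul_add, mul_div_cancel₀ _ h0]
      nlinarith [mul_nonneg h3.le (sq_nonneg (γ' t).2.1), mul_nonneg h3.le (sq_nonneg (γ' t).2.2)]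
  exact h2.trans (mul_le_mul_of_nonneg_right (hK t htm) (speed_nonneg _ _))

theorem restrict (h : IsHorizontalCurve γ γ' x y) {c : ℝ} (hc : 0 < c) (hc1 : c ≤ 1) :
    IsHorizontalCurve (fun t => γ (c * t)) (fun t => c • γ' (c * t)) x (γ c) where
  integrable := by
    have h1 := (h.integrable_sub (a := 0) (b := c) (by simp) ⟨hc.le, hc1⟩).comp_mul_left (c := c)
    simp only [zero_div, div_self hc.ne'] at h1
    exact h1.smul c
  eq_integral t ht := by
    rw [intervalIntegral.integral_smul, intervalIntegral.smul_integral_comp_mul_left, mul_zero]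
    exact h.eq_integral _ ⟨mul_nonneg hc.le ht.1, mul_le_one₀ hc1 ht.1 ht.2⟩
  endpoint := by simp
  horizontal := by
    rw [ae_restrict_iff' measurableSet_Icc]
    filter_upwards [ae_comp_affine hc.ne' 0 h.ae_horizontal] with t h1 ht h2 h3
    rw [add_zero] at h1
    rw [Prod.smul_fst, h1 ⟨mul_nonneg hc.le ht.1, mul_le_one₀ hc1 ht.1 ht.2⟩ h2 h3, smul_zero]

theorem length_restrict (γ γ' : ℝ → Pt m) {c : ℝ} (hc : 0 < c) :
    curveLength (fun t => γ (c * t)) (fun t => c • γ' (c * t)) =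
      ∫⁻ t in Icc 0 c, ENNReal.ofReal (speed (γ t) (γ' t)) := by
  have h := lintegral_comp_affine hc 0 0 1 (fun t => ENNReal.ofReal (speed (γ t) (γ' t)))
  simp only [add_zero, mul_zero, mul_one] at h
  rw [← h]
  unfold curveLength
  simp only [speed_smul, abs_of_pos hc, ENNReal.ofReal_mul hc.le]

theorem reverse (h : IsHorizontalCurve γ γ' x y) :
    IsHorizontalCurve (fun t => γ (1 - t)) (fun t => -γ' (1 - t)) y x where
  integrable := by
    have := h.integrable.comp_sub_left 1
    rw [sub_zero, sub_self] at this
    exact this.symm.neg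
  eq_integral t ht := by
    rw [intervalIntegral.integral_neg, intervalIntegral.integral_comp_sub_left (fun t => γ' t),
      ← h.endpoint, ← sub_eq_add_neg, sub_zero,
      ← h.sub_eq_integral ⟨by linarith [ht.2], by linarith [ht.1]⟩ (by simp)]
    abel
  endpoint := by simp [h.start]
  horizontal := by
    rw [ae_restrict_iff' measurableSet_Icc]
    filter_upwards [ae_comp_affine (c := -1) (by norm_num) 1 h.ae_horizontal] with t h1 ht h2 h3
    have e : -1 * t + 1 = 1 - t := by ring
    rw [e] at h1
    rw [Prod.fst_neg, h1 ⟨by linarith [ht.2], by linarith [ht.1]⟩ h2 h3, neg_zero]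

theorem length_reverse (γ γ' : ℝ → Pt m) :
    curveLength (fun t => γ (1 - t)) (fun t => -γ' (1 - t)) = curveLength γ γ' := by
  unfold curveLength
  have e : (fun t : ℝ => 1 - t) '' Icc 0 1 = Icc 0 1 := by simp
  conv_rhs => rw [← e]
  rw [lintegral_image_eq_lintegral_abs_deriv_mul (f' := fun _ => -1) measurableSet_Icc]
  · have : ∀ y w : Pt m, speed y (-w) = speed y w := fun y w => by
      have := speed_smul y w (-1); simpa using this
    simp [this]
  · intro x _
    simpa using ((hasDerivAt_id x).const_sub 1).hasDerivWithinAt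
  · intro x _ y _ h
    simpa using h

end IsHorizontalCurve

end

section

variable {m : ℕ}

namespace IsHorizontalCurve

variable {γ₁ γ₁' γ₂ γ₂' : ℝ → Pt m} {x y z : Pt m}

theorem trans (h₁ : IsHorizontalCurve γ₁ γ₁' x y) (h₂ : IsHorizontalCurve γ₂ γ₂' y z) :
    IsHorizontalCurve (fun t => if t ≤ 1 / 2 then γ₁ (2 * t) else γ₂ (2 * t - 1))
      (fun t => if t ≤ 1 / 2 then (2 : ℝ) • γ₁' (2 * t) else (2 : ℝ) • γ₂' (2 * t - 1)) x z := by
  set σ' : ℝ → Pt m :=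
    fun t => if t ≤ 1 / 2 then (2 : ℝ) • γ₁' (2 * t) else (2 : ℝ) • γ₂' (2 * t - 1) with hσ
  have i1 : IntervalIntegrable (fun t => (2 : ℝ) • γ₁' (2 * t)) volume 0 (1 / 2) := by
    have := h₁.integrable.comp_mul_left (c := 2)
    rw [zero_div] at this
    exact this.smul (2 : ℝ)
  have i2 : IntervalIntegrable (fun t => (2 : ℝ) • γ₂' (2 * t - 1)) volume (1 / 2) 1 := by
    have h3 := (h₂.integrable.comp_add_right (-1)).comp_mul_left (c := 2)
    have e1 : ((0 : ℝ) - -1) / 2 = 1 / 2 := by norm_num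
    have e2 : ((1 : ℝ) - -1) / 2 = 1 := by norm_num
    rw [e1, e2] at h3
    exact h3.smul (2 : ℝ)
  have c1 : ∀ t ≤ (1 / 2 : ℝ), 0 ≤ t → EqOn (fun t => (2 : ℝ) • γ₁' (2 * t)) σ' (uIoc 0 t) :=
    fun t ht h0 τ hτ => by
      rw [uIoc_of_le h0] at hτ
      simp only [hσ, if_pos (hτ.2.trans ht)]
  have c2 : ∀ t, (1 / 2 : ℝ) ≤ t →
      EqOn (fun t => (2 : ℝ) • γ₂' (2 * t - 1)) σ' (uIoc (1 / 2) t) :=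
    fun t ht τ hτ => by
      rw [uIoc_of_le ht] at hτ
      simp only [hσ, if_neg (not_le.mpr hτ.1)]
  have j1 : IntervalIntegrable σ' volume 0 (1 / 2) := i1.congr (c1 _ le_rfl (by norm_num))
  have j2 : IntervalIntegrable σ' volume (1 / 2) 1 := i2.congr (c2 _ (by norm_num))
  have k1 : ∀ t ≤ (1 / 2 : ℝ), 0 ≤ t → ∫ τ in (0 : ℝ)..t, σ' τ = γ₁ (2 * t) - x := fun t ht h0 => by
    rw [← intervalIntegral.integral_congr_ae (Eventually.of_forall fun τ hτ => c1 t ht h0 hτ), intervalIntegral.integral_smul,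
      intervalIntegral.smul_integral_comp_mul_left, mul_zero,
      h₁.eq_integral (2 * t) ⟨by linarith, by linarith⟩]
    abel
  refine ⟨j1.trans j2, fun t ht => ?_, ?_, ?_⟩
  · split_ifs with h
    · rw [k1 t h ht.1]; abel
    · push Not at h
      have l1 : IntervalIntegrable σ' volume (1 / 2) t := j2.mono_set (by
        rw [uIcc_of_le h.le, uIcc_of_le (by norm_num)]
        exact Icc_subset_Icc le_rfl ht.2)
      have k2 : ∫ τ in (1 / 2 : ℝ)..t, σ' τ = γ₂ (2 * t - 1) - y := by
        rw [← intervalIntegral.integral_congr_ae (Eventually.of_forall fun τ hτ => c2 t h.le hτ), intervalIntegral.integral_smul,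
          intervalIntegral.smul_integral_comp_mul_sub (fun τ => γ₂' τ) 2 1,
          h₂.eq_integral (2 * t - 1) ⟨by linarith, by linarith [ht.2]⟩]
        norm_num
      rw [← intervalIntegral.integral_add_adjacent_intervals j1 l1, k1 _ le_rfl (by norm_num), k2]
      have : (2 : ℝ) * (1 / 2) = 1 := by norm_num
      rw [this, h₁.endpoint]
      abel
  · simp only [show ¬ ((1 : ℝ) ≤ 1 / 2) by norm_num, if_false]
    rw [← h₂.endpoint]; norm_num
  · rw [ae_restrict_iff' measurableSet_Icc]
    filter_upwards [ae_comp_affine (c := 2) two_ne_zero 0 h₁.ae_horizontal,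
      ae_comp_affine (c := 2) two_ne_zero (-1) h₂.ae_horizontal] with t h3 h4 ht
    simp only [hσ]
    rw [add_zero] at h3
    rw [← sub_eq_add_neg] at h4
    split_ifs with h
    · intro h5 h6
      rw [Prod.smul_fst, h3 ⟨by linarith [ht.1], by linarith⟩ h5 h6, smul_zero]
    · intro h5 h6
      push Not at h
      rw [Prod.smul_fst, h4 ⟨by linarith, by linarith [ht.2]⟩ h5 h6, smul_zero]

theorem length_trans (γ₁ γ₁' γ₂ γ₂' : ℝ → Pt m) :
    curveLength (fun t => if t ≤ 1 / 2 then γ₁ (2 * t) else γ₂ (2 * t - 1))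
      (fun t => if t ≤ 1 / 2 then (2 : ℝ) • γ₁' (2 * t) else (2 : ℝ) • γ₂' (2 * t - 1)) ≤
      curveLength γ₁ γ₁' + curveLength γ₂ γ₂' := by
  unfold curveLength
  have hu : Icc (0 : ℝ) 1 = Icc 0 (1 / 2) ∪ Ioc (1 / 2) 1 :=
    (Icc_union_Ioc_eq_Icc (by norm_num) (by norm_num)).symm
  conv_lhs => rw [hu]
  refine (lintegral_union_le _ _ _).trans (add_le_add ?_ ?_)
  · have h := lintegral_comp_affine two_pos 0 0 (1 / 2)
      (fun t => ENNReal.ofReal (speed (γ₁ t) (γ₁' t)))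
    norm_num at h
    rw [← h]
    refine (setLIntegral_congr_fun measurableSet_Icc fun t ht => ?_).le
    have ht2 : t ≤ 1 / 2 := by linarith [ht.2]
    simp only [if_pos ht2, speed_smul]
    rw [ENNReal.ofReal_mul (abs_nonneg _)]
    norm_num
  · have h := lintegral_comp_affine two_pos (-1) (1 / 2) 1
      (fun t => ENNReal.ofReal (speed (γ₂ t) (γ₂' t)))
    norm_num at h
    rw [← h]
    refine (setLIntegral_congr_fun measurableSet_Ioc fun t ht => ?_).le.trans
      (lintegral_mono_set Ioc_subset_Icc_self)
    simp only [if_neg (not_le.mpr ht.1), speed_smul]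
    rw [ENNReal.ofReal_mul (abs_nonneg _), ← sub_eq_add_neg]
    norm_num

end IsHorizontalCurve

/-! ### The distance -/

theorem eG_le_length {γ γ' : ℝ → Pt m} {x y : Pt m} (h : IsHorizontalCurve γ γ' x y) :
    eG x y ≤ curveLength γ γ' :=
  iInf_le_of_le γ (iInf_le_of_le γ' (iInf_le _ h))

theorem exists_curve_of_eG_lt {x y : Pt m} {L : ℝ≥0∞} (h : eG x y < L) :
    ∃ γ γ', IsHorizontalCurve γ γ' x y ∧ curveLength γ γ' < L := by
  unfold eG at h
  simp only [iInf_lt_iff] at h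
  obtain ⟨γ, γ', h1, h2⟩ := h
  exact ⟨γ, γ', h1, h2⟩

theorem eG_triangle (x y z : Pt m) : eG x z ≤ eG x y + eG y z := by
  refine le_of_forall_gt fun L hL => ?_
  -- Half of the slack between the sum of the distances and L goes to each of the two curves.
  obtain ⟨a, ha, b, hb, hab⟩ : ∃ a, eG x y < a ∧ ∃ b, eG y z < b ∧ a + b ≤ L := by
    have hx : eG x y ≠ ⊤ := fun h => by simp [h] at hL
    have hz : eG y z ≠ ⊤ := fun h => by simp [h] at hL
    obtain ⟨δ, hδ, hδL⟩ := ENNReal.lt_iff_exists_add_pos_lt.mp hL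
    have hδ0 : (δ : ℝ≥0∞) / 2 ≠ 0 := by simpa using hδ.ne'
    refine ⟨_, ENNReal.lt_add_right hx hδ0, _, ENNReal.lt_add_right hz hδ0, ?_⟩
    rw [add_add_add_comm, ENNReal.add_halves]
    exact hδL.le
  obtain ⟨γ₁, γ₁', h1, l1⟩ := exists_curve_of_eG_lt ha
  obtain ⟨γ₂, γ₂', h2, l2⟩ := exists_curve_of_eG_lt hb
  calc eG x z ≤ _ := eG_le_length (h1.trans h2)
    _ ≤ _ := IsHorizontalCurve.length_trans _ _ _ _
    _ < a + b := ENNReal.add_lt_add l1 l2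
    _ ≤ L := hab

theorem eG_symm_le (x y : Pt m) : eG x y ≤ eG y x := by
  refine le_of_forall_gt fun L hL => ?_
  obtain ⟨γ, γ', h1, l1⟩ := exists_curve_of_eG_lt hL
  exact (eG_le_length h1.reverse).trans_lt
    ((IsHorizontalCurve.length_reverse γ γ').trans_lt l1)

theorem eG_symm (x y : Pt m) : eG x y = eG y x := le_antisymm (eG_symm_le _ _) (eG_symm_le _ _)

/-- The straight segment, if it is horizontal. -/
theorem eG_segment_le {x y : Pt m} {M : ℝ}
    (hh : ∀ t ∈ Icc (0 : ℝ) 1, (x + t • (y - x)).2.1 = 0 → (x + t • (y - x)).2.2 = 0 → y.1 = x.1)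
    (hs : ∀ t ∈ Icc (0 : ℝ) 1, speed (x + t • (y - x)) (y - x) ≤ M) :
    eG x y ≤ ENNReal.ofReal M := by
  have hcurve : IsHorizontalCurve (fun t : ℝ => x + t • (y - x)) (fun _ => y - x) x y := by
    refine ⟨by simp, fun t _ => by simp [smul_sub], by simp, ?_⟩
    exact (ae_restrict_iff' measurableSet_Icc).mpr (Eventually.of_forall fun t ht h1 h2 => by
      rw [Prod.fst_sub, hh t ht h1 h2, sub_self])
  refine (eG_le_length hcurve).trans ?_
  unfold curveLength
  calc ∫⁻ t in Icc (0 : ℝ) 1, ENNReal.ofReal (speed (x + t • (y - x)) (y - x))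
      ≤ ∫⁻ _ in Icc (0 : ℝ) 1, ENNReal.ofReal M :=
        setLIntegral_mono measurable_const fun t ht => ENNReal.ofReal_le_ofReal (hs t ht)
    _ = ENNReal.ofReal M := by simp

theorem eG_vertical_le (x : EuclideanSpace ℝ (Fin m)) (a b : ℝ × ℝ) :
    eG (x, a) (x, b) ≤ ENNReal.ofReal √((b.1 - a.1) ^ 2 + (b.2 - a.2) ^ 2) := by
  refine eG_segment_le (fun _ _ _ _ => rfl) fun t _ => ?_
  simp [speed]

theorem eG_proj_le (y : Pt m) : eG y (proj y) ≤ ENNReal.ofReal (rho y) := by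
  have := eG_vertical_le y.1 y.2 (0, 0)
  simpa [rho, proj] using this

theorem eG_level_le (x z : EuclideanSpace ℝ (Fin m)) {a : ℝ × ℝ} (ha : 0 < a.1 ^ 2 + a.2 ^ 2) :
    eG (x, a) (z, a) ≤ ENNReal.ofReal (‖z - x‖ / √(a.1 ^ 2 + a.2 ^ 2)) := by
  refine eG_segment_le (fun t _ h1 h2 => ?_) fun t _ => ?_
  · simp at h1 h2
    simp [h1, h2] at ha
  · simp only [speed, Prod.mk_sub_mk, Prod.smul_mk, Prod.mk_add_mk, sub_self, smul_zero, add_zero,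
      Prod.fst_zero, Prod.snd_zero]
    rw [← Real.sqrt_sq (norm_nonneg (z - x)), ← Real.sqrt_div (by positivity)]
    simp

/-- Climb to height h = √‖z - x‖, travel there at cost ‖z - x‖ / h = h, and descend: three pieces of
length at most h. -/
theorem eG_edge_le (x z : EuclideanSpace ℝ (Fin m)) :
    eG ((x, 0, 0) : Pt m) (z, 0, 0) ≤ ENNReal.ofReal (3 * √‖z - x‖) := by
  rcases eq_or_ne z x with rfl | hne
  · refine (eG_vertical_le z (0, 0) (0, 0)).trans ?_
    simp
  · have hp : 0 < ‖z - x‖ := norm_pos_iff.mpr (sub_ne_zero.mpr hne)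
    set h := √‖z - x‖ with hh
    have h0 : 0 < h := Real.sqrt_pos.mpr hp
    have hsq : h ^ 2 = ‖z - x‖ := Real.sq_sqrt hp.le
    have e1 : eG ((x, 0, 0) : Pt m) (x, h, 0) ≤ ENNReal.ofReal h := by
      refine (eG_vertical_le x (0, 0) (h, 0)).trans (ENNReal.ofReal_le_ofReal ?_)
      simp [Real.sqrt_sq h0.le]
    have e2 : eG ((x, h, 0) : Pt m) (z, h, 0) ≤ ENNReal.ofReal h := by
      refine (eG_level_le x z (a := (h, 0)) (by positivity)).trans (ENNReal.ofReal_le_ofReal ?_)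
      simp only [ne_eq, OfNat.ofNat_ne_zero, not_false_eq_true, zero_pow, add_zero,
        Real.sqrt_sq h0.le, ← hsq]
      rw [pow_two, mul_div_cancel_right₀ _ h0.ne']
    have e3 : eG ((z, h, 0) : Pt m) (z, 0, 0) ≤ ENNReal.ofReal h := by
      refine (eG_vertical_le z (h, 0) (0, 0)).trans (ENNReal.ofReal_le_ofReal ?_)
      simp [Real.sqrt_sq h0.le]
    calc eG ((x, 0, 0) : Pt m) (z, 0, 0)
        ≤ eG ((x, 0, 0) : Pt m) (z, h, 0) + eG ((z, h, 0) : Pt m) (z, 0, 0) := eG_triangle _ _ _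
      _ ≤ (eG ((x, 0, 0) : Pt m) (x, h, 0) + eG ((x, h, 0) : Pt m) (z, h, 0)) +
          eG ((z, h, 0) : Pt m) (z, 0, 0) := by gcongr; exact eG_triangle _ _ _
      _ ≤ ENNReal.ofReal h + ENNReal.ofReal h + ENNReal.ofReal h := by gcongr
      _ = _ := by
          rw [← ENNReal.ofReal_add h0.le h0.le, ← ENNReal.ofReal_add (by positivity) h0.le]
          congr 1; ring

/-- Any two points are joined through their projections onto P. Hence the passage to real numbers in
`dG` never meets its default value at infinity. -/
theorem eG_lt_top (x y : Pt m) : eG x y < ⊤ := by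
  calc eG x y ≤ eG x (proj x) + eG (proj x) y := eG_triangle _ _ _
    _ ≤ eG x (proj x) + (eG (proj x) (proj y) + eG (proj y) y) := by
        gcongr; exact eG_triangle _ _ _
    _ < ⊤ := by
        refine ENNReal.add_lt_top.mpr ⟨(eG_proj_le x).trans_lt ENNReal.ofReal_lt_top,
          ENNReal.add_lt_top.mpr ⟨(eG_edge_le _ _).trans_lt ENNReal.ofReal_lt_top, ?_⟩⟩
        rw [eG_symm]
        exact (eG_proj_le y).trans_lt ENNReal.ofReal_lt_top

theorem eG_eq_ofReal (x y : Pt m) : eG x y = ENNReal.ofReal (dG x y) :=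
  (ENNReal.ofReal_toReal (eG_lt_top x y).ne).symm

theorem dG_le_of_eG {x y : Pt m} {M : ℝ} (hM : 0 ≤ M) (h : eG x y ≤ ENNReal.ofReal M) :
    dG x y ≤ M := ENNReal.toReal_le_of_le_ofReal hM h

theorem dG_comm (x y : Pt m) : dG x y = dG y x := by
  rw [dG_eq_toReal, dG_eq_toReal, eG_symm]

theorem dG_triangle (x y z : Pt m) : dG x z ≤ dG x y + dG y z := by
  rw [dG_eq_toReal, dG_eq_toReal, dG_eq_toReal,
    ← ENNReal.toReal_add (eG_lt_top _ _).ne (eG_lt_top _ _).ne]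
  exact ENNReal.toReal_mono (ENNReal.add_ne_top.mpr ⟨(eG_lt_top _ _).ne, (eG_lt_top _ _).ne⟩)
    (eG_triangle x y z)

theorem exists_curve_of_dG_lt {x y : Pt m} {L : ℝ} (h : dG x y < L) :
    ∃ γ γ', IsHorizontalCurve γ γ' x y ∧ curveLength γ γ' < ENNReal.ofReal L := by
  refine exists_curve_of_eG_lt ?_
  rw [eG_eq_ofReal]
  exact (ENNReal.ofReal_lt_ofReal_iff ((dG_nonneg x y).trans_lt h)).mpr h

theorem dG_vertical_le (x : EuclideanSpace ℝ (Fin m)) (a b : ℝ × ℝ) :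
    dG (x, a) (x, b) ≤ √((b.1 - a.1) ^ 2 + (b.2 - a.2) ^ 2) :=
  dG_le_of_eG (Real.sqrt_nonneg _) (eG_vertical_le _ _ _)

theorem dG_level_le (x z : EuclideanSpace ℝ (Fin m)) {a : ℝ × ℝ} (ha : 0 < a.1 ^ 2 + a.2 ^ 2) :
    dG (x, a) (z, a) ≤ ‖z - x‖ / √(a.1 ^ 2 + a.2 ^ 2) :=
  dG_le_of_eG (by positivity) (eG_level_le x z ha)

theorem dG_edge_le (x z : EuclideanSpace ℝ (Fin m)) :
    dG ((x, 0, 0) : Pt m) (z, 0, 0) ≤ 3 * √‖z - x‖ :=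
  dG_le_of_eG (by positivity) (eG_edge_le x z)

/-- Bounds in terms of the length L of an almost optimal curve pass to the distance as L decreases
to it, so no minimizing curve is needed. -/
theorem le_of_forall_gt_dG {x y : Pt m} {a : ℝ} {f : ℝ → ℝ} (hf : Continuous f)
    (h : ∀ L, dG x y < L → a ≤ f L) : a ≤ f (dG x y) := by
  have h1 : Tendsto f (𝓝[>] dG x y) (𝓝 (f (dG x y))) := hf.continuousWithinAt
  exact ge_of_tendsto h1 (eventually_nhdsWithin_of_forall fun L hL => h L hL)

theorem abs_rho_sub_le (x y : Pt m) : |rho y - rho x| ≤ dG x y :=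
  le_of_forall_gt_dG (f := id) continuous_id fun L hL => by
    obtain ⟨γ, γ', h, hl⟩ := exists_curve_of_dG_lt hL
    have := h.rho_sub_le le_rfl zero_le_one le_rfl ((dG_nonneg x y).trans hL.le) hl.le
    rwa [h.start, h.endpoint] at this

theorem abs_sub_n_le (x y : Pt m) : |y.2.1 - x.2.1| ≤ dG x y :=
  le_of_forall_gt_dG (f := id) continuous_id fun L hL => by
    obtain ⟨γ, γ', h, hl⟩ := exists_curve_of_dG_lt hL
    have := h.normal_le (p := 1) (q := 0) (by norm_num) le_rfl zero_le_one le_rfl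
      ((dG_nonneg x y).trans hL.le) hl.le
    rw [h.start, h.endpoint] at this
    simpa using this

theorem abs_sub_l_le (x y : Pt m) : |y.2.2 - x.2.2| ≤ dG x y :=
  le_of_forall_gt_dG (f := id) continuous_id fun L hL => by
    obtain ⟨γ, γ', h, hl⟩ := exists_curve_of_dG_lt hL
    have := h.normal_le (p := 0) (q := 1) (by norm_num) le_rfl zero_le_one le_rfl
      ((dG_nonneg x y).trans hL.le) hl.le
    rw [h.start, h.endpoint] at this
    simpa using this

/-- A curve from x of length below L never rises above `rho x + L`, and this height bounds the
tangential drift per unit of length. -/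
theorem norm_tangential_le (x y : Pt m) : ‖y.1 - x.1‖ ≤ (rho x + dG x y) * dG x y :=
  le_of_forall_gt_dG (f := fun L => (rho x + L) * L) (by fun_prop) fun L hL => by
    obtain ⟨γ, γ', h, hl⟩ := exists_curve_of_dG_lt hL
    have hL0 := (dG_nonneg x y).trans hL.le
    have := h.norm_tangential_sub_le (K := rho x + L) le_rfl zero_le_one le_rfl
      hL0 (fun t ht => by
        have := h.rho_sub_le le_rfl ht.1 ht.2 hL0
          ((lintegral_mono_set (Icc_subset_Icc_right ht.2)).trans hl.le)
        rw [h.start] at this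
        linarith [le_abs_self (rho (γ t) - rho x)]) hl.le
    rwa [h.start, h.endpoint] at this

end

/-! ### Projection onto P, rotations of the normal plane, and the shape of the domain -/

section

variable {m : ℕ}

theorem rho_proj (y : Pt m) : rho (proj y) = 0 := by simp [rho, proj]

theorem rho_zero : rho (0 : Pt m) = 0 := by simp [rho]

theorem abs_n_le_rho (y : Pt m) : |y.2.1| ≤ rho y :=
  Real.abs_le_sqrt (by nlinarith [sq_nonneg y.2.2])

theorem abs_l_le_rho (y : Pt m) : |y.2.2| ≤ rho y :=
  Real.abs_le_sqrt (by nlinarith [sq_nonneg y.2.1])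

theorem rho_le_abs_add (y : Pt m) : rho y ≤ |y.2.1| + |y.2.2| := by
  refine Real.sqrt_le_iff.mpr ⟨by positivity, ?_⟩
  nlinarith [abs_nonneg y.2.1, abs_nonneg y.2.2, sq_abs y.2.1, sq_abs y.2.2,
    mul_nonneg (abs_nonneg y.2.1) (abs_nonneg y.2.2)]

theorem dG_pos {x y : Pt m} (h : x ≠ y) : 0 < dG x y := by
  refine lt_of_le_of_ne (dG_nonneg _ _) fun h0 => h ?_
  have h1 := norm_tangential_le x y
  have h2 := abs_sub_n_le x y
  have h3 := abs_sub_l_le x y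
  rw [← h0] at h1 h2 h3
  rw [mul_zero] at h1
  have e1 := sub_eq_zero.mp (norm_le_zero_iff.mp h1)
  have e2 := sub_eq_zero.mp (abs_nonpos_iff.mp h2)
  have e3 := sub_eq_zero.mp (abs_nonpos_iff.mp h3)
  exact (Prod.ext e1 (Prod.ext e2 e3)).symm

theorem dG_proj_le (y : Pt m) : dG y (proj y) ≤ rho y :=
  dG_le_of_eG (rho_nonneg _) (eG_proj_le y)

theorem dG_proj (y : Pt m) : dG y (proj y) = rho y := by
  refine le_antisymm (dG_proj_le y) ?_
  have := (le_abs_self _).trans (abs_rho_sub_le (proj y) y)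
  rwa [rho_proj, sub_zero, dG_comm] at this

/-- Moving within P costs the square root of the Euclidean displacement. Away from P the projection
is therefore only 1/2-Hölder, and functions on P lose half of their exponent when extended normally.
-/
theorem dG_proj_proj_le (y z : Pt m) :
    dG (proj y) (proj z) ≤ 3 * √((rho y + dG y z) * dG y z) := by
  refine (dG_edge_le y.1 z.1).trans ?_
  gcongr
  exact norm_tangential_le y z

theorem rho_le_dG (y : Pt m) {b : Pt m} (hb : rho b = 0) : rho y ≤ dG y b := by
  have := (le_abs_self _).trans (abs_rho_sub_le b y)
  rwa [hb, sub_zero, dG_comm] at this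

/-- The coordinate `y_n`. -/
def coN : Pt m →L[ℝ] ℝ := (ContinuousLinearMap.fst ℝ ℝ ℝ).comp (ContinuousLinearMap.snd ℝ _ _)

/-- The coordinate `y_{n+1}`. -/
def coL : Pt m →L[ℝ] ℝ := (ContinuousLinearMap.snd ℝ ℝ ℝ).comp (ContinuousLinearMap.snd ℝ _ _)

theorem coN_apply (y : Pt m) : coN y = y.2.1 := rfl

theorem coL_apply (y : Pt m) : coL y = y.2.2 := rfl

/-- The rotation in the plane of the normal variables. -/
def rot (c s : ℝ) : Pt m →L[ℝ] Pt m :=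
  ContinuousLinearMap.prod (ContinuousLinearMap.fst ℝ _ _)
    (ContinuousLinearMap.prod (c • coN - s • coL) (s • coN + c • coL))

theorem rot_apply (c s : ℝ) (y : Pt m) :
    rot c s y = (y.1, c * y.2.1 - s * y.2.2, s * y.2.1 + c * y.2.2) := by
  simp [rot, coN_apply, coL_apply]

/-- A rotation in (y_n, y_{n+1}) preserves both the metric and P, hence horizontality and the length
of every curve. -/
theorem dG_rot_le {c s : ℝ} (hcs : c ^ 2 + s ^ 2 = 1) (x y : Pt m) :
    dG (rot c s x) (rot c s y) ≤ dG x y := by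
  refine ENNReal.toReal_mono (eG_lt_top _ _).ne (le_of_forall_gt fun L hL => ?_)
  obtain ⟨γ, γ', h, hl⟩ := exists_curve_of_eG_lt hL
  have hc : IsHorizontalCurve (fun t => rot c s (γ t)) (fun t => rot c s (γ' t))
      (rot c s x) (rot c s y) := by
    refine ⟨⟨(rot c s).integrable_comp h.integrable.1, (rot c s).integrable_comp h.integrable.2⟩, fun t ht => ?_,
      by rw [h.endpoint], ?_⟩
    · rw [(rot c s).intervalIntegral_comp_comm (h.integrable_sub (by simp) ht), ← map_add,
        ← h.eq_integral t ht]
    · rw [ae_restrict_iff' measurableSet_Icc]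
      filter_upwards [h.ae_horizontal] with t h1 ht h2 h3
      simp only [rot_apply] at h2 h3 ⊢
      refine h1 ht ?_ ?_
      · linear_combination c * h2 + s * h3 - (γ t).2.1 * hcs
      · linear_combination -s * h2 + c * h3 - (γ t).2.2 * hcs
  refine (eG_le_length hc).trans_lt (lt_of_le_of_lt (le_of_eq ?_) hl)
  unfold curveLength
  congr 1
  funext t
  congr 1
  simp only [speed, rot_apply]
  congr 1
  have e : ∀ a b : ℝ, (c * a - s * b) ^ 2 + (s * a + c * b) ^ 2 = a ^ 2 + b ^ 2 := fun a b => by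
    linear_combination (a ^ 2 + b ^ 2) * hcs
  rw [e, add_assoc, e, ← add_assoc]

/-- The rotation by the angle from w to w' fixes the origin; c and s are the cosine and sine of this
angle. -/
theorem dG_zero_rotate_le (x : EuclideanSpace ℝ (Fin m)) {w w' : ℝ × ℝ} {r : ℝ} (hr : 0 < r)
    (hw : w.1 ^ 2 + w.2 ^ 2 = r ^ 2) (hw' : w'.1 ^ 2 + w'.2 ^ 2 = r ^ 2) :
    dG ((x, w') : Pt m) 0 ≤ dG ((x, w) : Pt m) 0 := by
  have h := dG_rot_le (m := m) (c := (w.1 * w'.1 + w.2 * w'.2) / r ^ 2)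
    (s := (w.1 * w'.2 - w.2 * w'.1) / r ^ 2) (by
      field_simp
      linear_combination (w'.1 ^ 2 + w'.2 ^ 2) * hw + r ^ 2 * hw') (x, w) 0
  rw [map_zero] at h
  convert h using 2
  rw [rot_apply]
  refine Prod.ext rfl (Prod.ext ?_ ?_)
  · simp only
    field_simp
    linear_combination -w'.1 * hw
  · simp only
    field_simp
    linear_combination -w'.2 * hw

/-- A curve of length below 1 from the origin to (x, 0, 0) must reach height r, since otherwise it
would drift by at most r < ‖x‖. After its last visit to height r it stays below this height, so its
remaining length is at least the remaining tangential displacement divided by r. A straight segment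
at the level of that last visit costs no more, and it ends above x at height r. -/
theorem dG_lt_one_of_edge_aux {x : EuclideanSpace ℝ (Fin m)}
    (hx : dG ((x, 0, 0) : Pt m) 0 < 1) {r : ℝ} (hr : 0 < r) (hrx : r < ‖x‖) :
    ∃ w : ℝ × ℝ, w.1 ^ 2 + w.2 ^ 2 = r ^ 2 ∧ dG ((x, w) : Pt m) 0 < 1 := by
  rw [dG_comm] at hx
  obtain ⟨γ, γ', h, hl⟩ := exists_curve_of_dG_lt hx
  set lam : ℝ → ℝ≥0∞ := fun t => ENNReal.ofReal (speed (γ t) (γ' t)) with hlam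
  have hlt : ∫⁻ t in Icc 0 1, lam t < ENNReal.ofReal 1 := hl
  have hcont : ContinuousOn (fun t => rho (γ t)) (Icc 0 1) := by
    have := h.continuousOn
    unfold rho
    fun_prop
  set A : Set ℝ := Icc 0 1 ∩ (fun t => rho (γ t)) ⁻¹' Ici r with hA
  have hAc : IsCompact A := isCompact_Icc.of_isClosed_subset
    (hcont.preimage_isClosed_of_isClosed isClosed_Icc isClosed_Ici) inter_subset_left
  have hAn : A.Nonempty := by
    by_contra hcon
    rw [not_nonempty_iff_eq_empty] at hcon
    have hle : ∀ t ∈ Icc (0 : ℝ) 1, rho (γ t) ≤ r := fun t ht => by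
      by_contra hc
      have : t ∈ A := ⟨ht, (not_le.mp hc).le⟩
      simp [hcon] at this
    have := h.norm_tangential_sub_le le_rfl zero_le_one le_rfl zero_le_one hle hlt.le
    rw [h.endpoint, h.start] at this
    simp at this
    linarith
  obtain ⟨⟨h01, hρ⟩, hmax⟩ : sSup A ∈ A ∧ ∀ t ∈ A, t ≤ sSup A :=
    ⟨hAc.sSup_mem hAn, fun t ht => le_csSup hAc.bddAbove ht⟩
  set t₁ := sSup A with ht1
  have hρ1 : rho (γ 1) = 0 := by rw [h.endpoint]; simp [rho]
  have hρ0 : rho (γ 0) = 0 := by rw [h.start]; simp [rho]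
  have hpos : 0 < t₁ := by
    refine lt_of_le_of_ne h01.1 fun h0 => ?_
    rw [← h0] at hρ
    simp only [mem_preimage, mem_Ici, hρ0] at hρ
    linarith
  have heq : rho (γ t₁) = r := by
    obtain ⟨t, ht, htr⟩ := intermediate_value_Icc' h01.2
      (hcont.mono (Icc_subset_Icc_left h01.1)) (show r ∈ Icc _ _ from ⟨by rw [hρ1]; exact hr.le, hρ⟩)
    have : t ≤ t₁ := hmax t ⟨⟨h01.1.trans ht.1, ht.2⟩, by simp at htr; simp [htr]⟩
    rw [le_antisymm this ht.1] at htr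
    exact htr
  have hafter : ∀ t ∈ Icc t₁ 1, rho (γ t) ≤ r := fun t ht => by
    rcases eq_or_lt_of_le ht.1 with h2 | h2
    · rw [← h2, heq]
    · by_contra hc
      exact absurd (hmax t ⟨⟨h01.1.trans ht.1, ht.2⟩, (not_le.mp hc).le⟩) (not_le.mpr h2)
  have hsplit : ∫⁻ t in Icc 0 1, lam t = (∫⁻ t in Icc 0 t₁, lam t) + ∫⁻ t in Icc t₁ 1, lam t := by
    rw [← Icc_union_Ioc_eq_Icc h01.1 h01.2, lintegral_union measurableSet_Ioc,
      setLIntegral_congr (s := Ioc t₁ 1) Ioc_ae_eq_Icc]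
    exact disjoint_left.mpr fun a ha hb => absurd ha.2 (not_le.mpr hb.1)
  rw [hsplit] at hlt
  have f1 : ∫⁻ t in Icc 0 t₁, lam t ≠ ⊤ :=
    (le_self_add.trans_lt (hlt.trans ENNReal.ofReal_lt_top)).ne
  have f2 : ∫⁻ t in Icc t₁ 1, lam t ≠ ⊤ :=
    (le_add_self.trans_lt (hlt.trans ENNReal.ofReal_lt_top)).ne
  set L₁ := (∫⁻ t in Icc 0 t₁, lam t).toReal with hL1
  set L₂ := (∫⁻ t in Icc t₁ 1, lam t).toReal with hL2
  have hsum : L₁ + L₂ < 1 := by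
    rw [hL1, hL2, ← ENNReal.toReal_add f1 f2]
    exact (ENNReal.toReal_lt_of_lt_ofReal hlt)
  have hd1 : dG 0 (γ t₁) ≤ L₁ := by
    refine dG_le_of_eG ENNReal.toReal_nonneg ?_
    rw [hL1, ENNReal.ofReal_toReal f1]
    refine (eG_le_length (h.restrict hpos h01.2)).trans ?_
    rw [IsHorizontalCurve.length_restrict _ _ hpos]
  have hr2 : (γ t₁).2.1 ^ 2 + (γ t₁).2.2 ^ 2 = r ^ 2 := by rw [← rho_sq, heq]
  have hd2 : dG (γ t₁) (x, (γ t₁).2) ≤ L₂ := by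
    have h3 := h.norm_tangential_sub_le h01.1 h01.2 le_rfl ENNReal.toReal_nonneg hafter
      (L := L₂) (by rw [hL2, ENNReal.ofReal_toReal f2])
    rw [h.endpoint] at h3
    refine (dG_level_le (γ t₁).1 x (a := (γ t₁).2) (by rw [hr2]; positivity)).trans ?_
    rw [hr2, Real.sqrt_sq hr.le, div_le_iff₀ hr]
    linarith
  refine ⟨(γ t₁).2, hr2, ?_⟩
  rw [dG_comm]
  linarith [dG_triangle 0 (γ t₁) (x, (γ t₁).2)]

/-- Over every point of `P` in the unit ball there is room of a uniform height. -/
theorem dG_lt_one_of_edge {x : EuclideanSpace ℝ (Fin m)} (hx : dG ((x, 0, 0) : Pt m) 0 < 1)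
    {w : ℝ × ℝ} (hw : w.1 ^ 2 + w.2 ^ 2 ≤ (1 / 25) ^ 2) : dG ((x, w) : Pt m) 0 < 1 := by
  set r := √(w.1 ^ 2 + w.2 ^ 2) with hr
  have hr25 : r ≤ 1 / 25 := Real.sqrt_le_iff.mpr ⟨by norm_num, hw⟩
  have hrsq : w.1 ^ 2 + w.2 ^ 2 = r ^ 2 := (Real.sq_sqrt (by positivity)).symm
  -- If ‖x‖ ≤ 1/25, descending and then moving within P costs at most 1/25 + 3·(1/5) < 1. Otherwise
  -- r < ‖x‖, and a rotation of the point found by the auxiliary lemma reaches w.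
  rcases le_or_gt ‖x‖ (1 / 25) with h | h
  · have h1 := dG_vertical_le x w (0, 0)
    have h2 := dG_edge_le x (0 : EuclideanSpace ℝ (Fin m))
    have h3 : √‖0 - x‖ ≤ 1 / 5 := by
      rw [zero_sub, norm_neg]
      exact Real.sqrt_le_iff.mpr ⟨by norm_num, by linarith⟩
    have h4 := dG_triangle ((x, w) : Pt m) (x, 0, 0) (0, 0, 0)
    simp only [zero_sub, neg_sq, ← hr] at h1
    change dG ((x, w) : Pt m) (0, 0, 0) < 1
    linarith
  · rcases eq_or_lt_of_le (Real.sqrt_nonneg (w.1 ^ 2 + w.2 ^ 2)) with h0 | h0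
    · rw [← hr] at h0
      rw [← h0] at hrsq
      have e1 : w.1 = 0 := by nlinarith [sq_nonneg w.1, sq_nonneg w.2]
      have e2 : w.2 = 0 := by nlinarith [sq_nonneg w.1, sq_nonneg w.2]
      have : w = (0, 0) := Prod.ext e1 e2
      rw [this]; exact hx
    · obtain ⟨w', hw', hd⟩ := dG_lt_one_of_edge_aux hx h0 (hr25.trans_lt h)
      exact (dG_zero_rotate_le x h0 hw' hrsq).trans_lt hd

/-! ### The local domain -/

theorem proj_mem_edge {y : Pt m} (hy : y ∈ ball1 m) : proj y ∈ edge m :=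
  ⟨⟨hy.2, hy.2⟩, rfl, rfl⟩

theorem eq_of_mem_edge {b : Pt m} (hb : b ∈ edge m) : b = (b.1, 0, 0) :=
  Prod.ext rfl (Prod.ext hb.2.1 hb.2.2)

theorem rho_of_mem_edge {b : Pt m} (hb : b ∈ edge m) : rho b = 0 := by
  rw [eq_of_mem_edge hb]; simp [rho]

theorem rho_pos {y : Pt m} (hy : y ∈ dom m) : 0 < rho y :=
  Real.sqrt_pos.mpr (by have := hy.2.1; positivity)

theorem rho_lt_one {y : Pt m} (hy : y ∈ ball1 m) : rho y < 1 :=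
  (rho_le_dG y rho_zero).trans_lt hy.1

theorem dG_lt_two {y z : Pt m} (hy : y ∈ ball1 m) (hz : z ∈ ball1 m) : dG y z < 2 := by
  have := dG_triangle y 0 z
  rw [dG_comm 0 z] at this
  linarith [hy.1, hz.1]

theorem dG_edge_pos {y b : Pt m} (hy : y ∈ dom m) (hb : b ∈ edge m) : 0 < dG y b :=
  (rho_pos hy).trans_le (rho_le_dG y (rho_of_mem_edge hb))

theorem n_pos {y : Pt m} (hy : y ∈ dom m) : 0 < y.2.1 := hy.2.1

theorem l_pos {y : Pt m} (hy : y ∈ dom m) : 0 < y.2.2 := hy.2.2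

theorem mem_dom_of_edge {b : Pt m} (hb : b ∈ edge m) {p q : ℝ} (hp : 0 < p) (hq : 0 < q)
    (hp1 : p ≤ 1 / 50) (hq1 : q ≤ 1 / 50) : ((b.1, p, q) : Pt m) ∈ dom m := by
  have h : dG ((b.1, 0, 0) : Pt m) 0 < 1 := by rw [← eq_of_mem_edge hb]; exact hb.1.1
  -- Two coordinates of size at most 1/50 stay within the admissible radius: 2·(1/50)² ≤ (1/25)².
  exact ⟨⟨dG_lt_one_of_edge h (by norm_num; nlinarith), h⟩, hp, hq⟩

theorem dG_above_le {b : Pt m} (hb : b ∈ edge m) {p q : ℝ} (hp : 0 ≤ p) (hq : 0 ≤ q) :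
    dG ((b.1, p, q) : Pt m) b ≤ p + q := by
  have h := dG_proj_le ((b.1, p, q) : Pt m)
  have h2 := rho_le_abs_add ((b.1, p, q) : Pt m)
  have h3 : proj ((b.1, p, q) : Pt m) = b := (eq_of_mem_edge hb).symm
  rw [h3] at h
  simp only [abs_of_nonneg hp, abs_of_nonneg hq] at h2
  linarith

theorem shift_mem_edge {b : Pt m} (hb : b ∈ edge m) {x : EuclideanSpace ℝ (Fin m)}
    (hx : dG b 0 + 3 * √‖x‖ < 1) : ((b.1 + x, 0, 0) : Pt m) ∈ edge m := by
  have h1 := dG_edge_le (b.1 + x) b.1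
  rw [← eq_of_mem_edge hb, sub_add_cancel_left, norm_neg] at h1
  have h2 := dG_triangle ((b.1 + x, 0, 0) : Pt m) b 0
  have h3 : dG ((b.1 + x, 0, 0) : Pt m) 0 < 1 := by linarith
  exact ⟨⟨h3, h3⟩, rfl, rfl⟩

theorem dG_shift_le {b : Pt m} (hb : b ∈ edge m) (x : EuclideanSpace ℝ (Fin m)) {p q : ℝ}
    (hp : 0 ≤ p) (hq : 0 ≤ q) : dG ((b.1 + x, p, q) : Pt m) b ≤ p + q + 3 * √‖x‖ := by
  have h1 := dG_edge_le (b.1 + x) b.1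
  rw [← eq_of_mem_edge hb, sub_add_cancel_left, norm_neg] at h1
  have h2 := dG_triangle ((b.1 + x, p, q) : Pt m) (b.1 + x, 0, 0) b
  have h3 := dG_proj_le ((b.1 + x, p, q) : Pt m)
  have h4 := rho_le_abs_add ((b.1 + x, p, q) : Pt m)
  simp only [abs_of_nonneg hp, abs_of_nonneg hq] at h4
  change dG ((b.1 + x, p, q) : Pt m) (b.1 + x, 0, 0) ≤ _ at h3
  linarith

theorem shift_mem_dom {b : Pt m} (hb : b ∈ edge m) {x : EuclideanSpace ℝ (Fin m)}
    (hx : dG b 0 + 3 * √‖x‖ < 1) {p q : ℝ} (hp : 0 < p) (hq : 0 < q)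
    (hp1 : p ≤ 1 / 50) (hq1 : q ≤ 1 / 50) : ((b.1 + x, p, q) : Pt m) ∈ dom m :=
  mem_dom_of_edge (shift_mem_edge hb hx) hp hq hp1 hq1

/-- Along the segment the n-th coordinate stays above half of its initial value, so the metric is
bounded there by a Euclidean one. This compares the distance with the usual topology away from P. -/
theorem dG_le_of_half {y z : Pt m} (hy : 0 < y.2.1) (hz : y.2.1 / 2 ≤ z.2.1) :
    dG y z ≤ √(4 * ‖z.1 - y.1‖ ^ 2 / y.2.1 ^ 2 + (z.2.1 - y.2.1) ^ 2 + (z.2.2 - y.2.2) ^ 2) := by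
  have hpos : ∀ t ∈ Icc (0 : ℝ) 1, y.2.1 / 2 ≤ (y + t • (z - y)).2.1 := fun t ht => by
    have : (y + t • (z - y)).2.1 = (1 - t) * y.2.1 + t * z.2.1 := by simp; ring
    rw [this]
    nlinarith [mul_le_mul_of_nonneg_left hz ht.1, mul_nonneg (sub_nonneg.mpr ht.2) hy.le]
  refine dG_le_of_eG (Real.sqrt_nonneg _) (eG_segment_le (fun t ht h _ => ?_) fun t ht => ?_)
  · have := hpos t ht; linarith
  · unfold speed
    refine Real.sqrt_le_sqrt (add_le_add (add_le_add ?_ le_rfl) le_rfl)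
    have h2 := hpos t ht
    have h3 : y.2.1 ^ 2 / 4 ≤ (y + t • (z - y)).2.1 ^ 2 + (y + t • (z - y)).2.2 ^ 2 := by
      nlinarith [sq_nonneg (y + t • (z - y)).2.2]
    calc ‖(z - y).1‖ ^ 2 / ((y + t • (z - y)).2.1 ^ 2 + (y + t • (z - y)).2.2 ^ 2)
        ≤ ‖(z - y).1‖ ^ 2 / (y.2.1 ^ 2 / 4) := by gcongr
      _ = _ := by rw [Prod.fst_sub]; field_simp

theorem tendsto_dG_nhds {y : Pt m} (hy : 0 < y.2.1) : Tendsto (fun z => dG y z) (𝓝 y) (𝓝 0) := by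
  have h1 : Tendsto (fun z : Pt m =>
      √(4 * ‖z.1 - y.1‖ ^ 2 / y.2.1 ^ 2 + (z.2.1 - y.2.1) ^ 2 + (z.2.2 - y.2.2) ^ 2))
      (𝓝 y) (𝓝 0) := by
    have hc : Continuous (fun z : Pt m =>
        √(4 * ‖z.1 - y.1‖ ^ 2 / y.2.1 ^ 2 + (z.2.1 - y.2.1) ^ 2 + (z.2.2 - y.2.2) ^ 2)) := by
      fun_prop
    have := hc.tendsto y
    simpa using this
  refine squeeze_zero' (Eventually.of_forall fun z => dG_nonneg _ _) ?_ h1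
  have : ∀ᶠ z : Pt m in 𝓝 y, y.2.1 / 2 < z.2.1 :=
    (continuous_fst.comp continuous_snd).continuousAt.eventually_const_lt (by simp; linarith)
  filter_upwards [this] with z hz
  exact dG_le_of_half hy hz.le

theorem tendsto_dG_proj_nhds (y : Pt m) :
    Tendsto (fun z => dG (proj y) (proj z)) (𝓝 y) (𝓝 0) := by
  have hc : Continuous (fun z : Pt m => 3 * √‖z.1 - y.1‖) := by fun_prop
  have h1 := hc.tendsto y
  simp only [sub_self, norm_zero, Real.sqrt_zero, mul_zero] at h1
  exact squeeze_zero (fun z => dG_nonneg _ _) (fun z => dG_edge_le y.1 z.1) h1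

/-- Derivatives at points of the domain are thus determined by the values on the domain, which
matters because all functions are cut off to zero outside. -/
theorem isOpen_dom : IsOpen (dom m) := by
  rw [isOpen_iff_mem_nhds]
  intro y hy
  have e1 : ∀ᶠ z in 𝓝 y, dG y z < 1 - dG y 0 :=
    (tendsto_dG_nhds hy.2.1).eventually_lt_const (by linarith [hy.1.1])
  have e2 : ∀ᶠ z in 𝓝 y, dG (proj y) (proj z) < 1 - dG (proj y) 0 :=
    (tendsto_dG_proj_nhds y).eventually_lt_const (by linarith [hy.1.2])
  have e3 : ∀ᶠ z : Pt m in 𝓝 y, 0 < z.2.1 :=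
    (continuous_fst.comp continuous_snd).continuousAt.eventually_const_lt hy.2.1
  have e4 : ∀ᶠ z : Pt m in 𝓝 y, 0 < z.2.2 :=
    (continuous_snd.comp continuous_snd).continuousAt.eventually_const_lt hy.2.2
  filter_upwards [e1, e2, e3, e4] with z h1 h2 h3 h4
  refine ⟨⟨?_, ?_⟩, h3, h4⟩
  · have := dG_triangle z y 0
    rw [dG_comm z y] at this
    linarith
  · have := dG_triangle (proj z) (proj y) 0
    rw [dG_comm (proj z) (proj y)] at this
    linarith

end

section

/-! ### Spaces of Hölder functions with respect to a general modulus -/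

section Holder

variable {S T E F G : Type} [NormedAddCommGroup E] [NormedSpace ℝ E] [NormedAddCommGroup F]
  [NormedSpace ℝ F] [NormedAddCommGroup G] [NormedSpace ℝ G]

/-- The bounded functions `u` with `‖u y - u z‖ ≤ b * δ y z`, as a vector space. -/
def holSubmodule (δ : S → S → ℝ≥0) (E : Type) [NormedAddCommGroup E] [NormedSpace ℝ E] :
    Submodule ℝ (S → E) where
  carrier := {u | ∃ a b : ℝ, 0 ≤ a ∧ 0 ≤ b ∧ (∀ y, ‖u y‖ ≤ a) ∧ ∀ y z, ‖u y - u z‖ ≤ b * δ y z}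
  add_mem' := by
    rintro u v ⟨a, b, ha, hb, h1, h2⟩ ⟨a', b', ha', hb', h1', h2'⟩
    refine ⟨a + a', b + b', by positivity, by positivity, fun y => ?_, fun y z => ?_⟩
    · exact (norm_add_le _ _).trans (add_le_add (h1 y) (h1' y))
    · rw [add_mul, Pi.add_apply, Pi.add_apply, add_sub_add_comm]
      exact (norm_add_le _ _).trans (add_le_add (h2 y z) (h2' y z))
  zero_mem' := ⟨0, 0, le_rfl, le_rfl, by simp, by simp⟩
  smul_mem' := by
    rintro c u ⟨a, b, ha, hb, h1, h2⟩
    refine ⟨|c| * a, |c| * b, by positivity, by positivity, fun y => ?_, fun y z => ?_⟩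
    · rw [Pi.smul_apply, norm_smul, Real.norm_eq_abs]
      exact mul_le_mul_of_nonneg_left (h1 y) (abs_nonneg c)
    · rw [Pi.smul_apply, Pi.smul_apply, ← smul_sub, norm_smul, Real.norm_eq_abs, mul_assoc]
      exact mul_le_mul_of_nonneg_left (h2 y z) (abs_nonneg c)

/-- The normed space of bounded functions that are Hölder continuous with modulus `δ`. -/
def Hol (δ : S → S → ℝ≥0) (E : Type) [NormedAddCommGroup E] [NormedSpace ℝ E] : Type :=
  holSubmodule δ E

namespace Hol

variable {δ : S → S → ℝ≥0}

instance : AddCommGroup (Hol δ E) := inferInstanceAs (AddCommGroup (holSubmodule δ E))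

instance : Module ℝ (Hol δ E) := inferInstanceAs (Module ℝ (holSubmodule δ E))

instance : FunLike (Hol δ E) S E where
  coe u := u.1
  coe_injective := fun _ _ h => Subtype.ext h

@[ext] theorem ext {u v : Hol δ E} (h : ∀ y, u y = v y) : u = v := DFunLike.ext _ _ h

@[simp] theorem add_apply (u v : Hol δ E) (y : S) : (u + v) y = u y + v y := rfl

@[simp] theorem sub_apply (u v : Hol δ E) (y : S) : (u - v) y = u y - v y := rfl

@[simp] theorem neg_apply (u : Hol δ E) (y : S) : (-u) y = -u y := rfl

@[simp] theorem zero_apply (y : S) : (0 : Hol δ E) y = 0 := rfl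

@[simp] theorem smul_apply (c : ℝ) (u : Hol δ E) (y : S) : (c • u) y = c • u y := rfl

/-- Membership in `Hol δ E` from explicit bounds. -/
def mk (u : S → E) (a b : ℝ) (ha : 0 ≤ a) (hb : 0 ≤ b) (h1 : ∀ y, ‖u y‖ ≤ a)
    (h2 : ∀ y z, ‖u y - u z‖ ≤ b * δ y z) : Hol δ E :=
  ⟨u, a, b, ha, hb, h1, h2⟩

@[simp] theorem mk_apply (u : S → E) (a b : ℝ) (ha hb h1 h2) (y : S) :
    (mk (δ := δ) u a b ha hb h1 h2) y = u y := rfl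

/-- The supremum part of the norm. -/
def supN (u : Hol δ E) : ℝ := ⨆ y, ‖u y‖

/-- The seminorm part of the norm. -/
def semN (u : Hol δ E) : ℝ := ⨆ p : S × S, ‖u p.1 - u p.2‖ / δ p.1 p.2

instance : Norm (Hol δ E) := ⟨fun u => supN u + semN u⟩

theorem norm_eq (u : Hol δ E) : ‖u‖ = supN u + semN u := rfl

theorem supN_nonneg (u : Hol δ E) : 0 ≤ supN u := Real.iSup_nonneg fun _ => norm_nonneg _

theorem semN_nonneg (u : Hol δ E) : 0 ≤ semN u := Real.iSup_nonneg fun _ => by positivity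

theorem norm_apply_le_supN (u : Hol δ E) (y : S) : ‖u y‖ ≤ supN u := by
  obtain ⟨a, b, ha, hb, h1, h2⟩ := u.2
  exact le_ciSup (f := fun y => ‖u y‖) ⟨a, by rintro _ ⟨y, rfl⟩; exact h1 y⟩ y

theorem norm_sub_le_semN (u : Hol δ E) (y z : S) : ‖u y - u z‖ ≤ semN u * δ y z := by
  obtain ⟨a, b, ha, hb, h1, h2⟩ := u.2
  have h3 : ‖u y - u z‖ / δ y z ≤ semN u :=
    le_ciSup (f := fun p : S × S => ‖u p.1 - u p.2‖ / δ p.1 p.2) ⟨b, by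
      rintro _ ⟨p, rfl⟩
      exact div_le_of_le_mul₀ (NNReal.coe_nonneg _) hb (h2 p.1 p.2)⟩ (y, z)
  -- Where δ vanishes the difference quotient is 0 by convention; the bound from membership then
  -- forces equal values.
  rcases eq_or_lt_of_le (NNReal.coe_nonneg (δ y z)) with h0 | h0
  · have h4 : ‖u y - u z‖ ≤ b * δ y z := h2 y z
    rw [← h0] at h4 ⊢
    simpa using h4
  · rwa [div_le_iff₀ h0] at h3

theorem supN_le {u : Hol δ E} {a : ℝ} (ha : 0 ≤ a) (h : ∀ y, ‖u y‖ ≤ a) : supN u ≤ a :=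
  Real.iSup_le h ha

theorem semN_le {u : Hol δ E} {b : ℝ} (hb : 0 ≤ b) (h : ∀ y z, ‖u y - u z‖ ≤ b * δ y z) :
    semN u ≤ b :=
  Real.iSup_le (fun p => div_le_of_le_mul₀ (NNReal.coe_nonneg _) hb (h p.1 p.2)) hb

theorem norm_le {u : Hol δ E} {a b : ℝ} (ha : 0 ≤ a) (hb : 0 ≤ b) (h1 : ∀ y, ‖u y‖ ≤ a)
    (h2 : ∀ y z, ‖u y - u z‖ ≤ b * δ y z) : ‖u‖ ≤ a + b :=
  add_le_add (supN_le ha h1) (semN_le hb h2)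

theorem norm_core : NormedSpace.Core ℝ (Hol δ E) where
  norm_nonneg u := add_nonneg (supN_nonneg u) (semN_nonneg u)
  norm_smul := norm_smul_of_le
    (le_antisymm ((norm_le le_rfl le_rfl (by simp) (by simp)).trans (by simp))
      (add_nonneg (supN_nonneg _) (semN_nonneg _))) fun c u => by
    rw [norm_eq u, mul_add]
    refine norm_le (mul_nonneg (norm_nonneg c) (supN_nonneg u))
      (mul_nonneg (norm_nonneg c) (semN_nonneg u)) (fun y => ?_) (fun y z => ?_)
    · rw [smul_apply, norm_smul]
      exact mul_le_mul_of_nonneg_left (norm_apply_le_supN u y) (norm_nonneg c)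
    · rw [smul_apply, smul_apply, ← smul_sub, norm_smul, mul_assoc]
      exact mul_le_mul_of_nonneg_left (norm_sub_le_semN u y z) (norm_nonneg c)
  norm_triangle u v := by
    rw [norm_eq u, norm_eq v, add_add_add_comm]
    refine norm_le (add_nonneg (supN_nonneg u) (supN_nonneg v))
      (add_nonneg (semN_nonneg u) (semN_nonneg v)) (fun y => ?_) (fun y z => ?_)
    · exact (norm_add_le _ _).trans (add_le_add (norm_apply_le_supN u y) (norm_apply_le_supN v y))
    · rw [add_mul, add_apply, add_apply, add_sub_add_comm]
      exact (norm_add_le _ _).trans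
        (add_le_add (norm_sub_le_semN u y z) (norm_sub_le_semN v y z))
  norm_eq_zero_iff u := by
    constructor
    · intro h
      ext y
      have h1 := norm_apply_le_supN u y
      have h2 := semN_nonneg u
      rw [norm_eq] at h
      exact norm_le_zero_iff.mp (by linarith)
    · rintro rfl
      exact le_antisymm ((norm_le le_rfl le_rfl (by simp) (by simp)).trans (by simp))
        (add_nonneg (supN_nonneg _) (semN_nonneg _))

instance : NormedAddCommGroup (Hol δ E) := NormedAddCommGroup.ofCore norm_core

instance : NormedSpace ℝ (Hol δ E) := NormedSpace.ofCore norm_core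

theorem supN_le_norm (u : Hol δ E) : supN u ≤ ‖u‖ := le_add_of_nonneg_right (semN_nonneg u)

theorem semN_le_norm (u : Hol δ E) : semN u ≤ ‖u‖ := le_add_of_nonneg_left (supN_nonneg u)

theorem norm_apply_le (u : Hol δ E) (y : S) : ‖u y‖ ≤ ‖u‖ :=
  (norm_apply_le_supN u y).trans (supN_le_norm u)

theorem norm_sub_le (u : Hol δ E) (y z : S) : ‖u y - u z‖ ≤ ‖u‖ * δ y z :=
  (norm_sub_le_semN u y z).trans
    (mul_le_mul_of_nonneg_right (semN_le_norm u) (NNReal.coe_nonneg _))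

/-- A linear map into `Hol δ E` with uniform bounds. -/
def mkCLM {V : Type*} [NormedAddCommGroup V] [NormedSpace ℝ V] (u : V → S → E) (a b : ℝ)
    (ha : 0 ≤ a) (hb : 0 ≤ b) (hadd : ∀ v w y, u (v + w) y = u v y + u w y)
    (hsmul : ∀ (c : ℝ) v y, u (c • v) y = c • u v y)
    (h1 : ∀ v y, ‖u v y‖ ≤ a * ‖v‖) (h2 : ∀ v y z, ‖u v y - u v z‖ ≤ b * ‖v‖ * δ y z) :
    V →L[ℝ] Hol δ E :=
  LinearMap.mkContinuous
    { toFun := fun v => mk (u v) (a * ‖v‖) (b * ‖v‖) (by positivity) (by positivity) (h1 v) (h2 v)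
      map_add' := fun v w => by ext y; exact hadd v w y
      map_smul' := fun c v => by ext y; exact hsmul c v y } (a + b) fun v => by
    rw [add_mul]
    exact norm_le (by positivity) (by positivity) (h1 v) (h2 v)

@[simp] theorem mkCLM_apply {V : Type*} [NormedAddCommGroup V] [NormedSpace ℝ V] (u : V → S → E)
    (a b : ℝ) (ha hb hadd hsmul h1 h2) (v : V) (y : S) :
    mkCLM (δ := δ) u a b ha hb hadd hsmul h1 h2 v y = u v y := rfl

/-- Evaluation at a point. -/
def eval (y : S) : Hol δ E →L[ℝ] E :=
  LinearMap.mkContinuous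
    { toFun := fun u => u y
      map_add' := fun _ _ => rfl
      map_smul' := fun _ _ => rfl } 1 fun u => by
    rw [one_mul]; exact norm_apply_le u y

@[simp] theorem eval_apply (y : S) (u : Hol δ E) : eval y u = u y := rfl

/-- Composition with a map of the underlying sets. -/
def pull {δ' : T → T → ℝ≥0} (i : T → S) (c : ℝ≥0) (h : ∀ y z, δ (i y) (i z) ≤ c * δ' y z) :
    Hol δ E →L[ℝ] Hol δ' E :=
  mkCLM (fun u y => u (i y)) 1 c zero_le_one c.2 (fun _ _ _ => rfl) (fun _ _ _ => rfl)
    (fun u y => by rw [one_mul]; exact norm_apply_le u _) fun u y z => by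
      refine (norm_sub_le u _ _).trans ?_
      rw [mul_comm (c : ℝ), mul_assoc]
      exact mul_le_mul_of_nonneg_left (by exact_mod_cast h y z) (norm_nonneg u)

@[simp] theorem pull_apply {δ' : T → T → ℝ≥0} (i : T → S) (c : ℝ≥0)
    (h : ∀ y z, δ (i y) (i z) ≤ c * δ' y z) (u : Hol δ E) (y : T) : pull i c h u y = u (i y) := rfl

/-- Composition with a continuous linear map. -/
def push (l : E →L[ℝ] F) : Hol δ E →L[ℝ] Hol δ F :=
  mkCLM (fun u y => l (u y)) ‖l‖ ‖l‖ (norm_nonneg _) (norm_nonneg _)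
    (fun _ _ _ => map_add l _ _) (fun _ _ _ => map_smul l _ _)
    (fun u y => (l.le_opNorm _).trans
      (mul_le_mul_of_nonneg_left (norm_apply_le u y) (norm_nonneg l))) fun u y z => by
      rw [← map_sub, mul_assoc]
      exact (l.le_opNorm _).trans (mul_le_mul_of_nonneg_left (norm_sub_le u y z) (norm_nonneg l))

@[simp] theorem push_apply (l : E →L[ℝ] F) (u : Hol δ E) (y : S) : push l u y = l (u y) := rfl

theorem norm_bilin_apply_le (B : E →L[ℝ] F →L[ℝ] G) (u : Hol δ E) (v : Hol δ F) (y : S) :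
    ‖B (u y) (v y)‖ ≤ ‖B‖ * (supN u * supN v) :=
  (B.le_opNorm₂ _ _).trans (by
    rw [mul_assoc]
    have := supN_nonneg u
    gcongr
    · exact norm_apply_le_supN u y
    · exact norm_apply_le_supN v y)

theorem norm_bilin_sub_le (B : E →L[ℝ] F →L[ℝ] G) (u : Hol δ E) (v : Hol δ F) (y z : S) :
    ‖B (u y) (v y) - B (u z) (v z)‖ ≤
      ‖B‖ * (semN u * supN v + supN u * semN v) * δ y z := by
  have hB : 0 ≤ ‖B‖ := norm_nonneg B
  have hu := supN_nonneg u
  have hu' := semN_nonneg u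
  have e : B (u y) (v y) - B (u z) (v z) = B (u y - u z) (v y) + B (u z) (v y - v z) := by
    simp
  rw [e]
  refine (norm_add_le _ _).trans ?_
  have n1 : ‖B (u y - u z) (v y)‖ ≤ ‖B‖ * (semN u * δ y z) * supN v :=
    (B.le_opNorm₂ _ _).trans (by
      gcongr
      · exact norm_sub_le_semN u y z
      · exact norm_apply_le_supN v y)
  have n2 : ‖B (u z) (v y - v z)‖ ≤ ‖B‖ * supN u * (semN v * δ y z) :=
    (B.le_opNorm₂ _ _).trans (by
      gcongr
      · exact norm_apply_le_supN u z
      · exact norm_sub_le_semN v y z)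
  linarith

theorem bilin_sup_nonneg (B : E →L[ℝ] F →L[ℝ] G) (u : Hol δ E) (v : Hol δ F) :
    0 ≤ ‖B‖ * (supN u * supN v) := by
  have hB : 0 ≤ ‖B‖ := norm_nonneg B
  have hu := supN_nonneg u
  have hv := supN_nonneg v
  positivity

theorem bilin_sem_nonneg (B : E →L[ℝ] F →L[ℝ] G) (u : Hol δ E) (v : Hol δ F) :
    0 ≤ ‖B‖ * (semN u * supN v + supN u * semN v) := by
  have hB : 0 ≤ ‖B‖ := norm_nonneg B
  have hu := supN_nonneg u
  have hv := supN_nonneg v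
  have hu' := semN_nonneg u
  have hv' := semN_nonneg v
  positivity

/-- The pointwise application of a bilinear map to two functions. -/
def bilinMk (B : E →L[ℝ] F →L[ℝ] G) (u : Hol δ E) (v : Hol δ F) : Hol δ G :=
  mk (fun y => B (u y) (v y)) _ _ (bilin_sup_nonneg B u v) (bilin_sem_nonneg B u v)
    (norm_bilin_apply_le B u v) (norm_bilin_sub_le B u v)

@[simp] theorem bilinMk_apply (B : E →L[ℝ] F →L[ℝ] G) (u : Hol δ E) (v : Hol δ F) (y : S) :
    bilinMk B u v y = B (u y) (v y) := rfl

/-- The sum of supremum and seminorm is the right norm: the product rule produces s s' + (r s' + s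
r'), which is at most (s + r)(s' + r'), so no constant is lost. -/
theorem norm_bilinMk_le (B : E →L[ℝ] F →L[ℝ] G) (u : Hol δ E) (v : Hol δ F) :
    ‖bilinMk B u v‖ ≤ ‖B‖ * ‖u‖ * ‖v‖ := by
  refine (norm_le (bilin_sup_nonneg B u v) (bilin_sem_nonneg B u v)
    (norm_bilin_apply_le B u v) (norm_bilin_sub_le B u v)).trans ?_
  rw [norm_eq u, norm_eq v, ← mul_add, mul_assoc]
  refine mul_le_mul_of_nonneg_left ?_ (norm_nonneg B)
  nlinarith [mul_nonneg (semN_nonneg u) (semN_nonneg v)]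

/-- The pointwise application of a bilinear map, as a bilinear map. -/
def bilin (B : E →L[ℝ] F →L[ℝ] G) : Hol δ E →L[ℝ] Hol δ F →L[ℝ] Hol δ G :=
  LinearMap.mkContinuous₂
    (LinearMap.mk₂ ℝ (bilinMk B)
      (fun u u' v => by ext y; simp) (fun c u v => by ext y; simp)
      (fun u v v' => by ext y; simp) (fun c u v => by ext y; simp)) ‖B‖ (norm_bilinMk_le B)

@[simp] theorem bilin_apply (B : E →L[ℝ] F →L[ℝ] G) (u : Hol δ E) (v : Hol δ F) (y : S) :
    bilin B u v y = B (u y) (v y) := rfl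

instance : Mul (Hol δ ℝ) := ⟨fun u v => bilinMk (ContinuousLinearMap.mul ℝ ℝ) u v⟩

@[simp] theorem mul_apply (u v : Hol δ ℝ) (y : S) : (u * v) y = u y * v y := rfl

instance : One (Hol δ ℝ) := ⟨mk (fun _ => 1) 1 0 zero_le_one le_rfl (by simp) (by simp)⟩

@[simp] theorem one_apply (y : S) : (1 : Hol δ ℝ) y = 1 := rfl

/-- With a submultiplicative norm, products of coefficients depend analytically on their factors
without further estimates. -/
instance : NormedCommRing (Hol δ ℝ) where
  mul_assoc u v w := by ext y; simp [mul_assoc]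
  one_mul u := by ext y; simp
  mul_one u := by ext y; simp
  mul_comm u v := by ext y; simp [mul_comm]
  left_distrib u v w := by ext y; simp [mul_add]
  right_distrib u v w := by ext y; simp [add_mul]
  zero_mul u := by ext y; simp
  mul_zero u := by ext y; simp
  norm_mul_le u v := by
    refine (norm_bilinMk_le (ContinuousLinearMap.mul ℝ ℝ) u v).trans ?_
    have h := ContinuousLinearMap.opNorm_mul_le ℝ ℝ
    rw [mul_assoc]
    exact mul_le_of_le_one_left (by positivity) h
  dist_eq u v := by rw [dist_comm, dist_eq_norm, neg_add_eq_sub]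

instance : Algebra ℝ (Hol δ ℝ) :=
  Algebra.ofModule (fun c u v => by ext y; simp [mul_assoc]) (fun c u v => by ext y; simp; ring)

instance : NormedAlgebra ℝ (Hol δ ℝ) where
  norm_smul_le c u := (norm_smul c u).le

/-- A function in `holSubmodule δ E`, as an element of `Hol δ E`. -/
def ofMem (u : S → E) (h : u ∈ holSubmodule δ E) : Hol δ E := ⟨u, h⟩

@[simp] theorem ofMem_apply (u : S → E) (h : u ∈ holSubmodule δ E) (y : S) :
    ofMem u h y = u y := rfl

/-- The superposition of `f` with `u`, if it belongs to `Hol δ F`, and zero otherwise. -/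
def comp (f : E → F) (u : Hol δ E) : Hol δ F :=
  open scoped Classical in
  if h : (fun y => f (u y)) ∈ holSubmodule δ F then ofMem _ h else 0

theorem comp_apply {f : E → F} {u : Hol δ E} (h : (fun y => f (u y)) ∈ holSubmodule δ F) (y : S) :
    comp f u y = f (u y) := by
  unfold comp
  rw [dif_pos h, ofMem_apply]

theorem mem_of_bounds {u : S → E} {a b : ℝ} (h1 : ∀ y, ‖u y‖ ≤ a)
    (h2 : ∀ y z, ‖u y - u z‖ ≤ b * δ y z) : u ∈ holSubmodule δ E :=
  ⟨|a|, |b|, abs_nonneg _, abs_nonneg _, fun y => (h1 y).trans (le_abs_self a), fun y z =>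
    (h2 y z).trans (mul_le_mul_of_nonneg_right (le_abs_self b) (NNReal.coe_nonneg _))⟩

theorem mem_of_lipschitz {f : E → F} {D : Set E} {K C : ℝ} (hK : 0 ≤ K)
    (hf : ∀ p ∈ D, ∀ q ∈ D, ‖f p - f q‖ ≤ K * ‖p - q‖) (hC : ∀ p ∈ D, ‖f p‖ ≤ C) (u : Hol δ E)
    (hu : ∀ y, u y ∈ D) : (fun y => f (u y)) ∈ holSubmodule δ F :=
  mem_of_bounds (fun y => hC _ (hu y)) (b := K * semN u) fun y z =>
    (hf _ (hu y) _ (hu z)).trans (by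
      rw [mul_assoc]
      exact mul_le_mul_of_nonneg_left (norm_sub_le_semN u y z) hK)

end Hol

end Holder

end

section

/-! ### Superposition with smooth functions on compact convex sets -/

section Superposition

variable {S E F : Type} [NormedAddCommGroup E] [NormedSpace ℝ E] [NormedAddCommGroup F]
  [NormedSpace ℝ F]

namespace Hol

variable {δ : S → S → ℝ≥0}

/-- Compactness bounds the derivative and convexity turns this bound into a Lipschitz constant. The
derivative is taken within D because D may touch the boundary of the region where f is defined. -/
theorem norm_fderivWithin_bounded {D : Set E} (hD : Convex ℝ D) (hDc : IsCompact D)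
    (hDu : UniqueDiffOn ℝ D) {f : E → F} (hf : ContDiffOn ℝ ∞ f D) :
    ∃ K, 0 ≤ K ∧ (∀ p ∈ D, ‖fderivWithin ℝ f D p‖ ≤ K) ∧
      ∀ p ∈ D, ∀ q ∈ D, ‖f p - f q‖ ≤ K * ‖p - q‖ := by
  have h1 : ContinuousOn (fderivWithin ℝ f D) D :=
    hf.continuousOn_fderivWithin hDu (by simp)
  obtain ⟨K, hK⟩ := hDc.exists_bound_of_continuousOn h1
  refine ⟨|K|, abs_nonneg _, fun p hp => (hK p hp).trans (le_abs_self K), fun p hp q hq => ?_⟩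
  exact hD.norm_image_sub_le_of_norm_fderivWithin_le (hf.differentiableOn (by simp))
    (fun x hx => (hK x hx).trans (le_abs_self K)) hq hp

theorem comp_mem_of_range {D : Set E} (hD : Convex ℝ D) (hDc : IsCompact D)
    (hDu : UniqueDiffOn ℝ D) {f : E → F} (hf : ContDiffOn ℝ ∞ f D) {u : Hol δ E}
    (hu : ∀ y, u y ∈ D) : (fun y => f (u y)) ∈ holSubmodule δ F := by
  obtain ⟨K, hK, -, h2⟩ := norm_fderivWithin_bounded hD hDc hDu hf
  obtain ⟨C, hC⟩ := hDc.exists_bound_of_continuousOn hf.continuousOn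
  exact mem_of_lipschitz hK h2 hC u hu

theorem segment_mem {D : Set E} (hD : Convex ℝ D) {p q : E} (hp : p ∈ D) (hq : q ∈ D) {t : ℝ}
    (ht : t ∈ Icc (0 : ℝ) 1) : p + t • (q - p) ∈ D := by
  have := hD hp hq (sub_nonneg.mpr ht.2) ht.1 (by ring)
  convert this using 1
  module

theorem hasDerivWithinAt_segment {D : Set E} (hD : Convex ℝ D) {f : E → F}
    (hf : DifferentiableOn ℝ f D) {p q : E} (hp : p ∈ D) (hq : q ∈ D) {t : ℝ}
    (ht : t ∈ Icc (0 : ℝ) 1) :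
    HasDerivWithinAt (fun t : ℝ => f (p + t • (q - p)))
      (fderivWithin ℝ f D (p + t • (q - p)) (q - p)) (Icc 0 1) t := by
  have h1 : HasDerivWithinAt (fun t : ℝ => p + t • (q - p)) (q - p) (Icc 0 1) t := by
    have := ((hasDerivAt_id t).smul_const (q - p)).const_add p
    simpa using this.hasDerivWithinAt
  exact ((hf _ (segment_mem hD hp hq ht)).hasFDerivWithinAt).comp_hasDerivWithinAt t h1
    (fun τ hτ => segment_mem hD hp hq hτ)

/-- Superposition is locally Lipschitz at the price of one more derivative of f. For the seminorm,
the second difference of f is the increment over [0, 1] of the difference of f along the segments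
from u' z to u' y and from u z to u y. Its derivative splits into f' applied to the increment of u'
- u, and a difference of values of f' applied to the increment of u. The constant 2K collects the
supremum part and the first of these terms. -/
theorem norm_comp_sub_comp_le {D : Set E} (hD : Convex ℝ D) (hDc : IsCompact D)
    (hDu : UniqueDiffOn ℝ D) {f : E → F} (hf : ContDiffOn ℝ ∞ f D) :
    ∃ K₁ K₂ : ℝ, 0 ≤ K₁ ∧ 0 ≤ K₂ ∧ ∀ u u' : Hol δ E, (∀ y, u y ∈ D) → (∀ y, u' y ∈ D) →
      ‖comp f u' - comp f u‖ ≤ (K₁ + K₂ * ‖u‖) * ‖u' - u‖ := by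
  obtain ⟨K, hK, h1, h2⟩ := norm_fderivWithin_bounded hD hDc hDu hf
  obtain ⟨K', hK', -, h3⟩ := norm_fderivWithin_bounded hD hDc hDu
    (hf.fderivWithin hDu (m := ∞) (by simp))
  refine ⟨2 * K, K', by positivity, hK', fun u u' hu hu' => ?_⟩
  have hm := comp_mem_of_range hD hDc hDu hf hu
  have hm' := comp_mem_of_range hD hDc hDu hf hu'
  have hfin : (2 * K + K' * ‖u‖) * ‖u' - u‖ =
      K * ‖u' - u‖ + (K * ‖u' - u‖ + K' * ‖u‖ * ‖u' - u‖) := by ring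
  rw [hfin]
  refine norm_le (by positivity) (by positivity) (fun y => ?_) (fun y z => ?_)
  · rw [sub_apply, comp_apply hm, comp_apply hm']
    exact (h2 _ (hu' y) _ (hu y)).trans
      (mul_le_mul_of_nonneg_left (norm_apply_le (u' - u) y) hK)
  · rw [sub_apply, sub_apply, comp_apply hm, comp_apply hm', comp_apply hm, comp_apply hm']
    have hd := hf.differentiableOn (by simp : (∞ : WithTop ℕ∞) ≠ 0)
    have hder : ∀ t ∈ Icc (0 : ℝ) 1, HasDerivWithinAt
        (fun t : ℝ => f (u' z + t • (u' y - u' z)) - f (u z + t • (u y - u z)))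
        (fderivWithin ℝ f D (u' z + t • (u' y - u' z)) (u' y - u' z) -
          fderivWithin ℝ f D (u z + t • (u y - u z)) (u y - u z)) (Icc 0 1) t := fun t ht =>
      (hasDerivWithinAt_segment hD hd (hu' z) (hu' y) ht).sub
        (hasDerivWithinAt_segment hD hd (hu z) (hu y) ht)
    have hb : ∀ t ∈ Ico (0 : ℝ) 1, ‖fderivWithin ℝ f D (u' z + t • (u' y - u' z)) (u' y - u' z) -
          fderivWithin ℝ f D (u z + t • (u y - u z)) (u y - u z)‖ ≤
        (K * ‖u' - u‖ + K' * ‖u‖ * ‖u' - u‖) * δ y z := fun t ht => by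
      have ht' : t ∈ Icc (0 : ℝ) 1 := ⟨ht.1, ht.2.le⟩
      have m1 := segment_mem hD (hu z) (hu y) ht'
      have m2 := segment_mem hD (hu' z) (hu' y) ht'
      set P := u z + t • (u y - u z)
      set Q := u' z + t • (u' y - u' z)
      have e : fderivWithin ℝ f D Q (u' y - u' z) - fderivWithin ℝ f D P (u y - u z) =
          fderivWithin ℝ f D Q ((u' - u) y - (u' - u) z) +
            (fderivWithin ℝ f D Q - fderivWithin ℝ f D P) (u y - u z) := by
        simp only [sub_apply, map_sub, _root_.sub_apply]
        abel
      have hQP : ‖Q - P‖ ≤ ‖u' - u‖ := by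
        have e2 : Q - P = (1 - t) • (u' - u) z + t • (u' - u) y := by
          simp only [sub_apply, P, Q]
          module
        rw [e2]
        refine (norm_add_le _ _).trans ?_
        rw [norm_smul, norm_smul, Real.norm_of_nonneg ht.1,
          Real.norm_of_nonneg (sub_nonneg.mpr ht.2.le)]
        have a1 := mul_le_mul_of_nonneg_left (norm_apply_le (u' - u) z) (sub_nonneg.mpr ht.2.le)
        have a2 := mul_le_mul_of_nonneg_left (norm_apply_le (u' - u) y) ht.1
        linarith
      rw [e, add_mul]
      refine (norm_add_le _ _).trans (add_le_add ?_ ?_)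
      · refine (ContinuousLinearMap.le_opNorm _ _).trans ?_
        rw [mul_assoc]
        exact mul_le_mul (h1 _ m2) (norm_sub_le _ _ _) (norm_nonneg _) hK
      · refine (ContinuousLinearMap.le_opNorm _ _).trans ?_
        have a1 := (h3 _ m2 _ m1).trans (mul_le_mul_of_nonneg_left hQP hK')
        calc _ ≤ (K' * ‖u' - u‖) * (‖u‖ * δ y z) :=
              mul_le_mul a1 (norm_sub_le _ _ _) (norm_nonneg _) (by positivity)
          _ = _ := by ring
    have := norm_image_sub_le_of_norm_deriv_le_segment_01' hder hb
    refine le_trans (le_of_eq ?_) this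
    congr 1
    simp only [one_smul, zero_smul, add_zero, add_sub_cancel]

/-- The candidate derivative is pointwise application of f' ∘ u. The remainder is the increment over
[0, 1] of a curve with derivative (f'(u + t(u' - u)) - f'(u))(u' - u). This is quadratic in u' - u
in the full Hölder norm because superposition with f' is Lipschitz. -/
theorem hasFDerivWithinAt_comp {D : Set E} (hD : Convex ℝ D) (hDc : IsCompact D)
    (hDu : UniqueDiffOn ℝ D) {f : E → F} (hf : ContDiffOn ℝ ∞ f D) {u : Hol δ E}
    (hu : ∀ y, u y ∈ D) :
    HasFDerivWithinAt (comp f) (bilin (.id ℝ (E →L[ℝ] F)) (comp (fderivWithin ℝ f D) u))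
      {u : Hol δ E | ∀ y, u y ∈ D} u := by
  have hf' : ContDiffOn ℝ ∞ (fderivWithin ℝ f D) D := hf.fderivWithin hDu (m := ∞) (by simp)
  obtain ⟨K₁, K₂, hK₁, hK₂, hlip⟩ := norm_comp_sub_comp_le (δ := δ) hD hDc hDu hf'
  set C := K₁ + K₂ * ‖u‖ with hC
  have hC0 : 0 ≤ C := by positivity
  have hd := hf.differentiableOn (by simp : (∞ : WithTop ℕ∞) ≠ 0)
  have key : ∀ u' : Hol δ E, (∀ y, u' y ∈ D) →
      ‖comp f u' - comp f u - bilin (.id ℝ (E →L[ℝ] F)) (comp (fderivWithin ℝ f D) u) (u' - u)‖ ≤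
        C * ‖u' - u‖ * ‖u' - u‖ + C * ‖u' - u‖ * ‖u' - u‖ := by
    intro u' hu'
    have hm := comp_mem_of_range hD hDc hDu hf hu
    have hm' := comp_mem_of_range hD hDc hDu hf hu'
    have hmd := comp_mem_of_range hD hDc hDu hf' hu
    have hut : ∀ t ∈ Icc (0 : ℝ) 1, ∀ y, (u + t • (u' - u)) y ∈ D := fun t ht y =>
      segment_mem hD (hu y) (hu' y) ht
    -- Since R t lives in the Hölder space, a single norm bound controls its values and its
    -- differences. The mean value theorem is then used once at y and once for the pair y, z.
    set R : ℝ → Hol δ F := fun t => bilin (.id ℝ (E →L[ℝ] F))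
      (comp (fderivWithin ℝ f D) (u + t • (u' - u)) - comp (fderivWithin ℝ f D) u) (u' - u)
      with hR
    have hRn : ∀ t ∈ Icc (0 : ℝ) 1, ‖R t‖ ≤ C * ‖u' - u‖ * ‖u' - u‖ := fun t ht => by
      refine (norm_bilinMk_le _ _ _).trans ?_
      refine mul_le_mul_of_nonneg_right ?_ (norm_nonneg _)
      refine (mul_le_of_le_one_left (norm_nonneg _) ContinuousLinearMap.norm_id_le).trans ?_
      refine (hlip u (u + t • (u' - u)) hu (hut t ht)).trans ?_
      refine mul_le_mul_of_nonneg_left ?_ hC0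
      rw [add_sub_cancel_left, norm_smul, Real.norm_of_nonneg ht.1]
      exact mul_le_of_le_one_left (norm_nonneg _) ht.2
    have hder : ∀ y, ∀ t ∈ Icc (0 : ℝ) 1, HasDerivWithinAt
        (fun t : ℝ => f (u y + t • (u' y - u y)) - t • fderivWithin ℝ f D (u y) (u' y - u y))
        (R t y) (Icc 0 1) t := fun y t ht => by
      have h1 := (hasDerivWithinAt_segment hD hd (hu y) (hu' y) ht).sub
        (((hasDerivAt_id t).smul_const (fderivWithin ℝ f D (u y) (u' y - u y))).hasDerivWithinAt
          (s := Icc 0 1))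
      have e : R t y = fderivWithin ℝ f D (u y + t • (u' y - u y)) (u' y - u y) -
          (1 : ℝ) • fderivWithin ℝ f D (u y) (u' y - u y) := by
        change (comp (fderivWithin ℝ f D) (u + t • (u' - u)) y - comp (fderivWithin ℝ f D) u y)
          (u' y - u y) = _
        rw [comp_apply hmd, comp_apply (comp_mem_of_range hD hDc hDu hf' (hut t ht))]
        simp
      rw [e]
      exact h1
    have hval : ∀ y, (comp f u' - comp f u -
        bilin (.id ℝ (E →L[ℝ] F)) (comp (fderivWithin ℝ f D) u) (u' - u)) y =
        (f (u y + (1 : ℝ) • (u' y - u y)) - (1 : ℝ) • fderivWithin ℝ f D (u y) (u' y - u y)) -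
        (f (u y + (0 : ℝ) • (u' y - u y)) - (0 : ℝ) • fderivWithin ℝ f D (u y) (u' y - u y)) :=
      fun y => by
        change comp f u' y - comp f u y - (comp (fderivWithin ℝ f D) u y) (u' y - u y) = _
        rw [comp_apply hm, comp_apply hm', comp_apply hmd]
        simp only [one_smul, zero_smul, add_zero, sub_zero, add_sub_cancel]
        abel
    refine norm_le (by positivity) (by positivity) (fun y => ?_) (fun y z => ?_)
    · rw [hval]
      exact norm_image_sub_le_of_norm_deriv_le_segment_01' (hder y) fun t ht =>
        (norm_apply_le _ y).trans (hRn t ⟨ht.1, ht.2.le⟩)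
    · rw [hval, hval]
      have := norm_image_sub_le_of_norm_deriv_le_segment_01'
        (fun t ht => (hder y t ht).sub (hder z t ht)) (C := C * ‖u' - u‖ * ‖u' - u‖ * δ y z)
        fun t ht => (norm_sub_le (R t) y z).trans
          (mul_le_mul_of_nonneg_right (hRn t ⟨ht.1, ht.2.le⟩) (NNReal.coe_nonneg _))
      refine le_trans (le_of_eq ?_) this
      congr 1
      simp only [Pi.sub_apply]
      abel
  rw [hasFDerivWithinAt_iff_isLittleO]
  refine Asymptotics.IsLittleO.of_bound fun c hc => ?_
  have hev : ∀ᶠ u' in 𝓝[{u : Hol δ E | ∀ y, u y ∈ D}] u, ‖u' - u‖ < c / (2 * C + 1) := by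
    have : Tendsto (fun u' => ‖u' - u‖) (𝓝 u) (𝓝 0) := by
      have hc : Continuous fun u' : Hol δ E => ‖u' - u‖ := by fun_prop
      simpa using hc.tendsto u
    exact (this.mono_left nhdsWithin_le_nhds).eventually_lt_const (by positivity)
  filter_upwards [hev, self_mem_nhdsWithin] with u' h1 h2
  refine (key u' h2).trans ?_
  rw [← add_mul]
  refine mul_le_mul_of_nonneg_right ?_ (norm_nonneg _)
  rw [lt_div_iff₀ (by positivity)] at h1
  nlinarith [norm_nonneg (u' - u)]

/-- The derivative is a fixed bounded bilinear operation applied to superposition with f', which is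
again smooth on D. The induction has to run over all target spaces because f' takes values in linear
maps. -/
theorem contDiffOn_comp_nat {D : Set E} (hD : Convex ℝ D) (hDc : IsCompact D)
    (hDu : UniqueDiffOn ℝ D) (n : ℕ) : ∀ {F : Type} [NormedAddCommGroup F] [NormedSpace ℝ F]
    {f : E → F}, ContDiffOn ℝ ∞ f D →
      ContDiffOn ℝ n (comp f) {u : Hol δ E | ∀ y, u y ∈ D} := by
  induction n with
  | zero =>
    intro F _ _ f hf
    exact contDiffOn_zero.mpr fun u hu => (hasFDerivWithinAt_comp hD hDc hDu hf hu).continuousWithinAt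
  | succ n ih =>
    intro F _ _ f hf
    push_cast
    rw [contDiffOn_succ_iff_hasFDerivWithinAt (by simp)]
    intro u hu
    refine ⟨{u : Hol δ E | ∀ y, u y ∈ D}, ?_, by simp,
      fun u => bilin (.id ℝ (E →L[ℝ] F)) (comp (fderivWithin ℝ f D) u),
      fun u hu => hasFDerivWithinAt_comp hD hDc hDu hf hu, ?_⟩
    · rw [insert_eq_of_mem hu]; exact self_mem_nhdsWithin
    · exact (bilin (.id ℝ (E →L[ℝ] F))).contDiff.comp_contDiffOn
        (ih (hf.fderivWithin hDu (m := ∞) (by simp)))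

/-- Superposition with a smooth function on a convex compact set is smooth. -/
theorem contDiffOn_comp {D : Set E} (hD : Convex ℝ D) (hDc : IsCompact D)
    (hDu : UniqueDiffOn ℝ D) {f : E → F} (hf : ContDiffOn ℝ ∞ f D) :
    ContDiffOn ℝ ∞ (comp f) {u : Hol δ E | ∀ y, u y ∈ D} :=
  contDiffOn_infty.mpr fun n => contDiffOn_comp_nat hD hDc hDu n hf

end Hol

end Superposition

end

section

/-! ### Superposition with convergent power series -/

section AnalyticSuperposition

variable {S T E F : Type} [NormedAddCommGroup E] [NormedSpace ℝ E] [NormedAddCommGroup F]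
  [NormedSpace ℝ F]

namespace Hol

variable {δ : S → S → ℝ≥0}

/-- A Cauchy sequence that converges pointwise converges. -/
theorem exists_tendsto_of_cauchySeq {s : ℕ → Hol δ E} (hs : CauchySeq s) {g : S → E}
    (hg : ∀ y, Tendsto (fun n => s n y) atTop (𝓝 (g y))) :
    ∃ h : g ∈ holSubmodule δ E, Tendsto s atTop (𝓝 (ofMem g h)) := by
  obtain ⟨R, hR⟩ := hs.norm_bddAbove
  have hRn : ∀ n, ‖s n‖ ≤ R := fun n => hR ⟨n, rfl⟩
  have hmem : g ∈ holSubmodule δ E := by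
    refine mem_of_bounds (a := R) (b := R) (fun y => ?_) fun y z => ?_
    · exact le_of_tendsto (hg y).norm (Eventually.of_forall fun n =>
        (norm_apply_le _ y).trans (hRn n))
    · exact le_of_tendsto ((hg y).sub (hg z)).norm (Eventually.of_forall fun n =>
        (norm_sub_le _ y z).trans (mul_le_mul_of_nonneg_right (hRn n) (NNReal.coe_nonneg _)))
  refine ⟨hmem, ?_⟩
  rw [Metric.tendsto_atTop]
  intro c hc
  obtain ⟨N, hN⟩ := Metric.cauchySeq_iff.mp hs (c / 4) (by positivity)
  refine ⟨N, fun n hn => ?_⟩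
  have hnm : ∀ k ≥ N, ‖s n - s k‖ ≤ c / 4 := fun k hk => by
    rw [← dist_eq_norm]; exact (hN n hn k hk).le
  have h1 : ‖s n - ofMem g hmem‖ ≤ c / 4 + c / 4 := by
    refine norm_le (by positivity) (by positivity) (fun y => ?_) fun y z => ?_
    · have ht : Tendsto (fun k => ‖(s n - s k) y‖) atTop (𝓝 ‖(s n - ofMem g hmem) y‖) :=
        ((hg y).const_sub (s n y)).norm
      exact le_of_tendsto ht ((eventually_ge_atTop N).mono fun k hk =>
        (norm_apply_le _ y).trans (hnm k hk))
    · have ht : Tendsto (fun k => ‖(s n - s k) y - (s n - s k) z‖) atTop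
          (𝓝 ‖(s n - ofMem g hmem) y - (s n - ofMem g hmem) z‖) :=
        (((hg y).const_sub (s n y)).sub ((hg z).const_sub (s n z))).norm
      exact le_of_tendsto ht ((eventually_ge_atTop N).mono fun k hk =>
        (norm_sub_le _ y z).trans
          (mul_le_mul_of_nonneg_right (hnm k hk) (NNReal.coe_nonneg _)))
  rw [dist_eq_norm]
  linarith

instance [CompleteSpace E] : CompleteSpace (Hol δ E) := by
  refine Metric.complete_of_cauchySeq_tendsto fun s hs => ?_
  have hc : ∀ y, ∃ a, Tendsto (fun n => s n y) atTop (𝓝 a) := fun y =>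
    cauchySeq_tendsto_of_complete ((eval y).uniformContinuous.comp_cauchySeq hs)
  choose g hg using hc
  obtain ⟨h, ht⟩ := exists_tendsto_of_cauchySeq hs hg
  exact ⟨_, ht⟩

/-- The constant functions. -/
def const (δ : S → S → ℝ≥0) (x : E) : Hol δ E :=
  mk (fun _ => x) ‖x‖ 0 (norm_nonneg _) le_rfl (fun _ => le_rfl) (by simp)

@[simp] theorem const_apply (x : E) (y : S) : const δ x y = x := rfl

/-- The left side collects the terms of order at most one in r of the product on the right. This is
what keeps a factor n out of the norm of an n-linear map acting pointwise, so radii of convergence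
do not shrink. -/
theorem prod_add_sum_le_prod {ι : Type*} [DecidableEq ι] (t : Finset ι) {s r : ι → ℝ}
    (hs : ∀ i, 0 ≤ s i) (hr : ∀ i, 0 ≤ r i) :
    (∏ i ∈ t, s i) + ∑ i ∈ t, ∏ j ∈ t, (if j = i then r i else s j) ≤ ∏ i ∈ t, (s i + r i) := by
  induction t using Finset.induction_on with
  | empty => simp
  | insert a t ha ih =>
    rw [Finset.prod_insert ha, Finset.sum_insert ha, Finset.prod_insert ha, Finset.prod_insert ha,
      if_pos rfl]
    have e1 : ∏ x ∈ t, (if x = a then r a else s x) = ∏ x ∈ t, s x :=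
      Finset.prod_congr rfl fun x hx => if_neg fun h : x = a => ha (by rw [← h]; exact hx)
    have e2 : ∑ i ∈ t, ∏ j ∈ insert a t, (if j = i then r i else s j) =
        s a * ∑ i ∈ t, ∏ j ∈ t, (if j = i then r i else s j) := by
      rw [Finset.mul_sum]
      refine Finset.sum_congr rfl fun i hi => ?_
      rw [Finset.prod_insert ha, if_neg fun h : a = i => ha (by rw [h]; exact hi)]
    rw [e1, e2]
    have h1 : ∏ x ∈ t, s x ≤ ∏ i ∈ t, (s i + r i) :=
      Finset.prod_le_prod (fun i _ => hs i) fun i _ => le_add_of_nonneg_right (hr i)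
    have h2 := mul_le_mul_of_nonneg_left ih (hs a)
    have h3 := mul_le_mul_of_nonneg_left h1 (hr a)
    nlinarith

section Multi

variable {n : ℕ} (P : ContinuousMultilinearMap ℝ (fun _ : Fin n => E) F) (w : Fin n → Hol δ E)

theorem norm_multi_apply_le (y : S) : ‖P fun i => w i y‖ ≤ ‖P‖ * ∏ i, supN (w i) :=
  (P.le_opNorm _).trans (mul_le_mul_of_nonneg_left
    (Finset.prod_le_prod (fun _ _ => norm_nonneg _) fun i _ => norm_apply_le_supN (w i) y)
    (norm_nonneg P))

/-- The arguments are exchanged one at a time: the exchanged slot contributes its seminorm, and each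
other slot its supremum. -/
theorem norm_multi_sub_le (y z : S) : ‖(P fun i => w i y) - P fun i => w i z‖ ≤
    ‖P‖ * (∑ i, ∏ j, if j = i then semN (w i) else supN (w j)) * δ y z := by
  refine (P.norm_image_sub_le' _ _).trans ?_
  rw [mul_assoc, Finset.sum_mul]
  refine mul_le_mul_of_nonneg_left (Finset.sum_le_sum fun i _ => ?_) (norm_nonneg P)
  rw [← Finset.mul_prod_erase _ _ (Finset.mem_univ i),
    ← Finset.mul_prod_erase _ (fun j => if j = i then semN (w i) else supN (w j))
      (Finset.mem_univ i), if_pos rfl, if_pos rfl, mul_right_comm]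
  refine mul_le_mul (norm_sub_le_semN _ _ _) (Finset.prod_le_prod (fun j hj => ?_) fun j hj => ?_)
    (Finset.prod_nonneg fun j hj => ?_) (mul_nonneg (semN_nonneg _) (NNReal.coe_nonneg _))
  · rw [if_neg (Finset.ne_of_mem_erase hj)]; exact le_max_of_le_left (norm_nonneg _)
  · rw [if_neg (Finset.ne_of_mem_erase hj), if_neg (Finset.ne_of_mem_erase hj)]
    exact max_le (norm_apply_le_supN _ _) (norm_apply_le_supN _ _)
  · rw [if_neg (Finset.ne_of_mem_erase hj)]; exact le_max_of_le_left (norm_nonneg _)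

theorem multi_sup_nonneg : 0 ≤ ‖P‖ * ∏ i, supN (w i) :=
  mul_nonneg (norm_nonneg _) (Finset.prod_nonneg fun _ _ => supN_nonneg _)

theorem multi_sem_nonneg :
    0 ≤ ‖P‖ * (∑ i, ∏ j, if j = i then semN (w i) else supN (w j)) :=
  mul_nonneg (norm_nonneg _) (Finset.sum_nonneg fun i _ => Finset.prod_nonneg fun j _ => by
    split_ifs
    · exact semN_nonneg _
    · exact supN_nonneg _)

/-- The pointwise application of a multilinear map to a family of functions. -/
def multiMk : Hol δ F :=
  mk (fun y => P fun i => w i y) _ _ (multi_sup_nonneg P w) (multi_sem_nonneg P w)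
    (norm_multi_apply_le P w) (norm_multi_sub_le P w)

@[simp] theorem multiMk_apply (y : S) : multiMk P w y = P fun i => w i y := rfl

theorem norm_multiMk_le : ‖multiMk P w‖ ≤ ‖P‖ * ∏ i, ‖w i‖ := by
  refine (norm_le (multi_sup_nonneg P w) (multi_sem_nonneg P w)
    (norm_multi_apply_le P w) (norm_multi_sub_le P w)).trans ?_
  rw [← mul_add]
  exact mul_le_mul_of_nonneg_left (prod_add_sum_le_prod Finset.univ
    (fun i => supN_nonneg (w i)) (fun i => semN_nonneg (w i))) (norm_nonneg P)

/-- The pointwise application of a multilinear map. -/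
def multi : ContinuousMultilinearMap ℝ (fun _ : Fin n => Hol δ E) (Hol δ F) :=
  MultilinearMap.mkContinuous
    { toFun := multiMk P
      map_update_add' := fun {inst} w i a b => by
        ext y
        have e : ∀ c : Hol δ E, (fun j => Function.update w i c j y) =
            Function.update (fun j => w j y) i (c y) := fun c => by
          funext j
          by_cases h : j = i
          · subst h; simp
          · simp [h]
        simp only [multiMk_apply, add_apply, e]
        exact P.map_update_add _ _ _ _
      map_update_smul' := fun {inst} w i a b => by
        ext y
        have e : ∀ c : Hol δ E, (fun j => Function.update w i c j y) =
            Function.update (fun j => w j y) i (c y) := fun c => by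
          funext j
          by_cases h : j = i
          · subst h; simp
          · simp [h]
        simp only [multiMk_apply, smul_apply, e]
        exact P.map_update_smul _ _ _ _ } ‖P‖ (norm_multiMk_le P)

@[simp] theorem multi_apply (y : S) : multi P w y = P fun i => w i y := rfl

theorem norm_multi_le : ‖multi (δ := δ) P‖ ≤ ‖P‖ :=
  ContinuousMultilinearMap.opNorm_le_bound (norm_nonneg P) (norm_multiMk_le P)

end Multi

variable {f : E → F} {p : FormalMultilinearSeries ℝ E F} {x : E} {r : ℝ≥0∞}

/-- The pointwise terms obey the same norm bounds as the original series, so the partial sums are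
Cauchy in the Hölder space. The limit is identified by its pointwise values, and for this reason no
completeness of F is needed. -/
theorem hasSum_multi (hf : HasFPowerSeriesOnBall f p x r) {w : Hol δ E}
    (hw : w ∈ Metric.eball (0 : Hol δ E) r) :
    ∃ h : (fun y => f (x + w y)) ∈ holSubmodule δ F,
      HasSum (fun n => multi (δ := δ) (p n) fun _ => w) (ofMem _ h) := by
  have hrad : r ≤ FormalMultilinearSeries.radius fun n => multi (δ := δ) (p n) :=
    hf.r_le.trans (FormalMultilinearSeries.radius_le_of_le fun n => norm_multi_le (p n))
  have hsum : Summable fun n => ‖multi (δ := δ) (p n) fun _ => w‖ :=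
    FormalMultilinearSeries.summable_norm_apply (fun n => multi (δ := δ) (p n))
      (Metric.eball_subset_eball hrad hw)
  have hcau : CauchySeq fun N => ∑ n ∈ Finset.range N, multi (δ := δ) (p n) fun _ => w :=
    cauchySeq_range_of_norm_bounded hsum.hasSum.tendsto_sum_nat.cauchySeq fun n => le_rfl
  obtain ⟨h, ht⟩ := exists_tendsto_of_cauchySeq hcau (g := fun y => f (x + w y)) fun y => by
    have hy : w y ∈ Metric.eball (0 : E) r := by
      refine Metric.mem_eball.mpr (lt_of_le_of_lt ?_ (Metric.mem_eball.mp hw))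
      rw [edist_zero_right, edist_zero_right, enorm_le_iff_norm_le]
      exact norm_apply_le w y
    have := (hf.hasSum hy).tendsto_sum_nat
    refine this.congr fun N => ?_
    exact (map_sum (eval y : Hol δ F →L[ℝ] F) (fun n => multi (δ := δ) (p n) fun _ => w) _).symm
  exact ⟨h, (hasSum_iff_tendsto_nat_of_summable_norm hsum).mpr ht⟩

/-- Superposition with an analytic function, near a constant function. -/
theorem hasFPowerSeriesOnBall_comp (hf : HasFPowerSeriesOnBall f p x r) :
    HasFPowerSeriesOnBall (comp f) (fun n => multi (δ := δ) (p n)) (const δ x) r where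
  r_le := hf.r_le.trans (FormalMultilinearSeries.radius_le_of_le fun n => norm_multi_le (p n))
  r_pos := hf.r_pos
  hasSum {w} hw := by
    obtain ⟨h, hs⟩ := hasSum_multi hf hw
    convert hs using 1
    ext y
    rw [comp_apply (u := const δ x + w) h]
    rfl

theorem comp_mem_of_mem_eball (hf : HasFPowerSeriesOnBall f p x r) {u : Hol δ E}
    (hu : u ∈ Metric.eball (const δ x) r) : (fun y => f (u y)) ∈ holSubmodule δ F := by
  obtain ⟨h, -⟩ := hasSum_multi (w := u - const δ x) hf (by
    rw [Metric.mem_eball, edist_zero_right, ← edist_eq_enorm_sub]; exact hu)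
  convert h using 2
  simp

end Hol

end AnalyticSuperposition

end

section

/-! ### Localization of superposition by Lipschitz partitions of unity -/

section Gluing

variable {S E F : Type} [NormedAddCommGroup E] [NormedSpace ℝ E] [NormedAddCommGroup F]
  [NormedSpace ℝ F]

namespace Hol

variable {δ : S → S → ℝ≥0}

/-- A Lipschitz partition of unity subordinate to a cover of the range of a function. -/
theorem exists_partition (u₀ : Hol δ E) {C : Set E} (hC : IsCompact C) (hu : ∀ y, u₀ y ∈ C)
    {r : E → ℝ} (hr : ∀ p ∈ C, 0 < r p) :
    ∃ (t : Finset E) (χ : E → S → ℝ) (L : ℝ), (∀ p ∈ t, p ∈ C) ∧ 0 ≤ L ∧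
      (∀ y, ∑ p ∈ t, χ p y = 1) ∧ (∀ p ∈ t, ∀ y, |χ p y| ≤ 1) ∧
      (∀ p ∈ t, ∀ y, u₀ y ∉ Metric.ball p (r p) → χ p y = 0) ∧
      ∀ p ∈ t, ∀ y z, |χ p y - χ p z| ≤ L * δ y z := by
  obtain ⟨t, hcov⟩ := hC.elim_nhds_subcover' (fun p _ => Metric.ball p (r p))
    fun p hp => Metric.ball_mem_nhds p (hr p hp)
  classical
  set T : Finset E := t.image Subtype.val with hT
  have hTC : ∀ p ∈ T, p ∈ C := fun p hp => by
    obtain ⟨q, -, rfl⟩ := Finset.mem_image.mp hp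
    exact q.2
  -- Hat functions of Lipschitz constant 1. Their sum is bounded below on C by compactness, so the
  -- normalized hats are Lipschitz along the range of u₀.
  set ψ : E → E → ℝ := fun p x => max 0 (r p - dist x p) with hψ
  have hψ0 : ∀ p x, 0 ≤ ψ p x := fun p x => le_max_left _ _
  set Ψ : E → ℝ := fun x => ∑ p ∈ T, ψ p x with hΨ
  have hψlip : ∀ p x x', |ψ p x - ψ p x'| ≤ ‖x - x'‖ := fun p x x' => by
    refine (abs_max_sub_max_le_max _ _ _ _).trans ?_
    rw [sub_self, abs_zero, sub_sub_sub_cancel_left, max_eq_right (abs_nonneg _), ← dist_eq_norm,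
      dist_comm x x']
    exact abs_dist_sub_le x' x p
  have hΨlip : ∀ x x', |Ψ x - Ψ x'| ≤ T.card * ‖x - x'‖ := fun x x' => by
    rw [hΨ, ← Finset.sum_sub_distrib]
    refine (Finset.abs_sum_le_sum_abs _ _).trans ?_
    rw [← nsmul_eq_mul]
    exact Finset.sum_le_card_nsmul _ _ _ fun p _ => hψlip p x x'
  have hΨpos : ∀ x ∈ C, 0 < Ψ x := fun x hx => by
    obtain ⟨q, hq, hxq⟩ := mem_iUnion₂.mp (hcov hx)
    refine Finset.sum_pos' (fun p _ => hψ0 p x) ⟨q, Finset.mem_image_of_mem _ hq, ?_⟩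
    exact lt_max_of_lt_right (sub_pos.mpr hxq)
  obtain ⟨c, hc, hcΨ⟩ : ∃ c > 0, ∀ x ∈ C, c ≤ Ψ x := by
    rcases C.eq_empty_or_nonempty with h | h
    · exact ⟨1, one_pos, by simp [h]⟩
    · have hcont : Continuous Ψ := by
        refine continuous_finsetSum _ fun p _ => ?_
        exact continuous_const.max (continuous_const.sub (continuous_id.dist continuous_const))
      obtain ⟨x, hx, hmin⟩ := hC.exists_isMinOn h hcont.continuousOn
      exact ⟨Ψ x, hΨpos x hx, hmin⟩
  refine ⟨T, fun p y => ψ p (u₀ y) / Ψ (u₀ y), (1 + T.card) / c * ‖u₀‖, hTC, by positivity,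
    fun y => ?_, fun p hp y => ?_, fun p hp y hy => ?_, fun p hp y z => ?_⟩
  · rw [← Finset.sum_div, div_self (hΨpos _ (hu y)).ne']
  · rw [abs_of_nonneg (div_nonneg (hψ0 _ _) (hΨpos _ (hu y)).le)]
    exact (div_le_one (hΨpos _ (hu y))).mpr
      (Finset.single_le_sum (f := fun p => ψ p (u₀ y)) (fun p _ => hψ0 p _) hp)
  · have : ψ p (u₀ y) = 0 := max_eq_left (by
      rw [Metric.mem_ball, not_lt] at hy; linarith)
    simp only [this, zero_div]
  · have hA := hΨpos _ (hu y)
    have hB := hΨpos _ (hu z)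
    -- In this form of the quotient rule the factor in front of the change of the denominator is a
    -- normalized hat, hence at most 1.
    have e : ψ p (u₀ y) / Ψ (u₀ y) - ψ p (u₀ z) / Ψ (u₀ z) =
        (ψ p (u₀ y) - ψ p (u₀ z)) / Ψ (u₀ y) +
          ψ p (u₀ z) / Ψ (u₀ z) * ((Ψ (u₀ z) - Ψ (u₀ y)) / Ψ (u₀ y)) := by
      field_simp
      ring
    have h1 : |(ψ p (u₀ y) - ψ p (u₀ z)) / Ψ (u₀ y)| ≤ ‖u₀ y - u₀ z‖ / c := by
      rw [abs_div, abs_of_pos hA]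
      exact div_le_div₀ (norm_nonneg _) (hψlip _ _ _) hc (hcΨ _ (hu y))
    have h2 : |ψ p (u₀ z) / Ψ (u₀ z)| ≤ 1 := by
      rw [abs_of_nonneg (div_nonneg (hψ0 _ _) hB.le)]
      exact (div_le_one hB).mpr
        (Finset.single_le_sum (f := fun p => ψ p (u₀ z)) (fun p _ => hψ0 p _) hp)
    have h3 : |(Ψ (u₀ z) - Ψ (u₀ y)) / Ψ (u₀ y)| ≤ T.card * ‖u₀ y - u₀ z‖ / c := by
      rw [abs_div, abs_of_pos hA, abs_sub_comm]
      exact div_le_div₀ (by positivity) (hΨlip _ _) hc (hcΨ _ (hu y))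
    rw [e]
    refine (abs_add_le _ _).trans ?_
    rw [abs_mul]
    have h4 := mul_le_of_le_one_left (abs_nonneg ((Ψ (u₀ z) - Ψ (u₀ y)) / Ψ (u₀ y))) h2
    calc _ ≤ ‖u₀ y - u₀ z‖ / c + T.card * ‖u₀ y - u₀ z‖ / c := by linarith
      _ = (1 + T.card) / c * ‖u₀ y - u₀ z‖ := by ring
      _ ≤ (1 + T.card) / c * (‖u₀‖ * δ y z) :=
          mul_le_mul_of_nonneg_left (norm_sub_le _ _ _) (by positivity)
      _ = _ := by ring

/-- The modulus `Λ * δ` on a subset. -/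
def scaled (δ : S → S → ℝ≥0) (A : Set S) (Λ : ℝ≥0) : A → A → ℝ≥0 := fun y z => Λ * δ y z

/-- The restriction to a subset. -/
def restrict (A : Set S) {Λ : ℝ≥0} (hΛ : 0 < Λ) : Hol δ E →L[ℝ] Hol (scaled δ A Λ) E :=
  pull (fun y => (y : S)) Λ⁻¹ fun y z => by
    rw [scaled, ← mul_assoc, inv_mul_cancel₀ hΛ.ne', one_mul]

@[simp] theorem restrict_apply (A : Set S) {Λ : ℝ≥0} (hΛ : 0 < Λ) (u : Hol δ E) (y : A) :
    restrict A hΛ u y = u y := rfl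

/-- Enlarging the modulus by Λ divides the seminorm by Λ. A function of small oscillation thus
becomes close to a constant in norm, however large its original seminorm; this reduces analyticity
everywhere to analyticity near constants. -/
theorem norm_restrict_sub_const_le (A : Set S) {Λ : ℝ≥0} (hΛ : 0 < Λ) (u : Hol δ E) {p : E}
    {a : ℝ} (ha : 0 ≤ a) (h : ∀ y ∈ A, ‖u y - p‖ ≤ a) :
    ‖restrict A hΛ u - const _ p‖ ≤ a + ‖u‖ / Λ := by
  refine norm_le ha (by positivity) (fun y => h y y.2) fun y z => ?_
  simp only [sub_apply, restrict_apply, const_apply, sub_sub_sub_cancel_right]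
  refine (norm_sub_le u y z).trans (le_of_eq ?_)
  have : (Λ : ℝ) ≠ 0 := by exact_mod_cast hΛ.ne'
  simp only [scaled, NNReal.coe_mul]
  field_simp

open scoped Classical in
/-- The product of a function on a subset with a cut-off function supported there. -/
def cutoff (A : Set S) (Λ : ℝ≥0) (χ : S → ℝ) {L : ℝ} (hL : 0 ≤ L) (h0 : ∀ y ∉ A, χ y = 0)
    (h1 : ∀ y, |χ y| ≤ 1) (h2 : ∀ y z, |χ y - χ z| ≤ L * δ y z) :
    Hol (scaled δ A Λ) F →L[ℝ] Hol δ F :=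
  mkCLM (fun g y => if h : y ∈ A then χ y • g ⟨y, h⟩ else 0) 1 (Λ + L) zero_le_one
    (by positivity)
    (fun g g' y => by
      by_cases h : y ∈ A <;> simp [h])
    (fun c g y => by
      by_cases h : y ∈ A
      · simp only [h, dif_pos, smul_apply]; exact smul_comm _ _ _
      · simp [h])
    (fun g y => by
      rw [one_mul]
      by_cases h : y ∈ A
      · simp only [h, dif_pos, norm_smul, Real.norm_eq_abs]
        exact (mul_le_mul (h1 y) (norm_apply_le g _) (norm_nonneg _) zero_le_one).trans
          (one_mul _).le
      · simp [h])
    (fun g y z => by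
      -- For a pair separated by the boundary of A, the cut-off vanishes at the outer point, so its
      -- value at the inner point is at most L δ.
      have key : ∀ y z, ∀ hz : z ∈ A, ∀ hy : y ∉ A, ‖χ z • g ⟨z, hz⟩‖ ≤ (Λ + L) * ‖g‖ * δ y z :=
        fun y z hz hy => by
          have h3 := h2 y z
          rw [h0 y hy, zero_sub, abs_neg] at h3
          rw [norm_smul, Real.norm_eq_abs]
          calc |χ z| * ‖g ⟨z, hz⟩‖ ≤ (L * δ y z) * ‖g‖ :=
                mul_le_mul h3 (norm_apply_le g _) (norm_nonneg _) (by positivity)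
            _ ≤ _ := by
                have : 0 ≤ Λ * ‖g‖ * δ y z := by positivity
                nlinarith
      by_cases hy : y ∈ A <;> by_cases hz : z ∈ A
      · simp only [hy, hz, dif_pos]
        have e : χ y • g ⟨y, hy⟩ - χ z • g ⟨z, hz⟩ =
            χ y • (g ⟨y, hy⟩ - g ⟨z, hz⟩) + (χ y - χ z) • g ⟨z, hz⟩ := by module
        rw [e]
        refine (norm_add_le _ _).trans ?_
        rw [norm_smul, norm_smul, Real.norm_eq_abs, Real.norm_eq_abs]
        have n1 : |χ y| * ‖g ⟨y, hy⟩ - g ⟨z, hz⟩‖ ≤ ‖g‖ * (Λ * δ y z) :=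
          (mul_le_mul (h1 y) (norm_sub_le g ⟨y, hy⟩ ⟨z, hz⟩) (norm_nonneg _) zero_le_one).trans
            (one_mul _).le
        have n2 : |χ y - χ z| * ‖g ⟨z, hz⟩‖ ≤ (L * δ y z) * ‖g‖ :=
          mul_le_mul (h2 y z) (norm_apply_le g _) (norm_nonneg _) (by positivity)
        linarith
      · simp only [hy, hz, dif_pos, dif_neg, not_false_eq_true, sub_zero]
        have h3 := h2 y z
        rw [h0 z hz, sub_zero] at h3
        rw [norm_smul, Real.norm_eq_abs]
        calc |χ y| * ‖g ⟨y, hy⟩‖ ≤ (L * δ y z) * ‖g‖ :=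
              mul_le_mul h3 (norm_apply_le g _) (norm_nonneg _) (by positivity)
          _ ≤ _ := by
              have : 0 ≤ Λ * ‖g‖ * δ y z := by positivity
              nlinarith
      · simp only [hy, hz, dif_pos, dif_neg, not_false_eq_true, zero_sub, norm_neg]
        exact key y z hz hy
      · simp only [hy, hz, dif_neg, not_false_eq_true, sub_self, norm_zero]
        positivity)

theorem cutoff_apply (A : Set S) (Λ : ℝ≥0) (χ : S → ℝ) {L : ℝ} (hL : 0 ≤ L)
    (h0 : ∀ y ∉ A, χ y = 0) (h1 : ∀ y, |χ y| ≤ 1) (h2 : ∀ y z, |χ y - χ z| ≤ L * δ y z)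
    (g : Hol (scaled δ A Λ) F) {f : S → F} (hf : ∀ y : A, g y = f y) (y : S) :
    cutoff A Λ χ hL h0 h1 h2 g y = χ y • f y := by
  unfold cutoff
  rw [mkCLM_apply]
  split_ifs with h
  · rw [hf]
  · rw [h0 y h, zero_smul]

/-- Superposition is a finite sum of localized superpositions. -/
theorem exists_localization (f : E → F) (u₀ : Hol δ E) {C : Set E} (hC : IsCompact C)
    (hu : ∀ y, u₀ y ∈ C) {r : E → ℝ} (hr : ∀ p ∈ C, 0 < r p) :
    ∃ (t : Finset E) (A : E → Set S) 
      (M : ∀ (Λ : ℝ≥0) (p : E), Hol (scaled δ (A p) Λ) F →L[ℝ] Hol δ F),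
      (∀ p ∈ t, p ∈ C) ∧ (∀ p, ∀ y ∈ A p, ‖u₀ y - p‖ < r p) ∧
      ∀ {Λ : ℝ≥0} (hΛ : 0 < Λ) (u : Hol δ E),
        (∀ p ∈ t, (fun y => f (restrict (A p) hΛ u y)) ∈ holSubmodule (scaled δ (A p) Λ) F) →
        (fun y => f (u y)) ∈ holSubmodule δ F ∧
          comp f u = ∑ p ∈ t, M Λ p (comp f (restrict (A p) hΛ u)) := by
  classical
  obtain ⟨t, χ, L, htC, hL, hsum, h1, h0, h2⟩ := exists_partition u₀ hC hu hr
  set A : E → Set S := fun p => {y | u₀ y ∈ Metric.ball p (r p)} with hA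
  refine ⟨t, A, fun Λ p => if hp : p ∈ t then
    cutoff (A p) Λ (χ p) hL (h0 p hp) (h1 p hp) (h2 p hp) else 0, htC, fun p y hy => ?_, ?_⟩
  · rw [← dist_eq_norm]; exact hy
  · intro Λ hΛ u hmem
    have hval : ∀ y, (∑ p ∈ t, (if hp : p ∈ t then
        cutoff (F := F) (A p) Λ (χ p) hL (h0 p hp) (h1 p hp) (h2 p hp) else 0)
        (comp f (restrict (A p) hΛ u))) y = f (u y) := fun y => by
      rw [← eval_apply, map_sum]
      calc _ = ∑ p ∈ t, χ p y • f (u y) := Finset.sum_congr rfl fun p hp => by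
            rw [dif_pos hp, eval_apply]
            exact cutoff_apply (A p) Λ (χ p) hL (h0 p hp) (h1 p hp) (h2 p hp) _
              (f := fun y => f (u y)) (fun z => comp_apply (hmem p hp) z) y
        _ = _ := by rw [← Finset.sum_smul, hsum, one_smul]
    have hu' : (fun y => f (u y)) ∈ holSubmodule δ F := by
      have : (fun y => f (u y)) = ⇑(∑ p ∈ t, (if hp : p ∈ t then
        cutoff (F := F) (A p) Λ (χ p) hL (h0 p hp) (h1 p hp) (h2 p hp) else 0)
        (comp f (restrict (A p) hΛ u))) := funext fun y => (hval y).symm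
      rw [this]
      exact Subtype.prop (p := fun g => g ∈ holSubmodule δ F) _
    refine ⟨hu', ?_⟩
    ext y
    rw [hval, comp_apply hu']

end Hol

end Gluing

end

section

/-! ### Regularity of superposition near an arbitrary function -/

section SuperpositionRegularity

variable {S E F : Type} [NormedAddCommGroup E] [NormedSpace ℝ E] [NormedAddCommGroup F]
  [NormedSpace ℝ F]

namespace Hol

variable {δ : S → S → ℝ≥0}

theorem eventually_norm_sub_lt (u₀ : Hol δ E) {c : ℝ} (hc : 0 < c) :
    ∀ᶠ u in 𝓝 u₀, ‖u - u₀‖ < c := by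
  have hc' : Continuous fun u : Hol δ E => ‖u - u₀‖ := by fun_prop
  have ht : Tendsto (fun u : Hol δ E => ‖u - u₀‖) (𝓝 u₀) (𝓝 0) := by simpa using hc'.tendsto u₀
  exact ht.eventually_lt_const hc

/-- Superposition with a smooth function on a convex set with interior is smooth. -/
theorem contDiffWithinAt_comp [ProperSpace E] {O H : Set E} (hO : IsOpen O) (hH : Convex ℝ H)
    (hHc : IsClosed H) (hHi : (interior H).Nonempty) {f : E → F} (hf : ContDiffOn ℝ ∞ f (O ∩ H))
    {u₀ : Hol δ E} {C : Set E} (hC : IsCompact C) (hCO : C ⊆ O ∩ H) (hu : ∀ y, u₀ y ∈ C) :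
    (fun y => f (u₀ y)) ∈ holSubmodule δ F ∧
      ContDiffWithinAt ℝ ∞ (comp f) {u : Hol δ E | ∀ y, u y ∈ H} u₀ := by
  -- The radius is chosen so that 2R still fits into O: one R for the oscillation of u₀ on the piece
  -- around p, another for the distance of u from u₀.
  have hex : ∀ p, ∃ R : ℝ, p ∈ C → 0 < R ∧ Metric.closedBall p (2 * R) ⊆ O := fun p => by
    by_cases hp : p ∈ C
    · obtain ⟨R, hR, hRO⟩ := Metric.nhds_basis_closedBall.mem_iff.mp
        (hO.mem_nhds (hCO hp).1)
      exact ⟨R / 2, fun _ => ⟨by positivity, by rwa [mul_div_cancel₀ _ two_ne_zero]⟩⟩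
    · exact ⟨0, fun h => absurd h hp⟩
  choose R hR using hex
  obtain ⟨t, A, M, htC, hA, hloc⟩ := exists_localization f u₀ hC hu (r := R) fun p hp => (hR p hp).1
  set D : E → Set E := fun p => Metric.closedBall p (2 * R p) ∩ H with hD
  have hDc : ∀ p, IsCompact (D p) := fun p => (isCompact_closedBall _ _).inter_right hHc
  have hDconv : ∀ p, Convex ℝ (D p) := fun p => (convex_closedBall _ _).inter hH
  -- A convex set with nonempty interior is contained in the closure of its interior, so the ball
  -- about p meets the interior of H. A convex set with interior points has unique derivatives.
  have hDu : ∀ p ∈ C, UniqueDiffOn ℝ (D p) := fun p hp => by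
    refine uniqueDiffOn_convex (hDconv p) ?_
    have h1 : p ∈ closure (interior H) := by
      rw [hH.closure_interior_eq_closure_of_nonempty_interior hHi]
      exact subset_closure (hCO hp).2
    obtain ⟨q, hq1, hq2⟩ := mem_closure_iff.mp h1 (Metric.ball p (2 * R p)) Metric.isOpen_ball
      (Metric.mem_ball_self (by have := (hR p hp).1; positivity))
    refine ⟨q, ?_⟩
    rw [hD, interior_inter]
    exact ⟨interior_mono Metric.ball_subset_closedBall (by rwa [Metric.isOpen_ball.interior_eq]),
      hq2⟩
  have hfD : ∀ p ∈ C, ContDiffOn ℝ ∞ f (D p) := fun p hp =>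
    hf.mono (inter_subset_inter_left _ (hR p hp).2)
  have hev : ∀ᶠ u in 𝓝 u₀, ∀ p ∈ t, ‖u - u₀‖ < R p :=
    (Finset.eventually_all t).mpr fun p hp => eventually_norm_sub_lt u₀ (hR p (htC p hp)).1
  have hrange : ∀ u : Hol δ E, (∀ y, u y ∈ H) → (∀ p ∈ t, ‖u - u₀‖ < R p) → ∀ p ∈ t,
      ∀ y, restrict (A p) one_pos u y ∈ D p := fun u huH hun p hp y => by
    refine ⟨?_, huH y⟩
    rw [Metric.mem_closedBall, dist_eq_norm, restrict_apply]
    have h1 := hA p y y.2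
    have h2 := norm_apply_le (u - u₀) (y : S)
    have h3 := hun p hp
    rw [sub_apply] at h2
    have h4 := norm_sub_le_norm_sub_add_norm_sub (u y) (u₀ y) p
    linarith
  have hmain : ∀ u : Hol δ E, (∀ y, u y ∈ H) → (∀ p ∈ t, ‖u - u₀‖ < R p) →
      (fun y => f (u y)) ∈ holSubmodule δ F ∧
        comp f u = ∑ p ∈ t, M 1 p (comp f (restrict (A p) one_pos u)) := fun u huH hun =>
    hloc one_pos u fun p hp => comp_mem_of_range (hDconv p) (hDc p) (hDu p (htC p hp))
      (hfD p (htC p hp)) (hrange u huH hun p hp)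
  have hu₀H : ∀ y, u₀ y ∈ H := fun y => (hCO (hu y)).2
  have hu₀n : ∀ p ∈ t, ‖u₀ - u₀‖ < R p := fun p hp => by
    rw [sub_self, norm_zero]; exact (hR p (htC p hp)).1
  refine ⟨(hmain u₀ hu₀H hu₀n).1, ?_⟩
  set V : Set (Hol δ E) := {u | (∀ y, u y ∈ H) ∧ ∀ p ∈ t, ‖u - u₀‖ < R p} with hV
  have hVn : V ∈ 𝓝[{u : Hol δ E | ∀ y, u y ∈ H}] u₀ := by
    filter_upwards [self_mem_nhdsWithin, mem_nhdsWithin_of_mem_nhds hev] with u h1 h2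
    exact ⟨h1, h2⟩
  have hcd : ContDiffWithinAt ℝ ∞
      (fun u => ∑ p ∈ t, M 1 p (comp f (restrict (A p) one_pos u))) V u₀ := by
    refine ContDiffWithinAt.sum fun p hp => ?_
    refine (M 1 p).contDiff.comp_contDiffWithinAt ?_
    exact ((contDiffOn_comp (hDconv p) (hDc p) (hDu p (htC p hp)) (hfD p (htC p hp))).comp
      (restrict (A p) one_pos).contDiff.contDiffOn
      (fun u hu => hrange u hu.1 hu.2 p hp)) u₀ ⟨hu₀H, hu₀n⟩
  refine (hcd.congr (fun u hu => (hmain u hu.1 hu.2).2) (hmain u₀ hu₀H hu₀n).2).mono_of_mem_nhdsWithin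
    hVn

/-- Superposition with an analytic function is analytic. -/
theorem analyticAt_comp [CompleteSpace F] {f : E → F} {u₀ : Hol δ E} {C : Set E}
    (hf : AnalyticOnNhd ℝ f C) (hC : IsCompact C) (hu : ∀ y, u₀ y ∈ C) :
    (fun y => f (u₀ y)) ∈ holSubmodule δ F ∧ AnalyticAt ℝ (comp f) u₀ := by
  have hex : ∀ p, ∃ (R : ℝ≥0) (P : FormalMultilinearSeries ℝ E F), p ∈ C → 0 < R ∧
      HasFPowerSeriesOnBall f P p R := fun p => by
    by_cases hp : p ∈ C
    · obtain ⟨P, r, hP⟩ := hf p hp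
      obtain ⟨R, hR, hRr⟩ := ENNReal.lt_iff_exists_nnreal_btwn.mp hP.r_pos
      exact ⟨R, P, fun _ => ⟨by exact_mod_cast hR, hP.mono hR hRr.le⟩⟩
    · exact ⟨0, 0, fun h => absurd h hp⟩
  choose R P hR using hex
  -- Half of the radius of convergence is spent on the oscillation of u₀; the other half is left for
  -- the rescaled seminorm.
  obtain ⟨t, A, M, htC, hA, hloc⟩ := exists_localization f u₀ hC hu (r := fun p => R p / 2)
    fun p hp => by have := (hR p hp).1; positivity
  -- Finitely many pieces allow one common factor Λ that brings every rescaled seminorm below half a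
  -- radius.
  obtain ⟨Λ, hΛ, hΛt⟩ : ∃ Λ : ℝ≥0, 0 < Λ ∧ ∀ p ∈ t, ‖u₀‖ / Λ < R p / 2 := by
    have h1 : ∀ᶠ x : ℝ in atTop, ∀ p ∈ t, ‖u₀‖ / x < R p / 2 := by
      refine (Finset.eventually_all t).mpr fun p hp => ?_
      have := (hR p (htC p hp)).1
      exact (tendsto_const_nhds.div_atTop tendsto_id).eventually_lt_const (by positivity)
    obtain ⟨x, hx, hx0⟩ := (h1.and (eventually_gt_atTop 0)).exists
    exact ⟨⟨x, hx0.le⟩, hx0, hx⟩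
  have hball : ∀ p ∈ t, restrict (A p) hΛ u₀ ∈ Metric.eball (const _ p) (R p) := fun p hp => by
    have h := norm_restrict_sub_const_le (A p) hΛ u₀ (p := p) (a := R p / 2) (by positivity)
      fun y hy => (hA p y hy).le
    have h2 := hΛt p hp
    rw [Metric.mem_eball, edist_eq_enorm_sub, ← ofReal_norm, ← ENNReal.ofReal_coe_nnreal]
    exact (ENNReal.ofReal_lt_ofReal_iff (by exact_mod_cast (hR p (htC p hp)).1)).mpr (by linarith)
  have hmain : ∀ u : Hol δ E, (∀ p ∈ t, restrict (A p) hΛ u ∈ Metric.eball (const _ p) (R p)) →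
      (fun y => f (u y)) ∈ holSubmodule δ F ∧
        comp f u = ∑ p ∈ t, M Λ p (comp f (restrict (A p) hΛ u)) := fun u h =>
    hloc hΛ u fun p hp => comp_mem_of_mem_eball (hR p (htC p hp)).2 (h p hp)
  refine ⟨(hmain u₀ hball).1, ?_⟩
  have han : AnalyticAt ℝ (fun u => ∑ p ∈ t, M Λ p (comp f (restrict (A p) hΛ u))) u₀ := by
    refine Finset.analyticAt_fun_sum _ fun p hp => ?_
    refine ((M Λ p).analyticAt _).comp ?_
    exact AnalyticAt.fun_comp ((hasFPowerSeriesOnBall_comp (hR p (htC p hp)).2).analyticAt_of_mem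
      (hball p hp)) ((restrict (A p) hΛ).analyticAt u₀)
  refine han.congr ?_
  have hev : ∀ᶠ u in 𝓝 u₀, ∀ p ∈ t, restrict (A p) hΛ u ∈ Metric.eball (const _ p) (R p) :=
    (Finset.eventually_all t).mpr fun p hp =>
      (restrict (A p) hΛ).continuous.continuousAt.preimage_mem_nhds
        (Metric.isOpen_eball.mem_nhds (hball p hp))
  filter_upwards [hev] with u hu
  exact (hmain u hu).2.symm

end Hol

end SuperpositionRegularity

end

section

variable {m : ℕ}

/-! ### Polynomials of homogeneous degree at most two -/

/-- The exponent of `y_i`. -/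
def expT (i : Fin m) : (Fin m ⊕ Fin 2) →₀ ℕ := Finsupp.single (Sum.inl i) 1

/-- The exponent of `y_n ^ a * y_{n+1} ^ b`. -/
def expN (a b : ℕ) : (Fin m ⊕ Fin 2) →₀ ℕ :=
  Finsupp.single (Sum.inr 0) a + Finsupp.single (Sum.inr 1) b

theorem expN_inl (a b : ℕ) (i : Fin m) : expN a b (Sum.inl i) = 0 := by simp [expN]

theorem expN_zero (a b : ℕ) : (expN a b : (Fin m ⊕ Fin 2) →₀ ℕ) (Sum.inr 0) = a := by
  simp [expN]

theorem expN_one (a b : ℕ) : (expN a b : (Fin m ⊕ Fin 2) →₀ ℕ) (Sum.inr 1) = b := by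
  simp [expN]

theorem expT_inr (i : Fin m) (j : Fin 2) : expT i (Sum.inr j) = 0 := by simp [expT]

theorem expN_inj {a b a' b' : ℕ} :
    (expN a b : (Fin m ⊕ Fin 2) →₀ ℕ) = expN a' b' ↔ a = a' ∧ b = b' := by
  constructor
  · intro h
    have h0 := DFunLike.congr_fun h (Sum.inr 0)
    have h1 := DFunLike.congr_fun h (Sum.inr 1)
    rw [expN_zero, expN_zero] at h0
    rw [expN_one, expN_one] at h1
    exact ⟨h0, h1⟩
  · rintro ⟨rfl, rfl⟩; rfl

theorem expN_ne_expT (a b : ℕ) (i : Fin m) : expN a b ≠ expT i := by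
  intro h
  have h0 := DFunLike.congr_fun h (Sum.inl i)
  rw [expN_inl] at h0
  simp [expT] at h0

theorem expT_injective : Function.Injective (expT (m := m)) := fun i j h => by
  by_contra hij
  have h0 := DFunLike.congr_fun h (Sum.inl i)
  simp [expT, hij] at h0

/-- The exponents of homogeneous degree at most two. -/
theorem exponent_cases {β : (Fin m ⊕ Fin 2) →₀ ℕ}
    (h : (∑ i : Fin m, 2 * β (Sum.inl i)) + β (Sum.inr 0) + β (Sum.inr 1) ≤ 2) :
    (∃ i, β = expT i) ∨ β = expN (β (Sum.inr 0)) (β (Sum.inr 1)) := by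
  by_cases hz : ∀ i, β (Sum.inl i) = 0
  · right
    ext j
    rcases j with i | j
    · rw [hz, expN_inl]
    · fin_cases j
      · exact (expN_zero _ _).symm
      · exact (expN_one _ _).symm
  · left
    push Not at hz
    obtain ⟨i, hi⟩ := hz
    have h1 : ∑ j ∈ Finset.univ.erase i, 2 * β (Sum.inl j) + 2 * β (Sum.inl i)
        = ∑ j : Fin m, 2 * β (Sum.inl j) := Finset.sum_erase_add _ _ (Finset.mem_univ i)
    have h2 : 1 ≤ β (Sum.inl i) := Nat.one_le_iff_ne_zero.mpr hi
    have h3 : ∑ j ∈ Finset.univ.erase i, 2 * β (Sum.inl j) = 0 := by omega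
    refine ⟨i, ?_⟩
    ext j
    rcases j with j | j
    · by_cases hj : j = i
      · subst hj
        have : β (Sum.inl j) = 1 := by omega
        simp [expT, this]
      · have h4 := Finset.sum_eq_zero_iff.mp h3 j (by simp [hj])
        have : β (Sum.inl j) = 0 := by omega
        simp [expT, this, Ne.symm hj]
    · rw [expT_inr]
      fin_cases j <;> simp <;> omega

theorem eval_monomial_expT (i : Fin m) (c : ℝ) (y : Pt m) :
    MvPolynomial.eval (coords y) (MvPolynomial.monomial (expT i) c) = c * y.1 i := by
  simp [expT, MvPolynomial.eval_monomial, coords]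

theorem eval_monomial_expN (a b : ℕ) (c : ℝ) (y : Pt m) :
    MvPolynomial.eval (coords y) (MvPolynomial.monomial (expN a b) c) =
      c * (y.2.1 ^ a * y.2.2 ^ b) := by
  rw [MvPolynomial.eval_monomial, expN, Finsupp.prod_add_index' (by simp) (by simp [pow_add])]
  simp [coords]

/-- A polynomial of homogeneous degree at most two, written out. -/
theorem pev_eq {p : Poly m} (hp : HomDegLE 2 p) (y : Pt m) :
    pev p y = p.coeff (expN 0 0) + ∑ i, p.coeff (expT i) * y.1 i + p.coeff (expN 1 0) * y.2.1
      + p.coeff (expN 0 1) * y.2.2 + p.coeff (expN 2 0) * y.2.1 ^ 2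
      + p.coeff (expN 1 1) * (y.2.1 * y.2.2) + p.coeff (expN 0 2) * y.2.2 ^ 2 := by
  classical
  set T : Finset ((Fin m ⊕ Fin 2) →₀ ℕ) := insert (expN 0 0) (insert (expN 1 0) (insert (expN 0 1)
    (insert (expN 2 0) (insert (expN 1 1) (insert (expN 0 2) (Finset.univ.image expT)))))) with hT
  have hsub : p.support ⊆ T := fun β hβ => by
    have hβ' := hp β (MvPolynomial.mem_support_iff.mp hβ)
    rcases exponent_cases hβ' with ⟨i, rfl⟩ | h
    · simp [hT]
    · have h2 : β (Sum.inr 0) + β (Sum.inr 1) ≤ 2 := by omega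
      have h3 : (β (Sum.inr 0) = 0 ∧ β (Sum.inr 1) = 0) ∨ (β (Sum.inr 0) = 1 ∧ β (Sum.inr 1) = 0)
        ∨ (β (Sum.inr 0) = 0 ∧ β (Sum.inr 1) = 1) ∨ (β (Sum.inr 0) = 2 ∧ β (Sum.inr 1) = 0)
        ∨ (β (Sum.inr 0) = 1 ∧ β (Sum.inr 1) = 1) ∨ (β (Sum.inr 0) = 0 ∧ β (Sum.inr 1) = 2) := by
        omega
      rw [h, hT]
      rcases h3 with h3 | h3 | h3 | h3 | h3 | h3 <;> simp [h3.1, h3.2]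
  have hp2 : p = ∑ β ∈ T, MvPolynomial.monomial β (p.coeff β) := by
    conv_lhs => rw [MvPolynomial.as_sum p]
    exact Finset.sum_subset hsub fun β _ h => by
      rw [MvPolynomial.notMem_support_iff.mp h, MvPolynomial.monomial_zero]
  have hne := fun (a b : ℕ) (i : Fin m) => (expN_ne_expT a b i).symm
  unfold pev
  conv_lhs => rw [hp2]
  rw [map_sum, hT, Finset.sum_insert (by simp [expN_inj, hne]),
    Finset.sum_insert (by simp [expN_inj, hne]), Finset.sum_insert (by simp [expN_inj, hne]),
    Finset.sum_insert (by simp [expN_inj, hne]), Finset.sum_insert (by simp [expN_inj, hne]),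
    Finset.sum_insert (by simp [hne]), Finset.sum_image (by intro i _ j _ h; exact expT_injective h)]
  simp only [eval_monomial_expN, eval_monomial_expT]
  ring

/-- A polynomial of homogeneous degree at most two vanishes as soon as its coefficients of degree at
most two do. -/
theorem eq_zero_of_coeff {p : Poly m} (hp : HomDegLE 2 p) (h0 : p.coeff (expN 0 0) = 0)
    (hT : ∀ i, p.coeff (expT i) = 0) (h1 : p.coeff (expN 1 0) = 0) (h2 : p.coeff (expN 0 1) = 0)
    (h3 : p.coeff (expN 2 0) = 0) (h4 : p.coeff (expN 1 1) = 0) (h5 : p.coeff (expN 0 2) = 0) :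
    p = 0 := by
  refine MvPolynomial.ext _ _ fun β => ?_
  rw [MvPolynomial.coeff_zero]
  by_contra hβ
  have hβ' := hp β hβ
  rcases exponent_cases hβ' with ⟨i, rfl⟩ | h
  · exact hβ (hT i)
  · have h3 : (β (Sum.inr 0) = 0 ∧ β (Sum.inr 1) = 0) ∨ (β (Sum.inr 0) = 1 ∧ β (Sum.inr 1) = 0)
      ∨ (β (Sum.inr 0) = 0 ∧ β (Sum.inr 1) = 1) ∨ (β (Sum.inr 0) = 2 ∧ β (Sum.inr 1) = 0)
      ∨ (β (Sum.inr 0) = 1 ∧ β (Sum.inr 1) = 1) ∨ (β (Sum.inr 0) = 0 ∧ β (Sum.inr 1) = 2) := by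
      omega
    rw [h] at hβ
    rcases h3 with h3 | h3 | h3 | h3 | h3 | h3 <;> rw [h3.1, h3.2] at hβ <;> exact hβ ‹_›

theorem abs_coeff_le (p : Poly m) (β : (Fin m ⊕ Fin 2) →₀ ℕ) : |p.coeff β| ≤ coeffNorm p := by
  by_cases h : β ∈ p.support
  · exact Finset.single_le_sum (f := fun β => |p.coeff β|) (fun _ _ => abs_nonneg _) h
  · rw [MvPolynomial.notMem_support_iff.mp h, abs_zero]
    exact Finset.sum_nonneg fun _ _ => abs_nonneg _

theorem sum_abs_coeff_expT_le (p : Poly m) : ∑ i, |p.coeff (expT i)| ≤ coeffNorm p := by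
  classical
  calc ∑ i, |p.coeff (expT i)| = ∑ β ∈ Finset.univ.image expT, |p.coeff β| :=
        (Finset.sum_image (f := fun β => |p.coeff β|) fun i _ j _ h => expT_injective h).symm
    _ ≤ ∑ β ∈ p.support ∪ Finset.univ.image expT, |p.coeff β| :=
        Finset.sum_le_sum_of_subset_of_nonneg Finset.subset_union_right
          fun _ _ _ => abs_nonneg _
    _ = coeffNorm p := (coeffNorm_eq Finset.subset_union_left).symm

/-! ### Uniqueness of approximating polynomials -/

/-- The coefficients are peeled off in order: let t tend to 0, divide by t, and repeat. The exponent
a exceeds 2, so some positive power remains on the right each time. -/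
theorem eq_zero_of_quadratic_le {K₀ K₁ K₂ C a t₀ : ℝ} (ha : 2 < a) (ht₀ : 0 < t₀)
    (h : ∀ t, 0 < t → t < t₀ → |K₀ + K₁ * t + K₂ * t ^ 2| ≤ C * t ^ a) :
    K₀ = 0 ∧ K₁ = 0 ∧ K₂ = 0 := by
  have hev : ∀ᶠ t : ℝ in 𝓝[>] 0, 0 < t ∧ t < t₀ := by
    filter_upwards [Ioo_mem_nhdsGT ht₀] with t ht using ht
  have hpow : ∀ b : ℝ, 0 < b → Tendsto (fun t : ℝ => C * t ^ b) (𝓝[>] 0) (𝓝 0) := fun b hb => by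
    have hc : Continuous fun t : ℝ => C * t ^ b :=
      continuous_const.mul (continuous_id.rpow_const fun _ => Or.inr hb.le)
    have := (hc.tendsto 0).mono_left (nhdsWithin_le_nhds (s := Ioi 0))
    simpa [Real.zero_rpow hb.ne'] using this
  have hz : ∀ (f : ℝ → ℝ) (b c : ℝ), 0 < b → Continuous f → f 0 = c →
      (∀ t, 0 < t → t < t₀ → |f t| ≤ C * t ^ b) → c = 0 := by
    intro f b c hb hf h0 hle
    have h1 : Tendsto f (𝓝[>] 0) (𝓝 c) := h0 ▸ (hf.tendsto 0).mono_left nhdsWithin_le_nhds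
    have h2 : Tendsto f (𝓝[>] 0) (𝓝 0) :=
      squeeze_zero_norm' (hev.mono fun t ht => hle t ht.1 ht.2) (hpow b hb)
    exact tendsto_nhds_unique h1 h2
  have hdiv : ∀ (f : ℝ → ℝ) (b : ℝ) (n : ℕ),
      (∀ t, 0 < t → t < t₀ → |f t * t ^ n| ≤ C * t ^ b) →
      ∀ t, 0 < t → t < t₀ → |f t| ≤ C * t ^ (b - n) := by
    intro f b n hf t ht ht1
    have h1 := hf t ht ht1
    rw [abs_mul, abs_of_pos (pow_pos ht n)] at h1
    rw [Real.rpow_sub ht, Real.rpow_natCast, ← mul_div_assoc, le_div_iff₀ (pow_pos ht n)]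
    exact h1
  have h0 : K₀ = 0 := hz _ a K₀ (by linarith) (by fun_prop) (by simp) h
  subst h0
  have h1 : K₁ = 0 := hz (fun t => K₁ + K₂ * t) (a - (1 : ℕ)) K₁ (by push_cast; linarith)
    (by fun_prop) (by simp) (hdiv _ a 1 fun t ht ht1 => by
      have := h t ht ht1
      rwa [show (K₁ + K₂ * t) * t ^ 1 = 0 + K₁ * t + K₂ * t ^ 2 by ring])
  subst h1
  refine ⟨rfl, rfl, hz (fun _ => K₂) (a - (2 : ℕ)) K₂ (by push_cast; linarith)
    (by fun_prop) rfl (hdiv _ a 2 fun t ht ht1 => ?_)⟩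
  have := h t ht ht1
  rwa [show K₂ * t ^ 2 = 0 + 0 * t + K₂ * t ^ 2 by ring]

/-- A polynomial in `𝒫_2` that is of higher order at a point of `P` is zero. -/
theorem eq_zero_of_abs_pev_le {p : Poly m} (hp : HomDegLE 2 p) {b : Pt m} (hb : b ∈ edge m)
    {C a : ℝ} (ha : 2 < a)
    (h : ∀ y ∈ dom m, dG y b ≤ 1 → |pev p y| ≤ C * dG y b ^ a) : p = 0 := by
  have hdb : dG b 0 < 1 := hb.1.1
  -- Along the curve t ↦ (b'' + t² x, t u, t w) the distance to b is at most K t, and a polynomial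
  -- in 𝒫_2 becomes an ordinary quadratic in t.
  have key : ∀ (x : EuclideanSpace ℝ (Fin m)) (u w : ℝ), 0 < u → 0 < w →
      p.coeff (expN 0 0) + ∑ i, p.coeff (expT i) * b.1 i = 0 ∧
      p.coeff (expN 1 0) * u + p.coeff (expN 0 1) * w = 0 ∧
      ∑ i, p.coeff (expT i) * x i + p.coeff (expN 2 0) * u ^ 2
        + p.coeff (expN 1 1) * (u * w) + p.coeff (expN 0 2) * w ^ 2 = 0 := by
    intro x u w hu hw
    set K := u + w + 3 * √‖x‖ with hK
    have hK0 : 0 < K := by positivity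
    set t₀ := min ((1 - dG b 0) / K) (1 / (50 * K)) with ht₀
    have ht₀' : 0 < t₀ := lt_min (div_pos (by linarith) hK0) (by positivity)
    refine eq_zero_of_quadratic_le (C := |C| * K ^ a) ha ht₀' fun t ht htt => ?_
    have h1 : t * K < 1 - dG b 0 := (lt_div_iff₀ hK0).mp (htt.trans_le (min_le_left _ _))
    have h2 : t * K < 1 / 50 := by
      have := htt.trans_le (min_le_right _ _)
      rw [lt_div_iff₀ (by positivity)] at this
      linarith
    have hs : 3 * √‖t ^ 2 • x‖ = t * (3 * √‖x‖) := by
      rw [norm_smul, Real.sqrt_mul (norm_nonneg _), Real.norm_eq_abs, abs_of_nonneg (sq_nonneg t),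
        Real.sqrt_sq ht.le]
      ring
    have hx0 := Real.sqrt_nonneg ‖x‖
    have hm : ((b.1 + t ^ 2 • x, t * u, t * w) : Pt m) ∈ dom m := by
      refine shift_mem_dom hb ?_ (by positivity) (by positivity) ?_ ?_
      · rw [hs]; nlinarith
      · nlinarith
      · nlinarith
    have hd : dG ((b.1 + t ^ 2 • x, t * u, t * w) : Pt m) b ≤ t * K := by
      refine (dG_shift_le hb _ (by positivity) (by positivity)).trans ?_
      rw [hs, hK]; apply le_of_eq; ring
    have h3 := h _ hm (by linarith)
    rw [pev_eq hp] at h3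
    have h4 : C * dG ((b.1 + t ^ 2 • x, t * u, t * w) : Pt m) b ^ a ≤ |C| * K ^ a * t ^ a := by
      have h5 := Real.rpow_le_rpow (dG_nonneg _ _) hd (z := a) (by linarith)
      rw [Real.mul_rpow ht.le hK0.le] at h5
      calc _ ≤ |C| * dG ((b.1 + t ^ 2 • x, t * u, t * w) : Pt m) b ^ a :=
            mul_le_mul_of_nonneg_right (le_abs_self C) (Real.rpow_nonneg (dG_nonneg _ _) _)
        _ ≤ |C| * (t ^ a * K ^ a) := mul_le_mul_of_nonneg_left h5 (abs_nonneg _)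
        _ = _ := by ring
    refine le_trans (le_of_eq ?_) (h3.trans h4)
    congr 1
    simp only [PiLp.add_apply, PiLp.smul_apply, smul_eq_mul, mul_add, Finset.sum_add_distrib]
    rw [show ∑ i, p.coeff (expT i) * (t ^ 2 * x i) = t ^ 2 * ∑ i, p.coeff (expT i) * x i by
      rw [Finset.mul_sum]; exact Finset.sum_congr rfl fun i _ => by ring]
    ring
  -- The normal directions (1,1), (1,2), (1,3) form an invertible Vandermonde system for the three
  -- quadratic coefficients, and the first two already separate the linear ones. Tangential unit
  -- vectors give the rest.
  obtain ⟨k0, l1, q1⟩ := key 0 1 1 one_pos one_pos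
  obtain ⟨-, l2, q2⟩ := key 0 1 2 one_pos two_pos
  obtain ⟨-, -, q3⟩ := key 0 1 3 one_pos (by norm_num)
  simp only [PiLp.zero_apply, mul_zero, Finset.sum_const_zero, zero_add] at q1 q2 q3
  have hA : p.coeff (expN 2 0) = 0 := by linarith
  have hB : p.coeff (expN 1 1) = 0 := by linarith
  have hD : p.coeff (expN 0 2) = 0 := by linarith
  have hT : ∀ i, p.coeff (expT i) = 0 := fun i => by
    obtain ⟨-, -, q4⟩ := key (EuclideanSpace.single i 1) 1 1 one_pos one_pos
    simpa [hA, hB, hD, Finset.sum_ite_eq'] using q4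
  refine eq_zero_of_coeff hp ?_ hT (by linarith) (by linarith) hA hB hD
  simpa [hT] using k0

/-- The difference of two approximating polynomials is of order 2 + 2α > 2, hence zero. It follows
that the polynomial depends linearly on v and that the infimum in the norm of X is attained at a
single family. -/
theorem isApprox_unique {α : ℝ} (hα : 0 < α) {u : Pt m → ℝ} {b : Pt m} (hb : b ∈ edge m)
    {p q : Poly m} (hp : IsApprox 2 α u b p) (hq : IsApprox 2 α u b q) : p = q := by
  have h := isApprox_comb (w := fun _ => 0) 1 (-1) (fun y _ => by ring) hp hq
  obtain ⟨hd, C, hC⟩ := h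
  have := eq_zero_of_abs_pev_le hd hb (C := C) (a := ((2 : ℕ) : ℝ) + 2 * α)
    (by push_cast; linarith) fun y hy h1 => by simpa using hC y hy h1
  have h2 : p - q = 0 := by rw [← this]; module
  exact sub_eq_zero.mp h2

end

section

variable {m : ℕ}

/-! ### Partial derivatives -/

theorem pd_congr {u v : Pt m → ℝ} {y : Pt m} (h : u =ᶠ[𝓝 y] v) (e : Pt m) : pd e u y = pd e v y := by
  unfold pd; rw [h.fderiv_eq]

theorem pd_sub {u v : Pt m → ℝ} {y : Pt m} (e : Pt m) (hu : DifferentiableAt ℝ u y)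
    (hv : DifferentiableAt ℝ v y) : pd e (fun z => u z - v z) y = pd e u y - pd e v y := by
  unfold pd; rw [fderiv_fun_sub hu hv]; rfl

theorem pd_mul {u v : Pt m → ℝ} {y : Pt m} (e : Pt m) (hu : DifferentiableAt ℝ u y)
    (hv : DifferentiableAt ℝ v y) :
    pd e (fun z => u z * v z) y = u y * pd e v y + v y * pd e u y := by
  unfold pd; rw [fderiv_fun_mul hu hv]; rfl

theorem pd_of_hasFDerivAt {u : Pt m → ℝ} {y : Pt m} {L : Pt m →L[ℝ] ℝ} (h : HasFDerivAt u L y)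
    (e : Pt m) : pd e u y = L e := by unfold pd; rw [h.fderiv]

theorem hasFDerivAt_n (y : Pt m) : HasFDerivAt (fun z : Pt m => z.2.1) coN y := coN.hasFDerivAt

theorem hasFDerivAt_l (y : Pt m) : HasFDerivAt (fun z : Pt m => z.2.2) coL y := coL.hasFDerivAt

/-- The `i`-th tangential coordinate. -/
def coT (i : Fin m) : Pt m →L[ℝ] ℝ :=
  (EuclideanSpace.proj i).comp (ContinuousLinearMap.fst ℝ _ _)

theorem coT_apply (i : Fin m) (y : Pt m) : coT i y = y.1 i := rfl

theorem hasFDerivAt_t (i : Fin m) (y : Pt m) : HasFDerivAt (fun z : Pt m => z.1 i) (coT i) y :=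
  (coT i).hasFDerivAt

theorem pd_rpow {y : Pt m} (hy : 0 < y.2.1) (c : ℝ) (e : Pt m) :
    pd e (fun z : Pt m => z.2.1 ^ c) y = c * y.2.1 ^ (c - 1) * e.2.1 := by
  rw [pd_of_hasFDerivAt ((hasFDerivAt_n y).rpow_const (Or.inl hy.ne'))]
  rfl

theorem pd_rpow_l {y : Pt m} (hy : 0 < y.2.2) (c : ℝ) (e : Pt m) :
    pd e (fun z : Pt m => z.2.2 ^ c) y = c * y.2.2 ^ (c - 1) * e.2.2 := by
  rw [pd_of_hasFDerivAt ((hasFDerivAt_l y).rpow_const (Or.inl hy.ne'))]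
  rfl

theorem differentiable_pev (p : Poly m) : Differentiable ℝ (pev p) :=
  (contDiff_pev p).differentiable (by norm_num)

theorem pd_pev {p : Poly m} (hp : HomDegLE 2 p) (e y : Pt m) :
    pd e (pev p) y = ∑ i, p.coeff (expT i) * e.1 i
      + (p.coeff (expN 1 0) + 2 * p.coeff (expN 2 0) * y.2.1 + p.coeff (expN 1 1) * y.2.2) * e.2.1
      + (p.coeff (expN 0 1) + p.coeff (expN 1 1) * y.2.1 + 2 * p.coeff (expN 0 2) * y.2.2) * e.2.2 := by
  have hf : pev p = fun y : Pt m => p.coeff (expN 0 0) + ∑ i, p.coeff (expT i) * y.1 i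
      + p.coeff (expN 1 0) * y.2.1 + p.coeff (expN 0 1) * y.2.2 + p.coeff (expN 2 0) * y.2.1 ^ 2
      + p.coeff (expN 1 1) * (y.2.1 * y.2.2) + p.coeff (expN 0 2) * y.2.2 ^ 2 := funext (pev_eq hp)
  have hn := hasFDerivAt_n y
  have hl := hasFDerivAt_l y
  have h := (((((((hasFDerivAt_const (p.coeff (expN 0 0)) y).fun_add
    (HasFDerivAt.fun_sum (u := Finset.univ)
      fun i _ => (hasFDerivAt_t i y).const_mul (p.coeff (expT i)))).fun_add
    (hn.const_mul (p.coeff (expN 1 0)))).fun_add (hl.const_mul (p.coeff (expN 0 1)))).fun_add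
    ((HasFDerivAt.fun_pow' hn 2).const_mul (p.coeff (expN 2 0)))).fun_add
    ((hn.fun_mul hl).const_mul (p.coeff (expN 1 1)))).fun_add
    ((HasFDerivAt.fun_pow' hl 2).const_mul (p.coeff (expN 0 2))))
  rw [hf, pd_of_hasFDerivAt h]
  simp [coN_apply, coL_apply, coT_apply, Finset.sum_range_succ]
  ring

/-! ### An elementary inequality -/

/-- After scaling to t = b/a this combines 1 - t^γ ≤ 4(1 - t), which is Bernoulli's inequality if γ
≥ 1, with 1 - t ≤ (1 - t)^ε. It moves a power of the distance in or out of a Hölder difference. -/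
theorem rpow_mul_rpow_sub_le {a b ε γ : ℝ} (hb : 0 ≤ b) (hba : b ≤ a) (hε : 0 < ε) (hε1 : ε ≤ 1)
    (hγ : 0 < γ) (hγ4 : γ ≤ 4) : b ^ ε * (a ^ γ - b ^ γ) ≤ 4 * a ^ γ * (a - b) ^ ε := by
  rcases (hb.trans hba).eq_or_lt with ha | ha
  · subst ha
    have : b = 0 := le_antisymm hba hb
    subst this
    simp [Real.zero_rpow hγ.ne']
  set t := b / a with ht
  have ht0 : 0 ≤ t := by positivity
  have ht1 : t ≤ 1 := (div_le_one ha).mpr hba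
  have hbt : b = a * t := by rw [ht]; field_simp
  have h1 : 1 - t ^ γ ≤ 4 * (1 - t) := by
    rcases le_total γ 1 with h | h
    · have := Real.rpow_le_rpow_of_exponent_ge' ht0 ht1 hγ.le h
      rw [Real.rpow_one] at this
      linarith
    · have := one_add_mul_self_le_rpow_one_add (s := t - 1) (by linarith) h
      rw [show 1 + (t - 1) = t by ring] at this
      nlinarith
  have h2 : 1 - t ≤ (1 - t) ^ ε := by
    simpa using Real.rpow_le_rpow_of_exponent_ge' (by linarith : 0 ≤ 1 - t) (by linarith) hε.le hε1
  have h3 : a - b = a * (1 - t) := by rw [hbt]; ring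
  rw [h3, Real.mul_rpow ha.le (by linarith), hbt, Real.mul_rpow ha.le ht0, Real.mul_rpow ha.le ht0]
  have h4 : t ^ ε ≤ 1 := Real.rpow_le_one ht0 ht1 hε.le
  have hA := Real.rpow_nonneg ha.le ε
  have hG := Real.rpow_nonneg ha.le γ
  have h5 : 0 ≤ 1 - t ^ γ := by linarith [Real.rpow_le_one ht0 ht1 hγ.le]
  calc a ^ ε * t ^ ε * (a ^ γ - a ^ γ * t ^ γ) = a ^ ε * a ^ γ * (t ^ ε * (1 - t ^ γ)) := by ring
    _ ≤ a ^ ε * a ^ γ * (1 * (4 * (1 - t) ^ ε)) := by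
        gcongr
        linarith
    _ = _ := by ring

/-! ### Weighted Hölder bounds and vanishing at a point of `P` -/

theorem holder_le_of_holderSemi_le {ε N : ℝ} {w : Pt m → ℝ} (hN : 0 ≤ N)
    (h : holderSemi ε w ≤ ENNReal.ofReal N) {y z : Pt m} (hy : y ∈ dom m) (hz : z ∈ dom m) :
    |w y - w z| ≤ N * dG y z ^ ε := by
  rcases eq_or_ne y z with rfl | hne
  · rw [sub_self, abs_zero]
    exact mul_nonneg hN (Real.rpow_nonneg (dG_nonneg _ _) _)
  have h1 := (le_holderSemi (ε := ε) (u := w) hy hz).trans h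
  have h2 : ENNReal.ofReal (dG y z ^ ε) ≠ 0 := by
    simpa using Real.rpow_pos_of_pos (dG_pos hne) ε
  rw [ENNReal.div_le_iff_le_mul (Or.inl h2) (Or.inl ENNReal.ofReal_ne_top),
    ← ENNReal.ofReal_mul hN, ENNReal.ofReal_le_ofReal_iff
      (mul_nonneg hN (Real.rpow_nonneg (dG_nonneg _ _) _))] at h1
  exact h1

theorem holderSemi_le_of {ε N : ℝ} {w : Pt m → ℝ}
    (h : ∀ y ∈ dom m, ∀ z ∈ dom m, |w y - w z| ≤ N * dG y z ^ ε) :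
    holderSemi ε w ≤ ENNReal.ofReal N := by
  refine iSup₂_le fun y hy => iSup₂_le fun z hz => ?_
  rcases eq_or_ne y z with rfl | hne
  · simp
  have h2 : 0 < dG y z ^ ε := Real.rpow_pos_of_pos (dG_pos hne) ε
  rw [← ENNReal.ofReal_div_of_pos h2]
  exact ENNReal.ofReal_le_ofReal ((div_le_iff₀ h2).mpr (h y hy z hz))

/-- `T` is of order `γ + ε` at `b`, with the corresponding weighted Hölder bound. -/
structure WeightedHolder (ε : ℝ) (b : Pt m) (γ N : ℝ) (T : Pt m → ℝ) : Prop where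
  bound : ∀ y ∈ dom m, |T y| ≤ N * dG y b ^ (γ + ε)
  holder : ∀ y ∈ dom m, ∀ z ∈ dom m,
    |T y - T z| ≤ 5 * N * dG y z ^ ε * max (dG y b) (dG z b) ^ γ

/-- There are points arbitrarily close to `b` at which `w` is arbitrarily small. -/
def SmallNear (b : Pt m) (w : Pt m → ℝ) : Prop :=
  ∀ η : ℝ, 0 < η → ∃ z ∈ dom m, dG z b < η ∧ |w z| < η

/-- Compare w at y with its value at a point z near b where w is small, and let z tend to b. A
Hölder bound alone would leave a constant undetermined. -/
theorem abs_le_of_smallNear {ε N : ℝ} (hε : 0 < ε) (hN : 0 ≤ N) {b : Pt m} {w : Pt m → ℝ}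
    (h : ∀ y ∈ dom m, ∀ z ∈ dom m, |w y - w z| ≤ N * dG y z ^ ε) (hs : SmallNear b w)
    {y : Pt m} (hy : y ∈ dom m) : |w y| ≤ N * dG y b ^ ε := by
  have hlim : Tendsto (fun η : ℝ => η + N * (dG y b + η) ^ ε) (𝓝[>] 0) (𝓝 (N * dG y b ^ ε)) := by
    have hc : Continuous fun η : ℝ => η + N * (dG y b + η) ^ ε :=
      continuous_id.add (continuous_const.mul
        ((continuous_const.add continuous_id).rpow_const fun _ => Or.inr hε.le))
    have := (hc.tendsto 0).mono_left (nhdsWithin_le_nhds (s := Ioi 0))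
    simpa using this
  refine ge_of_tendsto hlim ?_
  filter_upwards [self_mem_nhdsWithin] with η hη
  obtain ⟨z, hz, hd, hw⟩ := hs η hη
  have h1 := h y hy z hz
  have h2 : dG y z ≤ dG y b + η := by
    have := dG_triangle y b z
    rw [dG_comm b z] at this
    linarith
  have h3 := Real.rpow_le_rpow (dG_nonneg _ _) h2 hε.le
  have h4 : |w y| ≤ |w z| + |w y - w z| := by
    have := abs_add_le (w z) (w y - w z)
    rwa [add_sub_cancel] at this
  nlinarith [mul_le_mul_of_nonneg_left h3 hN]

theorem abs_dG_sub_le (y z b : Pt m) : |dG y b - dG z b| ≤ dG y z := by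
  rw [abs_le]
  have h1 := dG_triangle y z b
  have h2 := dG_triangle z y b
  rw [dG_comm z y] at h2
  constructor <;> linarith

/-- With T = d^γ w, the difference of T consists of d^γ times the difference of w and w times the
difference of d^γ. The second part is at most four times the bound of the first, which explains the
factor 5 in `WeightedHolder`. -/
theorem WeightedHolder.of_smallNear {ε γ N : ℝ} (hε : 0 < ε) (hε1 : ε ≤ 1) (hγ : 0 < γ)
    (hγ4 : γ ≤ 4) (hN : 0 ≤ N) {b : Pt m} (hb : b ∈ edge m) {T w : Pt m → ℝ}
    (hw : ∀ y ∈ dom m, w y = dG y b ^ (-γ) * T y)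
    (h : holderSemi ε w ≤ ENNReal.ofReal N) (hs : SmallNear b w) : WeightedHolder ε b γ N T := by
  have hh : ∀ y ∈ dom m, ∀ z ∈ dom m, |w y - w z| ≤ N * dG y z ^ ε := fun y hy z hz =>
    holder_le_of_holderSemi_le hN h hy hz
  have hv : ∀ y ∈ dom m, |w y| ≤ N * dG y b ^ ε := fun y hy => abs_le_of_smallNear hε hN hh hs hy
  have hT : ∀ y ∈ dom m, T y = dG y b ^ γ * w y := fun y hy => by
    have := dG_edge_pos hy hb
    rw [hw y hy, ← mul_assoc, ← Real.rpow_add this]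
    simp
  refine ⟨fun y hy => ?_, ?_⟩
  · have hd := dG_edge_pos hy hb
    rw [hT y hy, abs_mul, abs_of_pos (Real.rpow_pos_of_pos hd _), Real.rpow_add hd]
    calc _ ≤ dG y b ^ γ * (N * dG y b ^ ε) :=
          mul_le_mul_of_nonneg_left (hv y hy) (Real.rpow_nonneg hd.le _)
      _ = _ := by ring
  · have main : ∀ y ∈ dom m, ∀ z ∈ dom m, dG z b ≤ dG y b →
        |T y - T z| ≤ 5 * N * dG y z ^ ε * max (dG y b) (dG z b) ^ γ := by
      intro y hy z hz hle
      rw [max_eq_left hle]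
      have hdz := dG_edge_pos hz hb
      have hd := dG_edge_pos hy hb
      have e1 : T y - T z = dG y b ^ γ * (w y - w z) + (dG y b ^ γ - dG z b ^ γ) * w z := by
        rw [hT y hy, hT z hz]; ring
      have h0 : 0 ≤ dG y b ^ γ - dG z b ^ γ := sub_nonneg.mpr (Real.rpow_le_rpow hdz.le hle hγ.le)
      have h1 := rpow_mul_rpow_sub_le hdz.le hle hε hε1 hγ hγ4
      have h2 : (dG y b - dG z b) ^ ε ≤ dG y z ^ ε := Real.rpow_le_rpow (sub_nonneg.mpr hle)
        ((le_abs_self _).trans (abs_dG_sub_le y z b)) hε.le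
      have hp := Real.rpow_nonneg hd.le γ
      calc |T y - T z| ≤ dG y b ^ γ * |w y - w z| + (dG y b ^ γ - dG z b ^ γ) * |w z| := by
            rw [e1]
            refine (abs_add_le _ _).trans (le_of_eq ?_)
            rw [abs_mul, abs_mul, abs_of_nonneg hp, abs_of_nonneg h0]
        _ ≤ dG y b ^ γ * (N * dG y z ^ ε) + (dG y b ^ γ - dG z b ^ γ) * (N * dG z b ^ ε) :=
            add_le_add (mul_le_mul_of_nonneg_left (hh y hy z hz) hp)
              (mul_le_mul_of_nonneg_left (hv z hz) h0)
        _ = dG y b ^ γ * (N * dG y z ^ ε) + N * (dG z b ^ ε * (dG y b ^ γ - dG z b ^ γ)) := by ring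
        _ ≤ dG y b ^ γ * (N * dG y z ^ ε) + N * (4 * dG y b ^ γ * dG y z ^ ε) := by
            have := h1.trans (mul_le_mul_of_nonneg_left h2 (by positivity))
            have := mul_le_mul_of_nonneg_left this hN
            linarith
        _ = _ := by ring
    intro y hy z hz
    rcases le_total (dG z b) (dG y b) with hle | hle
    · exact main y hy z hz hle
    · rw [abs_sub_comm, dG_comm y z, max_comm]
      exact main z hz y hy hle

/-! ### Boxes at the points of `P` -/

/-- A box at scale `t` above the point `b` of `P`. -/
def box (b : Pt m) (t : ℝ) : Set (Pt m) :=
  {y | ‖y.1 - b.1‖ ≤ t ^ 2 ∧ y.2.1 ∈ Icc t (2 * t) ∧ y.2.2 ∈ Icc t (2 * t)}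

/-- The scales at which the boxes are contained in the domain. -/
def boxScale (b : Pt m) : ℝ := (1 - dG b 0) / 100

theorem boxScale_pos {b : Pt m} (hb : b ∈ edge m) : 0 < boxScale b := by
  have : dG b 0 < 1 := hb.1.1
  unfold boxScale; linarith

theorem mem_dom_of_box {b : Pt m} (hb : b ∈ edge m) {t : ℝ} (ht : 0 < t) (ht1 : t ≤ boxScale b)
    {y : Pt m} (hy : y ∈ box b t) : y ∈ dom m := by
  obtain ⟨h1, h2, h3⟩ := hy
  have h4 : √‖y.1 - b.1‖ ≤ t := Real.sqrt_le_iff.mpr ⟨ht.le, h1⟩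
  have h5 := dG_nonneg b 0
  unfold boxScale at ht1
  have := shift_mem_dom hb (x := y.1 - b.1) (p := y.2.1) (q := y.2.2) (by linarith)
    (by linarith [h2.1]) (by linarith [h3.1]) (by linarith [h2.2]) (by linarith [h3.2])
  rwa [add_sub_cancel] at this

theorem dG_box_le {b : Pt m} (hb : b ∈ edge m) {t : ℝ} (ht : 0 < t) {y : Pt m}
    (hy : y ∈ box b t) : dG y b ≤ 7 * t := by
  obtain ⟨h1, h2, h3⟩ := hy
  have h4 : √‖y.1 - b.1‖ ≤ t := Real.sqrt_le_iff.mpr ⟨ht.le, h1⟩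
  have := dG_shift_le hb (y.1 - b.1) (p := y.2.1) (q := y.2.2) (by linarith [h2.1])
    (by linarith [h3.1])
  rw [add_sub_cancel] at this
  linarith [h2.2, h3.2]

theorem le_dG_box {b : Pt m} (hb : b ∈ edge m) {t : ℝ} {y : Pt m} (hy : y ∈ box b t) :
    t ≤ dG y b :=
  (hy.2.1.1.trans (le_abs_self _)).trans
    ((abs_n_le_rho y).trans (rho_le_dG y (rho_of_mem_edge hb)))

/-- `φ` is of order `β` on the boxes at `b`. -/
def BoxOrder (b : Pt m) (β : ℝ) (φ : Pt m → ℝ) : Prop :=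
  ∃ C : ℝ, 0 ≤ C ∧ ∀ t, 0 < t → t ≤ boxScale b → ∀ y ∈ box b t, |φ y| ≤ C * t ^ β

theorem BoxOrder.of_le_dG {b : Pt m} (hb : b ∈ edge m) {β C : ℝ} (hC : 0 ≤ C) {φ : Pt m → ℝ}
    (h : ∀ y ∈ dom m, |φ y| ≤ C * dG y b ^ β) : BoxOrder b β φ := by
  refine ⟨C * max (7 ^ β) 1, by positivity, fun t ht ht1 y hy => ?_⟩
  refine (h y (mem_dom_of_box hb ht ht1 hy)).trans ?_
  rw [mul_assoc]
  refine mul_le_mul_of_nonneg_left ?_ hC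
  have h1 := dG_box_le hb ht hy
  have h2 := le_dG_box hb hy
  rcases le_total 0 β with h0 | h0
  · calc dG y b ^ β ≤ (7 * t) ^ β := Real.rpow_le_rpow (dG_nonneg _ _) h1 h0
      _ = 7 ^ β * t ^ β := Real.mul_rpow (by norm_num) ht.le
      _ ≤ _ := by gcongr; exact le_max_left _ _
  · calc dG y b ^ β ≤ t ^ β := Real.rpow_le_rpow_of_nonpos ht h2 h0
      _ = 1 * t ^ β := by ring
      _ ≤ _ := by gcongr; exact le_max_right _ _

theorem BoxOrder.mul {b : Pt m} {β γ : ℝ} {φ ψ : Pt m → ℝ} (h1 : BoxOrder b β φ)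
    (h2 : BoxOrder b γ ψ) : BoxOrder b (β + γ) (fun y => φ y * ψ y) := by
  obtain ⟨C, hC, h1⟩ := h1
  obtain ⟨D, hD, h2⟩ := h2
  refine ⟨C * D, by positivity, fun t ht ht1 y hy => ?_⟩
  rw [abs_mul, Real.rpow_add ht]
  calc |φ y| * |ψ y| ≤ (C * t ^ β) * (D * t ^ γ) :=
        mul_le_mul (h1 t ht ht1 y hy) (h2 t ht ht1 y hy) (abs_nonneg _) (by positivity)
    _ = _ := by ring

theorem BoxOrder.rpow_of_Icc {b : Pt m} (c : ℝ) {x : Pt m → ℝ}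
    (hx : ∀ t, ∀ y ∈ box b t, x y ∈ Icc t (2 * t)) : BoxOrder b c (fun y => x y ^ c) := by
  refine ⟨max (2 ^ c) 1, by positivity, fun t ht _ y hy => ?_⟩
  obtain ⟨h1, h2⟩ := hx t y hy
  rw [abs_of_nonneg (Real.rpow_nonneg (ht.le.trans h1) _)]
  rcases le_total 0 c with h0 | h0
  · calc x y ^ c ≤ (2 * t) ^ c := Real.rpow_le_rpow (ht.le.trans h1) h2 h0
      _ = 2 ^ c * t ^ c := Real.mul_rpow (by norm_num) ht.le
      _ ≤ _ := by gcongr; exact le_max_left _ _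
  · calc x y ^ c ≤ t ^ c := Real.rpow_le_rpow_of_nonpos ht h1 h0
      _ = 1 * t ^ c := by ring
      _ ≤ _ := by gcongr; exact le_max_right _ _

theorem BoxOrder.rpow_n (b : Pt m) (c : ℝ) : BoxOrder b c (fun y => y.2.1 ^ c) :=
  BoxOrder.rpow_of_Icc c fun _ _ hy => hy.2.1

theorem BoxOrder.rpow_l (b : Pt m) (c : ℝ) : BoxOrder b c (fun y => y.2.2 ^ c) :=
  BoxOrder.rpow_of_Icc c fun _ _ hy => hy.2.2

theorem BoxOrder.rpow_dG {b : Pt m} (hb : b ∈ edge m) (c : ℝ) :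
    BoxOrder b c (fun y => dG y b ^ c) :=
  .of_le_dG hb zero_le_one fun y _ => by
    rw [one_mul, abs_of_nonneg (Real.rpow_nonneg (dG_nonneg _ _) _)]

/-- The directions of order one or two. -/
def DirOrder (p : ℕ) (e : Pt m) : Prop :=
  ∀ (b : Pt m) (t : ℝ), 0 < t → ∀ θ ∈ Icc (0 : ℝ) (t ^ p), ((b.1, t, t) : Pt m) + θ • e ∈ box b t

theorem dirOrder_eN : DirOrder 1 (eN : Pt m) := fun b t ht θ hθ => by
  rw [pow_one] at hθ
  refine ⟨?_, ?_, ?_⟩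
  · simp [eN, sq_nonneg]
  · simpa [eN] using ⟨hθ.1, by linarith [hθ.2]⟩
  · simpa [eN] using (by linarith : t ≤ 2 * t)

theorem dirOrder_eL : DirOrder 1 (eL : Pt m) := fun b t ht θ hθ => by
  rw [pow_one] at hθ
  refine ⟨?_, ?_, ?_⟩
  · simp [eL, sq_nonneg]
  · simpa [eL] using (by linarith : t ≤ 2 * t)
  · simpa [eL] using ⟨hθ.1, by linarith [hθ.2]⟩

theorem dirOrder_eT (i : Fin m) : DirOrder 2 (eT i) := fun b t ht θ hθ => by
  refine ⟨?_, ?_, ?_⟩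
  · simpa [eT, norm_smul, abs_of_nonneg hθ.1] using hθ.2
  · simpa [eT] using (by linarith : t ≤ 2 * t)
  · simpa [eT] using (by linarith : t ≤ 2 * t)

/-- By the mean value theorem, derivatives of a function of order `β` are of the expected order at
some points close to `b`. -/
theorem smallNear_pd {b : Pt m} (hb : b ∈ edge m) {β q : ℝ} {p : ℕ} {e : Pt m} (he : DirOrder p e)
    {φ κ : Pt m → ℝ} (hφ : ∀ y ∈ dom m, DifferentiableAt ℝ φ y) (h : BoxOrder b β φ)
    (hκ : BoxOrder b q κ) (hpos : 0 < β - p + q) : SmallNear b (fun y => κ y * pd e φ y) := by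
  obtain ⟨C, hC, h⟩ := h
  obtain ⟨D, hD, hκ⟩ := hκ
  have hex : ∀ t, 0 < t → t ≤ boxScale b →
      ∃ z ∈ box b t, |κ z * pd e φ z| ≤ D * (2 * C) * t ^ (β - p + q) := by
    intro t ht ht1
    have htp : 0 < t ^ p := pow_pos ht p
    set c : ℝ → Pt m := fun θ => ((b.1, t, t) : Pt m) + θ • e with hc
    have hmem : ∀ θ ∈ Icc 0 (t ^ p), c θ ∈ box b t := fun θ hθ => he b t ht θ hθ
    have hderiv : ∀ θ ∈ Icc 0 (t ^ p), HasDerivAt (fun θ => φ (c θ)) (pd e φ (c θ)) θ := by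
      intro θ hθ
      have h1 : HasDerivAt c e θ := by
        have := ((hasDerivAt_id θ).smul_const e).const_add ((b.1, t, t) : Pt m)
        rwa [one_smul] at this
      exact (hφ _ (mem_dom_of_box hb ht ht1 (hmem θ hθ))).hasFDerivAt.comp_hasDerivAt θ h1
    -- On a segment inside the box, of length t in a normal direction or t² in a tangential one,
    -- some derivative equals the slope of φ. The order thus drops by exactly p.
    obtain ⟨θ, hθ, hslope⟩ := exists_hasDerivAt_eq_slope (fun θ => φ (c θ))
      (fun θ => pd e φ (c θ)) htp (fun θ hθ => (hderiv θ hθ).continuousAt.continuousWithinAt)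
      (fun θ hθ => hderiv θ ⟨hθ.1.le, hθ.2.le⟩)
    have hθ' : θ ∈ Icc 0 (t ^ p) := ⟨hθ.1.le, hθ.2.le⟩
    refine ⟨c θ, hmem θ hθ', ?_⟩
    rw [abs_mul, hslope, abs_div, sub_zero, abs_of_pos htp]
    have h1 := h t ht ht1 _ (hmem _ (right_mem_Icc.mpr htp.le))
    have h0 := h t ht ht1 _ (hmem _ (left_mem_Icc.mpr htp.le))
    have h2 : |φ (c (t ^ p)) - φ (c 0)| ≤ 2 * C * t ^ β := (abs_sub _ _).trans (by linarith)
    have h3 := hκ t ht ht1 _ (hmem θ hθ')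
    calc |κ (c θ)| * (|φ (c (t ^ p)) - φ (c 0)| / t ^ p)
        ≤ (D * t ^ q) * (2 * C * t ^ β / t ^ p) := by gcongr
      _ = D * (2 * C) * t ^ (β - p + q) := by
          rw [Real.rpow_add ht, Real.rpow_sub ht, Real.rpow_natCast]; ring
  intro η hη
  have hlim : Tendsto (fun t : ℝ => D * (2 * C) * t ^ (β - p + q)) (𝓝[>] 0) (𝓝 0) := by
    have hc : Continuous fun t : ℝ => D * (2 * C) * t ^ (β - p + q) :=
      continuous_const.mul (continuous_id.rpow_const fun _ => Or.inr hpos.le)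
    have := (hc.tendsto 0).mono_left (nhdsWithin_le_nhds (s := Ioi 0))
    simpa [Real.zero_rpow hpos.ne'] using this
  obtain ⟨t, h1, h2⟩ := ((hlim.eventually_lt_const hη).and (Ioo_mem_nhdsGT
    (lt_min (boxScale_pos hb) (by positivity : 0 < η / 8)))).exists
  obtain ⟨z, hz, hle⟩ := hex t h2.1 (h2.2.le.trans (min_le_left _ _))
  refine ⟨z, mem_dom_of_box hb h2.1 (h2.2.le.trans (min_le_left _ _)) hz, ?_, hle.trans_lt h1⟩
  have := h2.2.trans_le (min_le_right _ _)
  linarith [dG_box_le hb h2.1 hz]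

end

section

variable {m : ℕ}

variable {e : Exponents}

/-! ### The approximating polynomials and the norm of `X_{α,ε}` -/

theorem Exponents.α_pos (e : Exponents) : 0 < e.α := e.ε_pos.trans_le e.ε_le_α

theorem Exponents.ε_le_one (e : Exponents) : e.ε ≤ 1 := e.ε_le_α.trans e.α_lt_one.le

open Classical in
/-- The approximating polynomial of `y_n^{-2s} v` at a point of `P`. -/
def polyX (v : XSpace m e) (b : Pt m) : Poly m :=
  if h : b ∈ edge m then (v.2.approx b h).choose else 0

theorem polyX_spec (v : XSpace m e) {b : Pt m} (hb : b ∈ edge m) :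
    IsApprox 2 e.α (quotX e.s v.fn) b (polyX v b) := by
  rw [polyX, dif_pos hb]
  exact (v.2.approx b hb).choose_spec

theorem XSpace.fn_comb (c d : ℝ) (u v : XSpace m e) : (c • u + d • v).fn = c • u.fn + d • v.fn := rfl

theorem polyX_comb (c d : ℝ) (u v : XSpace m e) (b : Pt m) :
    polyX (c • u + d • v) b = c • polyX u b + d • polyX v b := by
  by_cases hb : b ∈ edge m
  · refine isApprox_unique e.α_pos hb (polyX_spec _ hb)
      (isApprox_comb c d (fun y _ => ?_) (polyX_spec u hb) (polyX_spec v hb))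
    rw [XSpace.fn_comb, quotX_comb]; rfl
  · simp [polyX, hb]

/-- All admissible families agree on P by uniqueness, so each single term of the norm can be bounded
by `‖v‖` with the chosen polynomials. -/
theorem eNormX_eq (v : XSpace m e) :
    eNormX e v.fn = (⨆ b ∈ edge m, homX e b (remX e.s v.fn (polyX v b)))
      + ⨆ b ∈ edge m, ENNReal.ofReal (coeffNorm (polyX v b)) := by
  refine le_antisymm (iInf_le _ (⟨polyX v, fun b hb => polyX_spec v hb⟩ : FamX e v.fn))
    (le_iInf fun P => ?_)
  have hP : ∀ b ∈ edge m, P.1 b = polyX v b := fun b hb =>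
    isApprox_unique e.α_pos hb (P.2 b hb) (polyX_spec v hb)
  refine le_of_eq (congrArg₂ _ ?_ ?_)
  · exact biSup_congr fun b hb => by rw [hP b hb]
  · exact biSup_congr fun b hb => by rw [hP b hb]

theorem ofReal_norm_X (v : XSpace m e) : ENNReal.ofReal ‖v‖ = eNormX e v.fn :=
  ENNReal.ofReal_toReal v.2.finite.ne

theorem homX_le (v : XSpace m e) {b : Pt m} (hb : b ∈ edge m) :
    homX e b (remX e.s v.fn (polyX v b)) ≤ ENNReal.ofReal ‖v‖ := by
  rw [ofReal_norm_X, eNormX_eq]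
  exact (le_iSup₂ (f := fun b (_ : b ∈ edge m) => homX e b (remX e.s v.fn (polyX v b))) b hb).trans
    le_self_add

theorem coeffNorm_le (v : XSpace m e) {b : Pt m} (hb : b ∈ edge m) :
    coeffNorm (polyX v b) ≤ ‖v‖ := by
  rw [← ENNReal.ofReal_le_ofReal_iff (norm_nonneg v), ofReal_norm_X, eNormX_eq]
  exact (le_iSup₂ (f := fun b (_ : b ∈ edge m) => ENNReal.ofReal (coeffNorm (polyX v b))) b hb).trans
    le_add_self

/-- The remainder of the second order expansion at a point of `P`. -/
def remP (v : XSpace m e) (b : Pt m) : Pt m → ℝ := remX e.s v.fn (polyX v b)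

theorem contDiffAt_remP (v : XSpace m e) (b : Pt m) {y : Pt m} (hy : y ∈ dom m) :
    ContDiffAt ℝ 2 (remP v b) y := contDiffAt_remX _ _ hy.2.1 (v.2.contDiff y hy)

theorem abs_remP_le (v : XSpace m e) {b : Pt m} (hb : b ∈ edge m) {y : Pt m} (hy : y ∈ dom m) :
    |remP v b y| ≤ ‖v‖ * dG y b ^ (2 + 2 * e.α) * y.2.1 ^ (2 * e.s) := by
  have h := homX_le v hb
  unfold homX at h
  have h1 := (le_self_add.trans (le_self_add.trans (le_self_add.trans (le_self_add.trans h))))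
  have h2 := (le_iSup₂ (f := fun y (_ : y ∈ dom m) => ENNReal.ofReal
    |dG y b ^ (-(2 + 2 * e.α)) * y.2.1 ^ (-(2 * e.s)) * remX e.s v.fn (polyX v b) y|) y hy).trans h1
  rw [ENNReal.ofReal_le_ofReal_iff (norm_nonneg v)] at h2
  have hd := dG_edge_pos hy hb
  have hn := n_pos hy
  have h3 : remP v b y = dG y b ^ (2 + 2 * e.α) * y.2.1 ^ (2 * e.s) *
      (dG y b ^ (-(2 + 2 * e.α)) * y.2.1 ^ (-(2 * e.s)) * remX e.s v.fn (polyX v b) y) := by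
    rw [Real.rpow_neg hd.le, Real.rpow_neg hn.le]
    have := Real.rpow_pos_of_pos hd (2 + 2 * e.α)
    have := Real.rpow_pos_of_pos hn (2 * e.s)
    unfold remP
    field_simp
  rw [h3, abs_mul, abs_of_nonneg (by positivity)]
  calc _ ≤ dG y b ^ (2 + 2 * e.α) * y.2.1 ^ (2 * e.s) * ‖v‖ :=
        mul_le_mul_of_nonneg_left h2 (by positivity)
    _ = _ := by ring

theorem boxOrder_remP (v : XSpace m e) {b : Pt m} (hb : b ∈ edge m) :
    BoxOrder b (2 + 2 * e.α + 2 * e.s) (remP v b) := by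
  obtain ⟨C, hC, h⟩ := (BoxOrder.rpow_dG hb (2 + 2 * e.α)).mul (BoxOrder.rpow_n b (2 * e.s))
  refine ⟨‖v‖ * C, mul_nonneg (norm_nonneg _) hC, fun t ht ht1 y hy => ?_⟩
  refine (abs_remP_le v hb (mem_dom_of_box hb ht ht1 hy)).trans ?_
  rw [mul_assoc, mul_assoc]
  exact mul_le_mul_of_nonneg_left ((le_abs_self _).trans (h t ht ht1 y hy)) (norm_nonneg _)

/-- For this and the analogous bounds below, the remainder has order 2 + 2α + 2s on boxes.
Subtracting the order of the derivative and adding the exponents of the weights always leaves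
exactly ε > 0, so the weighted derivative is small at suitable points near b. -/
theorem weightedHolder_l (v : XSpace m e) {b : Pt m} (hb : b ∈ edge m) :
    WeightedHolder e.ε b (2 * e.α - e.ε) ‖v‖
      (fun y => y.2.2⁻¹ * y.2.1 ^ (-(2 * e.s)) * pd eL (remP v b) y) := by
  have h := homX_le v hb
  unfold homX at h
  have h1 := le_add_self.trans (le_self_add.trans (le_self_add.trans (le_self_add.trans h)))
  have hα := e.α_pos
  have hε := e.ε_pos
  have hεα := e.ε_le_α
  have hα1 := e.α_lt_one
  have hw := ((BoxOrder.rpow_dG hb (-(2 * e.α) + e.ε)).mul (BoxOrder.rpow_l b (-1))).mul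
    (BoxOrder.rpow_n b (-(2 * e.s)))
  refine .of_smallNear hε e.ε_le_one (by linarith) (by linarith) (norm_nonneg _) hb (fun y hy => ?_)
    h1 ?_
  · rw [show -(2 * e.α) + e.ε = -(2 * e.α - e.ε) by ring]
    simp only [remP]; ring
  · have := smallNear_pd hb dirOrder_eL (fun y hy => differentiableAt_of_C2 (contDiffAt_remP v b hy))
      (boxOrder_remP v hb) hw (by push_cast; linarith)
    simpa only [Real.rpow_neg_one, remP] using this

theorem weightedHolder_n (v : XSpace m e) {b : Pt m} (hb : b ∈ edge m) :
    WeightedHolder e.ε b (2 + 2 * e.α - e.ε) ‖v‖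
      (fun y => y.2.1 ^ (1 - 2 * e.s) * pd eN (remP v b) y) := by
  have h := homX_le v hb
  unfold homX at h
  have h1 := le_add_self.trans (le_self_add.trans (le_self_add.trans h))
  have hα := e.α_pos
  have hε := e.ε_pos
  have hεα := e.ε_le_α
  have hα1 := e.α_lt_one
  have hw := (BoxOrder.rpow_dG hb (-(2 + 2 * e.α - e.ε))).mul (BoxOrder.rpow_n b (1 - 2 * e.s))
  refine .of_smallNear hε e.ε_le_one (by linarith) (by linarith) (norm_nonneg _) hb (fun y hy => ?_)
    h1 ?_
  · simp only [remP]; ring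
  · exact smallNear_pd hb dirOrder_eN (fun y hy => differentiableAt_of_C2 (contDiffAt_remP v b hy))
      (boxOrder_remP v hb) hw (by push_cast; linarith)

theorem weightedHolder_t (v : XSpace m e) {b : Pt m} (hb : b ∈ edge m) (i : Fin m) :
    WeightedHolder e.ε b (2 * e.α - e.ε) ‖v‖
      (fun y => y.2.1 ^ (-(2 * e.s)) * pd (eT i) (remP v b) y) := by
  have h := homX_le v hb
  unfold homX at h
  have h0 := le_add_self.trans (le_self_add.trans h)
  have h1 := (Finset.single_le_sum (f := fun i => holderSemi e.ε (fun y =>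
    dG y b ^ (-(2 * e.α - e.ε)) * y.2.1 ^ (-(2 * e.s)) *
      pd (eT i) (remX e.s v.fn (polyX v b)) y)) (fun _ _ => bot_le) (Finset.mem_univ i)).trans h0
  have hα := e.α_pos
  have hε := e.ε_pos
  have hεα := e.ε_le_α
  have hα1 := e.α_lt_one
  have hw := (BoxOrder.rpow_dG hb (-(2 * e.α - e.ε))).mul (BoxOrder.rpow_n b (-(2 * e.s)))
  refine .of_smallNear hε e.ε_le_one (by linarith) (by linarith) (norm_nonneg _) hb (fun y hy => ?_)
    h1 ?_
  · simp only [remP]; ring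
  · exact smallNear_pd hb (dirOrder_eT i)
      (fun y hy => differentiableAt_of_C2 (contDiffAt_remP v b hy))
      (boxOrder_remP v hb) hw (by push_cast; linarith)

theorem n_le_dG (y : Pt m) {b : Pt m} (hb : b ∈ edge m) : |y.2.1| ≤ dG y b :=
  (abs_n_le_rho y).trans (rho_le_dG y (rho_of_mem_edge hb))

theorem l_le_dG (y : Pt m) {b : Pt m} (hb : b ∈ edge m) : |y.2.2| ≤ dG y b :=
  (abs_l_le_rho y).trans (rho_le_dG y (rho_of_mem_edge hb))

theorem pd_smul_dir (c : ℝ) (d : Pt m) (u : Pt m → ℝ) (y : Pt m) : pd (c • d) u y = c * pd d u y := by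
  simp [pd]

/-- The weighted first derivative along the `l`-th vector field. -/
def wYd (s : ℝ) (l : FieldIdx m) (u : Pt m → ℝ) (y : Pt m) : ℝ := y.2.1 ^ (1 - 2 * s) * Yd l u y

theorem rpow_split {x : ℝ} (hx : 0 < x) (s : ℝ) : x ^ (1 - 2 * s) = x * x ^ (-(2 * s)) := by
  rw [sub_eq_add_neg, Real.rpow_add hx, Real.rpow_one]

/-- The pointwise bounds for the first derivatives provide the order 2 + 2α that the mean value
argument needs to treat the second derivatives. -/
theorem boxOrder_wYd (v : XSpace m e) {b : Pt m} (hb : b ∈ edge m) (l : FieldIdx m) :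
    BoxOrder b (2 + 2 * e.α) (wYd e.s l (remP v b)) := by
  have hN := norm_nonneg v
  have hα := e.α_pos
  have tang : ∀ (i : Fin m) (x : Pt m → ℝ), (∀ y, |x y| ≤ dG y b) →
      (∀ y ∈ dom m, |y.2.1 ^ (1 - 2 * e.s) * pd (x y • eT i) (remP v b) y|
        ≤ ‖v‖ * dG y b ^ (2 + 2 * e.α)) := by
    intro i x hx y hy
    have hd := dG_edge_pos hy hb
    have h := (weightedHolder_t v hb i).bound y hy
    rw [sub_add_cancel] at h
    rw [pd_smul_dir, rpow_split hy.2.1, show y.2.1 * y.2.1 ^ (-(2 * e.s)) *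
      (x y * pd (eT i) (remP v b) y) = y.2.1 * x y * (y.2.1 ^ (-(2 * e.s)) *
        pd (eT i) (remP v b) y) by ring, abs_mul, abs_mul, Real.rpow_add hd]
    calc |y.2.1| * |x y| * |y.2.1 ^ (-(2 * e.s)) * pd (eT i) (remP v b) y|
        ≤ dG y b * dG y b * (‖v‖ * dG y b ^ (2 * e.α)) := by
          gcongr
          · exact n_le_dG y hb
          · exact hx y
      _ = ‖v‖ * (dG y b ^ (2 : ℝ) * dG y b ^ (2 * e.α)) := by rw [Real.rpow_two]; ring
  refine .of_le_dG hb hN fun y hy => ?_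
  rcases l with (i | i) | i
  · exact tang i (fun y => y.2.1) (fun y => n_le_dG y hb) y hy
  · exact tang i (fun y => y.2.2) (fun y => l_le_dG y hb) y hy
  · fin_cases i
    · have h := (weightedHolder_n v hb).bound y hy
      rwa [sub_add_cancel] at h
    · have hd := dG_edge_pos hy hb
      have h := (weightedHolder_l v hb).bound y hy
      rw [sub_add_cancel] at h
      have hl := l_pos hy
      have h3 : wYd e.s (Sum.inr 1) (remP v b) y = y.2.1 * y.2.2 * (y.2.2⁻¹ * y.2.1 ^ (-(2 * e.s)) *
          pd eL (remP v b) y) := by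
        simp only [wYd, Yd, field]
        rw [rpow_split hy.2.1]
        field_simp
      change |wYd e.s (Sum.inr 1) (remP v b) y| ≤ _
      rw [h3, abs_mul, abs_mul, Real.rpow_add hd]
      calc _ ≤ dG y b * dG y b * (‖v‖ * dG y b ^ (2 * e.α)) := by
            gcongr
            · exact n_le_dG y hb
            · exact l_le_dG y hb
        _ = ‖v‖ * (dG y b ^ (2 : ℝ) * dG y b ^ (2 * e.α)) := by rw [Real.rpow_two]; ring

theorem differentiableAt_wYd {u : Pt m → ℝ} {y : Pt m} (hy : 0 < y.2.1) (hu : ContDiffAt ℝ 2 u y)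
    (s : ℝ) (l : FieldIdx m) : DifferentiableAt ℝ (wYd s l u) y :=
  differentiableAt_weight_pd hy hu (1 - 2 * s) (differentiable_field l).differentiableAt

theorem weightedHolder_Yd (v : XSpace m e) {b : Pt m} (hb : b ∈ edge m) (k l : FieldIdx m) :
    WeightedHolder e.ε b (1 + 2 * e.α - e.ε) ‖v‖ (Yd k (wYd e.s l (remP v b))) := by
  have h := homX_le v hb
  unfold homX at h
  have h0 := le_add_self.trans h
  have h1 := (Finset.single_le_sum (f := fun k => ∑ l : FieldIdx m, holderSemi e.ε (fun y =>
    dG y b ^ (-(1 + 2 * e.α - e.ε)) * Yd k (fun z => z.2.1 ^ (1 - 2 * e.s) *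
      Yd l (remX e.s v.fn (polyX v b)) z) y)) (fun _ _ => bot_le) (Finset.mem_univ k)).trans h0
  have h2 := (Finset.single_le_sum (f := fun l => holderSemi e.ε (fun y =>
    dG y b ^ (-(1 + 2 * e.α - e.ε)) * Yd k (fun z => z.2.1 ^ (1 - 2 * e.s) *
      Yd l (remX e.s v.fn (polyX v b)) z) y)) (fun _ _ => bot_le) (Finset.mem_univ l)).trans h1
  have hα := e.α_pos
  have hε := e.ε_pos
  have hεα := e.ε_le_α
  have hα1 := e.α_lt_one
  have hw := BoxOrder.rpow_dG hb (-(1 + 2 * e.α - e.ε))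
  have hd : ∀ y ∈ dom m, DifferentiableAt ℝ (wYd e.s l (remP v b)) y := fun y hy =>
    differentiableAt_wYd hy.2.1 (contDiffAt_remP v b hy) _ _
  refine .of_smallNear hε e.ε_le_one (by linarith) (by linarith) (norm_nonneg _) hb (fun y hy => rfl)
    h2 ?_
  rcases k with (i | i) | i
  · have := smallNear_pd hb (dirOrder_eT i) hd (boxOrder_wYd v hb l)
      (hw.mul (BoxOrder.rpow_n b 1)) (by push_cast; linarith)
    simpa only [Yd, field, pd_smul_dir, Real.rpow_one, mul_assoc] using this
  · have := smallNear_pd hb (dirOrder_eT i) hd (boxOrder_wYd v hb l)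
      (hw.mul (BoxOrder.rpow_l b 1)) (by push_cast; linarith)
    simpa only [Yd, field, pd_smul_dir, Real.rpow_one, mul_assoc] using this
  · fin_cases i
    · exact smallNear_pd hb dirOrder_eN hd (boxOrder_wYd v hb l) hw (by push_cast; linarith)
    · exact smallNear_pd hb dirOrder_eL hd (boxOrder_wYd v hb l) hw (by push_cast; linarith)

end

section

variable {m : ℕ}

variable {e : Exponents}

theorem XSpace.mem (v : XSpace m e) : MemX e v.fn := v.2

/-! ### Expansion of derivatives at the points of `P` -/

/-- The part of `wYd s l (y_n^{2s} P)` for a polynomial `P`. -/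
def wYdPoly (s : ℝ) (l : FieldIdx m) (p : Poly m) (y : Pt m) : ℝ :=
  y.2.1 * pd (field l y) (pev p) y + 2 * s * pev p y * (field l y).2.1

theorem pd_remX (s : ℝ) {v : Pt m → ℝ} (p : Poly m) {y : Pt m} (hy : 0 < y.2.1)
    (hv : DifferentiableAt ℝ v y) (d : Pt m) :
    pd d (remX s v p) y = pd d v y
      - (y.2.1 ^ (2 * s) * pd d (pev p) y + pev p y * (2 * s * y.2.1 ^ (2 * s - 1) * d.2.1)) := by
  have h1 : DifferentiableAt ℝ (fun z : Pt m => z.2.1 ^ (2 * s)) y :=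
    differentiableAt_of_C2 (contDiffAt_rpow hy _)
  rw [← pd_rpow hy, ← pd_mul d h1 (differentiable_pev p y),
    ← pd_sub d hv (h1.fun_mul (differentiable_pev p y))]
  rfl

theorem wYd_remX (s : ℝ) {v : Pt m → ℝ} (p : Poly m) {y : Pt m} (hy : 0 < y.2.1)
    (hv : DifferentiableAt ℝ v y) (l : FieldIdx m) :
    wYd s l (remX s v p) y = wYd s l v y - wYdPoly s l p y := by
  have h1 : y.2.1 ^ (1 - 2 * s) * y.2.1 ^ (2 * s) = y.2.1 := by rw [← Real.rpow_add hy]; simp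
  have h2 : y.2.1 ^ (1 - 2 * s) * y.2.1 ^ (2 * s - 1) = 1 := by rw [← Real.rpow_add hy]; simp
  unfold wYd wYdPoly Yd
  rw [pd_remX s p hy hv]
  linear_combination (-(pd (field l y) (pev p) y)) * h1 - 2 * s * pev p y * (field l y).2.1 * h2

theorem differentiable_wYdPoly (s : ℝ) (l : FieldIdx m) (p : Poly m) :
    Differentiable ℝ (wYdPoly s l p) := by
  intro y
  have h1 : DifferentiableAt ℝ (fun z => pd (field l z) (pev p) z) y := by
    have : ContDiffAt ℝ 1 (fderiv ℝ (pev p)) y :=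
      (contDiff_pev p).contDiffAt.fderiv_right (by norm_num)
    exact (this.differentiableAt (by norm_num)).clm_apply (differentiable_field l y)
  have h2 : DifferentiableAt ℝ (fun z => (field l z).2.1) y :=
    (coN.differentiableAt).comp y (differentiable_field l y)
  exact ((hasFDerivAt_n y).differentiableAt.fun_mul h1).fun_add
    (((differentiable_pev p y).const_mul _).fun_mul h2)

theorem Yd_wYd_remX (s : ℝ) {v : Pt m → ℝ} (p : Poly m) {y : Pt m} (hy : 0 < y.2.1)
    (hv : ContDiffAt ℝ 2 v y) (k l : FieldIdx m) :
    Yd k (wYd s l (remX s v p)) y = Yd k (wYd s l v) y - Yd k (wYdPoly s l p) y := by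
  unfold Yd
  rw [← pd_sub _ (differentiableAt_wYd hy hv s l) (differentiable_wYdPoly s l p y)]
  refine pd_congr ?_ _
  have hpos : ∀ᶠ z : Pt m in 𝓝 y, 0 < z.2.1 :=
    (continuous_fst.comp continuous_snd).continuousAt.eventually (lt_mem_nhds hy)
  filter_upwards [eventually_differentiableAt hv, hpos] with z h1 h2
  exact wYd_remX s p h2 h1 l

theorem pd_poly_N {p : Poly m} (hp : HomDegLE 2 p) (s : ℝ) (d y : Pt m) :
    pd d (wYdPoly s (Sum.inr 0) p) y = ∑ i, 2 * s * p.coeff (expT i) * d.1 i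
      + ((2 * s + 1) * p.coeff (expN 1 0) + (4 * s + 4) * p.coeff (expN 2 0) * y.2.1
        + (2 * s + 1) * p.coeff (expN 1 1) * y.2.2) * d.2.1
      + (2 * s * p.coeff (expN 0 1) + (2 * s + 1) * p.coeff (expN 1 1) * y.2.1
        + 4 * s * p.coeff (expN 0 2) * y.2.2) * d.2.2 := by
  have hn := hasFDerivAt_n y
  have hl := hasFDerivAt_l y
  have hf : wYdPoly s (Sum.inr 0) p = fun y => y.2.1 * (p.coeff (expN 1 0)
      + 2 * p.coeff (expN 2 0) * y.2.1 + p.coeff (expN 1 1) * y.2.2) + 2 * s * pev p y := by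
    funext y
    simp only [wYdPoly, field, pd_pev hp]
    simp [eN]
  have h := (hn.fun_mul (((hn.const_mul (2 * p.coeff (expN 2 0))).const_add
    (p.coeff (expN 1 0))).fun_add (hl.const_mul (p.coeff (expN 1 1))))).fun_add
    ((differentiable_pev p y).hasFDerivAt.const_mul (2 * s))
  rw [hf, pd_of_hasFDerivAt h]
  have h2 := pd_pev hp d y
  unfold pd at h2
  simp only [add_apply, smul_apply, h2, coN_apply,
    coL_apply, smul_eq_mul]
  rw [mul_add (2 * s), mul_add (2 * s), Finset.mul_sum]
  simp only [← mul_assoc]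
  ring

theorem pd_poly_L {p : Poly m} (hp : HomDegLE 2 p) (s : ℝ) (d y : Pt m) :
    pd d (wYdPoly s (Sum.inr 1) p) y =
      (p.coeff (expN 0 1) + 2 * p.coeff (expN 1 1) * y.2.1 + 2 * p.coeff (expN 0 2) * y.2.2) * d.2.1
      + (p.coeff (expN 1 1) * y.2.1 + 2 * p.coeff (expN 0 2) * y.2.1) * d.2.2
      - p.coeff (expN 1 1) * y.2.1 * d.2.2 := by
  have hn := hasFDerivAt_n y
  have hl := hasFDerivAt_l y
  have hf : wYdPoly s (Sum.inr 1) p = fun y : Pt m => y.2.1 * (p.coeff (expN 0 1)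
      + p.coeff (expN 1 1) * y.2.1 + 2 * p.coeff (expN 0 2) * y.2.2) := by
    funext y
    simp only [wYdPoly, field, pd_pev hp]
    simp [eL]
  have h := (hn.fun_mul (((hn.const_mul (p.coeff (expN 1 1))).const_add
    (p.coeff (expN 0 1))).fun_add (hl.const_mul (2 * p.coeff (expN 0 2)))))
  rw [hf, pd_of_hasFDerivAt h]
  simp only [add_apply, smul_apply, coN_apply,
    coL_apply, smul_eq_mul]
  ring

/-- A polynomial in 𝒫_2 is affine in y'' without mixed terms, so the polynomial part of a tangential
first derivative involves the normal variables only. -/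
theorem pd_poly_T {p : Poly m} (hp : HomDegLE 2 p) (s : ℝ) (j : Fin m ⊕ Fin m) (y : Pt m)
    (i : Fin m) : pd (eT i) (wYdPoly s (Sum.inl j) p) y = 0 := by
  have hn := hasFDerivAt_n y
  have hl := hasFDerivAt_l y
  rcases j with j | j
  · have hf : wYdPoly s (Sum.inl (Sum.inl j)) p = fun y => y.2.1 * (p.coeff (expT j) * y.2.1) := by
      funext y
      simp only [wYdPoly, field, pd_pev hp]
      simp [eT]
    rw [hf, pd_of_hasFDerivAt (hn.fun_mul (hn.const_mul _))]
    simp [coN_apply, eT]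
  · have hf : wYdPoly s (Sum.inl (Sum.inr j)) p = fun y => y.2.1 * (p.coeff (expT j) * y.2.2) := by
      funext y
      simp only [wYdPoly, field, pd_pev hp]
      simp [eT]
    rw [hf, pd_of_hasFDerivAt (hn.fun_mul (hl.const_mul _))]
    simp [coN_apply, coL_apply, eT]

/-! ### Vanishing coefficients -/

theorem homDegLE_polyX (v : XSpace m e) {b : Pt m} (hb : b ∈ edge m) : HomDegLE 2 (polyX v b) :=
  (polyX_spec v hb).1

theorem rpow_mul_pd_l_remP (v : XSpace m e) (b : Pt m) {y : Pt m} (hy : y ∈ dom m) :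
    y.2.1 ^ (-(2 * e.s)) * pd eL (remP v b) y =
      y.2.1 ^ (-(2 * e.s)) * pd eL v.fn y - pd eL (pev (polyX v b)) y := by
  have h1 : y.2.1 ^ (-(2 * e.s)) * y.2.1 ^ (2 * e.s) = 1 := by rw [← Real.rpow_add hy.2.1]; simp
  unfold remP
  rw [pd_remX _ _ hy.2.1 (differentiableAt_of_C2 (v.mem.contDiff y hy))]
  simp only [eL]
  linear_combination (-(pd ((0, 0, 1) : Pt m) (pev (polyX v b)) y)) * h1

theorem pd_l_quotX (v : XSpace m e) {y : Pt m} (hy : y ∈ dom m) :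
    pd eL (quotX e.s v.fn) y = y.2.1 ^ (-(2 * e.s)) * pd eL v.fn y := by
  have h1 : DifferentiableAt ℝ (fun z : Pt m => z.2.1 ^ (-(2 * e.s))) y :=
    differentiableAt_of_C2 (contDiffAt_rpow hy.2.1 _)
  have := pd_mul eL h1 (differentiableAt_of_C2 (v.mem.contDiff y hy))
  rw [pd_rpow hy.2.1] at this
  simp only [eL, mul_zero, add_zero] at this
  exact this

/-- Approach the face y_{n+1} = 0 vertically over b, at height τ in y_n. The derivative of the
quotient tends to 0 by the Neumann condition, and that of the remainder because its weighted bound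
carries a factor y_{n+1}. The derivative of the polynomial must therefore vanish on the face. -/
theorem neumann_eq (v : XSpace m e) {b : Pt m} (hb : b ∈ edge m) {τ : ℝ} (hτ : 0 < τ)
    (hτ1 : τ ≤ 1 / 50) :
    (polyX v b).coeff (expN 0 1) + (polyX v b).coeff (expN 1 1) * τ = 0 := by
  set z : Pt m := (b.1, τ, 0) with hz
  have hb1 : dG ((b.1, 0, 0) : Pt m) 0 < 1 := by rw [← eq_of_mem_edge hb]; exact hb.1.1
  have hzb : z ∈ ball1 m := ⟨dG_lt_one_of_edge hb1 (by simp only; nlinarith), hb1⟩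
  have hN := v.mem.neumann z hzb hτ rfl
  set c : ℝ → Pt m := fun η => (b.1, τ, η) with hc
  have hdom : ∀ η ∈ Ioo (0 : ℝ) (1 / 50), c η ∈ dom m := fun η hη =>
    mem_dom_of_edge hb hτ hη.1 hτ1 hη.2.le
  have hev : ∀ᶠ η : ℝ in 𝓝[>] 0, η ∈ Ioo (0 : ℝ) (1 / 50) := Ioo_mem_nhdsGT (by norm_num)
  have hct : Tendsto c (𝓝[>] 0) (𝓝[dom m ∩ {y | y.1 = z.1 ∧ y.2.1 = z.2.1}] z) := by
    refine tendsto_nhdsWithin_iff.mpr ⟨?_, hev.mono fun η hη => ⟨hdom η hη, rfl, rfl⟩⟩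
    have : Continuous c := by fun_prop
    exact (this.tendsto 0).mono_left nhdsWithin_le_nhds
  have h1 := hN.comp hct
  have h2 : Tendsto (fun η => c η |>.2.1 ^ (-(2 * e.s)) * pd eL (remP v b) (c η)) (𝓝[>] 0)
      (𝓝 0) := by
    have hlim : Tendsto (fun η : ℝ => ‖v‖ * η) (𝓝[>] 0) (𝓝 0) := by
      have : Continuous fun η : ℝ => ‖v‖ * η := by fun_prop
      simpa using (this.tendsto 0).mono_left (nhdsWithin_le_nhds (s := Ioi 0))
    refine squeeze_zero_norm' (hev.mono fun η hη => ?_) hlim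
    have h3 := (weightedHolder_l v hb).bound _ (hdom η hη)
    rw [sub_add_cancel, mul_assoc, abs_mul, abs_inv, abs_of_pos (l_pos (hdom η hη)),
      inv_mul_le_iff₀ (l_pos (hdom η hη))] at h3
    have h4 : dG (c η) b ^ (2 * e.α) ≤ 1 := Real.rpow_le_one (dG_nonneg _ _)
      ((dG_above_le hb hτ.le hη.1.le).trans (by linarith [hη.2])) (by linarith [e.α_pos])
    rw [Real.norm_eq_abs]
    refine h3.trans ?_
    have h5 := mul_le_mul_of_nonneg_left h4 (norm_nonneg v)
    change η * (‖v‖ * dG (c η) b ^ (2 * e.α)) ≤ _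
    nlinarith [hη.1]
  have h3 : Tendsto (fun η => pd eL (pev (polyX v b)) (c η)) (𝓝[>] 0) (𝓝 (0 - 0)) := by
    refine (h1.sub h2).congr' (hev.mono fun η hη => ?_)
    simp only [Function.comp_apply]
    rw [pd_l_quotX v (hdom η hη), rpow_mul_pd_l_remP v b (hdom η hη)]
    ring
  have h4 : Tendsto (fun η => pd eL (pev (polyX v b)) (c η)) (𝓝[>] 0)
      (𝓝 ((polyX v b).coeff (expN 0 1) + (polyX v b).coeff (expN 1 1) * τ)) := by
    have hcont : Continuous fun η : ℝ => (polyX v b).coeff (expN 0 1)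
      + (polyX v b).coeff (expN 1 1) * τ + 2 * (polyX v b).coeff (expN 0 2) * η := by fun_prop
    have := (hcont.tendsto 0).mono_left (nhdsWithin_le_nhds (s := Ioi 0))
    simp only [mul_zero, add_zero] at this
    refine this.congr fun η => ?_
    rw [pd_pev (homDegLE_polyX v hb)]
    simp [eL, hc]
  rw [sub_zero] at h3
  exact tendsto_nhds_unique h4 h3

/-- The affine function of τ from the Neumann condition vanishes at two values of τ. -/
theorem coeff_l_eq_zero (v : XSpace m e) {b : Pt m} (hb : b ∈ edge m) :
    (polyX v b).coeff (expN 0 1) = 0 ∧ (polyX v b).coeff (expN 1 1) = 0 := by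
  have h1 := neumann_eq v hb (τ := 1 / 50) (by norm_num) le_rfl
  have h2 := neumann_eq v hb (τ := 1 / 100) (by norm_num) (by norm_num)
  constructor <;> linarith

/-- Along the diagonal into b the condition `normal` and the decay of the remainder leave the
constant term (2s + 1) times this coefficient, which must then be zero. -/
theorem coeff_n_eq_zero (v : XSpace m e) {b : Pt m} (hb : b ∈ edge m) :
    (polyX v b).coeff (expN 1 0) = 0 := by
  obtain ⟨hL, hD⟩ := coeff_l_eq_zero v hb
  have hα := e.α_pos
  set c : ℝ → Pt m := fun t => (b.1, t, t) with hc
  have hdom : ∀ t ∈ Ioo (0 : ℝ) (1 / 50), c t ∈ dom m := fun t ht =>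
    mem_dom_of_edge hb ht.1 ht.1 ht.2.le ht.2.le
  have hev : ∀ᶠ t : ℝ in 𝓝[>] 0, t ∈ Ioo (0 : ℝ) (1 / 50) := Ioo_mem_nhdsGT (by norm_num)
  have hct : Tendsto c (𝓝[>] 0) (𝓝[dom m] b) := by
    refine tendsto_nhdsWithin_iff.mpr ⟨?_, hev.mono fun η hη => hdom η hη⟩
    have : Continuous c := by fun_prop
    have h := (this.tendsto 0).mono_left (nhdsWithin_le_nhds (s := Ioi 0))
    rwa [show c 0 = b from (eq_of_mem_edge hb).symm] at h
  have h1 := (v.mem.normal b hb).comp hct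
  have h2 : Tendsto (fun t => Yd (Sum.inr 0) (wYd e.s (Sum.inr 0) (remP v b)) (c t)) (𝓝[>] 0)
      (𝓝 0) := by
    have hlim : Tendsto (fun t : ℝ => ‖v‖ * (t + t) ^ (1 + 2 * e.α)) (𝓝[>] 0) (𝓝 0) := by
      have : Continuous fun t : ℝ => ‖v‖ * (t + t) ^ (1 + 2 * e.α) :=
        continuous_const.mul ((continuous_id.add continuous_id).rpow_const
          fun _ => Or.inr (by linarith))
      have h0 : (1 + 2 * e.α) ≠ 0 := by linarith
      simpa [Real.zero_rpow h0] using (this.tendsto 0).mono_left (nhdsWithin_le_nhds (s := Ioi 0))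
    refine squeeze_zero_norm' (hev.mono fun t ht => ?_) hlim
    have h3 := (weightedHolder_Yd v hb (Sum.inr 0) (Sum.inr 0)).bound _ (hdom t ht)
    rw [sub_add_cancel] at h3
    rw [Real.norm_eq_abs]
    refine h3.trans (mul_le_mul_of_nonneg_left ?_ (norm_nonneg _))
    exact Real.rpow_le_rpow (dG_nonneg _ _) (dG_above_le hb ht.1.le ht.1.le) (by linarith)
  have h3 : Tendsto (fun t => pd eN (wYdPoly e.s (Sum.inr 0) (polyX v b)) (c t)) (𝓝[>] 0)
      (𝓝 (0 - 0)) := by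
    refine (h1.sub h2).congr' (hev.mono fun t ht => ?_)
    unfold remP
    rw [Yd_wYd_remX _ _ (hdom t ht).2.1 (v.mem.contDiff _ (hdom t ht))]
    exact sub_sub_cancel _ _
  have h4 : Tendsto (fun t => pd eN (wYdPoly e.s (Sum.inr 0) (polyX v b)) (c t)) (𝓝[>] 0)
      (𝓝 ((2 * e.s + 1) * (polyX v b).coeff (expN 1 0))) := by
    have hcont : Continuous fun t : ℝ => (2 * e.s + 1) * (polyX v b).coeff (expN 1 0)
      + (4 * e.s + 4) * (polyX v b).coeff (expN 2 0) * t := by fun_prop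
    have := (hcont.tendsto 0).mono_left (nhdsWithin_le_nhds (s := Ioi 0))
    simp only [mul_zero, add_zero] at this
    refine this.congr fun η => ?_
    rw [pd_poly_N (homDegLE_polyX v hb)]
    simp [eN, hc, hD]
  rw [sub_zero] at h3
  have h5 := tendsto_nhds_unique h4 h3
  have hs := e.s_pos
  exact (mul_eq_zero.mp h5).resolve_left (by linarith)

/-! ### The expansion with the remaining coefficients -/

theorem pev_polyX (v : XSpace m e) {b : Pt m} (hb : b ∈ edge m) (y : Pt m) :
    pev (polyX v b) y = (polyX v b).coeff (expN 0 0) + ∑ i, (polyX v b).coeff (expT i) * y.1 i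
      + (polyX v b).coeff (expN 2 0) * y.2.1 ^ 2 + (polyX v b).coeff (expN 0 2) * y.2.2 ^ 2 := by
  obtain ⟨hL, hD⟩ := coeff_l_eq_zero v hb
  rw [pev_eq (homDegLE_polyX v hb), hL, hD, coeff_n_eq_zero v hb]
  ring

theorem expand_l (v : XSpace m e) {b : Pt m} (hb : b ∈ edge m) {y : Pt m} (hy : y ∈ dom m) :
    y.2.2⁻¹ * y.2.1 ^ (-(2 * e.s)) * pd eL (remP v b) y =
      y.2.2⁻¹ * y.2.1 ^ (-(2 * e.s)) * pd eL v.fn y - 2 * (polyX v b).coeff (expN 0 2) := by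
  obtain ⟨hL, hD⟩ := coeff_l_eq_zero v hb
  have h := rpow_mul_pd_l_remP v b hy
  rw [pd_pev (homDegLE_polyX v hb), hL, hD] at h
  simp only [eL, PiLp.zero_apply, mul_zero, Finset.sum_const_zero, zero_add, zero_mul,
    mul_one] at h
  have h2 : y.2.2⁻¹ * y.2.2 = 1 := inv_mul_cancel₀ (l_pos hy).ne'
  simp only [eL]
  linear_combination y.2.2⁻¹ * h - 2 * (polyX v b).coeff (expN 0 2) * h2

theorem expand_n (v : XSpace m e) {b : Pt m} (hb : b ∈ edge m) {y : Pt m} (hy : y ∈ dom m) :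
    y.2.1 ^ (1 - 2 * e.s) * pd eN (remP v b) y =
      fluxN e.s v.fn y - (2 * e.s * pev (polyX v b) y
        + 2 * (polyX v b).coeff (expN 2 0) * y.2.1 ^ 2) := by
  obtain ⟨hL, hD⟩ := coeff_l_eq_zero v hb
  have h := wYd_remX e.s (polyX v b) hy.2.1 (differentiableAt_of_C2 (v.mem.contDiff y hy))
    (Sum.inr 0)
  simp only [wYd, wYdPoly, Yd, field, pd_pev (homDegLE_polyX v hb), coeff_n_eq_zero v hb, hD] at h
  change y.2.1 ^ (1 - 2 * e.s) * pd eN (remX e.s v.fn (polyX v b)) y = _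
  rw [h]
  simp only [eN, PiLp.zero_apply, mul_zero, Finset.sum_const_zero, zero_add, zero_mul, fluxN]
  ring

/-- The normal coordinates. -/
def nc (c : Fin 2) (y : Pt m) : ℝ := ![y.2.1, y.2.2] c

/-- The expansion `W ∼ κ(b) y_c` at all points `b` of `P`. -/
structure Expands (e : Exponents) (N : ℝ) (W : Pt m → ℝ) (κ : Pt m → ℝ) (c : Fin 2) : Prop where
  weighted : ∀ b ∈ edge m,
    WeightedHolder e.ε b (1 + 2 * e.α - e.ε) N (fun y => W y - κ b * nc c y)
  bound : ∀ b ∈ edge m, |κ b| ≤ 8 * N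

theorem WeightedHolder.congr {ε γ N : ℝ} {b : Pt m} {T T' : Pt m → ℝ}
    (h : WeightedHolder ε b γ N T) (he : ∀ y ∈ dom m, T y = T' y) : WeightedHolder ε b γ N T' where
  bound y hy := by rw [← he y hy]; exact h.bound y hy
  holder y hy z hz := by rw [← he y hy, ← he z hz]; exact h.holder y hy z hz

theorem expands_of_eq (v : XSpace m e) (k l : FieldIdx m) (κ : Pt m → ℝ) (c : Fin 2)
    (h : ∀ b ∈ edge m, ∀ y : Pt m, Yd k (wYdPoly e.s l (polyX v b)) y = κ b * nc c y)
    (hκ : ∀ b ∈ edge m, |κ b| ≤ 8 * ‖v‖) :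
    Expands e ‖v‖ (Yd k (wYd e.s l v.fn)) κ c where
  weighted b hb := (weightedHolder_Yd v hb k l).congr fun y hy => by
    unfold remP
    rw [Yd_wYd_remX _ _ hy.2.1 (v.mem.contDiff y hy), h b hb]
  bound := hκ

/-- The constant 8 covers all factors that occur in the leading coefficients; the largest is 4s + 4.
-/
theorem abs_mul_coeff_le (v : XSpace m e) {b : Pt m} (hb : b ∈ edge m) {c : ℝ} (hc0 : 0 ≤ c)
    (hc : c ≤ 8) (β : (Fin m ⊕ Fin 2) →₀ ℕ) : |c * (polyX v b).coeff β| ≤ 8 * ‖v‖ := by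
  rw [abs_mul, abs_of_nonneg hc0]
  exact mul_le_mul hc ((abs_coeff_le _ _).trans (coeffNorm_le v hb)) (abs_nonneg _) (by norm_num)

theorem expands_NN (v : XSpace m e) : Expands e ‖v‖ (Yd (Sum.inr 0) (wYd e.s (Sum.inr 0) v.fn))
    (fun b => (4 * e.s + 4) * (polyX v b).coeff (expN 2 0)) 0 :=
  expands_of_eq v _ _ _ _ (fun b hb y => by
    obtain ⟨hL, hD⟩ := coeff_l_eq_zero v hb
    simp only [Yd, field]
    rw [pd_poly_N (homDegLE_polyX v hb), hD, coeff_n_eq_zero v hb]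
    simp [eN, nc]) fun b hb =>
      abs_mul_coeff_le v hb (by linarith [e.s_pos]) (by linarith [e.s_lt_one]) _

theorem expands_LN (v : XSpace m e) : Expands e ‖v‖ (Yd (Sum.inr 1) (wYd e.s (Sum.inr 0) v.fn))
    (fun b => 4 * e.s * (polyX v b).coeff (expN 0 2)) 1 :=
  expands_of_eq v _ _ _ _ (fun b hb y => by
    obtain ⟨hL, hD⟩ := coeff_l_eq_zero v hb
    simp only [Yd, field]
    rw [pd_poly_N (homDegLE_polyX v hb), hD, hL]
    simp [eL, nc]) fun b hb =>
      abs_mul_coeff_le v hb (by linarith [e.s_pos]) (by linarith [e.s_lt_one]) _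

theorem expands_LL (v : XSpace m e) : Expands e ‖v‖ (Yd (Sum.inr 1) (wYd e.s (Sum.inr 1) v.fn))
    (fun b => 2 * (polyX v b).coeff (expN 0 2)) 0 :=
  expands_of_eq v _ _ _ _ (fun b hb y => by
    obtain ⟨hL, hD⟩ := coeff_l_eq_zero v hb
    simp only [Yd, field]
    rw [pd_poly_L (homDegLE_polyX v hb), hD]
    simp [eL, nc]) fun b hb => abs_mul_coeff_le v hb (by norm_num) (by norm_num) _

/-- The vector field `y_c ∂_i`. -/
def tIdx (c : Fin 2) (i : Fin m) : FieldIdx m := Sum.inl (![Sum.inl i, Sum.inr i] c)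

theorem field_tIdx (c : Fin 2) (i : Fin m) (y : Pt m) : field (tIdx c i) y = nc c y • eT i := by
  fin_cases c <;> rfl

theorem expands_TN (v : XSpace m e) (c : Fin 2) (i : Fin m) :
    Expands e ‖v‖ (Yd (tIdx c i) (wYd e.s (Sum.inr 0) v.fn))
      (fun b => 2 * e.s * (polyX v b).coeff (expT i)) c :=
  expands_of_eq v _ _ _ _ (fun b hb y => by
    rw [Yd, field_tIdx, pd_smul_dir, pd_poly_N (homDegLE_polyX v hb)]
    simp [eT, mul_comm]) fun b hb =>
      abs_mul_coeff_le v hb (by linarith [e.s_pos]) (by linarith [e.s_lt_one]) _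

theorem expands_TL (v : XSpace m e) (c : Fin 2) (i : Fin m) :
    Expands e ‖v‖ (Yd (tIdx c i) (wYd e.s (Sum.inr 1) v.fn)) (fun _ => 0) c :=
  expands_of_eq v _ _ _ _ (fun b hb y => by
    rw [Yd, field_tIdx, pd_smul_dir, pd_poly_L (homDegLE_polyX v hb)]
    simp [eT]) fun b _ => by simp

/-- Nothing of the polynomial survives two tangential derivatives, so these functions are pure error
terms and vanish on P as coefficients. -/
theorem expands_TT (v : XSpace m e) (c d : Fin 2) (i j : Fin m) :
    Expands e ‖v‖ (Yd (tIdx c i) (wYd e.s (tIdx d j) v.fn)) (fun _ => 0) c :=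
  expands_of_eq v _ _ _ _ (fun b hb y => by
    rw [Yd, field_tIdx, pd_smul_dir, tIdx, pd_poly_T (homDegLE_polyX v hb)]
    simp) fun b _ => by simp

end

section

variable {m : ℕ}

open scoped NNReal

variable {e : Exponents}

/-! ### The algebra of coefficients -/

/-- The largest of the distance of two points and their distances to `P`. -/
def sep (y z : Pt m) : ℝ := max (dG y z) (max (rho y) (rho z))

theorem dG_le_sep (y z : Pt m) : dG y z ≤ sep y z := le_max_left _ _

theorem rho_le_sep (y z : Pt m) : rho y ≤ sep y z := (le_max_left _ _).trans (le_max_right _ _)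

theorem rho_le_sep' (y z : Pt m) : rho z ≤ sep y z := (le_max_right _ _).trans (le_max_right _ _)

theorem sep_nonneg (y z : Pt m) : 0 ≤ sep y z := (dG_nonneg y z).trans (dG_le_sep y z)

theorem sep_comm (y z : Pt m) : sep y z = sep z y := by
  unfold sep; rw [dG_comm, max_comm (rho y)]

theorem sep_le_two {y z : Pt m} (hy : y ∈ ball1 m) (hz : z ∈ ball1 m) : sep y z ≤ 2 :=
  max_le (dG_lt_two hy hz).le (max_le (by linarith [rho_lt_one hy]) (by linarith [rho_lt_one hz]))

/-- The modulus of continuity of the coefficients. -/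
def modulus (e : Exponents) (y z : Pt m) : ℝ := dG y z ^ e.ε * sep y z ^ (2 * e.α - e.ε)

theorem modulus_nonneg (y z : Pt m) : 0 ≤ modulus e y z :=
  mul_nonneg (Real.rpow_nonneg (dG_nonneg _ _) _) (Real.rpow_nonneg (sep_nonneg _ _) _)

theorem modulus_comm (y z : Pt m) : modulus e y z = modulus e z y := by
  unfold modulus; rw [dG_comm, sep_comm]

theorem rpow_add_of_nonneg' {x a b : ℝ} (hx : 0 ≤ x) (ha : 0 < a) (hb : 0 < b) :
    x ^ (a + b) = x ^ a * x ^ b := Real.rpow_add_of_nonneg hx ha.le hb.le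

theorem Exponents.gap_pos (e : Exponents) : 0 < 2 * e.α - e.ε := by
  linarith [e.α_pos, e.ε_le_α]

theorem rpow_le_modulus (y z : Pt m) : dG y z ^ (2 * e.α) ≤ modulus e y z := by
  have hd := dG_nonneg y z
  rw [show 2 * e.α = e.ε + (2 * e.α - e.ε) by ring, rpow_add_of_nonneg' hd e.ε_pos e.gap_pos]
  exact mul_le_mul_of_nonneg_left (Real.rpow_le_rpow hd (dG_le_sep y z) e.gap_pos.le)
    (Real.rpow_nonneg hd _)

/-- Write sep·d as d^ε·(sep·d^{1-ε}), which is at most the modulus times sep^{2-2α}; as sep ≤ 2 and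
0 < α < 1, this last power is at most 4. Functions of homogeneous degree two are therefore
admissible coefficients. -/
theorem sep_mul_dG_le {y z : Pt m} (hy : y ∈ ball1 m) (hz : z ∈ ball1 m) :
    sep y z * dG y z ≤ 4 * modulus e y z := by
  have hd := dG_nonneg y z
  have hs := sep_nonneg y z
  have hds := dG_le_sep y z
  have h2 := sep_le_two hy hz
  have hε := e.ε_pos
  have hα1 := e.α_lt_one
  have hεα := e.ε_le_α
  have h1 : dG y z = dG y z ^ e.ε * dG y z ^ (1 - e.ε) := by
    rw [← rpow_add_of_nonneg' hd hε (by linarith)]; simp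
  have h3 : dG y z ^ (1 - e.ε) ≤ sep y z ^ (1 - e.ε) := Real.rpow_le_rpow hd hds (by linarith)
  have h4 : sep y z * sep y z ^ (1 - e.ε) = sep y z ^ (2 * e.α - e.ε) * sep y z ^ (2 - 2 * e.α) := by
    rw [← rpow_add_of_nonneg' hs e.gap_pos (by linarith)]
    nth_rw 1 [← Real.rpow_one (sep y z)]
    rw [← rpow_add_of_nonneg' hs one_pos (by linarith)]
    congr 1; ring
  have h5 : sep y z ^ (2 - 2 * e.α) ≤ 4 := by
    calc sep y z ^ (2 - 2 * e.α) ≤ 2 ^ (2 - 2 * e.α) := Real.rpow_le_rpow hs h2 (by linarith)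
      _ ≤ 2 ^ (2 : ℝ) := Real.rpow_le_rpow_of_exponent_le (by norm_num) (by linarith [e.α_pos])
      _ = 4 := by norm_num
  have hA := Real.rpow_nonneg hd e.ε
  have hB := Real.rpow_nonneg hs (2 * e.α - e.ε)
  calc sep y z * dG y z = sep y z * (dG y z ^ e.ε * dG y z ^ (1 - e.ε)) := by rw [← h1]
    _ = dG y z ^ e.ε * (sep y z * dG y z ^ (1 - e.ε)) := by ring
    _ ≤ dG y z ^ e.ε * (sep y z * sep y z ^ (1 - e.ε)) := by gcongr
    _ = dG y z ^ e.ε * sep y z ^ (2 * e.α - e.ε) * sep y z ^ (2 - 2 * e.α) := by rw [h4]; ring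
    _ ≤ dG y z ^ e.ε * sep y z ^ (2 * e.α - e.ε) * 4 := by gcongr
    _ = _ := by unfold modulus; ring

theorem two_rpow_le : (2 : ℝ) ^ (2 * e.α) ≤ 4 := by
  calc (2 : ℝ) ^ (2 * e.α) ≤ 2 ^ (2 : ℝ) :=
        Real.rpow_le_rpow_of_exponent_le (by norm_num) (by linarith [e.α_lt_one])
    _ = 4 := by norm_num

theorem two_mul_rpow_le {d : ℝ} (hd : 0 ≤ d) : (2 * d) ^ (2 * e.α) ≤ 4 * d ^ (2 * e.α) := by
  rw [Real.mul_rpow (by norm_num) hd]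
  exact mul_le_mul_of_nonneg_right two_rpow_le (Real.rpow_nonneg hd _)

variable (m) in
/-- The local domain together with the points of `P`. -/
abbrev Dom : Type := {y : Pt m // y ∈ dom m ∪ edge m}

theorem not_mem_dom_of_edge {b : Pt m} (hb : b ∈ edge m) : b ∉ dom m := fun h =>
  h.2.1.ne' hb.2.1

theorem Dom.mem_edge {y : Dom m} (h : y.1 ∉ dom m) : y.1 ∈ edge m := y.2.resolve_left h

/-- The modulus of continuity as a function on the domain with its edge. -/
def domMod (e : Exponents) (y z : Dom m) : ℝ≥0 := ⟨modulus e y.1 z.1, modulus_nonneg _ _⟩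

theorem coe_domMod (y z : Dom m) : (domMod e y z : ℝ) = modulus e y.1 z.1 := rfl

section Glue

variable {E : Type}

open Classical in
/-- The function that is `u` on the domain and `k` on `P`. -/
def glue (u k : Pt m → E) (y : Dom m) : E := if y.1 ∈ dom m then u y.1 else k y.1

theorem glue_dom (u k : Pt m → E) {y : Dom m} (h : y.1 ∈ dom m) : glue u k y = u y.1 := if_pos h

theorem glue_edge (u k : Pt m → E) {y : Dom m} (h : y.1 ∈ edge m) : glue u k y = k y.1 :=
  if_neg (not_mem_dom_of_edge h)

end Glue

theorem exists_dom_above {b : Pt m} (hb : b ∈ edge m) {d : ℝ} (hd : 0 < d) (hd2 : d ≤ 2) :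
    ((b.1, d / 100, d / 100) : Pt m) ∈ dom m ∧ dG ((b.1, d / 100, d / 100) : Pt m) b ≤ d / 50 :=
  ⟨mem_dom_of_edge hb (by linarith) (by linarith) (by linarith) (by linarith),
    (dG_above_le hb (by linarith) (by linarith)).trans (by linarith)⟩

section HolData

variable {E : Type} [NormedAddCommGroup E]

/-- Bounds for a function `u` on the domain with values `k` on `P`. -/
structure HolData (e : Exponents) (M : ℝ) (u k : Pt m → E) : Prop where
  holder : ∀ y ∈ dom m, ∀ z ∈ dom m, ‖u y - u z‖ ≤ M * modulus e y z
  near : ∀ y ∈ dom m, ∀ b ∈ edge m, ‖u y - k b‖ ≤ M * dG y b ^ (2 * e.α)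
  bound : ∀ b ∈ edge m, ‖k b‖ ≤ M

theorem HolData.nonneg {M : ℝ} {u k : Pt m → E} (h : HolData e M u k) : 0 ≤ M :=
  (norm_nonneg _).trans (h.bound 0 zero_mem_edge)

theorem HolData.norm_le {M : ℝ} {u k : Pt m → E} (h : HolData e M u k) (y : Dom m) :
    ‖glue u k y‖ ≤ 2 * M := by
  have hM := h.nonneg
  by_cases hy : y.1 ∈ dom m
  · rw [glue_dom _ _ hy]
    have hp := proj_mem_edge hy.1
    have h1 := h.near _ hy _ hp
    have h2 := h.bound _ hp
    rw [dG_proj] at h1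
    have h3 : rho y.1 ^ (2 * e.α) ≤ 1 :=
      Real.rpow_le_one (rho_nonneg _) (rho_lt_one hy.1).le (by linarith [e.α_pos])
    have h4 := norm_add_le (u y.1 - k (proj y.1)) (k (proj y.1))
    rw [sub_add_cancel] at h4
    nlinarith
  · rw [glue_edge _ _ (Dom.mem_edge hy)]
    linarith [h.bound _ (Dom.mem_edge hy)]

/-- Two points of P are compared through a point of the domain above b at a height proportional to
their distance. The factor 5 is 1 + 4, with 4 bounding 2^{2α}. -/
theorem norm_sub_edge_le {M : ℝ} {u k : Pt m → E} (hM : 0 ≤ M)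
    (h : ∀ y ∈ dom m, ∀ b ∈ edge m, ‖u y - k b‖ ≤ M * dG y b ^ (2 * e.α)) {b c : Pt m}
    (hb : b ∈ edge m) (hc : c ∈ edge m) : ‖k b - k c‖ ≤ 5 * M * dG b c ^ (2 * e.α) := by
  have hα := e.α_pos
  rcases eq_or_ne b c with rfl | hne
  · rw [sub_self, norm_zero]
    have := Real.rpow_nonneg (dG_nonneg b b) (2 * e.α)
    positivity
  have hd := dG_pos hne
  obtain ⟨h1, h2⟩ := exists_dom_above hb hd (dG_lt_two hb.1 hc.1).le
  set y : Pt m := (b.1, dG b c / 100, dG b c / 100)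
  have h3 : dG y c ≤ 2 * dG b c := by linarith [dG_triangle y b c]
  have h4 : dG y b ^ (2 * e.α) ≤ dG b c ^ (2 * e.α) :=
    Real.rpow_le_rpow (dG_nonneg _ _) (by linarith) (by linarith)
  have h5 : dG y c ^ (2 * e.α) ≤ 4 * dG b c ^ (2 * e.α) :=
    (Real.rpow_le_rpow (dG_nonneg _ _) h3 (by linarith)).trans (two_mul_rpow_le hd.le)
  calc ‖k b - k c‖ = ‖(u y - k c) - (u y - k b)‖ := by congr 1; abel
    _ ≤ M * dG y c ^ (2 * e.α) + M * dG y b ^ (2 * e.α) :=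
        (_root_.norm_sub_le _ _).trans (add_le_add (h y h1 c hc) (h y h1 b hb))
    _ ≤ M * (4 * dG b c ^ (2 * e.α)) + M * dG b c ^ (2 * e.α) := by gcongr
    _ = _ := by ring

theorem HolData.norm_sub_le {M : ℝ} {u k : Pt m → E} (h : HolData e M u k) (y z : Dom m) :
    ‖glue u k y - glue u k z‖ ≤ 5 * M * domMod e y z := by
  have hM := h.nonneg
  have hmod := modulus_nonneg (e := e) y.1 z.1
  have hrm := rpow_le_modulus (e := e) y.1 z.1
  rw [coe_domMod]
  by_cases hy : y.1 ∈ dom m <;> by_cases hz : z.1 ∈ dom m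
  · rw [glue_dom _ _ hy, glue_dom _ _ hz]
    nlinarith [h.holder _ hy _ hz]
  · rw [glue_dom _ _ hy, glue_edge _ _ (Dom.mem_edge hz)]
    have := h.near _ hy _ (Dom.mem_edge hz)
    have := mul_le_mul_of_nonneg_left hrm hM
    nlinarith
  · rw [glue_dom _ _ hz, glue_edge _ _ (Dom.mem_edge hy), norm_sub_rev]
    have := h.near _ hz _ (Dom.mem_edge hy)
    rw [dG_comm] at this
    have := mul_le_mul_of_nonneg_left hrm hM
    nlinarith
  · rw [glue_edge _ _ (Dom.mem_edge hz), glue_edge _ _ (Dom.mem_edge hy)]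
    have := norm_sub_edge_le hM h.near (Dom.mem_edge hy) (Dom.mem_edge hz)
    exact this.trans (mul_le_mul_of_nonneg_left hrm (by positivity))

variable [NormedSpace ℝ E]

variable (m) in
/-- The spaces of coefficients. -/
abbrev Coef (e : Exponents) (E : Type) [NormedAddCommGroup E] [NormedSpace ℝ E] : Type :=
  Hol (domMod (m := m) e) E

/-- A single coefficient function. -/
def HolData.toCoef {M : ℝ} {u k : Pt m → E} (h : HolData e M u k) : Coef m e E :=
  Hol.mk (glue u k) (2 * M) (5 * M) (by linarith [h.nonneg]) (by linarith [h.nonneg]) h.norm_le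
    h.norm_sub_le

/-- A linear family of coefficient functions. -/
structure HolFamily (e : Exponents) (V : Type) [NormedAddCommGroup V] [NormedSpace ℝ V]
    (m : ℕ) (E : Type) [NormedAddCommGroup E] [NormedSpace ℝ E] where
  u : V → Pt m → E
  k : V → Pt m → E
  C : ℝ
  data : ∀ v, HolData e (C * ‖v‖) (u v) (k v)
  u_comb : ∀ (c d : ℝ) (v w : V), ∀ y ∈ dom m, u (c • v + d • w) y = c • u v y + d • u w y
  k_comb : ∀ (c d : ℝ) (v w : V), ∀ b ∈ edge m, k (c • v + d • w) b = c • k v b + d • k w b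

variable {V : Type} [NormedAddCommGroup V] [NormedSpace ℝ V]

theorem HolFamily.glue_comb (F : HolFamily e V m E) (c d : ℝ) (v w : V) (y : Dom m) :
    glue (F.u (c • v + d • w)) (F.k (c • v + d • w)) y =
      c • glue (F.u v) (F.k v) y + d • glue (F.u w) (F.k w) y := by
  by_cases hy : y.1 ∈ dom m
  · simp only [glue_dom _ _ hy, F.u_comb c d v w _ hy]
  · simp only [glue_edge _ _ (Dom.mem_edge hy), F.k_comb c d v w _ (Dom.mem_edge hy)]

/-- A linear family of coefficient functions as a continuous linear map. -/
def HolFamily.clm (F : HolFamily e V m E) : V →L[ℝ] Coef m e E :=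
  Hol.mkCLM (fun v => glue (F.u v) (F.k v)) (2 * |F.C|) (5 * |F.C|) (by positivity) (by positivity)
    (fun v w y => by simpa using F.glue_comb 1 1 v w y)
    (fun c v y => by simpa using F.glue_comb c 0 v v y)
    (fun v y => ((F.data v).norm_le y).trans (by
      have := mul_le_mul_of_nonneg_right (le_abs_self F.C) (norm_nonneg v)
      linarith))
    (fun v y z => ((F.data v).norm_sub_le y z).trans (by
      have := mul_le_mul_of_nonneg_right (le_abs_self F.C) (norm_nonneg v)
      exact mul_le_mul_of_nonneg_right (by linarith) (NNReal.coe_nonneg _)))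

theorem HolFamily.clm_dom (F : HolFamily e V m E) (v : V) {y : Dom m} (h : y.1 ∈ dom m) :
    F.clm v y = F.u v y.1 := glue_dom _ _ h

theorem HolFamily.clm_edge (F : HolFamily e V m E) (v : V) {y : Dom m} (h : y.1 ∈ edge m) :
    F.clm v y = F.k v y.1 := glue_edge _ _ h

end HolData

end

section

variable {m : ℕ}

open scoped NNReal

variable {e : Exponents}

/-! ### Coefficients of functions that vanish to first order on `P` -/

/-- `R` is of order `1 + 2α` at `P`, with the corresponding Hölder bound. -/
structure EdgeOrder (e : Exponents) (M : ℝ) (R : Pt m → ℝ) : Prop where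
  bound : ∀ y ∈ dom m, |R y| ≤ M * rho y ^ (1 + 2 * e.α)
  holder : ∀ y ∈ dom m, ∀ z ∈ dom m,
    |R y - R z| ≤ M * dG y z ^ e.ε * sep y z ^ (1 + 2 * e.α - e.ε)

theorem abs_nc_le_rho (c : Fin 2) (y : Pt m) : |nc c y| ≤ rho y := by
  fin_cases c
  · exact abs_n_le_rho y
  · exact abs_l_le_rho y

theorem abs_nc_sub_le (c : Fin 2) (y z : Pt m) : |nc c y - nc c z| ≤ dG y z := by
  rw [dG_comm]
  fin_cases c
  · exact abs_sub_n_le z y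
  · exact abs_sub_l_le z y

/-- The factor `y_a / ρ²` by which the coefficient of `y_a` is obtained. -/
def partCoef (a : Fin 2) (y : Pt m) : ℝ := nc a y / rho y ^ 2

theorem abs_partCoef_le (a : Fin 2) {y : Pt m} (hy : y ∈ dom m) : |partCoef a y| ≤ (rho y)⁻¹ := by
  have hr := rho_pos hy
  rw [partCoef, abs_div, abs_of_pos (by positivity : 0 < rho y ^ 2), div_le_iff₀ (by positivity)]
  calc |nc a y| ≤ rho y := abs_nc_le_rho a y
    _ = _ := by field_simp

/-- The factor is homogeneous of degree -1 in the normal variables, so at points of comparable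
height its differences are of size d/ρ². -/
theorem abs_partCoef_sub_le (a : Fin 2) {y z : Pt m} (hy : y ∈ dom m) (hz : z ∈ dom m)
    (hyz : rho y ≤ 2 * rho z) : |partCoef a y - partCoef a z| ≤ 4 * dG y z / rho y ^ 2 := by
  have hr := rho_pos hy
  have hs := rho_pos hz
  have h1 : partCoef a y - partCoef a z = ((nc a y - nc a z) * rho z ^ 2
      + nc a z * (rho z - rho y) * (rho z + rho y)) / (rho y ^ 2 * rho z ^ 2) := by
    unfold partCoef
    field_simp
    ring
  have h2 := abs_nc_sub_le a y z
  have h3 := abs_rho_sub_le y z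
  have h4 := abs_nc_le_rho a z
  rw [h1, abs_div, abs_of_pos (by positivity : 0 < rho y ^ 2 * rho z ^ 2), div_le_div_iff₀
    (by positivity) (by positivity)]
  have h5 : |(nc a y - nc a z) * rho z ^ 2 + nc a z * (rho z - rho y) * (rho z + rho y)|
      ≤ dG y z * rho z ^ 2 + rho z * dG y z * (3 * rho z) := by
    refine (abs_add_le _ _).trans (add_le_add ?_ ?_)
    · rw [abs_mul, abs_of_pos (by positivity : 0 < rho z ^ 2)]
      gcongr
    · rw [abs_mul, abs_mul, abs_of_pos (by positivity : 0 < rho z + rho y)]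
      have := dG_nonneg y z
      gcongr
      linarith
  calc _ ≤ (dG y z * rho z ^ 2 + rho z * dG y z * (3 * rho z)) * rho y ^ 2 := by gcongr
    _ = _ := by ring

theorem EdgeOrder.nonneg {M : ℝ} {R : Pt m → ℝ} (h : EdgeOrder e M R) : 0 ≤ M := by
  have hy := diag_mem_dom (m := m) (t := 1 / 4) (by norm_num) (by norm_num)
  have h1 := (abs_nonneg _).trans (h.bound _ hy)
  exact nonneg_of_mul_nonneg_left h1 (Real.rpow_pos_of_pos (rho_pos hy) _)

/-- Multiplication by y_a/ρ² lowers the order from 1 + 2α to 2α. If the larger height is at most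
twice the distance of the points, the sizes alone suffice; otherwise the heights are comparable and
a product rule applies. -/
theorem EdgeOrder.holData {M : ℝ} {R : Pt m → ℝ} (h : EdgeOrder e M R) (a : Fin 2) :
    HolData e (8 * M) (fun y => R y * partCoef a y) (fun _ => 0) := by
  have hM := h.nonneg
  have hα := e.α_pos
  have hε := e.ε_pos
  have hg := e.gap_pos
  have hb : ∀ y ∈ dom m, |R y * partCoef a y| ≤ M * rho y ^ (2 * e.α) := fun y hy => by
    have hr := rho_pos hy
    rw [abs_mul]
    calc _ ≤ M * rho y ^ (1 + 2 * e.α) * (rho y)⁻¹ := by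
          gcongr
          · exact h.bound y hy
          · exact abs_partCoef_le a hy
      _ = _ := by rw [Real.rpow_add hr, Real.rpow_one]; field_simp
  refine ⟨?_, fun y hy b hb' => ?_, fun b _ => by simpa using hM⟩
  · have main : ∀ y ∈ dom m, ∀ z ∈ dom m, rho z ≤ rho y →
        |R y * partCoef a y - R z * partCoef a z| ≤ 8 * M * modulus e y z := by
      intro y hy z hz hle
      have hr := rho_pos hy
      have hs := rho_pos hz
      have hd := dG_nonneg y z
      rcases le_total (rho y) (2 * dG y z) with hc | hc
      · have h1 : rho y ^ (2 * e.α) ≤ 4 * modulus e y z :=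
          (Real.rpow_le_rpow hr.le hc (by linarith)).trans ((two_mul_rpow_le hd).trans
            (mul_le_mul_of_nonneg_left (rpow_le_modulus y z) (by norm_num)))
        have h2 : rho z ^ (2 * e.α) ≤ rho y ^ (2 * e.α) :=
          Real.rpow_le_rpow hs.le hle (by linarith)
        have h3 := (abs_sub (R y * partCoef a y) (R z * partCoef a z)).trans
          (add_le_add (hb y hy) (hb z hz))
        nlinarith
      -- Here the points are closer to each other than to P, so sep is the height and d/ρ ≤ (d/ρ)^ε.
      · have hzy : rho y ≤ 2 * rho z := by
          have := (abs_le.mp (abs_rho_sub_le y z)).1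
          linarith
        have hsep : sep y z = rho y := by
          unfold sep
          rw [max_eq_left hle, max_eq_right (by linarith)]
        have e1 : R y * partCoef a y - R z * partCoef a z =
            (R y - R z) * partCoef a y + R z * (partCoef a y - partCoef a z) := by ring
        have h1 := h.holder y hy z hz
        have h2 := abs_partCoef_le a hy
        have h3 := abs_partCoef_sub_le a hy hz hzy
        have h4 : |R z| ≤ M * rho y ^ (1 + 2 * e.α) := (h.bound z hz).trans
          (mul_le_mul_of_nonneg_left (Real.rpow_le_rpow hs.le hle (by linarith)) hM)
        have h5 : dG y z / rho y ≤ (dG y z / rho y) ^ e.ε := by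
          have hq0 : 0 ≤ dG y z / rho y := by positivity
          have hq1 : dG y z / rho y ≤ 1 := (div_le_one hr).mpr (by linarith)
          simpa using Real.rpow_le_rpow_of_exponent_ge' hq0 hq1 hε.le e.ε_le_one
        rw [Real.div_rpow hd hr.le] at h5
        have h6 : rho y ^ (2 * e.α) = rho y ^ e.ε * rho y ^ (2 * e.α - e.ε) := by
          rw [← Real.rpow_add hr]; congr 1; ring
        have hp := Real.rpow_pos_of_pos hr e.ε
        have hq := Real.rpow_pos_of_pos hr (2 * e.α - e.ε)
        rw [e1]
        calc _ ≤ |R y - R z| * |partCoef a y| + |R z| * |partCoef a y - partCoef a z| := by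
              rw [← abs_mul, ← abs_mul]; exact abs_add_le _ _
          _ ≤ M * dG y z ^ e.ε * sep y z ^ (1 + 2 * e.α - e.ε) * (rho y)⁻¹
              + M * rho y ^ (1 + 2 * e.α) * (4 * dG y z / rho y ^ 2) := by
              have := Real.rpow_nonneg (sep_nonneg y z) (1 + 2 * e.α - e.ε)
              gcongr
          _ = M * modulus e y z + 4 * M * (rho y ^ (2 * e.α) * (dG y z / rho y)) := by
              unfold modulus
              rw [hsep, show 1 + 2 * e.α - e.ε = 1 + (2 * e.α - e.ε) by ring, Real.rpow_add hr,
                Real.rpow_add hr, Real.rpow_one]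
              field_simp
          _ ≤ M * modulus e y z + 4 * M * (rho y ^ (2 * e.α) * (dG y z ^ e.ε / rho y ^ e.ε)) := by
              gcongr
          _ = M * modulus e y z + 4 * M * modulus e y z := by
              unfold modulus
              rw [hsep, h6]; field_simp
          _ ≤ _ := by nlinarith [mul_nonneg hM (modulus_nonneg (e := e) y z)]
    intro y hy z hz
    rw [Real.norm_eq_abs]
    rcases le_total (rho z) (rho y) with hle | hle
    · exact main y hy z hz hle
    · rw [abs_sub_comm, modulus_comm]
      exact main z hz y hy hle
  · rw [sub_zero, Real.norm_eq_abs]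
    refine (hb y hy).trans ?_
    have h1 : rho y ^ (2 * e.α) ≤ dG y b ^ (2 * e.α) :=
      Real.rpow_le_rpow (rho_nonneg y) (rho_le_dG y (rho_of_mem_edge hb')) (by linarith)
    have := Real.rpow_nonneg (dG_nonneg y b) (2 * e.α)
    nlinarith

/-! ### Functions with an expansion at the points of `P` -/

theorem dG_proj_le_two_mul (y : Pt m) {b : Pt m} (hb : b ∈ edge m) :
    dG (proj y) b ≤ 2 * dG y b := by
  have h1 := dG_triangle (proj y) y b
  rw [dG_comm (proj y) y, dG_proj] at h1
  linarith [rho_le_dG y (rho_of_mem_edge hb)]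

/-- The 1/2-Hölder bound for the projection turns the exponent 2α into (sep·d)^α, which the modulus
dominates precisely because ε ≤ α. The constant is 3²·2. -/
theorem dG_proj_rpow_le (y z : Pt m) :
    dG (proj y) (proj z) ^ (2 * e.α) ≤ 18 * modulus e y z := by
  have hα := e.α_pos
  have hα1 := e.α_lt_one
  have hd := dG_nonneg y z
  have hs := sep_nonneg y z
  have h1 : dG (proj y) (proj z) ≤ 3 * √(2 * sep y z * dG y z) := by
    refine (dG_proj_proj_le y z).trans ?_
    gcongr
    linarith [rho_le_sep y z, dG_le_sep y z]
  have h2 : ∀ a : ℝ, 1 ≤ a → a ^ (2 * e.α) ≤ a ^ 2 := fun a ha => by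
    rw [← Real.rpow_two]
    exact Real.rpow_le_rpow_of_exponent_le ha (by linarith)
  have h3 : (√(2 * sep y z * dG y z)) ^ (2 * e.α) = (2 * sep y z * dG y z) ^ e.α := by
    rw [Real.rpow_mul (Real.sqrt_nonneg _), Real.rpow_two, Real.sq_sqrt (by positivity)]
  have h4 : (2 * sep y z * dG y z) ^ e.α = 2 ^ e.α * (sep y z ^ e.α * dG y z ^ e.α) := by
    rw [Real.mul_rpow (by positivity) hd, Real.mul_rpow (by norm_num) hs, mul_assoc]
  have h5 : (2 : ℝ) ^ e.α ≤ 2 := by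
    simpa using Real.rpow_le_rpow_of_exponent_le (x := 2) (by norm_num) hα1.le
  have h6 : sep y z ^ e.α * dG y z ^ e.α ≤ modulus e y z := by
    rcases eq_or_lt_of_le e.ε_le_α with h | h
    · unfold modulus
      rw [h, show 2 * e.α - e.α = e.α by ring, mul_comm]
    · have e1 : dG y z ^ e.α = dG y z ^ e.ε * dG y z ^ (e.α - e.ε) := by
        rw [← rpow_add_of_nonneg' hd e.ε_pos (by linarith)]; congr 1; ring
      have e2 : sep y z ^ (2 * e.α - e.ε) = sep y z ^ e.α * sep y z ^ (e.α - e.ε) := by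
        rw [← rpow_add_of_nonneg' hs hα (by linarith)]; congr 1; ring
      have e3 : dG y z ^ (e.α - e.ε) ≤ sep y z ^ (e.α - e.ε) :=
        Real.rpow_le_rpow hd (dG_le_sep y z) (by linarith)
      unfold modulus
      rw [e1, e2]
      have hA := Real.rpow_nonneg hs e.α
      have hB := Real.rpow_nonneg hd e.ε
      calc _ = sep y z ^ e.α * dG y z ^ e.ε * dG y z ^ (e.α - e.ε) := by ring
        _ ≤ sep y z ^ e.α * dG y z ^ e.ε * sep y z ^ (e.α - e.ε) := by gcongr
        _ = _ := by ring
  have hnn : 0 ≤ sep y z ^ e.α * dG y z ^ e.α :=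
    mul_nonneg (Real.rpow_nonneg hs _) (Real.rpow_nonneg hd _)
  calc dG (proj y) (proj z) ^ (2 * e.α) ≤ (3 * √(2 * sep y z * dG y z)) ^ (2 * e.α) :=
        Real.rpow_le_rpow (dG_nonneg _ _) h1 (by linarith)
    _ = 3 ^ (2 * e.α) * (2 ^ e.α * (sep y z ^ e.α * dG y z ^ e.α)) := by
        rw [Real.mul_rpow (by norm_num) (Real.sqrt_nonneg _), h3, h4]
    _ ≤ 3 ^ 2 * (2 * (sep y z ^ e.α * dG y z ^ e.α)) := by
        gcongr
        exact h2 3 (by norm_num)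
    _ ≤ 18 * modulus e y z := by linarith

/-- Both expansions are evaluated at one point above a, at height d/100 with d the distance of a and
b. There the leading terms differ by (κ a - κ b) d/100, while the errors are of order d^{1+2α}; the
constant is 9·100. -/
theorem Expands.holder_edge {N : ℝ} {W κ : Pt m → ℝ} {c : Fin 2} (h : Expands e N W κ c)
    (hN : 0 ≤ N) {a b : Pt m} (ha : a ∈ edge m) (hb : b ∈ edge m) :
    |κ a - κ b| ≤ 900 * N * dG a b ^ (2 * e.α) := by
  have hα := e.α_pos
  rcases eq_or_ne a b with rfl | hne
  · rw [sub_self, abs_zero]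
    have := Real.rpow_nonneg (dG_nonneg a a) (2 * e.α)
    positivity
  have hd := dG_pos hne
  obtain ⟨h1, h2⟩ := exists_dom_above ha hd (dG_lt_two ha.1 hb.1).le
  set y : Pt m := (a.1, dG a b / 100, dG a b / 100) with hy
  have hc : nc c y = dG a b / 100 := by fin_cases c <;> rfl
  have h3 := (h.weighted a ha).bound y h1
  have h4 := (h.weighted b hb).bound y h1
  rw [sub_add_cancel] at h3 h4
  have h5 : dG y b ≤ 2 * dG a b := by linarith [dG_triangle y a b]
  have h6 : dG y a ^ (1 + 2 * e.α) ≤ dG a b ^ (1 + 2 * e.α) :=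
    Real.rpow_le_rpow (dG_nonneg _ _) (by linarith) (by linarith)
  have h7 : dG y b ^ (1 + 2 * e.α) ≤ 8 * dG a b ^ (1 + 2 * e.α) := by
    refine (Real.rpow_le_rpow (dG_nonneg _ _) h5 (by linarith)).trans ?_
    rw [Real.rpow_add (by positivity), Real.rpow_add hd, Real.rpow_one, Real.rpow_one]
    nlinarith [two_mul_rpow_le (e := e) hd.le]
  have h8 : |κ a - κ b| * (dG a b / 100) ≤ 9 * N * dG a b ^ (1 + 2 * e.α) := by
    calc |κ a - κ b| * (dG a b / 100) = |(W y - κ b * nc c y) - (W y - κ a * nc c y)| := by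
          nth_rw 1 [← abs_of_pos (by positivity : 0 < dG a b / 100)]
          rw [← abs_mul, hc]
          congr 1; ring
      _ ≤ N * dG y b ^ (1 + 2 * e.α) + N * dG y a ^ (1 + 2 * e.α) :=
          (abs_sub _ _).trans (add_le_add h4 h3)
      _ ≤ N * (8 * dG a b ^ (1 + 2 * e.α)) + N * dG a b ^ (1 + 2 * e.α) := by gcongr
      _ = _ := by ring
  rw [Real.rpow_add hd, Real.rpow_one] at h8
  have h9 : |κ a - κ b| * dG a b ≤ 900 * N * dG a b ^ (2 * e.α) * dG a b := by linarith
  exact le_of_mul_le_mul_right h9 hd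

/-- The leading coefficient, known only on P, is extended constantly in the normal directions. The
constant is 900·18, from the estimate on P and from the projection. -/
theorem Expands.holData {N : ℝ} {W κ : Pt m → ℝ} {c : Fin 2} (h : Expands e N W κ c)
    (hN : 0 ≤ N) : HolData e (16200 * N) (fun y => κ (proj y)) κ where
  holder y hy z hz := by
    have h1 := h.holder_edge hN (proj_mem_edge hy.1) (proj_mem_edge hz.1)
    have h2 := mul_le_mul_of_nonneg_left (dG_proj_rpow_le (e := e) y z) hN
    rw [Real.norm_eq_abs]
    linarith
  near y hy b hb := by
    have h1 := h.holder_edge hN (proj_mem_edge hy.1) hb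
    have h2 : dG (proj y) b ^ (2 * e.α) ≤ 4 * dG y b ^ (2 * e.α) :=
      (Real.rpow_le_rpow (dG_nonneg _ _) (dG_proj_le_two_mul y hb)
        (by linarith [e.α_pos])).trans (two_mul_rpow_le (dG_nonneg _ _))
    have h3 := mul_le_mul_of_nonneg_left h2 hN
    have h4 := mul_nonneg hN (Real.rpow_nonneg (dG_nonneg y b) (2 * e.α))
    rw [Real.norm_eq_abs]
    linarith
  bound b hb := (h.bound b hb).trans (by linarith)

theorem Expands.edgeOrder {N : ℝ} {W κ : Pt m → ℝ} {c : Fin 2} (h : Expands e N W κ c)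
    (hN : 0 ≤ N) : EdgeOrder e (17000 * N) (fun y => W y - κ (proj y) * nc c y) := by
  have hα := e.α_pos
  have hg := e.gap_pos
  refine ⟨fun y hy => ?_, fun y hy z hz => ?_⟩
  · have h1 := (h.weighted _ (proj_mem_edge hy.1)).bound y hy
    rw [sub_add_cancel, dG_proj] at h1
    have := mul_nonneg hN (Real.rpow_nonneg (rho_nonneg y) (1 + 2 * e.α))
    linarith
  · have h1 := (h.weighted _ (proj_mem_edge hy.1)).holder y hy z hz
    have h2 := (h.holData hN).holder y hy z hz
    rw [Real.norm_eq_abs] at h2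
    have hs0 := sep_nonneg y z
    have hs : 0 < sep y z := (rho_pos hy).trans_le (rho_le_sep y z)
    have h3 : max (dG y (proj y)) (dG z (proj y)) ≤ 2 * sep y z := by
      rw [dG_proj]
      refine max_le (by linarith [rho_le_sep y z]) ?_
      have := dG_triangle z y (proj y)
      rw [dG_proj, dG_comm z y] at this
      linarith [rho_le_sep y z, dG_le_sep y z]
    have h4 : max (dG y (proj y)) (dG z (proj y)) ^ (1 + 2 * e.α - e.ε) ≤
        8 * sep y z ^ (1 + 2 * e.α - e.ε) := by
      refine (Real.rpow_le_rpow (le_max_of_le_left (dG_nonneg _ _)) h3 (by linarith)).trans ?_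
      rw [Real.mul_rpow (by norm_num) hs0]
      gcongr
      calc (2 : ℝ) ^ (1 + 2 * e.α - e.ε) ≤ 2 ^ (3 : ℝ) :=
            Real.rpow_le_rpow_of_exponent_le (by norm_num) (by linarith [e.α_lt_one, e.ε_pos])
        _ = 8 := by norm_num
    have h5 : |nc c z| ≤ sep y z := (abs_nc_le_rho c z).trans (rho_le_sep' y z)
    have hA := Real.rpow_nonneg (dG_nonneg y z) e.ε
    have hB := Real.rpow_nonneg hs0 (1 + 2 * e.α - e.ε)
    -- The expansion is frozen at the projection of y; the change of leading coefficient costs the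
    -- modulus times a normal coordinate of size at most sep.
    have e1 : (W y - κ (proj y) * nc c y) - (W z - κ (proj z) * nc c z) =
        ((W y - κ (proj y) * nc c y) - (W z - κ (proj y) * nc c z))
          - (κ (proj y) - κ (proj z)) * nc c z := by ring
    rw [e1]
    calc _ ≤ 5 * N * dG y z ^ e.ε * max (dG y (proj y)) (dG z (proj y)) ^ (1 + 2 * e.α - e.ε)
          + (16200 * N * modulus e y z) * sep y z := by
          refine (abs_sub _ _).trans (add_le_add h1 ?_)
          rw [abs_mul]
          exact mul_le_mul h2 h5 (abs_nonneg _)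
            (mul_nonneg (by positivity) (modulus_nonneg y z))
      _ ≤ 5 * N * dG y z ^ e.ε * (8 * sep y z ^ (1 + 2 * e.α - e.ε))
          + (16200 * N * modulus e y z) * sep y z := by gcongr
      _ = 16240 * N * dG y z ^ e.ε * sep y z ^ (1 + 2 * e.α - e.ε) := by
          unfold modulus
          rw [show 1 + 2 * e.α - e.ε = 1 + (2 * e.α - e.ε) by ring, Real.rpow_add hs, Real.rpow_one]
          ring
      _ ≤ _ := by
          have := mul_nonneg (mul_nonneg hN hA) hB
          nlinarith

/-- A linear family of functions with expansions. -/
structure ExpFamily (e : Exponents) (m : ℕ) where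
  W : XSpace m e → Pt m → ℝ
  κ : XSpace m e → Pt m → ℝ
  c : Fin 2
  expands : ∀ v, Expands e ‖v‖ (W v) (κ v) c
  W_comb : ∀ (r t : ℝ) (v w : XSpace m e), ∀ y ∈ dom m, W (r • v + t • w) y = r * W v y + t * W w y
  κ_comb : ∀ (r t : ℝ) (v w : XSpace m e), ∀ b ∈ edge m, κ (r • v + t • w) b = r * κ v b + t * κ w b

namespace ExpFamily

/-- The leading coefficient. -/
def lead (F : ExpFamily e m) : HolFamily e (XSpace m e) m ℝ where
  u v y := F.κ v (proj y)
  k := F.κ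
  C := 16200
  data v := (F.expands v).holData (norm_nonneg v)
  u_comb r t v w _ hy := F.κ_comb r t v w _ (proj_mem_edge hy.1)
  k_comb := F.κ_comb

/-- The coefficients of the remainder. -/
def rest (F : ExpFamily e m) (a : Fin 2) : HolFamily e (XSpace m e) m ℝ where
  u v y := (F.W v y - F.κ v (proj y) * nc F.c y) * partCoef a y
  k _ _ := 0
  C := 8 * 17000
  data v := by
    have := ((F.expands v).edgeOrder (norm_nonneg v)).holData a
    rwa [← mul_assoc] at this
  u_comb r t v w y hy := by
    rw [F.W_comb r t v w y hy, F.κ_comb r t v w _ (proj_mem_edge hy.1)]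
    simp only [smul_eq_mul]; ring
  k_comb _ _ _ _ _ _ := by simp

/-- The coefficients of `y_n` and `y_{n+1}`. -/
def part (F : ExpFamily e m) (a : Fin 2) : XSpace m e →L[ℝ] Coef m e ℝ :=
  (F.rest a).clm + if a = F.c then F.lead.clm else 0

theorem nc_sq (y : Pt m) : nc 0 y ^ 2 + nc 1 y ^ 2 = rho y ^ 2 := (rho_sq y).symm

theorem sum_partCoef {y : Pt m} (hy : y ∈ dom m) :
    nc 0 y * partCoef 0 y + nc 1 y * partCoef 1 y = 1 := by
  have := rho_pos hy
  unfold partCoef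
  field_simp
  exact nc_sq y

theorem rest_sum (F : ExpFamily e m) (v : XSpace m e) {y : Dom m} (hy : y.1 ∈ dom m) :
    nc 0 y.1 * (F.rest 0).clm v y + nc 1 y.1 * (F.rest 1).clm v y =
      F.W v y.1 - F.κ v (proj y.1) * nc F.c y.1 := by
  rw [HolFamily.clm_dom _ _ hy, HolFamily.clm_dom _ _ hy]
  simp only [rest]
  linear_combination (F.W v y.1 - F.κ v (proj y.1) * nc F.c y.1) * sum_partCoef hy

theorem part_sum (F : ExpFamily e m) (v : XSpace m e) {y : Dom m} (hy : y.1 ∈ dom m) :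
    nc 0 y.1 * F.part 0 v y + nc 1 y.1 * F.part 1 v y = F.W v y.1 := by
  have h := F.rest_sum v hy
  have hl : F.lead.clm v y = F.κ v (proj y.1) := HolFamily.clm_dom _ _ hy
  obtain hc | hc : F.c = 0 ∨ F.c = 1 := by
    generalize F.c = c
    fin_cases c <;> simp
  · simp only [part, hc, if_true, one_ne_zero, if_false, add_zero, add_apply, Hol.add_apply, hl]
    rw [hc] at h
    linarith
  · simp only [part, hc, if_true, zero_ne_one, if_false, add_zero, add_apply, Hol.add_apply, hl]
    rw [hc] at h
    linarith

/-- The coefficient of the variable that does not lead consists of the error term only, and this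
vanishes on P. -/
theorem part_edge (F : ExpFamily e m) {a : Fin 2} (ha : a ≠ F.c) (v : XSpace m e) {y : Dom m}
    (hy : y.1 ∈ edge m) : F.part a v y = 0 := by
  rw [part, if_neg ha, add_zero, HolFamily.clm_edge _ _ hy]
  rfl

end ExpFamily

end

section

variable {m : ℕ}

open scoped NNReal

variable {e : Exponents}

/-! ### Second derivatives -/

theorem Yd_wYd_comb (s r t : ℝ) (k l : FieldIdx m) (v w : XSpace m e) {y : Pt m} (hy : y ∈ dom m) :
    Yd k (wYd s l (r • v + t • w).fn) y = r * Yd k (wYd s l v.fn) y + t * Yd k (wYd s l w.fn) y := by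
  rw [XSpace.fn_comb]
  exact pd_weight_comb hy.2.1 r t _ _ (differentiable_field l).differentiableAt
    (v.mem.contDiff y hy) (w.mem.contDiff y hy)

theorem coeff_polyX_comb (r t : ℝ) (v w : XSpace m e) (b : Pt m) (β : (Fin m ⊕ Fin 2) →₀ ℕ) :
    (polyX (r • v + t • w) b).coeff β = r * (polyX v b).coeff β + t * (polyX w b).coeff β := by
  rw [polyX_comb]
  simp

/-- Families of second derivatives. -/
def famYd (k l : FieldIdx m) (a : ℝ) (β : (Fin m ⊕ Fin 2) →₀ ℕ) (c : Fin 2)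
    (h : ∀ v : XSpace m e, Expands e ‖v‖ (Yd k (wYd e.s l v.fn))
      (fun b => a * (polyX v b).coeff β) c) : ExpFamily e m where
  W v := Yd k (wYd e.s l v.fn)
  κ v b := a * (polyX v b).coeff β
  c := c
  expands := h
  W_comb r t v w _ hy := Yd_wYd_comb e.s r t k l v w hy
  κ_comb r t v w b _ := by rw [coeff_polyX_comb]; ring

variable (e m) in
/-- The family `∂_n (y_n^{1-2s} ∂_n v)`. -/
def famNN : ExpFamily e m := famYd _ _ _ _ _ expands_NN

variable (e m) in
/-- The family `∂_{n+1} (y_n^{1-2s} ∂_n v)`. -/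
def famLN : ExpFamily e m := famYd _ _ _ _ _ expands_LN

variable (e m) in
/-- The family `∂_{n+1} (y_n^{1-2s} ∂_{n+1} v)`. -/
def famLL : ExpFamily e m := famYd _ _ _ _ _ expands_LL

variable (e) in
/-- The families `y_c ∂_i (y_n^{1-2s} ∂_n v)`. -/
def famTN (c : Fin 2) (i : Fin m) : ExpFamily e m := famYd _ _ _ _ _ fun v => expands_TN v c i

variable (e) in
/-- The families `y_c ∂_i (y_n^{1-2s} ∂_{n+1} v)`. -/
def famTL (c : Fin 2) (i : Fin m) : ExpFamily e m :=
  famYd (tIdx c i) (Sum.inr 1) 0 0 c fun v => by simpa using expands_TL v c i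

variable (e) in
/-- The families `y_c ∂_i (y_n^{1-2s} y_d ∂_i v)`. -/
def famTT (c d : Fin 2) (i : Fin m) : ExpFamily e m :=
  famYd (tIdx c i) (tIdx d i) 0 0 c fun v => by simpa using expands_TT v c d i i

variable (e) in
/-- The coefficient `∂_i (y_n^{1-2s} ∂_n v)`. -/
def tnCLM (i : Fin m) : XSpace m e →L[ℝ] Coef m e ℝ :=
  (famTN e 0 i).lead.clm + (((famTN e 0 i).rest 0).clm + ((famTN e 1 i).rest 1).clm)

variable (e) in
/-- The coefficient `∂_i (y_n^{1-2s} ∂_{n+1} v)`. -/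
def tlCLM (i : Fin m) : XSpace m e →L[ℝ] Coef m e ℝ :=
  ((famTL e 0 i).rest 0).clm + ((famTL e 1 i).rest 1).clm

/-- The norm controls y_n ∂_i and y_{n+1} ∂_i of the flux but not ∂_i itself. Both products have the
same leading coefficient, and weighting them with y_n/ρ² and y_{n+1}/ρ² recovers the bare derivative
because these weights times the coordinates sum to 1. -/
theorem tnCLM_dom (i : Fin m) (v : XSpace m e) {y : Dom m} (hy : y.1 ∈ dom m) :
    tnCLM e i v y = pd (eT i) (fluxN e.s v.fn) y.1 := by
  have h0 : (famTN e 0 i).W v y.1 = nc 0 y.1 * pd (eT i) (fluxN e.s v.fn) y.1 := by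
    rw [← pd_smul_dir, ← field_tIdx]; rfl
  have h1 : (famTN e 1 i).W v y.1 = nc 1 y.1 * pd (eT i) (fluxN e.s v.fn) y.1 := by
    rw [← pd_smul_dir, ← field_tIdx]; rfl
  have hl : (famTN e 0 i).lead.clm v y = (famTN e 0 i).κ v (proj y.1) := HolFamily.clm_dom _ _ hy
  have hr0 : ((famTN e 0 i).rest 0).clm v y = ((famTN e 0 i).W v y.1
    - (famTN e 0 i).κ v (proj y.1) * nc 0 y.1) * partCoef 0 y.1 := HolFamily.clm_dom _ _ hy
  have hr1 : ((famTN e 1 i).rest 1).clm v y = ((famTN e 1 i).W v y.1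
    - (famTN e 0 i).κ v (proj y.1) * nc 1 y.1) * partCoef 1 y.1 := HolFamily.clm_dom _ _ hy
  simp only [tnCLM, add_apply, Hol.add_apply, hl, hr0, hr1, h0, h1]
  linear_combination (pd (eT i) (fluxN e.s v.fn) y.1 - (famTN e 0 i).κ v (proj y.1)) *
    ExpFamily.sum_partCoef hy

theorem tlCLM_dom (i : Fin m) (v : XSpace m e) {y : Dom m} (hy : y.1 ∈ dom m) :
    tlCLM e i v y = pd (eT i) (wYd e.s (Sum.inr 1) v.fn) y.1 := by
  have h0 : (famTL e 0 i).W v y.1 = nc 0 y.1 * pd (eT i) (wYd e.s (Sum.inr 1) v.fn) y.1 := by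
    rw [← pd_smul_dir, ← field_tIdx]; rfl
  have h1 : (famTL e 1 i).W v y.1 = nc 1 y.1 * pd (eT i) (wYd e.s (Sum.inr 1) v.fn) y.1 := by
    rw [← pd_smul_dir, ← field_tIdx]; rfl
  have hr0 : ((famTL e 0 i).rest 0).clm v y = ((famTL e 0 i).W v y.1
    - 0 * (polyX v (proj y.1)).coeff 0 * nc 0 y.1) * partCoef 0 y.1 := HolFamily.clm_dom _ _ hy
  have hr1 : ((famTL e 1 i).rest 1).clm v y = ((famTL e 1 i).W v y.1
    - 0 * (polyX v (proj y.1)).coeff 0 * nc 1 y.1) * partCoef 1 y.1 := HolFamily.clm_dom _ _ hy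
  simp only [tlCLM, add_apply, Hol.add_apply, hr0, hr1, h0, h1]
  linear_combination pd (eT i) (wYd e.s (Sum.inr 1) v.fn) y.1 * ExpFamily.sum_partCoef hy

theorem tlCLM_edge (i : Fin m) (v : XSpace m e) {y : Dom m} (hy : y.1 ∈ edge m) :
    tlCLM e i v y = 0 := by
  simp only [tlCLM, add_apply, Hol.add_apply, HolFamily.clm_edge _ _ hy]
  exact add_zero _

variable (e) in
/-- The coefficient of `y_a` in `y_c y_d y_n^{1-2s} ∂_{ii} v`. -/
def ttCLM (c d a : Fin 2) (i : Fin m) : XSpace m e →L[ℝ] Coef m e ℝ := ((famTT e c d i).rest a).clm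

theorem ttCLM_edge (c d a : Fin 2) (i : Fin m) (v : XSpace m e) {y : Dom m} (hy : y.1 ∈ edge m) :
    ttCLM e c d a i v y = 0 := HolFamily.clm_edge _ _ hy

theorem ttCLM_sum (c d : Fin 2) (i : Fin m) (v : XSpace m e) {y : Dom m} (hy : y.1 ∈ dom m) :
    nc 0 y.1 * ttCLM e c d 0 i v y + nc 1 y.1 * ttCLM e c d 1 i v y =
      Yd (tIdx c i) (wYd e.s (tIdx d i) v.fn) y.1 := by
  have h := (famTT e c d i).rest_sum v hy
  have h0 : (famTT e c d i).κ v (proj y.1) = 0 := zero_mul _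
  rw [h0, zero_mul, sub_zero] at h
  exact h

/-! ### First derivatives -/

/-- The height of y is at most its distance to b, so sep is this distance and the two powers
combine. -/
theorem modulus_edge (y : Pt m) {b : Pt m} (hb : b ∈ edge m) :
    modulus e y b = dG y b ^ (2 * e.α) := by
  have h : sep y b = dG y b := by
    have h1 := rho_le_dG y (rho_of_mem_edge hb)
    unfold sep
    rw [rho_of_mem_edge hb, max_eq_left (rho_nonneg y), max_eq_left h1]
  unfold modulus
  rw [h, ← rpow_add_of_nonneg' (dG_nonneg _ _) e.ε_pos e.gap_pos]
  congr 1; ring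

theorem abs_coord_le (x : EuclideanSpace ℝ (Fin m)) (i : Fin m) : |x i| ≤ ‖x‖ := by
  simpa using PiLp.norm_apply_le x i

theorem norm_tangential_le_sep (y z : Pt m) : ‖y.1 - z.1‖ ≤ 2 * (sep y z * dG y z) := by
  have h := norm_tangential_le z y
  rw [dG_comm] at h
  have := rho_le_sep' y z
  have := dG_le_sep y z
  have := dG_nonneg y z
  nlinarith

theorem abs_sq_sub_le (c : Fin 2) (y z : Pt m) :
    |nc c y ^ 2 - nc c z ^ 2| ≤ 2 * (sep y z * dG y z) := by
  have h1 := abs_nc_sub_le c y z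
  have h2 := (abs_nc_le_rho c y).trans (rho_le_sep y z)
  have h3 := (abs_nc_le_rho c z).trans (rho_le_sep' y z)
  rw [show nc c y ^ 2 - nc c z ^ 2 = (nc c y + nc c z) * (nc c y - nc c z) by ring, abs_mul]
  calc _ ≤ (sep y z + sep y z) * dG y z := by
        have := sep_nonneg y z
        gcongr
        exact (abs_add_le _ _).trans (add_le_add h2 h3)
    _ = _ := by ring

theorem norm_le_one_of_edge {b : Pt m} (hb : b ∈ edge m) : ‖b.1‖ ≤ 1 := by
  have h := norm_tangential_le 0 b
  rw [rho_zero, zero_add, dG_comm] at h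
  have h1 : dG b 0 < 1 := hb.1.1
  have h2 := dG_nonneg b 0
  simp only [Prod.fst_zero, sub_zero] at h
  nlinarith

theorem abs_sum_coeff_le (p : Poly m) (x : EuclideanSpace ℝ (Fin m)) :
    |∑ i, p.coeff (expT i) * x i| ≤ coeffNorm p * ‖x‖ := by
  refine (Finset.abs_sum_le_sum_abs _ _).trans ?_
  refine le_trans (Finset.sum_le_sum (g := fun i => |p.coeff (expT i)| * ‖x‖) fun i _ => ?_) ?_
  · rw [abs_mul]
    exact mul_le_mul_of_nonneg_left (abs_coord_le x i) (abs_nonneg _)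
  · rw [← Finset.sum_mul]
    exact mul_le_mul_of_nonneg_right (sum_abs_coeff_expT_le p) (norm_nonneg _)

/-- The polynomial part of `y_n^{1-2s} ∂_n v`. -/
def fluxPoly (v : XSpace m e) (b y : Pt m) : ℝ :=
  2 * e.s * pev (polyX v b) y + 2 * (polyX v b).coeff (expN 2 0) * y.2.1 ^ 2

/-- The polynomial part has weighted degree two: its tangential part and its two squares contribute
4, 8 and 4 to the constant. -/
theorem abs_fluxPoly_sub_le (v : XSpace m e) {b : Pt m} (hb : b ∈ edge m) (y z : Pt m) :
    |fluxPoly v b y - fluxPoly v b z| ≤ 16 * ‖v‖ * (sep y z * dG y z) := by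
  have hs := e.s_pos
  have hs1 := e.s_lt_one
  have hN := norm_nonneg v
  have hc := coeffNorm_le v hb
  set X := sep y z * dG y z with hX
  have hX0 : 0 ≤ X := mul_nonneg (sep_nonneg _ _) (dG_nonneg _ _)
  have hA := (abs_coeff_le (polyX v b) (expN 2 0)).trans hc
  have hB := (abs_coeff_le (polyX v b) (expN 0 2)).trans hc
  have e1 : fluxPoly v b y - fluxPoly v b z =
      2 * e.s * ∑ i, (polyX v b).coeff (expT i) * (y.1 - z.1) i
      + ((2 * e.s + 2) * (polyX v b).coeff (expN 2 0) * (nc 0 y ^ 2 - nc 0 z ^ 2)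
      + 2 * e.s * (polyX v b).coeff (expN 0 2) * (nc 1 y ^ 2 - nc 1 z ^ 2)) := by
    unfold fluxPoly
    rw [pev_polyX v hb, pev_polyX v hb]
    simp only [PiLp.sub_apply, mul_sub, Finset.sum_sub_distrib, nc, Matrix.cons_val_zero,
      Matrix.cons_val_one]
    ring
  have t1 : |2 * e.s * ∑ i, (polyX v b).coeff (expT i) * (y.1 - z.1) i| ≤ 2 * (‖v‖ * (2 * X)) := by
    rw [abs_mul, abs_of_pos (by positivity : 0 < 2 * e.s)]
    refine mul_le_mul (by linarith) ((abs_sum_coeff_le _ _).trans ?_) (abs_nonneg _) (by norm_num)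
    exact mul_le_mul hc (norm_tangential_le_sep y z) (norm_nonneg _) hN
  have t2 : |(2 * e.s + 2) * (polyX v b).coeff (expN 2 0) * (nc 0 y ^ 2 - nc 0 z ^ 2)|
      ≤ 4 * ‖v‖ * (2 * X) := by
    rw [abs_mul, abs_mul, abs_of_pos (by positivity : 0 < 2 * e.s + 2)]
    have := abs_sq_sub_le 0 y z
    gcongr
    linarith
  have t3 : |2 * e.s * (polyX v b).coeff (expN 0 2) * (nc 1 y ^ 2 - nc 1 z ^ 2)|
      ≤ 2 * ‖v‖ * (2 * X) := by
    rw [abs_mul, abs_mul, abs_of_pos (by positivity : 0 < 2 * e.s)]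
    have := abs_sq_sub_le 1 y z
    gcongr
    linarith
  rw [e1]
  refine (abs_add_le _ _).trans ?_
  have := (abs_add_le ((2 * e.s + 2) * (polyX v b).coeff (expN 2 0) * (nc 0 y ^ 2 - nc 0 z ^ 2))
    (2 * e.s * (polyX v b).coeff (expN 0 2) * (nc 1 y ^ 2 - nc 1 z ^ 2)))
  linarith

theorem max_dG_proj_le (y z : Pt m) : max (dG y (proj y)) (dG z (proj y)) ≤ 2 * sep y z := by
  rw [dG_proj]
  refine max_le (by linarith [rho_le_sep y z, sep_nonneg y z]) ?_
  have := dG_triangle z y (proj y)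
  rw [dG_proj, dG_comm z y] at this
  linarith [rho_le_sep y z, dG_le_sep y z]

theorem two_rpow_gap_le : (2 : ℝ) ^ (2 * e.α - e.ε) ≤ 4 := by
  calc (2 : ℝ) ^ (2 * e.α - e.ε) ≤ 2 ^ (2 : ℝ) :=
        Real.rpow_le_rpow_of_exponent_le (by norm_num) (by linarith [e.α_lt_one, e.ε_pos])
    _ = 4 := by norm_num

/-- About the projection of y the flux is a polynomial of weighted degree two plus an error of order
2 + 2α. The error is two orders better than required, and the superfluous power of sep is absorbed
by the diameter of the ball. -/
theorem holData_fluxN (v : XSpace m e) :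
    HolData e (500 * ‖v‖) (fluxN e.s v.fn) (fun b => 2 * e.s * pev (polyX v b) b) := by
  have hs := e.s_pos
  have hs1 := e.s_lt_one
  have hN := norm_nonneg v
  have hα := e.α_pos
  have hg := e.gap_pos
  have hT : ∀ b ∈ edge m, WeightedHolder e.ε b (2 + 2 * e.α - e.ε) ‖v‖
      (fun y => fluxN e.s v.fn y - fluxPoly v b y) := fun b hb =>
    (weightedHolder_n v hb).congr fun y hy => expand_n v hb hy
  refine ⟨fun y hy z hz => ?_, fun y hy b hb => ?_, fun b hb => ?_⟩
  · have hb := proj_mem_edge hy.1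
    have h1 := (hT _ hb).holder y hy z hz
    have h2 := abs_fluxPoly_sub_le v hb y z
    have h3 := sep_mul_dG_le (e := e) hy.1 hz.1
    have hs0 := sep_nonneg y z
    have h4 : max (dG y (proj y)) (dG z (proj y)) ^ (2 + 2 * e.α - e.ε) ≤
        64 * sep y z ^ (2 * e.α - e.ε) := by
      calc _ ≤ (2 * sep y z) ^ (2 + 2 * e.α - e.ε) := Real.rpow_le_rpow
            (le_max_of_le_left (dG_nonneg _ _)) (max_dG_proj_le y z) (by linarith)
        _ = (2 * sep y z) ^ 2 * (2 ^ (2 * e.α - e.ε) * sep y z ^ (2 * e.α - e.ε)) := by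
            rw [show 2 + 2 * e.α - e.ε = 2 + (2 * e.α - e.ε) by ring,
              rpow_add_of_nonneg' (by positivity) two_pos hg, Real.rpow_two,
              Real.mul_rpow (by norm_num) hs0]
        _ ≤ (2 * 2) ^ 2 * (4 * sep y z ^ (2 * e.α - e.ε)) := by
            gcongr
            · exact sep_le_two hy.1 hz.1
            · exact two_rpow_gap_le
        _ = _ := by ring
    have h5 : 5 * ‖v‖ * dG y z ^ e.ε * max (dG y (proj y)) (dG z (proj y)) ^ (2 + 2 * e.α - e.ε)
        ≤ 320 * ‖v‖ * modulus e y z := by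
      have := Real.rpow_nonneg (dG_nonneg y z) e.ε
      calc _ ≤ 5 * ‖v‖ * dG y z ^ e.ε * (64 * sep y z ^ (2 * e.α - e.ε)) := by gcongr
        _ = _ := by unfold modulus; ring
    have h6 : |fluxN e.s v.fn y - fluxN e.s v.fn z| ≤
        |(fluxN e.s v.fn y - fluxPoly v (proj y) y) - (fluxN e.s v.fn z - fluxPoly v (proj y) z)|
          + |fluxPoly v (proj y) y - fluxPoly v (proj y) z| := by
      refine le_trans (le_of_eq ?_) (abs_add_le _ _)
      congr 1; ring
    have h7 := mul_nonneg hN (modulus_nonneg (e := e) y z)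
    rw [Real.norm_eq_abs]
    have h8 := mul_le_mul_of_nonneg_left h3 hN
    linarith
  · have h1 := (hT _ hb).bound y hy
    have h2 := abs_fluxPoly_sub_le v hb y b
    have h3 := sep_mul_dG_le (e := e) hy.1 hb.1
    rw [modulus_edge y hb] at h3
    have hd := dG_edge_pos hy hb
    have hb0 : fluxPoly v b b = 2 * e.s * pev (polyX v b) b := by
      unfold fluxPoly
      rw [hb.2.1]; ring
    rw [sub_add_cancel, Real.rpow_add hd, Real.rpow_two] at h1
    have h4 : dG y b ^ 2 ≤ 4 := by nlinarith [dG_lt_two hy.1 hb.1]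
    have hp := Real.rpow_pos_of_pos hd (2 * e.α)
    have h5 : ‖v‖ * (dG y b ^ 2 * dG y b ^ (2 * e.α)) ≤ ‖v‖ * (4 * dG y b ^ (2 * e.α)) := by
      gcongr
    have h6 : |fluxN e.s v.fn y - fluxPoly v b b| ≤ |fluxN e.s v.fn y - fluxPoly v b y|
        + |fluxPoly v b y - fluxPoly v b b| := abs_sub_le _ _ _
    rw [Real.norm_eq_abs, ← hb0]
    have h8 := mul_le_mul_of_nonneg_left h3 hN
    have h9 := mul_nonneg hN hp.le
    linarith
  · have hc := coeffNorm_le v hb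
    rw [Real.norm_eq_abs, abs_mul, abs_of_pos (by positivity : 0 < 2 * e.s), pev_polyX v hb, hb.2.1,
      hb.2.2]
    have h1 := (abs_coeff_le (polyX v b) (expN 0 0)).trans hc
    have h2 := (abs_sum_coeff_le (polyX v b) b.1).trans (mul_le_mul hc (norm_le_one_of_edge hb)
      (norm_nonneg _) hN)
    have h3 := abs_add_le ((polyX v b).coeff (expN 0 0)) (∑ i, (polyX v b).coeff (expT i) * b.1 i)
    have e0 : (polyX v b).coeff (expN 0 0) + ∑ i, (polyX v b).coeff (expT i) * b.1 i
      + (polyX v b).coeff (expN 2 0) * 0 ^ 2 + (polyX v b).coeff (expN 0 2) * 0 ^ 2 =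
      (polyX v b).coeff (expN 0 0) + ∑ i, (polyX v b).coeff (expT i) * b.1 i := by ring
    rw [e0]
    nlinarith [abs_nonneg ((polyX v b).coeff (expN 0 0) + ∑ i, (polyX v b).coeff (expT i) * b.1 i)]

theorem holData_l (v : XSpace m e) :
    HolData e (21 * ‖v‖) (fun y => y.2.2⁻¹ * y.2.1 ^ (-(2 * e.s)) * pd eL v.fn y)
      (fun b => 2 * (polyX v b).coeff (expN 0 2)) := by
  have hN := norm_nonneg v
  have hα := e.α_pos
  have hg := e.gap_pos
  have hT : ∀ b ∈ edge m, WeightedHolder e.ε b (2 * e.α - e.ε) ‖v‖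
      (fun y => y.2.2⁻¹ * y.2.1 ^ (-(2 * e.s)) * pd eL v.fn y
        - 2 * (polyX v b).coeff (expN 0 2)) := fun b hb =>
    (weightedHolder_l v hb).congr fun y hy => expand_l v hb hy
  refine ⟨fun y hy z hz => ?_, fun y hy b hb => ?_, fun b hb => ?_⟩
  · have hb := proj_mem_edge hy.1
    have h1 := (hT _ hb).holder y hy z hz
    have hs0 := sep_nonneg y z
    have h4 : max (dG y (proj y)) (dG z (proj y)) ^ (2 * e.α - e.ε) ≤
        4 * sep y z ^ (2 * e.α - e.ε) := by
      refine (Real.rpow_le_rpow (le_max_of_le_left (dG_nonneg _ _)) (max_dG_proj_le y z)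
        hg.le).trans ?_
      rw [Real.mul_rpow (by norm_num) hs0]
      have := two_rpow_gap_le (e := e)
      gcongr
    have h5 : 5 * ‖v‖ * dG y z ^ e.ε * max (dG y (proj y)) (dG z (proj y)) ^ (2 * e.α - e.ε)
        ≤ 20 * ‖v‖ * modulus e y z := by
      have := Real.rpow_nonneg (dG_nonneg y z) e.ε
      calc _ ≤ 5 * ‖v‖ * dG y z ^ e.ε * (4 * sep y z ^ (2 * e.α - e.ε)) := by gcongr
        _ = _ := by unfold modulus; ring
    have h7 := mul_nonneg hN (modulus_nonneg (e := e) y z)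
    rw [sub_sub_sub_cancel_right] at h1
    rw [Real.norm_eq_abs]
    linarith
  · have h1 := (hT _ hb).bound y hy
    rw [sub_add_cancel] at h1
    have h9 := mul_nonneg hN (Real.rpow_nonneg (dG_nonneg y b) (2 * e.α))
    rw [Real.norm_eq_abs]
    linarith
  · have h1 := (abs_coeff_le (polyX v b) (expN 0 2)).trans (coeffNorm_le v hb)
    rw [Real.norm_eq_abs, abs_mul, abs_two]
    linarith

theorem pd_fn_comb (r t : ℝ) (v w : XSpace m e) (d : Pt m) {y : Pt m} (hy : y ∈ dom m) :
    pd d (r • v + t • w).fn y = r * pd d v.fn y + t * pd d w.fn y := by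
  rw [XSpace.fn_comb]
  exact pd_comb d r t (differentiableAt_of_C2 (v.mem.contDiff y hy))
    (differentiableAt_of_C2 (w.mem.contDiff y hy))

variable (e m) in
/-- The coefficient `y_n^{1-2s} ∂_n v`. -/
def famFlux : HolFamily e (XSpace m e) m ℝ where
  u v := fluxN e.s v.fn
  k v b := 2 * e.s * pev (polyX v b) b
  C := 500
  data := holData_fluxN
  u_comb r t v w y hy := by
    simp only [fluxN, pd_fn_comb r t v w _ hy, smul_eq_mul]; ring
  k_comb r t v w b _ := by
    rw [polyX_comb, pev_comb]; simp only [smul_eq_mul]; ring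

variable (e m) in
/-- The coefficient `y_n^{-2s} y_{n+1}^{-1} ∂_{n+1} v`. -/
def famB : HolFamily e (XSpace m e) m ℝ where
  u v y := y.2.2⁻¹ * y.2.1 ^ (-(2 * e.s)) * pd eL v.fn y
  k v b := 2 * (polyX v b).coeff (expN 0 2)
  C := 21
  data := holData_l
  u_comb r t v w y hy := by
    simp only [pd_fn_comb r t v w _ hy, smul_eq_mul]; ring
  k_comb r t v w b _ := by
    rw [coeff_polyX_comb]; simp only [smul_eq_mul]; ring

/-! ### Coordinates -/

/-- Weights of homogeneous degree two are coefficients that vanish on P, since ρ² ≤ ρ^{2α} inside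
the unit ball. -/
theorem holData_of_quadratic {C : ℝ} (hC : 0 ≤ C) {u : Pt m → ℝ}
    (h : ∀ y ∈ dom m, ∀ z ∈ dom m, |u y - u z| ≤ C * (sep y z * dG y z))
    (h2 : ∀ y ∈ dom m, |u y| ≤ C * rho y ^ 2) : HolData e (4 * C) u (fun _ => 0) where
  holder y hy z hz := by
    have := mul_le_mul_of_nonneg_left (sep_mul_dG_le (e := e) hy.1 hz.1) hC
    rw [Real.norm_eq_abs]
    linarith [h y hy z hz]
  near y hy b hb := by
    have h1 : rho y ^ 2 ≤ rho y ^ (2 * e.α) := by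
      rw [← Real.rpow_two]
      exact Real.rpow_le_rpow_of_exponent_ge (rho_pos hy) (rho_lt_one hy.1).le
        (by linarith [e.α_lt_one])
    have h3 : rho y ^ (2 * e.α) ≤ dG y b ^ (2 * e.α) :=
      Real.rpow_le_rpow (rho_nonneg y) (rho_le_dG y (rho_of_mem_edge hb)) (by linarith [e.α_pos])
    have h4 := mul_le_mul_of_nonneg_left (h1.trans h3) hC
    have h5 := mul_nonneg hC (Real.rpow_nonneg (dG_nonneg y b) (2 * e.α))
    rw [sub_zero, Real.norm_eq_abs]
    linarith [h2 y hy]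
  bound b _ := by simpa using hC

theorem abs_mul_sub_mul_le {a b c d A B P Q : ℝ} (ha : |a| ≤ A) (hd : |d| ≤ B) (hP : |a - b| ≤ P)
    (hQ : |c - d| ≤ Q) : |a * c - b * d| ≤ A * Q + B * P := by
  rw [show a * c - b * d = a * (c - d) + d * (a - b) by ring]
  refine (abs_add_le _ _).trans ?_
  rw [abs_mul, abs_mul]
  exact add_le_add (mul_le_mul ha hQ (abs_nonneg _) ((abs_nonneg _).trans ha))
    (mul_le_mul hd hP (abs_nonneg _) ((abs_nonneg _).trans hd))

theorem abs_nc_mul_sub_le (c d : Fin 2) (y z : Pt m) :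
    |nc c y * nc d y - nc c z * nc d z| ≤ 2 * (sep y z * dG y z) := by
  have := abs_mul_sub_mul_le ((abs_nc_le_rho c y).trans (rho_le_sep y z))
    ((abs_nc_le_rho d z).trans (rho_le_sep' y z)) (abs_nc_sub_le c y z) (abs_nc_sub_le d y z)
  linarith

variable (e m) in
/-- The coefficient `y_n y_{n+1}`. -/
def prodCoef : Coef m e ℝ :=
  (holData_of_quadratic (e := e) (C := 2) zero_le_two
    (u := fun y : Pt m => nc 0 y * nc 1 y) (fun y _ z _ => abs_nc_mul_sub_le 0 1 y z) fun y _ => by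
      rw [abs_mul]
      have h1 := abs_nc_le_rho 0 y
      have h2 := abs_nc_le_rho 1 y
      nlinarith [abs_nonneg (nc 0 y), abs_nonneg (nc 1 y)]).toCoef

/-- By Bernoulli's inequality and a^p ≤ a on (0, 1], powers with exponent at least 1 are Lipschitz
there. It is applied with p = 3 - 2s, which exceeds 1 because s < 1. -/
theorem abs_rpow_sub_le {a b p : ℝ} (ha : 0 < a) (hb : 0 < b) (ha1 : a ≤ 1) (hb1 : b ≤ 1)
    (hp : 1 ≤ p) (hp4 : p ≤ 4) : |a ^ p - b ^ p| ≤ 4 * |a - b| := by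
  have key : ∀ a b : ℝ, 0 < a → 0 < b → a ≤ 1 → b ≤ a → |a ^ p - b ^ p| ≤ 4 * |a - b| := by
    intro a b ha hb ha1 hba
    have h := rpow_mul_rpow_sub_le hb.le hba one_pos le_rfl (by linarith : 0 < p) hp4
    rw [Real.rpow_one, Real.rpow_one] at h
    have h0 : b ^ p ≤ a ^ p := Real.rpow_le_rpow hb.le hba (by linarith)
    rw [abs_of_nonneg (sub_nonneg.mpr h0), abs_of_nonneg (sub_nonneg.mpr hba)]
    have h1 : 1 - (b / a) ^ p ≤ p * (1 - b / a) := by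
      have := one_add_mul_self_le_rpow_one_add (s := b / a - 1) (by
        have : 0 ≤ b / a := by positivity
        linarith) hp
      rw [show 1 + (b / a - 1) = b / a by ring] at this
      linarith
    rw [Real.div_rpow hb.le ha.le] at h1
    have hap := Real.rpow_pos_of_pos ha p
    have h2 : a ^ p - b ^ p ≤ p * (a ^ p * (1 - b / a)) := by
      have := mul_le_mul_of_nonneg_left h1 hap.le
      rw [mul_sub, mul_div_cancel₀ _ hap.ne'] at this
      linarith
    have h3 : a ^ p ≤ a := by
      simpa using Real.rpow_le_rpow_of_exponent_ge ha ha1 hp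
    have h4 : 0 ≤ 1 - b / a := sub_nonneg.mpr ((div_le_one ha).mpr hba)
    have h5 : a ^ p * (1 - b / a) ≤ a * (1 - b / a) := mul_le_mul_of_nonneg_right h3 h4
    have h6 : a * (1 - b / a) = a - b := by field_simp
    have h7 : 0 ≤ a ^ p * (1 - b / a) := mul_nonneg hap.le h4
    nlinarith
  rcases le_total b a with h | h
  · exact key a b ha hb ha1 h
  · rw [abs_sub_comm, abs_sub_comm a]
    exact key b a hb ha hb1 h

variable (e m) in
/-- The coefficient `y_d y_{n+1}^2 y_n^{3-2s}`. -/
def weightCoef (d : Fin 2) : Coef m e ℝ :=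
  (holData_of_quadratic (e := e) (C := 10) (by norm_num)
    (u := fun y : Pt m => nc d y * nc 1 y * (nc 1 y * y.2.1 ^ (3 - 2 * e.s)))
    (fun y hy z hz => by
      have hs := e.s_pos
      have hs1 := e.s_lt_one
      have hy1 := (rho_lt_one hy.1).le
      have hz1 := (rho_lt_one hz.1).le
      have hyn : y.2.1 ≤ 1 := (le_abs_self _).trans ((abs_n_le_rho y).trans hy1)
      have hzn : z.2.1 ≤ 1 := (le_abs_self _).trans ((abs_n_le_rho z).trans hz1)
      have h1 : |y.2.1 ^ (3 - 2 * e.s) - z.2.1 ^ (3 - 2 * e.s)| ≤ 4 * dG y z :=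
        (abs_rpow_sub_le hy.2.1 hz.2.1 hyn hzn (by linarith) (by linarith)).trans
          (mul_le_mul_of_nonneg_left (abs_nc_sub_le 0 y z) (by norm_num))
      have h2 : |z.2.1 ^ (3 - 2 * e.s)| ≤ 1 := by
        rw [abs_of_nonneg (Real.rpow_nonneg hz.2.1.le _)]
        exact Real.rpow_le_one hz.2.1.le hzn (by linarith)
      have h3 := abs_mul_sub_mul_le ((abs_nc_le_rho 1 y).trans (rho_le_sep y z)) h2
        (abs_nc_sub_le 1 y z) h1
      have h4 := abs_nc_mul_sub_le d 1 y z
      have hs0 := sep_nonneg y z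
      have hs2 := sep_le_two hy.1 hz.1
      have hd := dG_nonneg y z
      have h5 : |nc d y * nc 1 y| ≤ sep y z * 1 := by
        rw [abs_mul]
        exact mul_le_mul ((abs_nc_le_rho d y).trans (rho_le_sep y z))
          ((abs_nc_le_rho 1 y).trans hy1) (abs_nonneg _) hs0
      have h6 : |nc 1 z * z.2.1 ^ (3 - 2 * e.s)| ≤ 1 := by
        rw [abs_mul]
        exact mul_le_one₀ ((abs_nc_le_rho 1 z).trans hz1) (abs_nonneg _) h2
      have h3' : |nc 1 y * y.2.1 ^ (3 - 2 * e.s) - nc 1 z * z.2.1 ^ (3 - 2 * e.s)| ≤ 8 * dG y z := by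
        have h8 : |nc 1 y| ≤ 1 := (abs_nc_le_rho 1 y).trans hy1
        have := abs_mul_sub_mul_le h8 h2 (abs_nc_sub_le 1 y z) h1
        linarith
      have := abs_mul_sub_mul_le h5 h6 h4 h3'
      nlinarith [mul_nonneg hs0 hd]) fun y hy => by
      have hs := e.s_pos
      have hs1 := e.s_lt_one
      have hy1 := (rho_lt_one hy.1).le
      have hyn : y.2.1 ≤ 1 := (le_abs_self _).trans ((abs_n_le_rho y).trans hy1)
      have h2 : |y.2.1 ^ (3 - 2 * e.s)| ≤ 1 := by
        rw [abs_of_nonneg (Real.rpow_nonneg hy.2.1.le _)]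
        exact Real.rpow_le_one hy.2.1.le hyn (by linarith)
      have h6 : |nc 1 y * y.2.1 ^ (3 - 2 * e.s)| ≤ 1 := by
        rw [abs_mul]
        exact mul_le_one₀ ((abs_nc_le_rho 1 y).trans hy1) (abs_nonneg _) h2
      have h7 : |nc d y * nc 1 y| ≤ rho y * rho y := by
        rw [abs_mul]
        exact mul_le_mul (abs_nc_le_rho d y) (abs_nc_le_rho 1 y) (abs_nonneg _) (rho_nonneg y)
      rw [abs_mul]
      nlinarith [mul_le_mul h7 h6 (abs_nonneg _) (mul_self_nonneg _), sq_nonneg (rho y)]).toCoef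

theorem holData_tangential :
    HolData e 8 (fun y : Pt m => ((y.1, 0, 0) : Pt m)) (fun y => (y.1, 0, 0)) where
  holder y hy z hz := by
    have h1 := norm_tangential_le_sep y z
    have h2 := sep_mul_dG_le (e := e) hy.1 hz.1
    simp only [Prod.mk_sub_mk, sub_zero, Prod.norm_def, norm_zero, max_self]
    exact max_le (by linarith) (by linarith [modulus_nonneg (e := e) y z])
  near y hy b hb := by
    have h1 := norm_tangential_le_sep y b
    have h2 := sep_mul_dG_le (e := e) hy.1 hb.1
    rw [modulus_edge y hb] at h2
    simp only [Prod.mk_sub_mk, sub_zero, Prod.norm_def, norm_zero, max_self]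
    exact max_le (by linarith) (by linarith [Real.rpow_nonneg (dG_nonneg y b) (2 * e.α)])
  bound b hb := by
    simp only [Prod.norm_def, norm_zero, max_self]
    exact max_le ((norm_le_one_of_edge hb).trans (by norm_num)) (by norm_num)

variable (e m) in
/-- The point `(y'', 0, 0)` as a coefficient. -/
def projCoef : Coef m e (Pt m) := (holData_tangential (e := e)).toCoef

end

section

variable {m : ℕ}

open scoped NNReal

variable {e : Exponents}

/-! ### Functions with prescribed coefficients in `Y_{α,ε}` -/

open Classical in
/-- The value of a coefficient at a point. -/
def ev (u : Coef m e ℝ) (y : Pt m) : ℝ := if h : y ∈ dom m ∪ edge m then u ⟨y, h⟩ else 0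

theorem ev_eq (u : Coef m e ℝ) (y : Dom m) : ev u y.1 = u y := dif_pos y.2

theorem ev_comb (r t : ℝ) (u v : Coef m e ℝ) (y : Pt m) :
    ev (r • u + t • v) y = r * ev u y + t * ev v y := by
  unfold ev
  split_ifs <;> simp

theorem abs_ev_le (u : Coef m e ℝ) (y : Pt m) : |ev u y| ≤ ‖u‖ := by
  unfold ev
  split_ifs with h
  · exact Hol.norm_apply_le u _
  · simp

theorem abs_ev_sub_le (u : Coef m e ℝ) {y z : Pt m} (hy : y ∈ dom m ∪ edge m)
    (hz : z ∈ dom m ∪ edge m) : |ev u y - ev u z| ≤ ‖u‖ * modulus e y z := by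
  rw [ev, dif_pos hy, ev, dif_pos hz]
  exact Hol.norm_sub_le u _ _

/-- The function `y_n γ₀ + y_{n+1} (γ₁ - γ₁ ∘ π)`. -/
def pairFun (γ : Coef m e ℝ × Coef m e ℝ) (y : Pt m) : ℝ :=
  -- Subtracting the value on P removes the y_{n+1}-term of the expansion for every γ, so the map
  -- into Y is linear on all pairs. For the functional the subtracted value is zero.
  y.2.1 * ev γ.1 y + y.2.2 * (ev γ.2 y - ev γ.2 (proj y))

/-- The function `y_{n+1}^{1-2s} (y_n γ₀ + y_{n+1} (γ₁ - γ₁ ∘ π))`, extended by zero. -/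
def psiFun (γ : Coef m e ℝ × Coef m e ℝ) : Pt m → ℝ :=
  (dom m).indicator fun y => y.2.2 ^ (1 - 2 * e.s) * pairFun γ y

/-- The remainder of the first order expansion of `pairFun` at a point of `P`. -/
def pairRem (γ : Coef m e ℝ × Coef m e ℝ) (b y : Pt m) : ℝ := pairFun γ y - ev γ.1 b * y.2.1

theorem pairFun_comb (r t : ℝ) (γ η : Coef m e ℝ × Coef m e ℝ) (y : Pt m) :
    pairFun (r • γ + t • η) y = r * pairFun γ y + t * pairFun η y := by
  simp only [pairFun, Prod.fst_add, Prod.snd_add, Prod.smul_fst, Prod.smul_snd, ev_comb]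
  ring

theorem abs_pairFun_le (γ : Coef m e ℝ × Coef m e ℝ) (y : Pt m) :
    |pairFun γ y| ≤ 3 * ‖γ‖ * rho y := by
  have h1 := (abs_ev_le γ.1 y).trans (norm_fst_le γ)
  have h2 : |ev γ.2 y - ev γ.2 (proj y)| ≤ 2 * ‖γ‖ := by
    refine (abs_sub _ _).trans ?_
    have := norm_snd_le γ
    linarith [abs_ev_le γ.2 y, abs_ev_le γ.2 (proj y)]
  unfold pairFun
  refine (abs_add_le _ _).trans ?_
  rw [abs_mul, abs_mul]
  have h3 := mul_le_mul (abs_n_le_rho y) h1 (abs_nonneg _) (rho_nonneg y)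
  have h4 := mul_le_mul (abs_l_le_rho y) h2 (abs_nonneg _) (rho_nonneg y)
  linarith

theorem abs_ev_sub_edge_le (u : Coef m e ℝ) {y b : Pt m} (hy : y ∈ dom m) (hb : b ∈ edge m) :
    |ev u y - ev u b| ≤ ‖u‖ * dG y b ^ (2 * e.α) := by
  rw [← modulus_edge y hb]
  exact abs_ev_sub_le u (Or.inl hy) (Or.inr hb)

theorem abs_ev_sub_proj_le (u : Coef m e ℝ) {y b : Pt m} (hy : y ∈ dom m) (hb : b ∈ edge m) :
    |ev u y - ev u (proj y)| ≤ ‖u‖ * dG y b ^ (2 * e.α) := by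
  refine (abs_ev_sub_edge_le u hy (proj_mem_edge hy.1)).trans
    (mul_le_mul_of_nonneg_left ?_ (norm_nonneg _))
  rw [dG_proj]
  exact Real.rpow_le_rpow (rho_nonneg _) (rho_le_dG y (rho_of_mem_edge hb)) (by linarith [e.α_pos])

/-- Each normal coordinate is at most the distance to b and multiplies a difference of coefficient
values of order 2α; that makes order 1 + 2α. -/
theorem abs_pairRem_le (γ : Coef m e ℝ × Coef m e ℝ) {b y : Pt m} (hb : b ∈ edge m)
    (hy : y ∈ dom m) : |pairRem γ b y| ≤ 2 * ‖γ‖ * dG y b ^ (1 + 2 * e.α) := by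
  have hd := dG_edge_pos hy hb
  have h1 := (abs_ev_sub_edge_le γ.1 hy hb).trans (mul_le_mul_of_nonneg_right (norm_fst_le γ)
    (Real.rpow_nonneg hd.le _))
  have h2 := (abs_ev_sub_proj_le γ.2 hy hb).trans (mul_le_mul_of_nonneg_right (norm_snd_le γ)
    (Real.rpow_nonneg hd.le _))
  have e1 : pairRem γ b y =
      y.2.1 * (ev γ.1 y - ev γ.1 b) + y.2.2 * (ev γ.2 y - ev γ.2 (proj y)) := by
    unfold pairRem pairFun; ring
  rw [e1, Real.rpow_add hd, Real.rpow_one]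
  refine (abs_add_le _ _).trans ?_
  rw [abs_mul, abs_mul]
  have h3 := mul_le_mul (n_le_dG y hb) h1 (abs_nonneg _) hd.le
  have h4 := mul_le_mul (l_le_dG y hb) h2 (abs_nonneg _) hd.le
  linarith

/-- A product rule with the larger distance D to b in place of sep. The y_n-term contributes 4 + 2.
The y_{n+1}-term contributes 76 + 2, where 76 = 4 + 18·4 includes the cost of projecting both points
onto P. -/
theorem abs_pairRem_sub_le (γ : Coef m e ℝ × Coef m e ℝ) {b y z : Pt m} (hb : b ∈ edge m)
    (hy : y ∈ dom m) (hz : z ∈ dom m) : |pairRem γ b y - pairRem γ b z| ≤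
      84 * ‖γ‖ * dG y z ^ e.ε * max (dG y b) (dG z b) ^ (1 + 2 * e.α - e.ε) := by
  have hα := e.α_pos
  have hε := e.ε_pos
  have hg := e.gap_pos
  have hG := norm_nonneg γ
  set D := max (dG y b) (dG z b) with hD
  have hyD : dG y b ≤ D := le_max_left _ _
  have hzD : dG z b ≤ D := le_max_right _ _
  have hD0 : 0 < D := (dG_edge_pos hy hb).trans_le hyD
  have hd := dG_nonneg y z
  have hdD : dG y z ≤ 2 * D := by
    have := dG_triangle y b z
    rw [dG_comm b z] at this
    linarith
  have hsep : sep y z ≤ 2 * D := max_le hdD (max_le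
    ((rho_le_dG y (rho_of_mem_edge hb)).trans (by linarith))
    ((rho_le_dG z (rho_of_mem_edge hb)).trans (by linarith)))
  set Z := dG y z ^ e.ε * D ^ (2 * e.α - e.ε) with hZ
  have hde := Real.rpow_nonneg hd e.ε
  have hDg := Real.rpow_pos_of_pos hD0 (2 * e.α - e.ε)
  have hmod : modulus e y z ≤ 4 * Z := by
    unfold modulus
    calc dG y z ^ e.ε * sep y z ^ (2 * e.α - e.ε)
        ≤ dG y z ^ e.ε * (4 * D ^ (2 * e.α - e.ε)) := by
          refine mul_le_mul_of_nonneg_left ?_ hde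
          refine (Real.rpow_le_rpow (sep_nonneg _ _) hsep hg.le).trans ?_
          rw [Real.mul_rpow (by norm_num) hD0.le]
          exact mul_le_mul_of_nonneg_right two_rpow_gap_le hDg.le
      _ = _ := by rw [hZ]; ring
  have hdZ : dG y z * D ^ (2 * e.α) ≤ 2 * (D * Z) := by
    have e1 : dG y z ≤ dG y z ^ e.ε * (2 * D ^ (1 - e.ε)) := by
      rcases hd.eq_or_lt with h | h
      · rw [← h]; positivity
      have h1 : dG y z = dG y z ^ e.ε * dG y z ^ (1 - e.ε) := by
        rw [← Real.rpow_add h]; simp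
      have h2 : dG y z ^ (1 - e.ε) ≤ 2 * D ^ (1 - e.ε) := by
        refine (Real.rpow_le_rpow hd hdD (by linarith [e.ε_le_one])).trans ?_
        rw [Real.mul_rpow (by norm_num) hD0.le]
        refine mul_le_mul_of_nonneg_right ?_ (Real.rpow_nonneg hD0.le _)
        simpa using Real.rpow_le_rpow_of_exponent_le (x := 2) (by norm_num)
          (by linarith : 1 - e.ε ≤ 1)
      calc dG y z = dG y z ^ e.ε * dG y z ^ (1 - e.ε) := h1
        _ ≤ _ := mul_le_mul_of_nonneg_left h2 hde
    have e2 : D ^ (1 - e.ε) * D ^ (2 * e.α) = D * D ^ (2 * e.α - e.ε) := by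
      nth_rw 3 [← Real.rpow_one D]
      rw [← Real.rpow_add hD0, ← Real.rpow_add hD0]; congr 1; ring
    calc dG y z * D ^ (2 * e.α) ≤ dG y z ^ e.ε * (2 * D ^ (1 - e.ε)) * D ^ (2 * e.α) :=
          mul_le_mul_of_nonneg_right e1 (Real.rpow_nonneg hD0.le _)
      _ = 2 * dG y z ^ e.ε * (D ^ (1 - e.ε) * D ^ (2 * e.α)) := by ring
      _ = _ := by rw [e2, hZ]; ring
  have hpz : dG z b ^ (2 * e.α) ≤ D ^ (2 * e.α) :=
    Real.rpow_le_rpow (dG_nonneg _ _) hzD (by linarith)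
  have a1 : |ev γ.1 z - ev γ.1 b| ≤ ‖γ‖ * D ^ (2 * e.α) :=
    (abs_ev_sub_edge_le γ.1 hz hb).trans (mul_le_mul (norm_fst_le γ) hpz
      (Real.rpow_nonneg (dG_nonneg _ _) _) hG)
  have a2 : |ev γ.2 z - ev γ.2 (proj z)| ≤ ‖γ‖ * D ^ (2 * e.α) :=
    (abs_ev_sub_proj_le γ.2 hz hb).trans (mul_le_mul (norm_snd_le γ) hpz
      (Real.rpow_nonneg (dG_nonneg _ _) _) hG)
  have b1 : |(ev γ.1 y - ev γ.1 b) - (ev γ.1 z - ev γ.1 b)| ≤ ‖γ‖ * (4 * Z) := by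
    rw [sub_sub_sub_cancel_right]
    exact (abs_ev_sub_le γ.1 (Or.inl hy) (Or.inl hz)).trans
      (mul_le_mul (norm_fst_le γ) hmod (modulus_nonneg _ _) hG)
  have b2 : |(ev γ.2 y - ev γ.2 (proj y)) - (ev γ.2 z - ev γ.2 (proj z))| ≤ ‖γ‖ * (76 * Z) := by
    have h1 := (abs_ev_sub_le γ.2 (Or.inl hy) (Or.inl hz)).trans
      (mul_le_mul (norm_snd_le γ) hmod (modulus_nonneg _ _) hG)
    have h2 := abs_ev_sub_le γ.2 (Or.inr (proj_mem_edge hy.1)) (Or.inr (proj_mem_edge hz.1))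
    rw [modulus_edge _ (proj_mem_edge hz.1)] at h2
    have h3 := h2.trans (mul_le_mul (norm_snd_le γ)
      ((dG_proj_rpow_le (e := e) y z).trans (mul_le_mul_of_nonneg_left hmod (by norm_num)))
      (Real.rpow_nonneg (dG_nonneg _ _) _) hG)
    rw [show (ev γ.2 y - ev γ.2 (proj y)) - (ev γ.2 z - ev γ.2 (proj z)) =
      (ev γ.2 y - ev γ.2 z) - (ev γ.2 (proj y) - ev γ.2 (proj z)) by ring]
    refine (abs_sub _ _).trans ?_
    linarith
  have c1 := abs_mul_sub_mul_le ((n_le_dG y hb).trans hyD) a1 (abs_nc_sub_le 0 y z) b1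
  have c2 := abs_mul_sub_mul_le ((l_le_dG y hb).trans hyD) a2 (abs_nc_sub_le 1 y z) b2
  have e3 : D ^ (1 + 2 * e.α - e.ε) = D * D ^ (2 * e.α - e.ε) := by
    rw [show 1 + 2 * e.α - e.ε = 1 + (2 * e.α - e.ε) by ring, Real.rpow_add hD0, Real.rpow_one]
  have e1 : pairRem γ b y - pairRem γ b z =
      (y.2.1 * (ev γ.1 y - ev γ.1 b) - z.2.1 * (ev γ.1 z - ev γ.1 b))
      + (y.2.2 * (ev γ.2 y - ev γ.2 (proj y)) - z.2.2 * (ev γ.2 z - ev γ.2 (proj z))) := by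
    unfold pairRem pairFun; ring
  rw [e1]
  refine (abs_add_le _ _).trans ?_
  have h6 : 84 * ‖γ‖ * dG y z ^ e.ε * D ^ (1 + 2 * e.α - e.ε) = 84 * (‖γ‖ * (D * Z)) := by
    rw [e3, hZ]; ring
  rw [h6]
  simp only [nc, Matrix.cons_val_zero, Matrix.cons_val_one] at c1 c2
  have h7 := mul_le_mul_of_nonneg_left hdZ hG
  linarith

/-- The converse of `WeightedHolder.of_smallNear`: an order bound together with a weighted
difference bound gives an ordinary Hölder bound after division by the weight. The size bound pays
for the variation of the weight. -/
theorem abs_weight_sub_le {ε β A B : ℝ} (hε : 0 < ε) (hε1 : ε ≤ 1) (hβ : 0 < β) (hβ4 : β ≤ 4)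
    (hA : 0 ≤ A) {b : Pt m} (hb : b ∈ edge m) {T : Pt m → ℝ}
    (h1 : ∀ y ∈ dom m, |T y| ≤ A * dG y b ^ (β + ε))
    (h2 : ∀ y ∈ dom m, ∀ z ∈ dom m,
      |T y - T z| ≤ B * dG y z ^ ε * max (dG y b) (dG z b) ^ β) {y z : Pt m} (hy : y ∈ dom m)
    (hz : z ∈ dom m) :
    |dG y b ^ (-β) * T y - dG z b ^ (-β) * T z| ≤ (B + 4 * A) * dG y z ^ ε := by
  have main : ∀ y ∈ dom m, ∀ z ∈ dom m, dG z b ≤ dG y b →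
      |dG y b ^ (-β) * T y - dG z b ^ (-β) * T z| ≤ (B + 4 * A) * dG y z ^ ε := by
    intro y hy z hz hle
    have hdz := dG_edge_pos hz hb
    have hd := dG_edge_pos hy hb
    have hp := Real.rpow_pos_of_pos hd β
    have hq := Real.rpow_pos_of_pos hdz β
    have t2 := h2 y hy z hz
    rw [max_eq_left hle] at t2
    have t1 := h1 z hz
    rw [Real.rpow_add hdz] at t1
    have h0 : 0 ≤ dG y b ^ β - dG z b ^ β := sub_nonneg.mpr (Real.rpow_le_rpow hdz.le hle hβ.le)
    have h3 := rpow_mul_rpow_sub_le hdz.le hle hε hε1 hβ hβ4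
    have h4 : (dG y b - dG z b) ^ ε ≤ dG y z ^ ε := Real.rpow_le_rpow (sub_nonneg.mpr hle)
      ((le_abs_self _).trans (abs_dG_sub_le y z b)) hε.le
    have h5 := h3.trans (mul_le_mul_of_nonneg_left h4 (by positivity))
    have e1 : dG y b ^ (-β) * T y - dG z b ^ (-β) * T z =
        (T y - T z) / dG y b ^ β
          - T z * (dG y b ^ β - dG z b ^ β) / (dG y b ^ β * dG z b ^ β) := by
      rw [Real.rpow_neg hd.le, Real.rpow_neg hdz.le]
      field_simp
      ring
    rw [e1]
    refine (abs_sub _ _).trans ?_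
    rw [add_mul]
    refine add_le_add ?_ ?_
    · rw [abs_div, abs_of_pos hp, div_le_iff₀ hp]
      exact t2
    · rw [abs_div, abs_mul, abs_of_nonneg h0, abs_of_pos (mul_pos hp hq),
        div_le_iff₀ (mul_pos hp hq)]
      calc |T z| * (dG y b ^ β - dG z b ^ β)
          ≤ A * (dG z b ^ β * dG z b ^ ε) * (dG y b ^ β - dG z b ^ β) := by gcongr
        _ = A * dG z b ^ β * (dG z b ^ ε * (dG y b ^ β - dG z b ^ β)) := by ring
        _ ≤ A * dG z b ^ β * (4 * dG y b ^ β * dG y z ^ ε) := by gcongr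
        _ = _ := by ring
  rcases le_total (dG z b) (dG y b) with hle | hle
  · exact main y hy z hz hle
  · rw [abs_sub_comm, dG_comm y z]
    exact main z hz y hy hle

/-- The polynomial `c y_n`. -/
def polyN (c : ℝ) : Poly m := MvPolynomial.monomial (expN 1 0) c

theorem pev_polyN (c : ℝ) (y : Pt m) : pev (polyN c) y = c * y.2.1 := by
  simp [pev, polyN, eval_monomial_expN]

theorem homDegLE_polyN (c : ℝ) : HomDegLE 1 (polyN (m := m) c) := by
  classical
  intro β hβ
  rw [polyN, MvPolynomial.coeff_monomial] at hβ
  split_ifs at hβ with h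
  · subst h
    simp [expN_inl, expN_zero, expN_one]
  · exact absurd rfl hβ

theorem coeffNorm_polyN (c : ℝ) : coeffNorm (polyN (m := m) c) = |c| := by
  rw [coeffNorm_eq (S := {expN 1 0}) (by unfold polyN; exact MvPolynomial.support_monomial_subset)]
  simp [polyN]

theorem coeff_polyN (c : ℝ) : (polyN (m := m) c).coeff (Finsupp.single (Sum.inr 1) 1) = 0 := by
  classical
  rw [polyN, MvPolynomial.coeff_monomial, if_neg]
  intro h
  have := DFunLike.congr_fun h (Sum.inr 0)
  rw [expN_zero] at this
  simp at this

theorem quotY_psiFun (γ : Coef m e ℝ × Coef m e ℝ) {y : Pt m} (hy : y ∈ dom m) :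
    quotY e.s (psiFun γ) y = pairFun γ y := by
  have h1 : y.2.2 ^ (2 * e.s - 1) * y.2.2 ^ (1 - 2 * e.s) = 1 := by
    rw [← Real.rpow_add hy.2.2]; simp
  rw [quotY, psiFun, indicator_of_mem hy, ← mul_assoc, h1, one_mul]

theorem isApprox_psiFun (γ : Coef m e ℝ × Coef m e ℝ) {b : Pt m} (hb : b ∈ edge m) :
    IsApprox 1 e.α (quotY e.s (psiFun γ)) b (polyN (ev γ.1 b)) :=
  ⟨homDegLE_polyN _, 2 * ‖γ‖, fun y hy _ => by
    rw [quotY_psiFun γ hy, pev_polyN, Nat.cast_one]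
    exact abs_pairRem_le γ hb hy⟩

theorem homY_psiFun_le (γ : Coef m e ℝ × Coef m e ℝ) {b : Pt m} (hb : b ∈ edge m) :
    homY e b (psiFun γ) (polyN (ev γ.1 b)) ≤ ENNReal.ofReal (92 * ‖γ‖) := by
  have hα := e.α_pos
  have hg := e.gap_pos
  refine holderSemi_le_of fun y hy z hz => ?_
  have e1 : ∀ y ∈ dom m, y.2.2 ^ (2 * e.s - 1) *
      (psiFun γ y - y.2.2 ^ (1 - 2 * e.s) * pev (polyN (ev γ.1 b)) y) = pairRem γ b y := by
    intro y hy
    have h1 : y.2.2 ^ (2 * e.s - 1) * y.2.2 ^ (1 - 2 * e.s) = 1 := by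
      rw [← Real.rpow_add hy.2.2]; simp
    rw [psiFun, indicator_of_mem hy, pev_polyN, ← mul_sub, ← mul_assoc, h1, one_mul]
    rfl
  rw [e1 y hy, e1 z hz]
  have := abs_weight_sub_le (β := 1 + 2 * e.α - e.ε) (A := 2 * ‖γ‖) (B := 84 * ‖γ‖) e.ε_pos
    e.ε_le_one (by linarith)
    (by linarith [e.α_lt_one, e.ε_pos]) (by positivity) hb
    (fun y hy => by rw [sub_add_cancel]; exact abs_pairRem_le γ hb hy)
    (fun y hy z hz => abs_pairRem_sub_le γ hb hy hz) hy hz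
  refine this.trans (le_of_eq ?_)
  ring

/-- The approximating polynomial at b is ev γ.1 b · y_n. Its coefficient contributes 1, and the
Hölder term 84 + 4·2 = 92. -/
theorem eNormY_psiFun_le (γ : Coef m e ℝ × Coef m e ℝ) :
    eNormY e (psiFun γ) ≤ ENNReal.ofReal (93 * ‖γ‖) := by
  refine (iInf_le _ (⟨fun b => polyN (ev γ.1 b), fun b hb => isApprox_psiFun γ hb⟩ :
    FamY e (psiFun γ))).trans ?_
  rw [show 93 * ‖γ‖ = 92 * ‖γ‖ + ‖γ‖ by ring, ENNReal.ofReal_add (by positivity) (norm_nonneg _)]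
  refine add_le_add (iSup₂_le fun b hb => homY_psiFun_le γ hb) (iSup₂_le fun b _ => ?_)
  rw [coeffNorm_polyN]
  exact ENNReal.ofReal_le_ofReal ((abs_ev_le _ _).trans (norm_fst_le γ))

theorem continuous_rho : Continuous (rho (m := m)) := by
  unfold rho; fun_prop

theorem memY_psiFun (γ : Coef m e ℝ × Coef m e ℝ) : MemY e (psiFun γ) where
  zero_off y hy := indicator_of_notMem hy _
  approx b hb := ⟨_, isApprox_psiFun γ hb, coeff_polyN _⟩
  vanish b hb := by
    have hlim : Tendsto (fun y => 3 * ‖γ‖ * rho y) (𝓝[dom m] b) (𝓝 0) := by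
      have := ((continuous_rho (m := m)).const_mul (3 * ‖γ‖)).tendsto b
      rw [rho_of_mem_edge hb, mul_zero] at this
      exact this.mono_left nhdsWithin_le_nhds
    refine squeeze_zero_norm' ?_ hlim
    filter_upwards [self_mem_nhdsWithin] with y hy
    rw [quotY_psiFun γ hy]
    exact abs_pairFun_le γ y
  finite := (eNormY_psiFun_le γ).trans_lt ENNReal.ofReal_lt_top

variable (e m) in
/-- The function with prescribed coefficients as an element of `Y_{α,ε}`. -/
def psiCLM : Coef m e ℝ × Coef m e ℝ →L[ℝ] YSpace m e :=
  LinearMap.mkContinuous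
    { toFun := fun γ => (⟨psiFun γ, memY_psiFun γ⟩ : YSubmodule m e)
      map_add' := fun γ η => by
        refine Subtype.ext (funext fun y => ?_)
        have h := pairFun_comb 1 1 γ η y
        rw [one_smul, one_smul, one_mul, one_mul] at h
        change psiFun (γ + η) y = psiFun γ y + psiFun η y
        by_cases hy : y ∈ dom m
        · simp only [psiFun, indicator_of_mem hy, h, mul_add]
        · simp only [psiFun, indicator_of_notMem hy, add_zero]
      map_smul' := fun c γ => by
        refine Subtype.ext (funext fun y => ?_)
        have h := pairFun_comb c 0 γ γ y
        rw [zero_smul, add_zero, zero_mul, add_zero] at h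
        change psiFun (c • γ) y = c * psiFun γ y
        by_cases hy : y ∈ dom m
        · simp only [psiFun, indicator_of_mem hy, h, mul_left_comm]
        · simp only [psiFun, indicator_of_notMem hy, mul_zero] } 93 fun γ => by
    have h := ENNReal.toReal_mono ENNReal.ofReal_ne_top (eNormY_psiFun_le γ)
    rw [ENNReal.toReal_ofReal (by positivity)] at h
    exact h

theorem psiCLM_fn (γ : Coef m e ℝ × Coef m e ℝ) : (psiCLM m e γ).fn = psiFun γ := rfl

end

/-! ### The model solution and its norm -/

section

variable {m : ℕ}

open scoped NNReal

variable {e : Exponents}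

theorem supNorm_eq_zero {u : Pt m → ℝ} (h : ∀ y ∈ dom m, u y = 0) : supNorm u = 0 := by
  simp only [supNorm, ENNReal.iSup_eq_zero]
  intro y hy
  rw [h y hy]; simp

theorem holderSemi_eq_zero {ε : ℝ} {u : Pt m → ℝ} (h : ∀ y ∈ dom m, u y = 0) :
    holderSemi ε u = 0 := by
  simp only [holderSemi, ENNReal.iSup_eq_zero]
  intro y hy z hz
  rw [h y hy, h z hz]; simp

/-- Vanishing on the domain suffices since the domain is open, so derivatives do not see the cut-off
outside. -/
theorem homX_eq_zero {b : Pt m} {h : Pt m → ℝ} (hh : ∀ y ∈ dom m, h y = 0) :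
    homX e b h = 0 := by
  have h1 : ∀ w : Pt m, ∀ y ∈ dom m, pd w h y = 0 := fun w y hy => by
    rw [pd_congr (v := fun _ => 0) (by filter_upwards [isOpen_dom.mem_nhds hy] with z hz
                                       exact hh z hz), pd_zero]
  have h2 : ∀ k l, ∀ y ∈ dom m,
      Yd k (fun z => z.2.1 ^ (1 - 2 * e.s) * Yd l h z) y = 0 := fun k l y hy => by
    rw [Yd, pd_congr (v := fun _ => 0) (by filter_upwards [isOpen_dom.mem_nhds hy] with z hz
                                           rw [Yd, h1 _ z hz, mul_zero]), pd_zero]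
  unfold homX
  rw [supNorm_eq_zero fun y hy => by rw [hh y hy, mul_zero],
    holderSemi_eq_zero fun y hy => by rw [h1 _ y hy, mul_zero],
    holderSemi_eq_zero fun y hy => by rw [h1 _ y hy, mul_zero],
    Finset.sum_eq_zero fun i _ => holderSemi_eq_zero fun y hy => by rw [h1 _ y hy, mul_zero],
    Finset.sum_eq_zero fun k _ => Finset.sum_eq_zero fun l _ => holderSemi_eq_zero fun y hy => by
      rw [h2 k l y hy, mul_zero]]
  simp

variable (m) in
/-- The polynomial `y_n^{-2s} v₀` for the model solution `v₀`. -/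
def modelPoly (s : ℝ) : Poly m :=
  MvPolynomial.monomial (expN 2 0) (-(s / (s + 1))) + MvPolynomial.monomial (expN 0 2) 1

theorem pev_modelPoly (s : ℝ) (y : Pt m) :
    pev (modelPoly m s) y = -(s / (s + 1)) * y.2.1 ^ 2 + y.2.2 ^ 2 := by
  simp [pev, modelPoly, eval_monomial_expN]

theorem coeff_modelPoly (s : ℝ) (β : (Fin m ⊕ Fin 2) →₀ ℕ) : (modelPoly m s).coeff β =
    (if expN 2 0 = β then -(s / (s + 1)) else 0) + (if expN 0 2 = β then 1 else 0) := by
  classical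
  rw [modelPoly, MvPolynomial.coeff_add, MvPolynomial.coeff_monomial, MvPolynomial.coeff_monomial]

theorem coeff_modelPoly_l (s : ℝ) : (modelPoly m s).coeff (expN 0 2) = 1 := by
  rw [coeff_modelPoly, if_neg (by rw [expN_inj]; omega), if_pos rfl, zero_add]

theorem homDegLE_modelPoly (s : ℝ) : HomDegLE 2 (modelPoly m s) := by
  intro β hβ
  rw [coeff_modelPoly] at hβ
  by_cases h1 : expN 2 0 = β
  · subst h1; simp [expN_inl, expN_zero, expN_one]
  · by_cases h2 : expN 0 2 = β
    · subst h2; simp [expN_inl, expN_zero, expN_one]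
    · simp [h1, h2] at hβ

theorem coeffNorm_modelPoly_le {s : ℝ} (hs : 0 < s) (hs1 : s < 1) :
    coeffNorm (modelPoly m s) ≤ 3 / 2 := by
  have h1 : coeffNorm (MvPolynomial.monomial (expN 2 0) (-(s / (s + 1))) : Poly m) ≤ 1 / 2 := by
    rw [coeffNorm_eq (S := {expN 2 0}) MvPolynomial.support_monomial_subset, Finset.sum_singleton,
      MvPolynomial.coeff_monomial, if_pos rfl, abs_neg, abs_of_pos (by positivity),
      div_le_div_iff₀ (by positivity) (by positivity)]
    linarith
  have h2 : coeffNorm (MvPolynomial.monomial (expN 0 2) 1 : Poly m) ≤ 1 := by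
    rw [coeffNorm_eq (S := {expN 0 2}) MvPolynomial.support_monomial_subset, Finset.sum_singleton,
      MvPolynomial.coeff_monomial, if_pos rfl, abs_one]
  have := coeffNorm_comb 1 1 (MvPolynomial.monomial (expN 2 0) (-(s / (s + 1))) : Poly m)
    (MvPolynomial.monomial (expN 0 2) 1)
  rw [one_smul, one_smul, abs_one, one_mul, one_mul] at this
  unfold modelPoly
  linarith

theorem modelSolution_apply (s : ℝ) {y : Pt m} (hy : y ∈ dom m) :
    modelSolution s y = y.2.1 ^ (2 * s) * pev (modelPoly m s) y := by
  have h1 : y.2.1 ^ (2 * s + 2) = y.2.1 ^ (2 * s) * y.2.1 ^ 2 := by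
    rw [Real.rpow_add hy.2.1]; norm_cast
  rw [modelSolution, indicator_of_mem hy, pev_modelPoly, h1]
  ring

theorem quotX_modelSolution (s : ℝ) {y : Pt m} (hy : y ∈ dom m) :
    quotX s (modelSolution s) y = pev (modelPoly m s) y := by
  rw [quotX, modelSolution_apply s hy, ← mul_assoc, ← Real.rpow_add hy.2.1]
  simp

theorem remX_modelSolution (s : ℝ) {y : Pt m} (hy : y ∈ dom m) :
    remX s (modelSolution s) (modelPoly m s) y = 0 := by
  rw [remX, modelSolution_apply s hy, sub_self]

theorem isApprox_modelSolution {b : Pt m} :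
    IsApprox 2 e.α (quotX e.s (modelSolution e.s)) b (modelPoly m e.s) :=
  ⟨homDegLE_modelPoly _, 0, fun y hy _ => by simp [quotX_modelSolution _ hy]⟩

/-- On the domain the model solution is exactly y_n^{2s} times a polynomial in 𝒫_2. All remainders
vanish and only the coefficients 1 and s/(s+1) ≤ 1/2 are counted. -/
theorem eNormX_modelSolution_le :
    eNormX e (modelSolution (m := m) e.s) ≤ ENNReal.ofReal (3 / 2) := by
  refine (iInf_le _ (⟨fun _ => modelPoly m e.s, fun _ _ => isApprox_modelSolution⟩ :
    FamX e (modelSolution e.s))).trans ?_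
  rw [← zero_add (ENNReal.ofReal (3 / 2))]
  exact add_le_add
    (iSup₂_le fun b _ => (homX_eq_zero fun y hy => remX_modelSolution _ hy).le)
    (iSup₂_le fun b _ => ENNReal.ofReal_le_ofReal (coeffNorm_modelPoly_le e.s_pos e.s_lt_one))

theorem eventuallyEq_modelSolution (s : ℝ) {y : Pt m} (hy : y ∈ dom m) :
    modelSolution s =ᶠ[𝓝 y] fun z => z.2.1 ^ (2 * s) * pev (modelPoly m s) z := by
  filter_upwards [isOpen_dom.mem_nhds hy] with z hz
  exact modelSolution_apply s hz

theorem pd_modelPoly (s : ℝ) (w y : Pt m) :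
    pd w (pev (modelPoly m s)) y = -(s / (s + 1)) * (2 * y.2.1 * w.2.1) + 2 * y.2.2 * w.2.2 := by
  have h : HasFDerivAt (fun z : Pt m => -(s / (s + 1)) * z.2.1 ^ 2 + z.2.2 ^ 2) _ y :=
    (((hasFDerivAt_n y).pow 2).const_mul (-(s / (s + 1)))).add ((hasFDerivAt_l y).pow 2)
  rw [show pev (modelPoly m s) = fun z => -(s / (s + 1)) * z.2.1 ^ 2 + z.2.2 ^ 2 from
    funext (pev_modelPoly s), pd_of_hasFDerivAt h]
  simp [coN_apply, coL_apply]

theorem fluxN_modelSolution {s : ℝ} (hs : 0 < s) {y : Pt m} (hy : y ∈ dom m) :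
    y.2.1 ^ (1 - 2 * s) * pd eN (modelSolution s) y = 2 * s * (y.2.2 ^ 2 - y.2.1 ^ 2) := by
  have h1 : DifferentiableAt ℝ (fun z : Pt m => z.2.1 ^ (2 * s)) y :=
    differentiableAt_of_C2 (contDiffAt_rpow hy.2.1 _)
  have h3 : y.2.1 ^ (1 - 2 * s) * y.2.1 ^ (2 * s - 1) = 1 := by
    rw [← Real.rpow_add hy.2.1]; simp
  have h4 : y.2.1 ^ (1 - 2 * s) * y.2.1 ^ (2 * s) = y.2.1 := by
    rw [← Real.rpow_add hy.2.1]; simp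
  have h5 : s / (s + 1) * (s + 1) = s := div_mul_cancel₀ _ (by positivity)
  rw [pd_congr (eventuallyEq_modelSolution s hy), pd_mul eN h1 (differentiable_pev _ y),
    pd_rpow hy.2.1, pd_modelPoly, pev_modelPoly]
  simp only [eN]
  linear_combination (-2 * (s / (s + 1)) * y.2.1) * h4 +
    (-(s / (s + 1)) * y.2.1 ^ 2 + y.2.2 ^ 2) * (2 * s) * h3 - 2 * y.2.1 ^ 2 * h5

theorem abs_modelSolution_le {s : ℝ} (hs : 0 < s) {y : Pt m} (hy : y ∈ dom m) :
    |modelSolution s y| ≤ 2 * y.2.1 ^ (2 * s) := by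
  have h0 := Real.rpow_nonneg hy.2.1.le (2 * s)
  have h1 : s / (s + 1) ≤ 1 := (div_le_one (by positivity)).mpr (by linarith)
  have h2 : (0 : ℝ) ≤ s / (s + 1) := by positivity
  have hr := rho_lt_one hy.1
  have h3 : y.2.1 ^ 2 + y.2.2 ^ 2 ≤ 1 := by
    rw [← rho_sq]; nlinarith [rho_nonneg y]
  have h4 : |pev (modelPoly m s) y| ≤ 2 := by
    rw [pev_modelPoly, abs_le]
    constructor <;> nlinarith [sq_nonneg y.2.1, sq_nonneg y.2.2]
  rw [modelSolution_apply s hy, abs_mul, abs_of_nonneg h0, mul_comm]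
  gcongr

theorem memX_modelSolution : MemX e (modelSolution (m := m) e.s) where
  zero_off y hy := indicator_of_notMem hy _
  contDiff y hy := (((contDiffAt_rpow hy.2.1 _).mul (contDiff_pev _).contDiffAt)).congr_of_eventuallyEq
    (eventuallyEq_modelSolution e.s hy)
  bounded := ⟨2, fun y hy => (abs_modelSolution_le e.s_pos hy).trans (by
    have hr := (abs_n_le_rho y).trans_lt (rho_lt_one hy.1)
    rw [abs_of_pos hy.2.1] at hr
    have := Real.rpow_le_one hy.2.1.le hr.le (by linarith [e.s_pos] : 0 ≤ 2 * e.s)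
    linarith)⟩
  dirichlet z hz h0 := by
    have hlim : Tendsto (fun y : Pt m => 2 * y.2.1 ^ (2 * e.s)) (𝓝[dom m] z) (𝓝 0) := by
      have hc : Continuous fun y : Pt m => 2 * y.2.1 ^ (2 * e.s) :=
        continuous_const.mul ((continuous_fst.comp continuous_snd).rpow_const
          fun _ => Or.inr (by linarith [e.s_pos]))
      have := hc.tendsto z
      rw [h0, Real.zero_rpow (by linarith [e.s_pos]), mul_zero] at this
      exact this.mono_left nhdsWithin_le_nhds
    refine squeeze_zero_norm' ?_ hlim
    filter_upwards [self_mem_nhdsWithin] with y hy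
    exact abs_modelSolution_le e.s_pos hy
  approx b _ := ⟨_, isApprox_modelSolution⟩
  neumann z _ _ h0 := by
    have hlim : Tendsto (fun y : Pt m => 2 * y.2.2)
        (𝓝[dom m ∩ {y | y.1 = z.1 ∧ y.2.1 = z.2.1}] z) (𝓝 0) := by
      have hc : Continuous fun y : Pt m => 2 * y.2.2 := by fun_prop
      have := hc.tendsto z
      rw [h0, mul_zero] at this
      exact this.mono_left nhdsWithin_le_nhds
    refine hlim.congr' ?_
    filter_upwards [self_mem_nhdsWithin] with y hy
    rw [pd_congr (v := pev (modelPoly m e.s)) (by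
      filter_upwards [isOpen_dom.mem_nhds hy.1] with w hw
      exact quotX_modelSolution _ hw), pd_modelPoly]
    simp [eL]
  normal b hb := by
    have hlim : Tendsto (fun y : Pt m => -(4 * e.s * y.2.1)) (𝓝[dom m] b) (𝓝 0) := by
      have hc : Continuous fun y : Pt m => -(4 * e.s * y.2.1) := by fun_prop
      have := hc.tendsto b
      rw [hb.2.1, mul_zero, neg_zero] at this
      exact this.mono_left nhdsWithin_le_nhds
    refine hlim.congr' ?_
    filter_upwards [self_mem_nhdsWithin] with y hy
    have h : HasFDerivAt (fun z : Pt m => 2 * e.s * (z.2.2 ^ 2 - z.2.1 ^ 2)) _ y :=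
      (((hasFDerivAt_l y).pow 2).sub ((hasFDerivAt_n y).pow 2)).const_mul (2 * e.s)
    rw [pd_congr (v := fun z => 2 * e.s * (z.2.2 ^ 2 - z.2.1 ^ 2)) (by
      filter_upwards [isOpen_dom.mem_nhds hy] with w hw
      exact fluxN_modelSolution e.s_pos hw), pd_of_hasFDerivAt h]
    simp [coN_apply, coL_apply, eN]
    ring
  finite := eNormX_modelSolution_le.trans_lt ENNReal.ofReal_lt_top

variable (m e) in
/-- The model solution as an element of `X_{α,ε}`. -/
def modelX : XSpace m e := (⟨modelSolution e.s, memX_modelSolution⟩ : XSubmodule m e)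

theorem modelX_fn : (modelX m e).fn = modelSolution e.s := rfl

/-- This bound turns r₀ ≤ ‖v₀‖/4 into the radius 3/8 used from here on. -/
theorem norm_modelX_le : ‖modelX m e‖ ≤ 3 / 2 := by
  rw [← ENNReal.ofReal_le_ofReal_iff (by norm_num), ofReal_norm_X, modelX_fn]
  exact eNormX_modelSolution_le

theorem polyX_modelX {b : Pt m} (hb : b ∈ edge m) : polyX (modelX m e) b = modelPoly m e.s :=
  isApprox_unique e.α_pos hb (polyX_spec _ hb) isApprox_modelSolution

end

section

variable {m : ℕ}

open scoped NNReal

variable {e : Exponents}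

/-! ### The functional in terms of the weighted derivatives -/

theorem differentiableAt_pd {u : Pt m → ℝ} {y : Pt m} (hu : ContDiffAt ℝ 2 u y) (d : Pt m) :
    DifferentiableAt ℝ (pd d u) y := by
  have h1 : ContDiffAt ℝ 1 (fderiv ℝ u) y := hu.fderiv_right (by norm_num)
  exact (h1.differentiableAt (by norm_num)).clm_apply (differentiableAt_const d)

theorem pd_pd {u : Pt m → ℝ} {y : Pt m} (hu : ContDiffAt ℝ 2 u y) (c d : Pt m) :
    pd c (pd d u) y = fderiv ℝ (fderiv ℝ u) y c d := by
  have h1 : ContDiffAt ℝ 1 (fderiv ℝ u) y := hu.fderiv_right (by norm_num)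
  have h2 := (h1.differentiableAt (by norm_num)).hasFDerivAt.clm_apply (hasFDerivAt_const d y)
  rw [pd_of_hasFDerivAt (u := pd d u) h2]
  simp

theorem pd_pd_comm {u : Pt m → ℝ} {y : Pt m} (hu : ContDiffAt ℝ 2 u y) (c d : Pt m) :
    pd c (pd d u) y = pd d (pd c u) y := by
  rw [pd_pd hu, pd_pd hu]
  exact hu.isSymmSndFDerivAt (by simp) c d

theorem pd_rpow_mul {u : Pt m → ℝ} {y : Pt m} (hy : 0 < y.2.1) (hu : DifferentiableAt ℝ u y)
    (c : ℝ) {w : Pt m} (hw : w.2.1 = 0) :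
    pd w (fun z => z.2.1 ^ c * u z) y = y.2.1 ^ c * pd w u y := by
  rw [pd_mul w (differentiableAt_of_C2 (contDiffAt_rpow hy c)) hu, pd_rpow hy, hw, mul_zero,
    mul_zero, add_zero]

theorem differentiableAt_rpow_l {y : Pt m} (hy : 0 < y.2.2) (c : ℝ) :
    DifferentiableAt ℝ (fun z : Pt m => z.2.2 ^ c) y :=
  ((hasFDerivAt_l y).rpow_const (Or.inl hy.ne')).differentiableAt

theorem pd_rpow_l_mul {u : Pt m → ℝ} {y : Pt m} (hy : 0 < y.2.2) (hu : DifferentiableAt ℝ u y)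
    (c : ℝ) (w : Pt m) :
    pd w (fun z => z.2.2 ^ c * u z) y =
      y.2.2 ^ c * pd w u y + u y * (c * y.2.2 ^ (c - 1) * w.2.2) := by
  rw [pd_mul w (differentiableAt_rpow_l hy c) hu, pd_rpow_l hy]

variable {s : ℝ} {f v : Pt m → ℝ} {y : Pt m}

theorem rpow_mul_pd_pd (hy : 0 < y.2.1) (hv : ContDiffAt ℝ 2 v y) (d : Pt m) {c : Pt m}
    (hc : c.2.1 = 0) :
    pd c (fun z => z.2.1 ^ (1 - 2 * s) * pd d v z) y = y.2.1 ^ (1 - 2 * s) * pd c (pd d v) y :=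
  pd_rpow_mul hy (differentiableAt_pd hv d) _ hc

theorem rpow_neg_cancel {x : ℝ} (hx : 0 < x) (s : ℝ) : x ^ (2 * s - 1) * x ^ (1 - 2 * s) = 1 := by
  rw [← Real.rpow_add hx]; simp

/-- The coefficient `y_n^{-2s} y_{n+1}^{-1} ∂_{n+1} v`. -/
def coefB (s : ℝ) (v : Pt m → ℝ) (y : Pt m) : ℝ := y.2.2⁻¹ * y.2.1 ^ (-(2 * s)) * pd eL v y

/-- The weighted second derivative `(y_n y_{n+1})^{1-2s} ∂_{n+1} (y_{n+1}^{2s-1} ∂_{n+1} v)`. -/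
def sigma (s : ℝ) (v : Pt m → ℝ) (y : Pt m) : ℝ :=
  (2 * s - 1) * y.2.1 * coefB s v y + pd eL (wYd s (Sum.inr 1) v) y

theorem pd_fluxL (hl : 0 < y.2.2) (hv : ContDiffAt ℝ 2 v y) {c : Pt m}
    (hc : c.2.2 = 0) : pd c (fluxL s v) y = y.2.2 ^ (2 * s - 1) * pd c (pd eL v) y := by
  unfold fluxL
  rw [pd_rpow_l_mul hl (differentiableAt_pd hv eL), hc]
  ring

theorem pd_pd_l (hy : 0 < y.2.1) (hv : ContDiffAt ℝ 2 v y) {c : Pt m} (hc : c.2.1 = 0) :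
    pd c (pd eL v) y = y.2.1 ^ (2 * s - 1) * pd c (wYd s (Sum.inr 1) v) y := by
  have h : pd c (wYd s (Sum.inr 1) v) y = y.2.1 ^ (1 - 2 * s) * pd c (pd eL v) y :=
    rpow_mul_pd_pd hy hv eL hc
  rw [h, ← mul_assoc, rpow_neg_cancel hy, one_mul]

theorem pd_pd_n (hy : 0 < y.2.1) (hv : ContDiffAt ℝ 2 v y) {c : Pt m} (hc : c.2.1 = 0) :
    pd c (pd eN v) y = y.2.1 ^ (2 * s - 1) * pd c (fluxN s v) y := by
  have h : pd c (fluxN s v) y = y.2.1 ^ (1 - 2 * s) * pd c (pd eN v) y :=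
    rpow_mul_pd_pd hy hv eN hc
  rw [h, ← mul_assoc, rpow_neg_cancel hy, one_mul]

/-- Differentiating the weight y_{n+1}^{2s-1} produces y_{n+1}^{-1} ∂_{n+1}v, which is B up to a
power of y_n. This is the origin of the first term in `sigma`. -/
theorem pd_l_fluxL (hy : 0 < y.2.1) (hl : 0 < y.2.2) (hv : ContDiffAt ℝ 2 v y) :
    pd eL (fluxL s v) y = y.2.2 ^ (2 * s - 1) * (y.2.1 ^ (2 * s - 1) * sigma s v y) := by
  unfold fluxL
  rw [pd_rpow_l_mul hl (differentiableAt_pd hv eL), pd_pd_l (s := s) hy hv rfl, sigma, coefB]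
  have h1 : y.2.2 ^ (2 * s - 1 - 1) = y.2.2 ^ (2 * s - 1) * y.2.2⁻¹ := by
    rw [Real.rpow_sub_one hl.ne']; rfl
  have h2 := rpow_neg_cancel hy s
  rw [rpow_split hy] at h2
  rw [h1]
  simp only [eL]
  linear_combination -(2 * s - 1) * pd ((0, 0, 1) : Pt m) v y * y.2.2 ^ (2 * s - 1) * y.2.2⁻¹ * h2

theorem fluxL_eq (hy : 0 < y.2.1) (hl : 0 < y.2.2) :
    fluxL s v y = (y.2.1 * y.2.2) ^ (2 * s) * coefB s v y := by
  have h1 : y.2.2 ^ (2 * s - 1) = y.2.2 ^ (2 * s) * y.2.2⁻¹ := by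
    rw [Real.rpow_sub_one hl.ne']; rfl
  have h2 : y.2.1 ^ (2 * s) * y.2.1 ^ (-(2 * s)) = 1 := by
    rw [← Real.rpow_add hy]; simp
  rw [fluxL, coefB, Real.mul_rpow hy.le hl.le, h1]
  linear_combination -(y.2.2 ^ (2 * s) * y.2.2⁻¹ * pd eL v y) * h2

/-- Every power of x_{n+1} is a monomial in y_n y_{n+1} times a power of B. Positivity of B is
essential, since the rules for real powers fail for negative bases. -/
theorem xL_rpow (hs : 0 < s) (hy : 0 < y.2.1) (hl : 0 < y.2.2) (hB : 0 < coefB s v y) (c : ℝ) :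
    xL s v y ^ c = (y.2.1 * y.2.2) ^ c * coefB s v y ^ (c / (2 * s)) := by
  have h := mul_pos hy hl
  rw [xL, fluxL_eq hy hl, Real.mul_rpow (by positivity) hB.le, ← Real.rpow_mul h.le,
    Real.mul_rpow (by positivity) (by positivity), ← Real.rpow_mul h.le, ← Real.rpow_mul hB.le]
  congr 2
  · field_simp
  · field_simp

theorem xL_eq (hs : 0 < s) (hy : 0 < y.2.1) (hl : 0 < y.2.2) (hB : 0 < coefB s v y) :
    xL s v y = y.2.1 * y.2.2 * coefB s v y ^ (1 / (2 * s)) := by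
  have := xL_rpow hs hy hl hB 1
  rwa [Real.rpow_one, Real.rpow_one] at this

/-- The weighted determinant of the normal second derivatives. -/
def normalDet (s : ℝ) (v : Pt m → ℝ) (y : Pt m) : ℝ :=
  pd eL (fluxN s v) y ^ 2 - pd eN (fluxN s v) y * sigma s v y

theorem jac_eq (hy : 0 < y.2.1) (hl : 0 < y.2.2) (hv : ContDiffAt ℝ 2 v y) :
    jac s v y = xL s v y ^ (1 - 2 * s) * (1 / (4 * s ^ 2) *
      (y.2.2 ^ (2 * s - 1) * y.2.1 ^ (2 * s - 1) * normalDet s v y)) := by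
  rw [jac, Matrix.det_fin_two_of, pd_l_fluxL hy hl hv, pd_fluxL hl hv rfl, pd_pd_comm hv,
    pd_pd_n (s := s) hy hv rfl, normalDet]
  ring

/-- By symmetry of second derivatives all entries are expressed through derivatives of the two
weighted first derivatives. The determinant then becomes one monomial weight times a polynomial
expression. -/
theorem tangDet_eq (hy : 0 < y.2.1) (hl : 0 < y.2.2) (hv : ContDiffAt ℝ 2 v y) (i : Fin m) :
    tangDet s v i y = y.2.1 ^ (2 * s - 1) * (y.2.2 ^ (2 * s - 1) * y.2.1 ^ (2 * s - 1)) *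
      (1 / (4 * s ^ 2) * (y.2.1 ^ (1 - 2 * s) * pd (eT i) (pd (eT i) v) y * normalDet s v y
        - pd (eT i) (fluxN s v) y ^ 2 * sigma s v y
        + 2 * (pd (eT i) (fluxN s v) y * pd (eT i) (wYd s (Sum.inr 1) v) y * pd eL (fluxN s v) y)
        - pd eN (fluxN s v) y * pd (eT i) (wYd s (Sum.inr 1) v) y ^ 2)) := by
  have h2 := rpow_neg_cancel hy s
  rw [tangDet, Matrix.det_fin_three, pd_l_fluxL hy hl hv, pd_fluxL hl hv rfl,
    pd_fluxL hl hv rfl, pd_pd_comm hv eN eL, pd_pd_n (s := s) hy hv rfl,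
    pd_pd_n (s := s) hy hv rfl, pd_pd_l (s := s) hy hv rfl, normalDet]
  simp only [Matrix.of_apply, Matrix.cons_val', Matrix.cons_val_zero, Matrix.cons_val_one,
    Matrix.cons_val, Matrix.cons_val_fin_one]
  linear_combination (-(1 / (4 * s ^ 2)) * pd (eT i) (pd (eT i) v) y * y.2.2 ^ (2 * s - 1) * y.2.1 ^ (2 * s - 1) * (pd eL (fluxN s v) y ^ 2 - pd eN (fluxN s v) y * sigma s v y)) * h2

/-- The powers of x_{n+1} in front of each term are tuned to its weights: everything singular
cancels except a common factor y_{n+1}^{1-2s}, and the term with f keeps the regular weight y_{n+1}²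
y_n^{3-2s}. -/
theorem nonlinExpr_eq (hs : 0 < s) (hy : 0 < y.2.1) (hl : 0 < y.2.2) (hv : ContDiffAt ℝ 2 v y)
    (hB : 0 < coefB s v y) :
    nonlinExpr s f v y = y.2.2 ^ (1 - 2 * s) *
      ((∑ i, coefB s v y ^ ((1 - 2 * s) / s) * (1 / (4 * s ^ 2) *
          (y.2.1 ^ (1 - 2 * s) * pd (eT i) (pd (eT i) v) y * normalDet s v y
        - pd (eT i) (fluxN s v) y ^ 2 * sigma s v y
        + 2 * (pd (eT i) (fluxN s v) y * pd (eT i) (wYd s (Sum.inr 1) v) y * pd eL (fluxN s v) y)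
        - pd eN (fluxN s v) y * pd (eT i) (wYd s (Sum.inr 1) v) y ^ 2)))
      + pd eN (fluxN s v) y + coefB s v y ^ ((1 - 2 * s) / s) * sigma s v y
      - 1 / (4 * s ^ 2) * (coefB s v y ^ ((2 - 2 * s) / s) *
          (y.2.2 ^ 2 * y.2.1 ^ (3 - 2 * s) * normalDet s v y)) * f (xPoint s v y)) := by
  have hn := rpow_neg_cancel hy s
  have hm := rpow_neg_cancel hl s
  have hX1 : xL s v y ^ (2 - 4 * s) = (y.2.1 ^ (1 - 2 * s) * y.2.2 ^ (1 - 2 * s)) ^ 2 *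
      coefB s v y ^ ((1 - 2 * s) / s) := by
    rw [xL_rpow hs hy hl hB, ← Real.mul_rpow hy.le hl.le, ← Real.rpow_natCast,
      ← Real.rpow_mul (mul_pos hy hl).le]
    congr 2
    · push_cast; ring
    · field_simp; ring
  have hX2 : xL s v y ^ (3 - 2 * s) * xL s v y ^ (1 - 2 * s) =
      y.2.1 ^ (3 - 2 * s) * y.2.1 ^ (1 - 2 * s) * (y.2.2 ^ 2 * y.2.2 ^ (1 - 2 * s) *
        y.2.2 ^ (1 - 2 * s)) * coefB s v y ^ ((2 - 2 * s) / s) := by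
    have e1 : y.2.2 ^ (3 - 2 * s) = y.2.2 ^ 2 * y.2.2 ^ (1 - 2 * s) := by
      rw [← Real.rpow_natCast, ← Real.rpow_add hl]; congr 1; push_cast; ring
    have e2 : coefB s v y ^ ((2 - 2 * s) / s) = coefB s v y ^ ((3 - 2 * s) / (2 * s)) *
        coefB s v y ^ ((1 - 2 * s) / (2 * s)) := by
      rw [← Real.rpow_add hB]; congr 1; field_simp; ring
    rw [xL_rpow hs hy hl hB, xL_rpow hs hy hl hB, Real.mul_rpow hy.le hl.le,
      Real.mul_rpow hy.le hl.le, e1, e2]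
    ring
  have hT2 : pd eN (fun z : Pt m => z.2.1 ^ (1 - 2 * s) * z.2.2 ^ (1 - 2 * s) * pd eN v z) y =
      y.2.2 ^ (1 - 2 * s) * pd eN (fluxN s v) y := by
    have hd : DifferentiableAt ℝ (fluxN s v) y :=
      (differentiableAt_of_C2 (contDiffAt_rpow hy _)).mul (differentiableAt_pd hv eN)
    rw [show (fun z : Pt m => z.2.1 ^ (1 - 2 * s) * z.2.2 ^ (1 - 2 * s) * pd eN v z) =
      fun z => z.2.2 ^ (1 - 2 * s) * fluxN s v z from funext fun z => by unfold fluxN; ring,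
      pd_rpow_l_mul hl hd]
    simp [eN]
  have hT3 : pd eL (fun z : Pt m => z.2.1 ^ (2 * s - 1) * z.2.2 ^ (2 * s - 1) * pd eL v z) y =
      y.2.1 ^ (2 * s - 1) * pd eL (fluxL s v) y := by
    have hd : DifferentiableAt ℝ (fluxL s v) y :=
      (differentiableAt_rpow_l hl _).mul (differentiableAt_pd hv eL)
    rw [show (fun z : Pt m => z.2.1 ^ (2 * s - 1) * z.2.2 ^ (2 * s - 1) * pd eL v z) =
      fun z => z.2.1 ^ (2 * s - 1) * fluxL s v z from funext fun z => by unfold fluxL; ring,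
      pd_rpow_mul hy hd _ rfl]
  rw [nonlinExpr, hT2, hT3, hX1, jac_eq hy hl hv,
    ← mul_assoc (xL s v y ^ (3 - 2 * s)), hX2, pd_l_fluxL hy hl hv, mul_sub,
    mul_add, mul_add, Finset.mul_sum]
  set a := y.2.1 ^ (2 * s - 1)
  set a' := y.2.1 ^ (1 - 2 * s)
  set c := y.2.2 ^ (2 * s - 1)
  set c' := y.2.2 ^ (1 - 2 * s)
  congr 1
  · congr 1
    · congr 1
      refine Finset.sum_congr rfl fun i _ => ?_
      rw [tangDet_eq hy hl hv]
      -- Only a a' = 1 and c c' = 1 are used: the weights of x_{n+1}^{2-4s} cancel those of the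
      -- determinant up to one factor.
      have key : (a' * c') ^ 2 * (a * (c * a)) = c' := by
        linear_combination c' * (c * c') * (a * a' + 1) * hn + c' * hm
      linear_combination (coefB s v y ^ ((1 - 2 * s) / s) * (1 / (4 * s ^ 2) *
          (y.2.1 ^ (1 - 2 * s) * pd (eT i) (pd (eT i) v) y * normalDet s v y
        - pd (eT i) (fluxN s v) y ^ 2 * sigma s v y
        + 2 * (pd (eT i) (fluxN s v) y * pd (eT i) (wYd s (Sum.inr 1) v) y * pd eL (fluxN s v) y)
        - pd eN (fluxN s v) y * pd (eT i) (wYd s (Sum.inr 1) v) y ^ 2))) * key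
    · have key : (a' * c') ^ 2 * (a * (c * a)) = c' := by
        linear_combination c' * (c * c') * (a * a' + 1) * hn + c' * hm
      linear_combination (coefB s v y ^ ((1 - 2 * s) / s) * sigma s v y) * key
  · have key : a' * c' * (c * a) = 1 := by
      linear_combination (c * c') * hn + hm
    linear_combination (y.2.1 ^ (3 - 2 * s) * y.2.2 ^ 2 * c' * coefB s v y ^ ((2 - 2 * s) / s) *
      (1 / (4 * s ^ 2)) * normalDet s v y * f (xPoint s v y)) * key

end

section

variable {m : ℕ}

open scoped NNReal

variable {e : Exponents}

/-! ### The coefficient `B` near the model solution -/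

variable (e m) in
/-- The coefficient `y_n^{-2s} y_{n+1}^{-1} ∂_{n+1} v` as a bounded linear map. -/
def bCLM : XSpace m e →L[ℝ] Coef m e ℝ := (famB m e).clm

theorem bCLM_dom (v : XSpace m e) {y : Dom m} (hy : y.1 ∈ dom m) :
    bCLM m e v y = coefB e.s v.fn y.1 := HolFamily.clm_dom _ _ hy

theorem bCLM_edge (v : XSpace m e) {y : Dom m} (hy : y.1 ∈ edge m) :
    bCLM m e v y = 2 * (polyX v y.1).coeff (expN 0 2) := HolFamily.clm_edge _ _ hy

theorem bCLM_modelX (y : Dom m) : bCLM m e (modelX m e) y = 2 := by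
  by_cases h : y.1 ∈ dom m
  · have h1 : y.1.2.1 ^ (-(2 * e.s)) * y.1.2.1 ^ (2 * e.s) = 1 := by
      rw [← Real.rpow_add h.2.1]; simp
    have h2 : y.1.2.2⁻¹ * y.1.2.2 = 1 := inv_mul_cancel₀ h.2.2.ne'
    rw [bCLM_dom _ h, coefB, modelX_fn, pd_congr (eventuallyEq_modelSolution e.s h),
      pd_rpow_mul h.2.1 (differentiable_pev _ _) _ rfl, pd_modelPoly]
    simp only [eL]
    linear_combination (2 * y.1.2.2⁻¹ * y.1.2.2) * h1 + 2 * h2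
  · have h' := Dom.mem_edge h
    rw [bCLM_edge _ h', polyX_modelX h', coeff_modelPoly_l, mul_one]

/-- Direct from the expansion at the projection: 2 for the coefficient and 1 for the error. The
small explicit constant matters for positivity near the model solution. -/
theorem abs_bCLM_le (v : XSpace m e) (y : Dom m) : |bCLM m e v y| ≤ 3 * ‖v‖ := by
  have hN := norm_nonneg v
  have hc : ∀ b ∈ edge m, |(polyX v b).coeff (expN 0 2)| ≤ ‖v‖ := fun b hb =>
    (abs_coeff_le _ _).trans (coeffNorm_le v hb)
  by_cases h : y.1 ∈ dom m
  · have hb := proj_mem_edge h.1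
    have h1 := (weightedHolder_l v hb).bound y.1 h
    rw [expand_l v hb h, sub_add_cancel, dG_proj] at h1
    have h2 := Real.rpow_le_one (rho_nonneg y.1) (rho_lt_one h.1).le
      (by linarith [e.α_pos] : 0 ≤ 2 * e.α)
    have h3 := mul_le_mul_of_nonneg_left h2 hN
    have h4 := hc _ hb
    rw [bCLM_dom v h, coefB]
    rw [abs_le] at *
    constructor <;> linarith [h1.1, h1.2, h4.1, h4.2]
  · have h' := Dom.mem_edge h
    rw [bCLM_edge v h', abs_mul, abs_two]
    linarith [hc _ h']

/-- For the model solution B is identically 2, and 2 - 3·(3/8) = 7/8. -/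
theorem le_bCLM {v : XSpace m e} (hv : ‖v - modelX m e‖ ≤ 3 / 8) (y : Dom m) :
    7 / 8 ≤ bCLM m e v y := by
  have h1 := abs_bCLM_le (v - modelX m e) y
  rw [map_sub, Hol.sub_apply, bCLM_modelX] at h1
  linarith [(abs_le.mp h1).1]

variable (e m) in
/-- The power `B ^ c`. -/
def powB (c : ℝ) (v : XSpace m e) : Coef m e ℝ := Hol.comp (fun t : ℝ => t ^ c) (bCLM m e v)

/-- B takes values in a compact interval of positive numbers, on which t ↦ t^c is analytic, so the
analytic superposition result applies. -/
theorem powB_spec (c : ℝ) {v : XSpace m e} (hv : ‖v - modelX m e‖ ≤ 3 / 8) :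
    (∀ y, powB m e c v y = bCLM m e v y ^ c) ∧ AnalyticAt ℝ (powB m e c) v := by
  have h := Hol.analyticAt_comp (f := fun t : ℝ => t ^ c) (u₀ := bCLM m e v)
    (C := Icc (7 / 8) (3 * ‖v‖)) (fun t ht => ?_) isCompact_Icc
    fun y => ⟨le_bCLM hv y, (le_abs_self _).trans (abs_bCLM_le v y)⟩
  · exact ⟨fun y => Hol.comp_apply h.1 y, h.2.comp ((bCLM m e).analyticAt v)⟩
  · have ht0 : 0 < t := by linarith [ht.1]
    exact (Real.contDiffAt_rpow_const_of_ne (n := ω) ht0.ne').analyticAt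

/-! ### The transformed points -/

/-- The inclusion of the `n`-th coordinate axis. -/
def injN : ℝ →L[ℝ] Pt m :=
  (ContinuousLinearMap.inr ℝ (EuclideanSpace ℝ (Fin m)) (ℝ × ℝ)).comp (ContinuousLinearMap.inl ℝ ℝ ℝ)

/-- The inclusion of the `n+1`-st coordinate axis. -/
def injL : ℝ →L[ℝ] Pt m :=
  (ContinuousLinearMap.inr ℝ (EuclideanSpace ℝ (Fin m)) (ℝ × ℝ)).comp (ContinuousLinearMap.inr ℝ ℝ ℝ)

variable (e m) in
/-- The map `v ↦ (y'', x_n, x_{n+1})`. -/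
def xMap (v : XSpace m e) : Coef m e (Pt m) :=
  projCoef m e + Hol.push injN (-(1 / (2 * e.s)) • (famFlux m e).clm v)
    + Hol.push injL (prodCoef m e * powB m e (1 / (2 * e.s)) v)

theorem xMap_dom {v : XSpace m e} (hv : ‖v - modelX m e‖ ≤ 3 / 8) {y : Dom m} (hy : y.1 ∈ dom m) :
    xMap m e v y = xPoint e.s v.fn y.1 := by
  have hB := le_bCLM hv y
  have h1 : projCoef m e y = ((y.1.1, 0, 0) : Pt m) := by
    rw [projCoef, HolData.toCoef, Hol.mk_apply, glue_dom _ _ hy]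
  have h2 : (famFlux m e).clm v y = fluxN e.s v.fn y.1 := HolFamily.clm_dom _ _ hy
  have h3 : prodCoef m e y = y.1.2.1 * y.1.2.2 := by
    rw [prodCoef, HolData.toCoef, Hol.mk_apply, glue_dom _ _ hy]; rfl
  rw [bCLM_dom v hy] at hB
  rw [xMap, Hol.add_apply, Hol.add_apply, h1, Hol.push_apply, Hol.push_apply, Hol.smul_apply,
    Hol.mul_apply, h2, h3, (powB_spec _ hv).1, bCLM_dom v hy, xPoint, xN,
    xL_eq e.s_pos hy.2.1 hy.2.2 (by linarith)]
  simp [injN, injL]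

theorem analyticAt_xMap {v : XSpace m e} (hv : ‖v - modelX m e‖ ≤ 3 / 8) :
    AnalyticAt ℝ (xMap m e) v := by
  have h := (powB_spec (1 / (2 * e.s)) hv).2
  have h1 : AnalyticAt ℝ (fun v => Hol.push (injN (m := m)) (-(1 / (2 * e.s)) • (famFlux m e).clm v))
      v := ((Hol.push injN).comp (-(1 / (2 * e.s)) • (famFlux m e).clm)).analyticAt v
  have h2 : AnalyticAt ℝ (fun v => Hol.push (injL (m := m))
      (prodCoef m e * powB m e (1 / (2 * e.s)) v)) v :=
    ((Hol.push injL).analyticAt _).comp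
      (f := fun v => prodCoef m e * powB m e (1 / (2 * e.s)) v) (analyticAt_const.mul h)
  exact (analyticAt_const.add h1).add h2

/-- At points of P the coefficient is a limit of its values in the domain. The closure in `nbhd`
therefore contains the whole range of the coefficient, including its values on P. -/
theorem xMap_mem {v : XSpace m e} (hv : ‖v - modelX m e‖ ≤ 3 / 8) (y : Dom m) :
    xMap m e v y ∈ closure (xPoint e.s v.fn '' dom m) := by
  by_cases h : y.1 ∈ dom m
  · exact subset_closure ⟨y.1, h, (xMap_dom hv h).symm⟩
  · have hb := Dom.mem_edge h
    rw [Metric.mem_closure_iff]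
    intro δ hδ
    set M := ‖xMap m e v‖
    have hM : 0 ≤ M := norm_nonneg _
    have hα := e.α_pos
    have hlim : Tendsto (fun d : ℝ => M * (d / 50) ^ (2 * e.α)) (𝓝[>] 0) (𝓝 0) := by
      have hc : Continuous fun d : ℝ => M * (d / 50) ^ (2 * e.α) :=
        continuous_const.mul ((continuous_id.div_const _).rpow_const fun _ => Or.inr (by linarith))
      have := hc.tendsto 0
      rw [zero_div, Real.zero_rpow (by linarith), mul_zero] at this
      exact this.mono_left nhdsWithin_le_nhds
    obtain ⟨d, hd, hd1⟩ := ((hlim.eventually_lt_const hδ).and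
      (Ioc_mem_nhdsGT (by norm_num : (0 : ℝ) < 2))).exists
    obtain ⟨hz, hzb⟩ := exists_dom_above hb hd1.1 hd1.2
    set z : Pt m := (y.1.1, d / 100, d / 100)
    refine ⟨_, ⟨z, hz, rfl⟩, ?_⟩
    rw [← xMap_dom hv (y := ⟨z, Or.inl hz⟩) hz, dist_comm, dist_eq_norm]
    refine ((xMap m e v).norm_sub_le _ _).trans_lt (lt_of_le_of_lt ?_ hd)
    rw [coe_domMod, modulus_edge z hb]
    gcongr
    exact dG_nonneg _ _

theorem isCompact_closure_xPoint {v : XSpace m e} (hv : ‖v - modelX m e‖ ≤ 3 / 8) :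
    IsCompact (closure (xPoint e.s v.fn '' dom m)) := by
  refine Bornology.IsBounded.isCompact_closure (isBounded_iff_forall_norm_le.mpr
    ⟨‖xMap m e v‖, ?_⟩)
  rintro _ ⟨y, hy, rfl⟩
  rw [← xMap_dom hv (y := ⟨y, Or.inl hy⟩) hy]
  exact Hol.norm_apply_le _ _

end

section

variable {m : ℕ}

open scoped NNReal

variable {e : Exponents}

/-! ### The coefficients of the functional -/

theorem Hol.sum_apply {S : Type} {δ : S → S → ℝ≥0} {ι : Type} (t : Finset ι) (u : ι → Hol δ ℝ)
    (y : S) : (∑ i ∈ t, u i) y = ∑ i ∈ t, u i y := map_sum (Hol.eval y) u t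

variable (m e) in
/-- The coefficients of `σ`. -/
def sigCLM (a : Fin 2) : XSpace m e →L[ℝ] Coef m e ℝ :=
  (famLL m e).part a + if a = 0 then (2 * e.s - 1) • bCLM m e else 0

/-- The term (2s - 1) y_n B already has the form y_n times a coefficient and is added to the first
part. -/
theorem sigCLM_sum (v : XSpace m e) {y : Dom m} (hy : y.1 ∈ dom m) :
    nc 0 y.1 * sigCLM m e 0 v y + nc 1 y.1 * sigCLM m e 1 v y = sigma e.s v.fn y.1 := by
  have h : nc 0 y.1 * (famLL m e).part 0 v y + nc 1 y.1 * (famLL m e).part 1 v y =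
    pd eL (wYd e.s (Sum.inr 1) v.fn) y.1 := (famLL m e).part_sum v hy
  have h0 : sigCLM m e 0 v y = (famLL m e).part 0 v y + (2 * e.s - 1) * bCLM m e v y := rfl
  have h1 : sigCLM m e 1 v y = (famLL m e).part 1 v y + 0 := rfl
  rw [h0, h1, sigma, ← h, bCLM_dom v hy]
  simp only [nc, Matrix.cons_val_zero, Matrix.cons_val_one]
  ring

theorem sigCLM_edge (v : XSpace m e) {y : Dom m} (hy : y.1 ∈ edge m) : sigCLM m e 1 v y = 0 := by
  have h1 : sigCLM m e 1 v y = (famLL m e).part 1 v y + 0 := rfl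
  have h2 : (famLL m e).part 1 v y = 0 := (famLL m e).part_edge (show (1 : Fin 2) ≠ 0 by decide) v hy
  rw [h1, h2, add_zero]

/-- The coefficients of `(∂_{n+1} (y_n^{1-2s} ∂_n v))^2 - ∂_n (y_n^{1-2s} ∂_n v) σ`. -/
def detCoef (c d : Fin 2) (v : XSpace m e) : Coef m e ℝ :=
  (famLN m e).part c v * (famLN m e).part d v - (famNN m e).part c v * sigCLM m e d v

theorem famNN_sum (v : XSpace m e) {y : Dom m} (hy : y.1 ∈ dom m) :
    nc 0 y.1 * (famNN m e).part 0 v y + nc 1 y.1 * (famNN m e).part 1 v y =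
      pd eN (fluxN e.s v.fn) y.1 := (famNN m e).part_sum v hy

theorem famLN_sum (v : XSpace m e) {y : Dom m} (hy : y.1 ∈ dom m) :
    nc 0 y.1 * (famLN m e).part 0 v y + nc 1 y.1 * (famLN m e).part 1 v y =
      pd eL (fluxN e.s v.fn) y.1 := (famLN m e).part_sum v hy

theorem detCoef_sum (v : XSpace m e) {y : Dom m} (hy : y.1 ∈ dom m) :
    ∑ c, ∑ d, nc c y.1 * nc d y.1 * detCoef c d v y = normalDet e.s v.fn y.1 := by
  simp only [Fin.sum_univ_two, detCoef, Hol.sub_apply, Hol.mul_apply]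
  rw [normalDet, ← famNN_sum v hy, ← famLN_sum v hy, ← sigCLM_sum v hy]
  ring

/-- The normal coordinates are constant in tangential directions, so the two factors y_c and y_d
pass through the derivative. A product of ∂_{ii}v with the determinant, which has two such factors,
thereby becomes linear in the normal variables. -/
theorem Yd_tIdx (c d : Fin 2) (i : Fin m) (s : ℝ) {u : Pt m → ℝ} {y : Pt m} (hy : 0 < y.2.1)
    (hu : ContDiffAt ℝ 2 u y) : Yd (tIdx c i) (wYd s (tIdx d i) u) y =
      nc c y * nc d y * (y.2.1 ^ (1 - 2 * s) * pd (eT i) (pd (eT i) u) y) := by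
  have hd : HasFDerivAt (nc d) (![coN, coL] d) y := by
    fin_cases d
    · exact hasFDerivAt_n y
    · exact hasFDerivAt_l y
  have hz : (![coN, coL] d : Pt m →L[ℝ] ℝ) (eT i) = 0 := by
    fin_cases d <;> rfl
  have hw : wYd s (tIdx d i) u = fun z => z.2.1 ^ (1 - 2 * s) * (nc d z * pd (eT i) u z) := by
    funext z
    rw [wYd, Yd, field_tIdx, pd_smul_dir]
  rw [Yd, field_tIdx, pd_smul_dir, hw, pd_rpow_mul hy
    (u := fun z => nc d z * pd (eT i) u z) (hd.differentiableAt.mul (differentiableAt_pd hu _)) _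
    rfl, pd_mul _ hd.differentiableAt (differentiableAt_pd hu _), pd_of_hasFDerivAt hd, hz]
  ring

/-- The tangential part of the coefficients of the functional. -/
def tangCoef (a : Fin 2) (i : Fin m) (v : XSpace m e) : Coef m e ℝ :=
  -- The factors y_c y_d of the determinant are used up by y_c y_d y_n^{1-2s} ∂_{ii}v, whose
  -- coefficients are controlled; ∂_{ii}v alone would not be.
  ∑ c, ∑ d, detCoef c d v * ttCLM e c d a i v
    - tnCLM e i v * tnCLM e i v * sigCLM m e a v
    + (2 : ℝ) • (tnCLM e i v * tlCLM e i v * (famLN m e).part a v)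
    - (famNN m e).part a v * (tlCLM e i v * tlCLM e i v)

theorem tangCoef_sum (i : Fin m) (v : XSpace m e) {y : Dom m} (hy : y.1 ∈ dom m) :
    nc 0 y.1 * tangCoef 0 i v y + nc 1 y.1 * tangCoef 1 i v y =
      y.1.2.1 ^ (1 - 2 * e.s) * pd (eT i) (pd (eT i) v.fn) y.1 * normalDet e.s v.fn y.1
        - pd (eT i) (fluxN e.s v.fn) y.1 ^ 2 * sigma e.s v.fn y.1
        + 2 * (pd (eT i) (fluxN e.s v.fn) y.1 * pd (eT i) (wYd e.s (Sum.inr 1) v.fn) y.1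
          * pd eL (fluxN e.s v.fn) y.1)
        - pd eN (fluxN e.s v.fn) y.1 * pd (eT i) (wYd e.s (Sum.inr 1) v.fn) y.1 ^ 2 := by
  have ht : ∀ c d, nc 0 y.1 * ttCLM e c d 0 i v y + nc 1 y.1 * ttCLM e c d 1 i v y =
      nc c y.1 * nc d y.1 * (y.1.2.1 ^ (1 - 2 * e.s) * pd (eT i) (pd (eT i) v.fn) y.1) :=
    fun c d => by
      rw [ttCLM_sum c d i v hy, Yd_tIdx c d i e.s hy.2.1 (v.mem.contDiff _ hy)]
  have hdet := detCoef_sum v hy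
  have hN := famNN_sum v hy
  have hL := famLN_sum v hy
  have hS := sigCLM_sum v hy
  simp only [Fin.sum_univ_two] at hdet
  simp only [tangCoef, Fin.sum_univ_two, Hol.add_apply, Hol.sub_apply, Hol.mul_apply,
    Hol.smul_apply, smul_eq_mul, tnCLM_dom i v hy, tlCLM_dom i v hy]
  linear_combination detCoef 0 0 v y * ht 0 0 + detCoef 0 1 v y * ht 0 1 + detCoef 1 0 v y * ht 1 0
    + detCoef 1 1 v y * ht 1 1
    + (y.1.2.1 ^ (1 - 2 * e.s) * pd (eT i) (pd (eT i) v.fn) y.1) * hdet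
    - pd (eT i) (fluxN e.s v.fn) y.1 ^ 2 * hS
    + 2 * (pd (eT i) (fluxN e.s v.fn) y.1 * pd (eT i) (wYd e.s (Sum.inr 1) v.fn) y.1) * hL
    - pd (eT i) (wYd e.s (Sum.inr 1) v.fn) y.1 ^ 2 * hN

/-- The coefficients of the functional, as a function of `v`, two powers of `B` and the values of
the inhomogeneity. -/
def coefFun (a : Fin 2) (v : XSpace m e) (b b' φ : Coef m e ℝ) : Coef m e ℝ :=
  (1 / (4 * e.s ^ 2)) • (b * ∑ i, tangCoef a i v) + (famNN m e).part a v + b * sigCLM m e a v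
    - (1 / (4 * e.s ^ 2)) • (b' * (∑ d, weightCoef m e d * detCoef a d v) * φ)

/-- Each summand contains a factor that vanishes on P: a second tangential derivative, a mixed
derivative with ∂_{n+1}v, the y_{n+1}-part of `sigma` or of the ∂_n flux derivative, or the weight
in front of f. Hence F(v) has no y_{n+1}-term on P. -/
theorem coefFun_edge (v : XSpace m e) (b b' φ : Coef m e ℝ) {y : Dom m} (hy : y.1 ∈ edge m) :
    coefFun 1 v b b' φ y = 0 := by
  have hw : ∀ d, weightCoef m e d y = 0 := fun d => by
    rw [weightCoef, HolData.toCoef, Hol.mk_apply, glue_edge _ _ hy]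
  have hN : (famNN m e).part 1 v y = 0 :=
    (famNN m e).part_edge (show (1 : Fin 2) ≠ 0 by decide) v hy
  simp only [coefFun, tangCoef, Hol.add_apply, Hol.sub_apply, Hol.mul_apply, Hol.smul_apply,
    Hol.sum_apply, hw, hN, sigCLM_edge v hy, tlCLM_edge _ v hy, ttCLM_edge _ _ _ _ v hy]
  simp

theorem coefFun_sum (v : XSpace m e) (b b' φ : Coef m e ℝ) {y : Dom m} (hy : y.1 ∈ dom m) :
    nc 0 y.1 * coefFun 0 v b b' φ y + nc 1 y.1 * coefFun 1 v b b' φ y =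
      (∑ i, b y * (1 / (4 * e.s ^ 2) *
        (y.1.2.1 ^ (1 - 2 * e.s) * pd (eT i) (pd (eT i) v.fn) y.1 * normalDet e.s v.fn y.1
        - pd (eT i) (fluxN e.s v.fn) y.1 ^ 2 * sigma e.s v.fn y.1
        + 2 * (pd (eT i) (fluxN e.s v.fn) y.1 * pd (eT i) (wYd e.s (Sum.inr 1) v.fn) y.1
          * pd eL (fluxN e.s v.fn) y.1)
        - pd eN (fluxN e.s v.fn) y.1 * pd (eT i) (wYd e.s (Sum.inr 1) v.fn) y.1 ^ 2)))
      + pd eN (fluxN e.s v.fn) y.1 + b y * sigma e.s v.fn y.1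
      - 1 / (4 * e.s ^ 2) * (b' y *
          (y.1.2.2 ^ 2 * y.1.2.1 ^ (3 - 2 * e.s) * normalDet e.s v.fn y.1)) * φ y := by
  have hw : ∀ d, weightCoef m e d y =
      nc d y.1 * nc 1 y.1 * (nc 1 y.1 * y.1.2.1 ^ (3 - 2 * e.s)) := fun d => by
    rw [weightCoef, HolData.toCoef, Hol.mk_apply, glue_dom _ _ hy]
  have hT : nc 0 y.1 * ∑ i, tangCoef 0 i v y + nc 1 y.1 * ∑ i, tangCoef 1 i v y =
      ∑ i, (nc 0 y.1 * tangCoef 0 i v y + nc 1 y.1 * tangCoef 1 i v y) := by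
    rw [Finset.sum_add_distrib, Finset.mul_sum, Finset.mul_sum]
  have hl : nc 1 y.1 = y.1.2.2 := rfl
  have hdet := detCoef_sum v hy
  have hN := famNN_sum v hy
  have hS := sigCLM_sum v hy
  rw [← Finset.mul_sum, ← Finset.mul_sum, ← Finset.sum_congr rfl fun i _ => tangCoef_sum i v hy,
    ← hT, ← hdet, ← hN, ← hS, ← hl]
  simp only [coefFun, Fin.sum_univ_two, Hol.add_apply, Hol.sub_apply, Hol.mul_apply,
    Hol.smul_apply, Hol.sum_apply, smul_eq_mul, hw]
  ring

theorem AnalyticAt.real_smul {V W : Type} [NormedAddCommGroup V] [NormedSpace ℝ V]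
    [NormedAddCommGroup W] [NormedSpace ℝ W] {u : V → W} {v : V} (c : ℝ) (h : AnalyticAt ℝ u v) :
    AnalyticAt ℝ (fun v => c • u v) v :=
  ((c • ContinuousLinearMap.id ℝ W).analyticAt _).comp h

theorem analyticAt_detCoef (c d : Fin 2) (v : XSpace m e) : AnalyticAt ℝ (detCoef c d) v :=
  ((((famLN m e).part c).analyticAt v).mul (((famLN m e).part d).analyticAt v)).sub
    ((((famNN m e).part c).analyticAt v).mul ((sigCLM m e d).analyticAt v))

theorem analyticAt_tangCoef (a : Fin 2) (i : Fin m) (v : XSpace m e) :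
    AnalyticAt ℝ (tangCoef a i) v := by
  have hn := (tnCLM e i).analyticAt v
  have hl := (tlCLM e i).analyticAt v
  have hL := ((famLN m e).part a).analyticAt v
  have hN := ((famNN m e).part a).analyticAt v
  have hS := (sigCLM m e a).analyticAt v
  have h1 : AnalyticAt ℝ (fun v => tnCLM e i v * tnCLM e i v * sigCLM m e a v) v := (hn.mul hn).mul hS
  have h2 : AnalyticAt ℝ (fun v => (2 : ℝ) • (tnCLM e i v * tlCLM e i v * (famLN m e).part a v)) v :=
    AnalyticAt.real_smul _ ((hn.mul hl).mul hL)
  have h3 : AnalyticAt ℝ (fun v => (famNN m e).part a v * (tlCLM e i v * tlCLM e i v)) v :=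
    hN.mul (hl.mul hl)
  have h4 : AnalyticAt ℝ (fun v => ∑ c, ∑ d, detCoef c d v * ttCLM e c d a i v) v :=
    Finset.analyticAt_fun_sum _ fun c _ => Finset.analyticAt_fun_sum _ fun d _ =>
      (analyticAt_detCoef c d v).mul ((ttCLM e c d a i).analyticAt v)
  exact ((h4.sub h1).add h2).sub h3

theorem analyticAt_coefFun_zero (a : Fin 2) {b : XSpace m e → Coef m e ℝ} {v : XSpace m e}
    (hb : AnalyticAt ℝ b v) : AnalyticAt ℝ (fun v => (1 / (4 * e.s ^ 2)) • (b v * ∑ i, tangCoef a i v)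
      + (famNN m e).part a v + b v * sigCLM m e a v) v := by
  have hT : AnalyticAt ℝ (fun v : XSpace m e => ∑ i, tangCoef a i v) v :=
    Finset.analyticAt_fun_sum _ fun i _ => analyticAt_tangCoef a i v
  have h1 : AnalyticAt ℝ (fun v => (1 / (4 * e.s ^ 2)) • (b v * ∑ i, tangCoef a i v)) v :=
    AnalyticAt.real_smul _ (hb.mul hT)
  have h2 : AnalyticAt ℝ (fun v => b v * sigCLM m e a v) v := hb.mul ((sigCLM m e a).analyticAt v)
  exact (h1.add (((famNN m e).part a).analyticAt v)).add h2

theorem analyticAt_weight_detCoef (a : Fin 2) {b : XSpace m e → Coef m e ℝ} {v : XSpace m e}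
    (hb : AnalyticAt ℝ b v) :
    AnalyticAt ℝ (fun v => b v * ∑ d, weightCoef m e d * detCoef a d v) v := by
  have hW : AnalyticAt ℝ (fun v : XSpace m e => ∑ d, weightCoef m e d * detCoef a d v) v :=
    Finset.analyticAt_fun_sum _ fun d _ => analyticAt_const.mul (analyticAt_detCoef a d v)
  exact hb.mul hW

theorem AnalyticAt.coefFun (a : Fin 2) {b b' φ : XSpace m e → Coef m e ℝ} {v : XSpace m e}
    (hb : AnalyticAt ℝ b v) (hb' : AnalyticAt ℝ b' v) (hφ : AnalyticAt ℝ φ v) :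
    AnalyticAt ℝ (fun v => coefFun a v (b v) (b' v) (φ v)) v := by
  have h : AnalyticAt ℝ (fun v => (1 / (4 * e.s ^ 2)) •
      (b' v * (∑ d, weightCoef m e d * detCoef a d v) * φ v)) v :=
    AnalyticAt.real_smul _ ((analyticAt_weight_detCoef a hb').mul hφ)
  exact (analyticAt_coefFun_zero a hb).sub h

/-- Only the values of f are differentiated within a set; all other ingredients are analytic in a
full neighborhood. -/
theorem ContDiffWithinAt.coefFun (a : Fin 2) {b b' φ : XSpace m e → Coef m e ℝ} {v : XSpace m e}
    {U : Set (XSpace m e)} {n : WithTop ℕ∞}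
    (hb : AnalyticAt ℝ b v) (hb' : AnalyticAt ℝ b' v) (hφ : ContDiffWithinAt ℝ n φ U v) :
    ContDiffWithinAt ℝ n (fun v => coefFun a v (b v) (b' v) (φ v)) U v := by
  have h : ContDiffWithinAt ℝ n (fun v => (1 / (4 * e.s ^ 2)) •
      (b' v * (∑ d, weightCoef m e d * detCoef a d v) * φ v)) U v :=
    ((analyticAt_weight_detCoef a hb').contDiffAt.contDiffWithinAt.mul hφ).const_smul _
  exact (analyticAt_coefFun_zero a hb).contDiffAt.contDiffWithinAt.sub h

/-! ### The functional -/

variable (m e) in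
/-- The functional `F` in terms of its coefficients. -/
def functional (f : Pt m → ℝ) (v : XSpace m e) : YSpace m e :=
  psiCLM m e (coefFun 0 v (powB m e ((1 - 2 * e.s) / e.s) v) (powB m e ((2 - 2 * e.s) / e.s) v)
      (Hol.comp f (xMap m e v)),
    coefFun 1 v (powB m e ((1 - 2 * e.s) / e.s) v) (powB m e ((2 - 2 * e.s) / e.s) v)
      (Hol.comp f (xMap m e v)))

theorem pairFun_coefFun (v : XSpace m e) (b b' φ : Coef m e ℝ) {y : Dom m} (hy : y.1 ∈ dom m) :
    pairFun (coefFun 0 v b b' φ, coefFun 1 v b b' φ) y.1 =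
      nc 0 y.1 * coefFun 0 v b b' φ y + nc 1 y.1 * coefFun 1 v b b' φ y := by
  have hp := proj_mem_edge hy.1
  have h1 : ev (coefFun 1 v b b' φ) (proj y.1) = 0 :=
    (ev_eq _ ⟨proj y.1, Or.inr hp⟩).trans (coefFun_edge v b b' φ hp)
  rw [pairFun, h1, sub_zero, ev_eq, ev_eq]
  rfl

/-- The membership hypothesis excludes the default value 0 of `Hol.comp`; lower bounds on B make the
identity for the weighted derivatives available. -/
theorem functional_fn {f : Pt m → ℝ} {v : XSpace m e} (hv : ‖v - modelX m e‖ ≤ 3 / 8)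
    (hf : (fun y => f (xMap m e v y)) ∈ holSubmodule (domMod (m := m) e) ℝ) :
    (functional m e f v).fn = nonlinF e.s f v.fn := by
  funext y
  rw [functional, psiCLM_fn, psiFun, nonlinF]
  by_cases hy : y ∈ dom m
  · obtain ⟨Y, rfl⟩ : ∃ Y : Dom m, Y.1 = y := ⟨⟨y, Or.inl hy⟩, rfl⟩
    have hB := le_bCLM hv Y
    rw [bCLM_dom v hy] at hB
    rw [indicator_of_mem hy, indicator_of_mem hy,
      nonlinExpr_eq e.s_pos hy.2.1 hy.2.2 (v.mem.contDiff _ hy) (by linarith),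
      pairFun_coefFun _ _ _ _ hy, coefFun_sum _ _ _ _ hy, (powB_spec _ hv).1, (powB_spec _ hv).1,
      Hol.comp_apply hf, xMap_dom hv hy, bCLM_dom v hy]
  · rw [indicator_of_notMem hy, indicator_of_notMem hy]

theorem contDiffWithinAt_functional {f : Pt m → ℝ} {v : XSpace m e}
    (hv : ‖v - modelX m e‖ ≤ 3 / 8) {U : Set (XSpace m e)} {n : WithTop ℕ∞}
    (hf : ContDiffWithinAt ℝ n (fun w => Hol.comp f (xMap m e w)) U v) :
    ContDiffWithinAt ℝ n (functional m e f) U v :=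
  (psiCLM m e).contDiff.contDiffAt.comp_contDiffWithinAt v
    ((ContDiffWithinAt.coefFun 0 (powB_spec _ hv).2 (powB_spec _ hv).2 hf).prodMk
      (ContDiffWithinAt.coefFun 1 (powB_spec _ hv).2 (powB_spec _ hv).2 hf))

theorem analyticAt_functional {f : Pt m → ℝ} {v : XSpace m e} (hv : ‖v - modelX m e‖ ≤ 3 / 8)
    (hf : AnalyticAt ℝ (fun v => Hol.comp f (xMap m e v)) v) :
    AnalyticAt ℝ (functional m e f) v :=
  ((psiCLM m e).analyticAt _).comp (f := fun _ => (_, _))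
    ((AnalyticAt.coefFun 0 (powB_spec _ hv).2 (powB_spec _ hv).2 hf).prod
      (AnalyticAt.coefFun 1 (powB_spec _ hv).2 (powB_spec _ hv).2 hf))

theorem convex_halfSpace : Convex ℝ (halfSpace m) :=
  (convex_Ici (0 : ℝ)).is_linear_preimage (coL (m := m)).isLinear

theorem isClosed_halfSpace : IsClosed (halfSpace m) :=
  isClosed_le continuous_const (by fun_prop)

theorem interior_halfSpace_nonempty : (interior (halfSpace m)).Nonempty := by
  refine ⟨eL, mem_interior.mpr ⟨{x | 0 < x.2.2}, fun x (hx : 0 < x.2.2) => hx.le,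
    isOpen_lt continuous_const (by fun_prop), ?_⟩⟩
  simp [eL]

end

end Grushin

end

theorem proposition6p2 (m : ℕ) (e : Grushin.Exponents) :
    ∃ v₀ : Grushin.XSpace m e, v₀.fn = Grushin.modelSolution e.s ∧
      ∀ r₀ : ℝ, 0 < r₀ → r₀ ≤ ‖v₀‖ / 4 →
      ∀ (G : Set (Grushin.Pt m)) (f : Grushin.Pt m → ℝ), IsOpen G →
        (ContDiffOn ℝ ((⊤ : ℕ∞) : WithTop ℕ∞) f (G ∩ Grushin.halfSpace m) →
          ∃ F : Grushin.XSpace m e → Grushin.YSpace m e,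
            (∀ v ∈ Grushin.nbhd v₀ r₀ (G ∩ Grushin.halfSpace m),
              (F v).fn = Grushin.nonlinF e.s f v.fn) ∧
            ContDiffOn ℝ ((⊤ : ℕ∞) : WithTop ℕ∞) F
              (Grushin.nbhd v₀ r₀ (G ∩ Grushin.halfSpace m))) ∧
        (AnalyticOnNhd ℝ f (G ∩ Grushin.halfSpace m) →
          ∃ F : Grushin.XSpace m e → Grushin.YSpace m e,
            (∀ v ∈ Grushin.nbhd v₀ r₀ (G ∩ Grushin.halfSpace m),
              (F v).fn = Grushin.nonlinF e.s f v.fn) ∧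
            AnalyticOnNhd ℝ F
              (Grushin.nbhd v₀ r₀ (G ∩ Grushin.halfSpace m))) := by
  refine ⟨Grushin.modelX m e, Grushin.modelX_fn, fun r₀ _ hr G f hG => ?_⟩
  -- The norm of the model solution is at most 3/2, and a quarter of it is 3/8.
  have hnear : ∀ v ∈ Grushin.nbhd (Grushin.modelX m e) r₀ (G ∩ Grushin.halfSpace m),
      ‖v - Grushin.modelX m e‖ ≤ 3 / 8 := fun v hv => by
    have := Grushin.norm_modelX_le (m := m) (e := e)
    linarith [hv.1]
  refine ⟨fun hf => ?_, fun hf => ?_⟩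
  · have key := fun v hv => Grushin.Hol.contDiffWithinAt_comp hG Grushin.convex_halfSpace
      Grushin.isClosed_halfSpace Grushin.interior_halfSpace_nonempty hf
      (Grushin.isCompact_closure_xPoint (hnear v hv)) hv.2 (Grushin.xMap_mem (hnear v hv))
    refine ⟨Grushin.functional m e f, fun v hv => Grushin.functional_fn (hnear v hv) (key v hv).1,
      fun v hv => Grushin.contDiffWithinAt_functional (hnear v hv) ?_⟩
    -- Superposition with f is smooth only within functions having values in the closed half space;
    -- every element of the neighborhood produces such a function because its range lies in the
    -- closure contained in Ω.
    exact (key v hv).2.comp v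
      (Grushin.analyticAt_xMap (hnear v hv)).contDiffAt.contDiffWithinAt
      fun w hw y => (hw.2 (Grushin.xMap_mem (hnear w hw) y)).2
  -- Here f is analytic in full neighborhoods of the compact range, so superposition is analytic in
  -- a full neighborhood and the half space needs no separate treatment.
  · have key := fun v hv => Grushin.Hol.analyticAt_comp (hf.mono hv.2)
      (Grushin.isCompact_closure_xPoint (hnear v hv)) (Grushin.xMap_mem (hnear v hv))
    refine ⟨Grushin.functional m e f, fun v hv => Grushin.functional_fn (hnear v hv) (key v hv).1,
      fun v hv => Grushin.analyticAt_functional (hnear v hv) ?_⟩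
    exact (key v hv).2.comp (Grushin.analyticAt_xMap (hnear v hv))
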